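/- **Setting.** Let $S$ be a closed connected oriented surface and let $Z\subset S$ be a finite non-empty set of marked points. A *half-translation surface* $(S,q)$ is an atlas of charts $S\setminus Z\to\mathbb{C}$ (compatible with the orientation) whose transition maps are locally of the form $z\mapsto \pm z+c$, such that each $z\in Z$ is a cone point of angle $k\pi$ for some integer $k\ge 1$ (equivalently, a meromorphic quadratic differential $q$ on $S$ whose zeros and poles all lie in $Z$ and whose poles are simple). A *saddle connection* is a straight segment whose interior is embedded in $S\setminus Z$ and whose endpoints lie in $Z$; it has a holonomy $\pm v\in\mathbb{C}\setminus\{0\}$, its *width* is $|\operatorname{Re} v|$ and its *slope* is $\operatorname{Im} v/\operatorname{Re} v$. The surface $(S,q)$ is *Keane* if it has no horizontal and no vertical saddle connection. A *straight triangulation* of $(S,q)$ is a triangulation of $S$ with vertex set exactly $Z$ all of whose edges are saddle connections (edges may be loops, and triangles may share several vertices and edges). It is a *veering triangulation* of $(S,q)$ if no edge is horizontal or vertical and, when edges of positive slope are coloured red and edges of negative slope blue, no triangle has all three edges of the same colour and no vertex has all its incident edges of the same colour. Let $e$ be an edge of a veering triangulation of $(S,q)$. Give $e$ an orientation and let $a,b,c,d$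 be the sides, in anti-clockwise order, of the quadrilateral formed by the two triangles adjacent to $e$, where $a$ starts at the head of $e$. The edge $e$ is *forward flippable* if $a,c$ are blue and $b,d$ are red, and *backward flippable* if $a,c$ are red and $b,d$ are blue. A veering triangulation of $(S,q)$ is *balanced* if 1. every forward flippable edge has width at most $1$, and 2. for every backward flippable edge $e$, the edge obtained by flipping $e$ back (the other diagonal of the quadrilateral around $e$) has width greater than $1$. **Proposition.** Every Keane half-translation surface $(S,q)$ admits exactly one balanced veering triangulation. -/

import Mathlib

open Set Filter Topology

/-- A half-translation of the plane: a map `z ↦ ± z + c`. -/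
def IsHalfTranslation (h : ℂ → ℂ) : Prop :=
  ∃ ε c : ℂ, (ε = 1 ∨ ε = -1) ∧ ∀ z, h z = ε * z + c

/-- A half-translation structure on the surface `S`, with a finite non-empty set `Z` of marked points
which contains all the singularities. Away from `Z` there is an atlas of charts to `ℂ` whose
transition maps are locally half-translations. Each marked point `z` is a cone point of angle `k π`
for some integer `k ≥ 1`: there is a topological chart `φ` centred at `z` such that, away from `z`,
the flat charts are, up to sign and an additive constant, the local branches of `φ ^ (k / 2)`.
Thus the quadratic differential `dψ ^ 2` (for `ψ` in the atlas) has a zero of order `k - 2` at `z`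
(a simple pole for `k = 1`, a regular point for `k = 2`). -/
structure HalfTranslationStructure (S : Type*) [TopologicalSpace S] where
  /-- The marked points. -/
  Z : Set S
  finite_Z : Z.Finite
  nonempty_Z : Z.Nonempty
  /-- The flat charts. -/
  atlas : Set (OpenPartialHomeomorph S ℂ)
  source_disjoint : ∀ ψ ∈ atlas, Disjoint ψ.source Z
  cover : ∀ p, p ∉ Z → ∃ ψ ∈ atlas, p ∈ ψ.source
  compatible : ∀ ψ₁ ∈ atlas, ∀ ψ₂ ∈ atlas, ∀ p ∈ ψ₁.source ∩ ψ₂.source,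
    ∃ h, IsHalfTranslation h ∧ ∀ᶠ p' in 𝓝 p, ψ₂ p' = h (ψ₁ p')
  cone : ∀ z ∈ Z, ∃ k : ℕ, 1 ≤ k ∧ ∃ φ : OpenPartialHomeomorph S ℂ,
    z ∈ φ.source ∧ φ z = 0 ∧
      ∀ ψ ∈ atlas, ∀ p ∈ φ.source ∩ ψ.source,
        ∃ c : ℂ, ∀ᶠ p' in 𝓝 p, (ψ p' - c) ^ 2 = φ p' ^ k

/-- The slope of a plane vector. A vertical vector gets the value `0`, so that a vector of positive
(or negative) slope is neither horizontal nor vertical. -/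
noncomputable def slopeOf (v : ℂ) : ℝ := v.im / v.re

/-- The plane triangle with vertices `P`, `Q`, `R`. -/
def planeTriangle (P Q R : ℂ) : Set ℂ := convexHull ℝ {P, Q, R}

/-- The triangle `P Q R` is non-degenerate, with its vertices in anti-clockwise order. -/
def Anticlockwise (P Q R : ℂ) : Prop :=
  0 < (Q - P).re * (R - P).im - (Q - P).im * (R - P).re

namespace HalfTranslationStructure

variable {S : Type*} [TopologicalSpace S]

/-- `f` maps the plane figure `D` to the surface, sending the vertices `V` to marked points and the
rest of `D` to unmarked points; away from the vertices, in flat charts it is locally the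
restriction of a half-translation. -/
structure IsFlatMap (q : HalfTranslationStructure S) (D V : Set ℂ) (f : ℂ → S) : Prop where
  continuousOn : ContinuousOn f D
  vertices : ∀ p ∈ V, f p ∈ q.Z
  rest : ∀ p ∈ D \ V, f p ∉ q.Z
  flat : ∀ p ∈ D \ V, ∀ ψ ∈ q.atlas, f p ∈ ψ.source →
    ∃ h, IsHalfTranslation h ∧ ∀ᶠ w in 𝓝[D] p, ψ (f w) = h w

/-- The subset `e` of `S` is a saddle connection (together with its end points) with holonomy `± v`:
the image of the straight segment from `0` to `v`, whose interior is embedded in the complement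
of the marked points and whose end points are marked. -/
def IsSaddleConnection (q : HalfTranslationStructure S) (e : Set S) (v : ℂ) : Prop :=
  v ≠ 0 ∧ ∃ f : ℂ → S, q.IsFlatMap (segment ℝ 0 v) {0, v} f ∧
    InjOn f (openSegment ℝ 0 v) ∧ e = f '' segment ℝ 0 v

def HorizontallyKeane (q : HalfTranslationStructure S) : Prop :=
  ¬ ∃ e v, q.IsSaddleConnection e v ∧ v.im = 0

def VerticallyKeane (q : HalfTranslationStructure S) : Prop :=
  ¬ ∃ e v, q.IsSaddleConnection e v ∧ v.re = 0

def IsKeane (q : HalfTranslationStructure S) : Prop :=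
  q.HorizontallyKeane ∧ q.VerticallyKeane

/-- Red saddle connections are those of positive slope. -/
def IsRed (q : HalfTranslationStructure S) (e : Set S) : Prop :=
  ∃ v, q.IsSaddleConnection e v ∧ 0 < slopeOf v

/-- Blue saddle connections are those of negative slope. -/
def IsBlue (q : HalfTranslationStructure S) (e : Set S) : Prop :=
  ∃ v, q.IsSaddleConnection e v ∧ slopeOf v < 0

/-- `f` parametrises a flat triangle in the surface with marked vertices, and with embedded interior,
by the plane triangle with vertices `P`, `Q`, `R` in anti-clockwise order. -/
structure IsFlatTriangle (q : HalfTranslationStructure S) (f : ℂ → S) (P Q R : ℂ) : Prop where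
  anticlockwise : Anticlockwise P Q R
  flatMap : q.IsFlatMap (planeTriangle P Q R) {P, Q, R} f
  injOn : InjOn f (interior (planeTriangle P Q R))

/-- A straight triangulation: finitely many saddle connections (the edges, with their end points)
and open flat triangles (the faces), each with its three sides among the edges, such that the
surface is the disjoint union of the marked points, the interiors of the edges, and the faces.
Sides of a triangle may be identified with each other, and edges may be loops. -/
structure StraightTriangulation (q : HalfTranslationStructure S) where
  edges : Set (Set S)
  faces : Set (Set S)
  finite_edges : edges.Finite
  finite_faces : faces.Finite
  edge_saddle : ∀ e ∈ edges, ∃ v, q.IsSaddleConnection e v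
  face_triangle : ∀ F ∈ faces, ∃ f P Q R, q.IsFlatTriangle f P Q R ∧
    F = f '' interior (planeTriangle P Q R) ∧
    f '' segment ℝ P Q ∈ edges ∧ f '' segment ℝ Q R ∈ edges ∧ f '' segment ℝ R P ∈ edges
  edges_disjoint : edges.PairwiseDisjoint (fun e => e \ q.Z)
  faces_disjoint : faces.PairwiseDisjoint id
  edge_face_disjoint : ∀ e ∈ edges, ∀ F ∈ faces, Disjoint e F
  cover : ⋃₀ edges ∪ ⋃₀ faces = univ

namespace StraightTriangulation

variable {q : HalfTranslationStructure S}

/-- A straight triangulation, with its edges coloured red or blue as their slope is positive or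
negative, is veering if every edge gets a colour and no triangle and no vertex is monochromatic. -/
structure IsVeering (τ : q.StraightTriangulation) : Prop where
  coloured : ∀ e ∈ τ.edges, q.IsRed e ∨ q.IsBlue e
  triangle : ∀ f P Q R, q.IsFlatTriangle f P Q R →
    f '' interior (planeTriangle P Q R) ∈ τ.faces →
      ¬ (q.IsRed (f '' segment ℝ P Q) ∧ q.IsRed (f '' segment ℝ Q R) ∧
          q.IsRed (f '' segment ℝ R P)) ∧
      ¬ (q.IsBlue (f '' segment ℝ P Q) ∧ q.IsBlue (f '' segment ℝ Q R) ∧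
          q.IsBlue (f '' segment ℝ R P))
  vertex : ∀ z ∈ q.Z, (∃ e ∈ τ.edges, z ∈ e ∧ q.IsRed e) ∧ (∃ e ∈ τ.edges, z ∈ e ∧ q.IsBlue e)

/-- The quadrilateral around an edge of `τ`, laid out in the plane. The edge, oriented, is the image
of the diagonal from `P` to `R`; the face on its left is the image of the triangle `P R A`, the
one on its right is the image of the triangle `P B R`. The boundary of the quadrilateral
consists, in anti-clockwise order, of the sides `R A`, `A P`, `P B`, `B R`. -/
structure QuadLayout (τ : q.StraightTriangulation) where
  f : ℂ → S
  P : ℂ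
  R : ℂ
  A : ℂ
  B : ℂ
  left_triangle : q.IsFlatTriangle f P R A
  right_triangle : q.IsFlatTriangle f P B R
  left_face : f '' interior (planeTriangle P R A) ∈ τ.faces
  right_face : f '' interior (planeTriangle P B R) ∈ τ.faces
  edge_mem : f '' segment ℝ P R ∈ τ.edges
  flatMap : q.IsFlatMap (planeTriangle P R A ∪ planeTriangle P B R) {P, R, A, B} f

namespace QuadLayout

variable {τ : q.StraightTriangulation}

/-- The edge is forward flippable: going around the quadrilateral anti-clockwise, from the head of
the edge, the sides are blue, red, blue, red. -/
def ForwardFlippable (L : τ.QuadLayout) : Prop :=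
  q.IsBlue (L.f '' segment ℝ L.R L.A) ∧ q.IsRed (L.f '' segment ℝ L.A L.P) ∧
  q.IsBlue (L.f '' segment ℝ L.P L.B) ∧ q.IsRed (L.f '' segment ℝ L.B L.R)

/-- The edge is backward flippable: as before, with the colours red, blue, red, blue. -/
def BackwardFlippable (L : τ.QuadLayout) : Prop :=
  q.IsRed (L.f '' segment ℝ L.R L.A) ∧ q.IsBlue (L.f '' segment ℝ L.A L.P) ∧
  q.IsRed (L.f '' segment ℝ L.P L.B) ∧ q.IsBlue (L.f '' segment ℝ L.B L.R)

/-- The width of the edge. -/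
def edgeWidth (L : τ.QuadLayout) : ℝ := |(L.R - L.P).re|

/-- The width of the edge that replaces the given one in a flip, the other diagonal. -/
def flippedWidth (L : τ.QuadLayout) : ℝ := |(L.A - L.B).re|

end QuadLayout

/-- Balanced: forward flippable edges have width at most one, and backward flippable edges have width
more than one after being flipped back. -/
def IsBalanced (τ : q.StraightTriangulation) : Prop :=
  (∀ L : τ.QuadLayout, L.ForwardFlippable → L.edgeWidth ≤ 1) ∧
  (∀ L : τ.QuadLayout, L.BackwardFlippable → 1 < L.flippedWidth)

end StraightTriangulation

end HalfTranslationStructure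

/-! The triangulation is written down explicitly. Its edges, `delaunayEdges`, are the saddle
connections of width at most one that join the bottom to the top of an immersed open rectangle free
of marked points (a window), of the same height and of width greater than one. Its faces are the
flat triangles with such sides.

To turn immersed figures into plane geometry, the surface is viewed from an unmarked point.
Developing along straight rays gives a star domain `D` in the plane, and the marked points in sight
form a set `V` of isolated tips (`exists_sky`). A flat figure that is star-shaped about the base
point and has its marked points as tips sits inside this view (`Sky.fit`). The Keane condition says
that no two points of `V` are joined inside `D` by a horizontal or vertical segment. Together with
compactness and connectedness it also excludes half-infinite vertical strips (`not_free_strip_up`),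
so a rectangle that is raised in a view must meet a marked point.

Existence. If two edges crossed, their ends would have to avoid each other's windows. This makes one
of the edges wider than one or produces a horizontal or vertical saddle connection
(`eq_of_crossing`). On each side of an edge, growing its window until it meets a marked point gives
the third vertex of a triangle whose other sides are again edges (`exists_apex`). Raising a
rectangle over a horizontal separatrix gives edges at every marked point (`exists_edges_at`). Only
finitely many edges exist, because windows at a given marked point contain one of finitely many
fixed rectangles (`finite_emanates`). The triangles and edges therefore fill an open and closed set,
which is all of `S` (`delaunay_cover`). A monochromatic triangle would have a vertex in the window
of the opposite side. For a backward flippable edge the window fits horizontally between the two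
opposite vertices, so the flipped edge is wider than one.

Uniqueness. In a balanced veering triangulation a widest edge is forward flippable, so all widths
are at most one (`width_le_one`). Following straight paths from triangle to triangle shows that,
beside the tallest side of a triangle, its bounding box contains no marked point other than the
third vertex (`eq_apex`). Then every edge has a window, by descending induction on its height. If an
adjacent triangle has a taller side, a window is inherited from that side. Otherwise the edge is
backward flippable, and balance makes the empty rectangle between the opposite vertices wide enough.
Hence all edges are in `delaunayEdges`, and the covering property forces equality (`eq_delaunay`).
-/

namespace IsHalfTranslation

/-! ### Algebra of half-translations. -/

theorem comp {h h' : ℂ → ℂ} (H : IsHalfTranslation h) (H' : IsHalfTranslation h') :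
    IsHalfTranslation (fun z => h (h' z)) := by
  obtain ⟨ε, c, hε, hh⟩ := H
  obtain ⟨ε', c', hε', hh'⟩ := H'
  refine ⟨ε * ε', ε * c' + c, ?_, fun z => by simp only [hh, hh']; ring⟩
  rcases hε with rfl | rfl <;> rcases hε' with rfl | rfl <;> simp

theorem continuous {h : ℂ → ℂ} (H : IsHalfTranslation h) : Continuous h := by
  obtain ⟨ε, c, -, hh⟩ := H
  rw [show h = fun z => ε * z + c from funext hh]
  fun_prop

theorem exists_inverse {h : ℂ → ℂ} (H : IsHalfTranslation h) :
    ∃ h', IsHalfTranslation h' ∧ (∀ z, h' (h z) = z) ∧ ∀ z, h (h' z) = z := by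
  obtain ⟨ε, c, hε, hh⟩ := H
  have h2 : ε * ε = 1 := by rcases hε with rfl | rfl <;> simp
  refine ⟨fun z => ε * z + -(ε * c), ⟨ε, _, hε, fun z => rfl⟩, fun z => ?_, fun z => ?_⟩
  · simp only [hh]; linear_combination z * h2
  · simp only [hh]; linear_combination (z - c) * h2

theorem injective {h : ℂ → ℂ} (H : IsHalfTranslation h) : Function.Injective h := by
  obtain ⟨h', -, h1, -⟩ := H.exists_inverse
  exact Function.LeftInverse.injective h1

/-- One value leaves the sign `ε` undetermined, and a second one fixes it. This rigidity is what
makes analytic continuation of flat maps possible. -/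
theorem eq_of_eq {h h' : ℂ → ℂ} (H : IsHalfTranslation h) (H' : IsHalfTranslation h') {a b : ℂ}
    (hab : a ≠ b) (ha : h a = h' a) (hb : h b = h' b) : h = h' := by
  obtain ⟨ε, c, -, hh⟩ := H
  obtain ⟨ε', c', -, hh'⟩ := H'
  rw [hh, hh'] at ha hb
  have : (ε - ε') * (a - b) = 0 := by linear_combination ha - hb
  have h1 : ε = ε' := by
    rcases mul_eq_zero.1 this with h | h
    · exact sub_eq_zero.1 h
    · exact absurd (sub_eq_zero.1 h) hab
  subst h1
  have : c = c' := by linear_combination ha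
  subst this
  funext z; rw [hh, hh']

theorem convex_preimage {h : ℂ → ℂ} (H : IsHalfTranslation h) {D : Set ℂ} (hD : Convex ℝ D) :
    Convex ℝ (h ⁻¹' D) := by
  obtain ⟨ε, c, -, hh⟩ := H
  intro x hx y hy a b ha hb hab
  have : h (a • x + b • y) = a • h x + b • h y := by
    simp only [hh, Complex.real_smul]
    have : (a : ℂ) + b = 1 := by exact_mod_cast hab
    linear_combination (-c) * this
  rw [mem_preimage, this]
  exact hD hx hy ha hb hab

theorem dist_eq {h : ℂ → ℂ} (H : IsHalfTranslation h) (x y : ℂ) : dist (h x) (h y) = dist x y := by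
  obtain ⟨ε, c, hε, hh⟩ := H
  rw [hh, hh, Complex.dist_eq, Complex.dist_eq]
  rcases hε with rfl | rfl
  · congr 1; ring
  · rw [← norm_neg]; congr 1; ring

theorem preimage_ball {h : ℂ → ℂ} (H : IsHalfTranslation h) (x : ℂ) (r : ℝ) :
    h ⁻¹' Metric.ball (h x) r = Metric.ball x r := by
  ext w; simp [H.dist_eq]

theorem image_segment {h : ℂ → ℂ} (H : IsHalfTranslation h) (x y : ℂ) :
    h '' segment ℝ x y = segment ℝ (h x) (h y) := by
  obtain ⟨ε, c, hε, hh⟩ := H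
  rw [segment_eq_image, segment_eq_image, ← image_comp]
  refine image_congr fun t _ => ?_
  simp only [Function.comp, hh, Complex.real_smul]
  push_cast; ring

theorem image_openSegment {h : ℂ → ℂ} (H : IsHalfTranslation h) (x y : ℂ) :
    h '' openSegment ℝ x y = openSegment ℝ (h x) (h y) := by
  obtain ⟨ε, c, hε, hh⟩ := H
  rw [openSegment_eq_image, openSegment_eq_image, ← image_comp]
  refine image_congr fun t _ => ?_
  simp only [Function.comp, hh, Complex.real_smul]
  push_cast; ring

end IsHalfTranslation

/-! ### Flat maps: identity principle, overlaps and gluing. -/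

namespace HalfTranslationStructure

variable {S : Type*} [TopologicalSpace S] {q : HalfTranslationStructure S}

/-- A flat map which avoids the marked points. -/
abbrev Free (q : HalfTranslationStructure S) (D : Set ℂ) (f : ℂ → S) : Prop := q.IsFlatMap D ∅ f

theorem IsFlatMap.free {D V : Set ℂ} {f : ℂ → S} (hf : q.IsFlatMap D V f) : q.Free (D \ V) f where
  continuousOn := hf.continuousOn.mono sdiff_subset
  vertices := by simp
  rest p hp := hf.rest p hp.1
  flat p hp ψ hψ hs := by
    obtain ⟨h, h1, h2⟩ := hf.flat p hp.1 ψ hψ hs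
    exact ⟨h, h1, h2.filter_mono (nhdsWithin_mono _ sdiff_subset)⟩

theorem IsFlatMap.mono {D V D' V' : Set ℂ} {f : ℂ → S} (hf : q.IsFlatMap D V f) (hD : D' ⊆ D)
    (hV : V' ⊆ V) (hV' : D' ∩ V ⊆ V') : q.IsFlatMap D' V' f where
  continuousOn := hf.continuousOn.mono hD
  vertices p hp := hf.vertices p (hV hp)
  rest p hp := hf.rest p ⟨hD hp.1, fun h => hp.2 (hV' ⟨hp.1, h⟩)⟩
  flat p hp ψ hψ hs := by
    obtain ⟨h, h1, h2⟩ := hf.flat p ⟨hD hp.1, fun h => hp.2 (hV' ⟨hp.1, h⟩)⟩ ψ hψ hs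
    exact ⟨h, h1, h2.filter_mono (nhdsWithin_mono _ hD)⟩

theorem Free.mono {D D' : Set ℂ} {f : ℂ → S} (hf : q.Free D f) (hD : D' ⊆ D) : q.Free D' f :=
  IsFlatMap.mono hf hD subset_rfl (by simp)

theorem Free.notMem {D : Set ℂ} {f : ℂ → S} (hf : q.Free D f) {p : ℂ} (hp : p ∈ D) : f p ∉ q.Z :=
  IsFlatMap.rest hf p ⟨hp, notMem_empty _⟩

theorem Free.chart_of_mem {D : Set ℂ} {f : ℂ → S} (hf : q.Free D f) {p : ℂ} (hp : p ∈ D)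
    {ψ : OpenPartialHomeomorph S ℂ} (hψ : ψ ∈ q.atlas) (hs : f p ∈ ψ.source) :
    ∃ h, IsHalfTranslation h ∧ ∀ᶠ w in 𝓝[D] p, f w ∈ ψ.source ∧ ψ (f w) = h w := by
  obtain ⟨h, h1, h2⟩ := IsFlatMap.flat hf p ⟨hp, notMem_empty _⟩ ψ hψ hs
  exact ⟨h, h1, ((IsFlatMap.continuousOn hf p hp).eventually_mem
    (ψ.open_source.mem_nhds hs)).and h2⟩

theorem Free.chart {D : Set ℂ} {f : ℂ → S} (hf : q.Free D f) {p : ℂ} (hp : p ∈ D) :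
    ∃ ψ ∈ q.atlas, f p ∈ ψ.source ∧ ∃ h, IsHalfTranslation h ∧
      ∀ᶠ w in 𝓝[D] p, f w ∈ ψ.source ∧ ψ (f w) = h w := by
  obtain ⟨ψ, hψ, hs⟩ := q.cover _ (hf.notMem hp)
  exact ⟨ψ, hψ, hs, hf.chart_of_mem hp hψ hs⟩

/-- Flatness is demanded in every chart of the atlas. One chart at each point is enough, since
`compatible` composes it with a half-translation to reach the others. -/
theorem Free.of_chart {D : Set ℂ} {f : ℂ → S} (H : ∀ p ∈ D, ∃ ψ ∈ q.atlas, f p ∈ ψ.source ∧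
    ∃ h, IsHalfTranslation h ∧ ∀ᶠ w in 𝓝[D] p, f w ∈ ψ.source ∧ ψ (f w) = h w) : q.Free D f where
  continuousOn p hp := by
    obtain ⟨ψ, hψ, hs, h, hh, hw⟩ := H p hp
    have hp' := hw.self_of_nhdsWithin hp
    have h1 : ContinuousWithinAt (fun w => ψ.symm (h w)) D p := by
      refine (ContinuousAt.comp ?_ hh.continuous.continuousAt).continuousWithinAt
      rw [← hp'.2]
      exact ψ.continuousAt_symm (ψ.map_source hs)
    refine h1.congr_of_eventuallyEq ?_ ?_
    · filter_upwards [hw] with w hw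
      rw [← hw.2, ψ.left_inv hw.1]
    · simp only [← hp'.2, ψ.left_inv hs]
  vertices := by simp
  rest p hp := by
    obtain ⟨ψ, hψ, hs, -⟩ := H p hp.1
    exact disjoint_left.1 (q.source_disjoint ψ hψ) hs
  flat p hp ψ' hψ' hs' := by
    obtain ⟨ψ, hψ, hs, h, hh, hw⟩ := H p hp.1
    have hp' := hw.self_of_nhdsWithin hp.1
    obtain ⟨h', hh', hc⟩ := q.compatible ψ hψ ψ' hψ' (f p) ⟨hs, hs'⟩
    refine ⟨_, hh'.comp hh, ?_⟩
    have h1 : ContinuousWithinAt (fun w => ψ.symm (h w)) D p := by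
      refine (ContinuousAt.comp ?_ hh.continuous.continuousAt).continuousWithinAt
      rw [← hp'.2]
      exact ψ.continuousAt_symm (ψ.map_source hs)
    have h2 : ContinuousWithinAt f D p := by
      refine h1.congr_of_eventuallyEq ?_ ?_
      · filter_upwards [hw] with w hw
        rw [← hw.2, ψ.left_inv hw.1]
      · simp only [← hp'.2, ψ.left_inv hs]
    filter_upwards [hw, h2.eventually hc] with w hw1 hw2
    rw [hw2, hw1.2]

theorem Free.of_eventuallyEq {D : Set ℂ} {f : ℂ → S} (H : ∀ p ∈ D, ∃ D' g, q.Free D' g ∧ p ∈ D' ∧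
    f p = g p ∧ ∀ᶠ w in 𝓝[D] p, w ∈ D' ∧ f w = g w) : q.Free D f := by
  refine Free.of_chart fun p hp => ?_
  obtain ⟨D', g, hg, hp', hfg, hw⟩ := H p hp
  obtain ⟨ψ, hψ, hs, h, hh, hw'⟩ := hg.chart hp'
  refine ⟨ψ, hψ, hfg ▸ hs, h, hh, ?_⟩
  rw [eventually_nhdsWithin_iff] at hw' hw ⊢
  filter_upwards [hw, hw'] with w h1 h2 h3
  rw [(h1 h3).2]
  exact h2 (h1 h3).1

/-- In a chart both maps are half-translations. Agreement at `p` and at one further nearby point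
identifies these by `eq_of_eq`. -/
theorem Free.eventuallyEq {D : Set ℂ} {f g : ℂ → S} (hf : q.Free D f) (hg : q.Free D g) {p : ℂ}
    (hp : p ∈ D) (he : f p = g p) (hfr : ∃ᶠ w in 𝓝[D] p, w ≠ p ∧ f w = g w) :
    f =ᶠ[𝓝[D] p] g := by
  obtain ⟨ψ, hψ, hs, h, hh, hw⟩ := hf.chart hp
  obtain ⟨h', hh', hw'⟩ := hg.chart_of_mem hp hψ (he ▸ hs)
  obtain ⟨w, ⟨hwp, hwe⟩, h1, h2⟩ := (hfr.and_eventually (hw.and hw')).exists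
  have hp1 := hw.self_of_nhdsWithin hp
  have hp2 := hw'.self_of_nhdsWithin hp
  have : h = h' := by
    refine hh.eq_of_eq hh' hwp ?_ ?_
    · rw [← h1.2, ← h2.2, hwe]
    · rw [← hp1.2, ← hp2.2, he]
  subst this
  filter_upwards [hw, hw'] with w h1 h2
  rw [← ψ.left_inv h1.1, ← ψ.left_inv h2.1, h1.2, h2.2]

/-- Identity principle: the points near which `f` and `g` agree form an open set. It is also closed,
because at a limit of such points `Free.eventuallyEq` applies. -/
theorem Free.eqOn [T2Space S] {D : Set ℂ} {f g : ℂ → S} (hf : q.Free D f) (hg : q.Free D g)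
    (hD : IsPreconnected D) {p : ℂ} (hp : p ∈ D) (he : f =ᶠ[𝓝[D] p] g) : EqOn f g D := by
  have : PreconnectedSpace D := isPreconnected_iff_preconnectedSpace.1 hD
  let A : Set D := {w | ∀ᶠ w' : D in 𝓝 w, f w' = g w'}
  have key : ∀ w : D, w ∈ A ↔ f =ᶠ[𝓝[D] (w : ℂ)] g := by
    intro w
    rw [nhdsWithin_eq_map_subtype_coe w.2]
    rfl
  have hA : IsClopen A := by
    refine ⟨?_, isOpen_setOfPred_eventually_nhds⟩
    refine isClosed_of_closure_subset fun w hw => ?_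
    have hfc : Continuous (fun w : D => f w) := continuousOn_iff_continuous_domRestrict.1
      (IsFlatMap.continuousOn hf)
    have hgc : Continuous (fun w : D => g w) := continuousOn_iff_continuous_domRestrict.1
      (IsFlatMap.continuousOn hg)
    have hwe : f w = g w :=
      closure_minimal (fun w' hw' => Eventually.self_of_nhds (p := fun w' : D => f w' = g w') hw')
        (isClosed_eq hfc hgc) hw
    by_contra hcon
    rw [key] at hcon
    refine hcon (hf.eventuallyEq hg w.2 hwe ?_)
    rw [nhdsWithin_eq_map_subtype_coe w.2, frequently_map]
    rw [mem_closure_iff_frequently] at hw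
    refine hw.mono fun w' hw' => ⟨fun h => ?_, hw'.self_of_nhds⟩
    have : w' = w := Subtype.ext h
    subst this
    exact hcon ((key _).1 hw')
  have := hA.eq_univ ⟨⟨p, hp⟩, (key _).2 he⟩
  intro w hw
  have h1 : (⟨w, hw⟩ : D) ∈ A := by rw [this]; trivial
  exact Eventually.self_of_nhds (p := fun w' : D => f w' = g w') h1

theorem IsFlatMap.comp {D V : Set ℂ} {f : ℂ → S} (hf : q.IsFlatMap D V f) {h : ℂ → ℂ}
    (hh : IsHalfTranslation h) : q.IsFlatMap (h ⁻¹' D) (h ⁻¹' V) (fun z => f (h z)) where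
  continuousOn := hf.continuousOn.comp hh.continuous.continuousOn (fun _ h => h)
  vertices p hp := hf.vertices _ hp
  rest p hp := hf.rest _ hp
  flat p hp ψ hψ hs := by
    obtain ⟨h', hh', hw⟩ := hf.flat _ hp ψ hψ hs
    refine ⟨_, hh'.comp hh, ?_⟩
    exact (hh.continuous.continuousWithinAt.tendsto_nhdsWithin (fun _ h => h)).eventually hw

theorem Free.comp {D : Set ℂ} {f : ℂ → S} (hf : q.Free D f) {h : ℂ → ℂ}
    (hh : IsHalfTranslation h) : q.Free (h ⁻¹' D) (fun z => f (h z)) := IsFlatMap.comp hf hh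

/-- Both maps are half-translations in a chart around the common value, and `h` is one of these
followed by the inverse of the other. Applied to a single map with a double point, this yields the
local symmetries by which self-overlaps are excluded. -/
theorem Free.align {D D' : Set ℂ} {f g : ℂ → S} (hf : q.Free D f) (hg : q.Free D' g) {u v : ℂ}
    (hu : u ∈ D) (hv : v ∈ D') (he : f u = g v) :
    ∃ h, IsHalfTranslation h ∧ h u = v ∧ ∀ᶠ w in 𝓝[D ∩ h ⁻¹' D'] u, f w = g (h w) := by
  obtain ⟨ψ, hψ, hs, h1, hh1, hw1⟩ := hf.chart hu
  obtain ⟨h2, hh2, hw2⟩ := hg.chart_of_mem hv hψ (he ▸ hs)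
  obtain ⟨h3, hh3, hl, hr⟩ := hh2.exists_inverse
  have huv : h3 (h1 u) = v := by
    rw [← (hw1.self_of_nhdsWithin hu).2, he, (hw2.self_of_nhdsWithin hv).2, hl]
  refine ⟨_, hh3.comp hh1, huv, ?_⟩
  have hc : Tendsto (fun z => h3 (h1 z)) (𝓝[D ∩ (fun z => h3 (h1 z)) ⁻¹' D'] u) (𝓝[D'] v) := by
    conv_rhs => rw [← huv]
    exact ((hh3.comp hh1).continuous.continuousWithinAt.tendsto_nhdsWithin (fun _ h => h)).mono_left
      (nhdsWithin_mono _ inter_subset_right)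
  filter_upwards [hw1.filter_mono (nhdsWithin_mono _ inter_subset_left), hc.eventually hw2]
    with w h4 h5
  rw [← ψ.left_inv h4.1, ← ψ.left_inv h5.1, h4.2, h5.2, hr]

theorem Free.overlap [T2Space S] {D D' : Set ℂ} {f g : ℂ → S} (hf : q.Free D f) (hg : q.Free D' g)
    (hD : Convex ℝ D) (hD' : Convex ℝ D') {u v : ℂ}
    (hu : u ∈ D) (hv : v ∈ D') (he : f u = g v) :
    ∃ h, IsHalfTranslation h ∧ h u = v ∧ EqOn f (fun w => g (h w)) (D ∩ h ⁻¹' D') := by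
  obtain ⟨h, hh, huv, hw⟩ := hf.align hg hu hv he
  refine ⟨h, hh, huv, ?_⟩
  exact (hf.mono inter_subset_left).eqOn ((hg.comp hh).mono inter_subset_right)
    (hD.inter (hh.convex_preimage hD')).isPreconnected ⟨hu, by rw [mem_preimage, huv]; exact hv⟩ hw

theorem Free.glue {N N' : Set ℂ} {f g : ℂ → S} (hf : q.Free N f) (hg : q.Free N' g)
    (hN : IsOpen N) (hN' : IsOpen N') (he : EqOn f g (N ∩ N')) :
    ∃ F, q.Free (N ∪ N') F ∧ EqOn F f N ∧ EqOn F g N' := by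
  classical
  let F := N.piecewise f g
  have h1 : EqOn F f N := piecewise_eqOn _ _ _
  have h2 : EqOn F g N' := fun w hw => by
    by_cases h : w ∈ N
    · rw [h1 h, he ⟨h, hw⟩]
    · exact piecewise_eq_of_notMem _ _ _ h
  refine ⟨F, Free.of_eventuallyEq fun p hp => ?_, h1, h2⟩
  rcases hp with hp | hp
  · refine ⟨N, f, hf, hp, h1 hp, mem_nhdsWithin_of_mem_nhds ?_⟩
    filter_upwards [hN.mem_nhds hp] with w hw using ⟨hw, h1 hw⟩
  · refine ⟨N', g, hg, hp, h2 hp, mem_nhdsWithin_of_mem_nhds ?_⟩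
    filter_upwards [hN'.mem_nhds hp] with w hw using ⟨hw, h2 hw⟩

theorem Free.congr {D : Set ℂ} {f g : ℂ → S} (hf : q.Free D f) (he : EqOn g f D) : q.Free D g :=
  Free.of_eventuallyEq fun _ hp => ⟨D, f, hf, hp, he hp, by
    filter_upwards [self_mem_nhdsWithin] with w hw using ⟨hw, he hw⟩⟩

theorem Free.image_mem_nhds {D : Set ℂ} {f : ℂ → S} (hf : q.Free D f) (hD : IsOpen D) {p : ℂ}
    (hp : p ∈ D) {U : Set ℂ} (hU : U ∈ 𝓝 p) : f '' U ∈ 𝓝 (f p) := by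
  obtain ⟨ψ, hψ, hs, h, hh, hw⟩ := hf.chart hp
  obtain ⟨h', hh', hl, hr⟩ := hh.exists_inverse
  rw [hD.nhdsWithin_eq hp] at hw
  have hp' := hw.self_of_nhds
  have hc : Tendsto (fun x => h' (ψ x)) (𝓝 (f p)) (𝓝 p) := by
    have : ContinuousAt (fun x => h' (ψ x)) (f p) :=
      hh'.continuous.continuousAt.comp (ψ.continuousAt hs)
    rwa [ContinuousAt, hp'.2, hl] at this
  filter_upwards [hc.eventually (hw.and hU), ψ.open_source.mem_nhds hs] with x hx hx'
  refine ⟨h' (ψ x), hx.2, ?_⟩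
  rw [← ψ.left_inv hx.1.1, hx.1.2, hr, ψ.left_inv hx']

theorem Free.injOn_nhds {D : Set ℂ} {f : ℂ → S} (hf : q.Free D f) {p : ℂ}
    (hp : p ∈ D) : ∃ U ∈ 𝓝[D] p, InjOn f U := by
  obtain ⟨ψ, hψ, hs, h, hh, hw⟩ := hf.chart hp
  refine ⟨_, hw, fun x hx y hy hxy => ?_⟩
  apply hh.injective
  rw [← hx.2, ← hy.2, hxy]

/-- Every unmarked point has a neighbourhood from which flat maps extend to discs of uniform size. -/
theorem exists_uniform_disc {p : S} (hp : p ∉ q.Z) : ∃ N ∈ 𝓝 p, ∃ r > 0,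
    N ∩ q.Z = ∅ ∧ (∀ x ∈ N, ∀ w, ∃ G, q.Free (Metric.ball w r) G ∧ G w = x) ∧
    ∀ D f w, IsOpen D → q.Free D f → w ∈ D → f w ∈ N →
      ∃ G, q.Free (Metric.ball w r) G ∧ G =ᶠ[𝓝 w] f := by
  obtain ⟨ψ, hψ, hs⟩ := q.cover p hp
  obtain ⟨r, hr, hb⟩ := Metric.isOpen_iff.1 ψ.open_target _ (ψ.map_source hs)
  have key : ∀ h, IsHalfTranslation h → ∀ w, h w ∈ Metric.ball (ψ p) (r / 2) →
      q.Free (Metric.ball w (r / 2)) (fun z => ψ.symm (h z)) := by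
    intro h hh w hw
    have ht : ∀ z ∈ Metric.ball w (r / 2), h z ∈ ψ.target := by
      intro z hz
      apply hb
      have h1 : dist (h z) (h w) < r / 2 := by rw [hh.dist_eq]; exact hz
      have h2 : dist (h w) (ψ p) < r / 2 := hw
      exact (dist_triangle _ _ _).trans_lt (by linarith)
    refine Free.of_chart fun z hz => ⟨ψ, hψ, ψ.map_target (ht z hz), h, hh, ?_⟩
    filter_upwards [self_mem_nhdsWithin] with z' hz'
    exact ⟨ψ.map_target (ht z' hz'), ψ.right_inv (ht z' hz')⟩
  -- Half the radius, so that a disc of radius `r / 2` about any point of the smaller disc still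
  -- lies in the chart's target.
  refine ⟨ψ.source ∩ ψ ⁻¹' Metric.ball (ψ p) (r / 2), ?_, r / 2, by positivity, ?_, ?_, ?_⟩
  · exact inter_mem (ψ.open_source.mem_nhds hs)
      ((ψ.continuousAt hs).preimage_mem_nhds (Metric.ball_mem_nhds _ (by positivity)))
  · exact ((q.source_disjoint ψ hψ).mono_left inter_subset_left).inter_eq
  · intro x hx w
    refine ⟨fun z => ψ.symm (1 * z + (ψ x - w)), key _ ⟨1, _, Or.inl rfl, fun z => rfl⟩ w ?_, ?_⟩
    · have := hx.2
      simpa using this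
    · simp [ψ.left_inv hx.1]
  · intro D f w hD hf hw hfw
    obtain ⟨h, hh, hev⟩ := hf.chart_of_mem hw hψ hfw.1
    rw [hD.nhdsWithin_eq hw] at hev
    refine ⟨fun z => ψ.symm (h z), key h hh w ?_, ?_⟩
    · rw [← hev.self_of_nhds.2]; exact hfw.2
    · filter_upwards [hev] with z hz
      rw [← hz.2, ψ.left_inv hz.1]

end HalfTranslationStructure

/-! ### Cone points: every flat map near a marked point is a branch of a power map. -/

namespace HalfTranslationStructure

variable {S : Type*} [TopologicalSpace S] {q : HalfTranslationStructure S}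

/-- `φ` is a chart at the cone point `z` in which the flat coordinates are branches of
`φ ^ (k / 2)`. -/
structure IsConeChart (q : HalfTranslationStructure S) (z : S) (k : ℕ)
    (φ : OpenPartialHomeomorph S ℂ) : Prop where
  one_le : 1 ≤ k
  mem_source : z ∈ φ.source
  map_eq : φ z = 0
  rel : ∀ ψ ∈ q.atlas, ∀ p ∈ φ.source ∩ ψ.source,
    ∃ c : ℂ, ∀ᶠ p' in 𝓝 p, (ψ p' - c) ^ 2 = φ p' ^ k

theorem exists_coneChart {z : S} (hz : z ∈ q.Z) : ∃ k φ, q.IsConeChart z k φ := by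
  obtain ⟨k, hk, φ, h1, h2, h3⟩ := q.cone z hz
  exact ⟨k, φ, hk, h1, h2, h3⟩

/-- The model flat map to the cone chart `φ` of angle `k π`: a branch of `w ^ (2 / k)`. -/
noncomputable def coneGerm (φ : OpenPartialHomeomorph S ℂ) (k : ℕ) (u ζ w : ℂ) : S :=
  φ.symm (ζ * (w / u) ^ ((2 : ℂ) / k))

/-- The disc about zero, slit along the ray opposite to `u`. -/
def slitBall (u : ℂ) (ρ : ℝ) : Set ℂ := {w | ‖w‖ < ρ ∧ w / u ∈ Complex.slitPlane}

theorem isOpen_slitBall (u : ℂ) (ρ : ℝ) : IsOpen (slitBall u ρ) := by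
  refine IsOpen.inter (isOpen_lt continuous_norm continuous_const) ?_
  exact Complex.isOpen_slitPlane.preimage (continuous_id.div_const u)

theorem ne_zero_of_mem_slitBall {u : ℂ} {ρ : ℝ} {w : ℂ} (h : w ∈ slitBall u ρ) : w ≠ 0 := by
  rintro rfl
  have := h.2
  simp at this

theorem cpow_two_div_pow {k : ℕ} (hk : 1 ≤ k) (x : ℂ) : (x ^ ((2 : ℂ) / k)) ^ k = x ^ 2 := by
  have hk' : (k : ℂ) ≠ 0 := by exact_mod_cast (by omega : k ≠ 0)
  rw [← Complex.cpow_mul_nat, div_mul_cancel₀ _ hk']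
  norm_cast

theorem coneGerm_arg_pow {k : ℕ} (hk : 1 ≤ k) {u ζ : ℂ} (hu : u ≠ 0) (hζ : ζ ^ k = u ^ 2) (w : ℂ) :
    (ζ * (w / u) ^ ((2 : ℂ) / k)) ^ k = w ^ 2 := by
  rw [mul_pow, cpow_two_div_pow hk, hζ, div_pow]
  field_simp

theorem continuousAt_two_div_cpow {k : ℕ} (hk : 1 ≤ k) {x : ℂ} (hx : 0 ≤ x.re ∨ x.im ≠ 0) :
    ContinuousAt (fun x : ℂ => x ^ ((2 : ℂ) / k)) x := by
  refine Complex.continuousAt_cpow_const_of_re_pos hx ?_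
  have : ((2 : ℂ) / k) = ((2 / k : ℝ) : ℂ) := by push_cast; rfl
  rw [this, Complex.ofReal_re]
  have : (0 : ℝ) < k := by exact_mod_cast hk
  positivity

theorem IsConeChart.zero_mem_target {z : S} {k : ℕ} {φ : OpenPartialHomeomorph S ℂ}
    (h : q.IsConeChart z k φ) : (0 : ℂ) ∈ φ.target := h.map_eq ▸ φ.map_source h.mem_source

theorem IsConeChart.symm_zero {z : S} {k : ℕ} {φ : OpenPartialHomeomorph S ℂ}
    (h : q.IsConeChart z k φ) : φ.symm 0 = z := h.map_eq ▸ φ.left_inv h.mem_source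

theorem IsConeChart.coneGerm_zero {z : S} {k : ℕ} {φ : OpenPartialHomeomorph S ℂ}
    (h : q.IsConeChart z k φ) (u ζ : ℂ) : coneGerm φ k u ζ 0 = z := by
  have hk' : (k : ℂ) ≠ 0 := by
    have := h.one_le
    exact_mod_cast (by omega : k ≠ 0)
  rw [coneGerm, zero_div, Complex.zero_cpow (by simpa using hk'), mul_zero, h.symm_zero]

theorem IsConeChart.continuousAt_coneGerm_zero {z : S} {k : ℕ} {φ : OpenPartialHomeomorph S ℂ}
    (h : q.IsConeChart z k φ) (u ζ : ℂ) : ContinuousAt (coneGerm φ k u ζ) 0 := by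
  have hk' : (k : ℂ) ≠ 0 := by
    have := h.one_le
    exact_mod_cast (by omega : k ≠ 0)
  have h1 : ContinuousAt (fun w : ℂ => ζ * (w / u) ^ ((2 : ℂ) / k)) 0 := by
    refine continuousAt_const.mul ?_
    refine ContinuousAt.comp (g := fun x : ℂ => x ^ ((2 : ℂ) / k)) ?_
      (continuousAt_id.div_const u)
    exact continuousAt_two_div_cpow h.one_le (by simp)
  refine ContinuousAt.comp (g := φ.symm) ?_ h1
  have h0 : ζ * ((0 : ℂ) / u) ^ ((2 : ℂ) / k) = 0 := by
    rw [zero_div, Complex.zero_cpow (by simpa using hk'), mul_zero]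
  rw [h0]
  exact φ.continuousAt_symm h.zero_mem_target

/-- The radius on which the cone germs are flat. -/
theorem IsConeChart.exists_radius [T2Space S] {z : S} {k : ℕ} {φ : OpenPartialHomeomorph S ℂ}
    (h : q.IsConeChart z k φ) : ∃ ρ > 0, ∀ u ζ : ℂ, u ≠ 0 → ζ ^ k = u ^ 2 →
      (∀ w, ‖w‖ < ρ → coneGerm φ k u ζ w ∈ φ.source ∧
        φ (coneGerm φ k u ζ w) = ζ * (w / u) ^ ((2 : ℂ) / k)) ∧
      q.Free (slitBall u ρ) (coneGerm φ k u ζ) := by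
  have hk := h.one_le
  have hev : ∀ᶠ x in 𝓝 (0 : ℂ), x ∈ φ.target ∧ φ.symm x ∉ q.Z \ {z} := by
    refine (φ.open_target.mem_nhds h.zero_mem_target |> fun h => (h : ∀ᶠ x in 𝓝 (0 : ℂ), _)).and ?_
    refine (φ.continuousAt_symm h.zero_mem_target).eventually_mem (IsOpen.mem_nhds
      (s := (q.Z \ {z})ᶜ) ?_ ?_)
    · exact (q.finite_Z.subset sdiff_subset).isClosed.isOpen_compl
    · rw [h.symm_zero]; simp
  obtain ⟨r, hr, hb⟩ := Metric.eventually_nhds_iff_ball.1 hev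
  -- Since `‖φ‖ ^ k = ‖w‖ ^ 2`, radius `r` in the cone chart corresponds to flat radius `√(r ^ k)`.
  refine ⟨√(r ^ k), by positivity, fun u ζ hu hζ => ?_⟩
  have hball : ∀ w : ℂ, ‖w‖ < √(r ^ k) → ζ * (w / u) ^ ((2 : ℂ) / k) ∈ Metric.ball (0 : ℂ) r := by
    intro w hw
    rw [mem_ball_zero_iff]
    refine lt_of_pow_lt_pow_left₀ k hr.le ?_
    rw [← norm_pow, coneGerm_arg_pow hk hu hζ, norm_pow]
    calc ‖w‖ ^ 2 < √(r ^ k) ^ 2 := by gcongr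
      _ = r ^ k := Real.sq_sqrt (by positivity)
  have hsrc : ∀ w, ‖w‖ < √(r ^ k) → coneGerm φ k u ζ w ∈ φ.source ∧
        φ (coneGerm φ k u ζ w) = ζ * (w / u) ^ ((2 : ℂ) / k) := fun w hw =>
    ⟨φ.map_target (hb _ (hball w hw)).1, φ.right_inv (hb _ (hball w hw)).1⟩
  have hcont : ∀ w ∈ slitBall u (√(r ^ k)), ContinuousAt (coneGerm φ k u ζ) w := by
    intro w hw
    refine ContinuousAt.comp (g := φ.symm) (φ.continuousAt_symm (hb _ (hball w hw.1)).1) ?_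
    refine continuousAt_const.mul ?_
    refine ContinuousAt.comp (g := fun x : ℂ => x ^ ((2 : ℂ) / k)) ?_
      (continuousAt_id.div_const u)
    refine continuousAt_two_div_cpow hk ?_
    rcases hw.2 with h1 | h1
    · exact Or.inl (le_of_lt h1)
    · exact Or.inr h1
  refine ⟨hsrc, ⟨fun w hw => (hcont w hw).continuousWithinAt, by simp, ?_, ?_⟩⟩
  · intro w hw hmem
    have hw := hw.1
    have hne : coneGerm φ k u ζ w ≠ z := by
      intro he
      have h1 := (hsrc w hw.1).2
      rw [he, h.map_eq] at h1
      have h2 := coneGerm_arg_pow hk hu hζ w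
      rw [← h1, zero_pow (by omega)] at h2
      exact ne_zero_of_mem_slitBall hw (pow_eq_zero_iff (two_ne_zero) |>.1 h2.symm)
    exact (hb _ (hball w hw.1)).2 ⟨hmem, hne⟩
  · intro w hw ψ hψ hs
    have hw := hw.1
    obtain ⟨c, hc⟩ := h.rel ψ hψ _ ⟨(hsrc w hw.1).1, hs⟩
    have hc' := (hcont w hw).eventually hc
    have hn : ∀ᶠ w' in 𝓝 w, w' ∈ slitBall u (√(r ^ k)) := (isOpen_slitBall _ _).mem_nhds hw
    have heq : ∀ᶠ w' in 𝓝 w, (ψ (coneGerm φ k u ζ w') - c) ^ 2 = w' ^ 2 := by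
      filter_upwards [hc', hn] with w' h1 h2
      rw [h1, (hsrc w' h2.1).2, coneGerm_arg_pow hk hu hζ]
    have hX : ContinuousAt (fun w' => ψ (coneGerm φ k u ζ w') - c) w :=
      (ContinuousAt.comp (g := ψ) (ψ.continuousAt hs) (hcont w hw)).sub continuousAt_const
    have hw0 : w ≠ 0 := ne_zero_of_mem_slitBall hw
    have h0 := heq.self_of_nhds
    -- The square determines `ψ - c` up to sign. As `w ≠ 0` keeps the two roots apart, the sign
    -- valid at `w` persists nearby.
    rcases sq_eq_sq_iff_eq_or_eq_neg.1 h0 with h1 | h1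
    · refine ⟨fun w => 1 * w + c, ⟨1, c, Or.inl rfl, fun _ => rfl⟩, nhdsWithin_le_nhds ?_⟩
      have hne : ∀ᶠ w' in 𝓝 w, ψ (coneGerm φ k u ζ w') - c + w' ≠ 0 := by
        refine (hX.add continuousAt_id).eventually_ne ?_
        change ψ (coneGerm φ k u ζ w) - c + w ≠ 0
        rw [h1]
        intro h2
        apply hw0
        linear_combination h2 / 2
      filter_upwards [heq, hne] with w' h2 h3
      have : (ψ (coneGerm φ k u ζ w') - c - w') * (ψ (coneGerm φ k u ζ w') - c + w') = 0 := by
        linear_combination h2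
      rcases mul_eq_zero.1 this with h4 | h4
      · linear_combination h4
      · exact absurd h4 h3
    · refine ⟨fun w => (-1) * w + c, ⟨-1, c, Or.inr rfl, fun _ => rfl⟩, nhdsWithin_le_nhds ?_⟩
      have hne : ∀ᶠ w' in 𝓝 w, ψ (coneGerm φ k u ζ w') - c - w' ≠ 0 := by
        refine (hX.sub continuousAt_id).eventually_ne ?_
        change ψ (coneGerm φ k u ζ w) - c - w ≠ 0
        rw [h1]
        intro h2
        apply hw0
        linear_combination -h2 / 2
      filter_upwards [heq, hne] with w' h2 h3
      have : (ψ (coneGerm φ k u ζ w') - c - w') * (ψ (coneGerm φ k u ζ w') - c + w') = 0 := by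
        linear_combination h2
      rcases mul_eq_zero.1 this with h4 | h4
      · exact absurd h4 h3
      · linear_combination h4

/-- `ψ ∘ f` is a half-translation, and its sign disappears in the relation `(ψ - c₀) ^ 2 = φ ^ k`.
The number `c` is the place in the plane where `f` would develop the cone point. -/
theorem IsConeChart.exists_center {z : S} {k : ℕ} {φ : OpenPartialHomeomorph S ℂ}
    (h : q.IsConeChart z k φ) {D : Set ℂ} {f : ℂ → S} (hD : IsOpen D) (hf : q.Free D f) {w : ℂ}
    (hw : w ∈ D) (hs : f w ∈ φ.source) :
    ∃ c : ℂ, ∀ᶠ w' in 𝓝 w, φ (f w') ^ k = (w' - c) ^ 2 := by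
  obtain ⟨ψ, hψ, hs', h', ⟨ε, c₁, hε, hh⟩, hev⟩ := hf.chart hw
  rw [hD.nhdsWithin_eq hw] at hev
  obtain ⟨c₀, hc₀⟩ := h.rel ψ hψ _ ⟨hs, hs'⟩
  have hc := (IsFlatMap.continuousOn hf).continuousAt (hD.mem_nhds hw)
  have h2 : ε * ε = 1 := by rcases hε with rfl | rfl <;> simp
  refine ⟨ε * (c₀ - c₁), ?_⟩
  filter_upwards [hev, hc.eventually hc₀] with w' h3 h4
  rw [← h4, h3.2, hh]
  linear_combination (w' ^ 2 - (c₀ - c₁) ^ 2) * h2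

theorem IsConeChart.apply_ne_zero {z : S} {k : ℕ} {φ : OpenPartialHomeomorph S ℂ}
    (h : q.IsConeChart z k φ) (hz : z ∈ q.Z) {p : S} (hp : p ∉ q.Z) (hs : p ∈ φ.source) :
    φ p ≠ 0 := by
  intro h0
  apply hp
  have := φ.injOn hs h.mem_source (h0.trans h.map_eq.symm)
  rwa [this]

/-- Choose `ζ` so that the germ has the right value at `w`. Alignment then leaves the identity or
the half-turn about `w`. The half-turn is impossible because it does not preserve `(w' - c) ^ 2`
near `w`. -/
theorem IsConeChart.eventuallyEq_coneGerm {z : S} {k : ℕ} {φ : OpenPartialHomeomorph S ℂ}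
    (h : q.IsConeChart z k φ) {ρ : ℝ} (hρ : ∀ u ζ : ℂ, u ≠ 0 → ζ ^ k = u ^ 2 →
      (∀ w, ‖w‖ < ρ → coneGerm φ k u ζ w ∈ φ.source ∧
        φ (coneGerm φ k u ζ w) = ζ * (w / u) ^ ((2 : ℂ) / k)) ∧
      q.Free (slitBall u ρ) (coneGerm φ k u ζ))
    {D : Set ℂ} {f : ℂ → S} (hD : IsOpen D) (hf : q.Free D f) {w : ℂ}
    (hw : w ∈ D) (hs : f w ∈ φ.source) {c u : ℂ} (hu : u ≠ 0)
    (hc : ∀ᶠ w' in 𝓝 w, φ (f w') ^ k = (w' - c) ^ 2) (hwc : w - c ∈ slitBall u ρ) :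
    ∃ ζ, ζ ^ k = u ^ 2 ∧ f =ᶠ[𝓝 w] fun w' => coneGerm φ k u ζ (w' - c) := by
  have hk := h.one_le
  have hwu : (w - c) / u ≠ 0 := div_ne_zero (ne_zero_of_mem_slitBall hwc) hu
  set x := ((w - c) / u) ^ ((2 : ℂ) / k) with hx
  have hxk : x ^ k = ((w - c) / u) ^ 2 := cpow_two_div_pow hk _
  have hx0 : x ≠ 0 := by
    intro h0
    rw [h0, zero_pow (by omega)] at hxk
    exact hwu (pow_eq_zero_iff two_ne_zero |>.1 hxk.symm)
  have hζ : (φ (f w) / x) ^ k = u ^ 2 := by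
    rw [div_pow, hc.self_of_nhds, hxk]
    have := ne_zero_of_mem_slitBall hwc
    field_simp
  refine ⟨φ (f w) / x, hζ, ?_⟩
  obtain ⟨hsrc, hfree⟩ := hρ u _ hu hζ
  set g := coneGerm φ k u (φ (f w) / x) with hg
  have hval : f w = g (w - c) := by
    rw [hg, coneGerm, ← hx, div_mul_cancel₀ _ hx0, φ.left_inv hs]
  have ht : IsHalfTranslation (fun w => w - c) :=
    ⟨1, -c, Or.inl rfl, fun z => by ring⟩
  have hE : IsOpen ((fun w => w - c) ⁻¹' slitBall u ρ) :=
    (isOpen_slitBall _ _).preimage (by fun_prop)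
  have hfree' := Free.comp hfree ht
  obtain ⟨t, htr, htw, hev⟩ := hf.align hfree' hw hwc hval
  have hopen : IsOpen (D ∩ t ⁻¹' ((fun w => w - c) ⁻¹' slitBall u ρ)) :=
    hD.inter (hE.preimage htr.continuous)
  have hmem : w ∈ D ∩ t ⁻¹' ((fun w => w - c) ⁻¹' slitBall u ρ) :=
    ⟨hw, by rw [mem_preimage, htw]; exact hwc⟩
  rw [hopen.nhdsWithin_eq hmem] at hev
  have htid : t = fun w => w := by
    obtain ⟨ε, d, hε, hh⟩ := htr
    have hd : d = w - ε * w := by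
      have h3 := hh w
      rw [htw] at h3
      linear_combination -h3
    rcases hε with rfl | rfl
    · funext v; rw [hh, hd]; ring
    exfalso
    have h1 : ∀ᶠ w' in 𝓝 w, (w' - c) ^ 2 = (2 * w - w' - c) ^ 2 := by
      filter_upwards [hev, hc, hopen.mem_nhds hmem] with w' h2 h3 h4
      rw [← h3, h2, (hsrc _ h4.2.1).2, coneGerm_arg_pow hk hu hζ, hh, hd]
      ring
    have h2 : ∀ᶠ w' in 𝓝[≠] w, w' = w := by
      filter_upwards [h1.filter_mono nhdsWithin_le_nhds, self_mem_nhdsWithin] with w' h2 h3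
      have h4 : (w - c) * (w - w') = 0 := by linear_combination (-1 / 4 : ℂ) * h2
      rcases mul_eq_zero.1 h4 with h5 | h5
      · exact absurd h5 (ne_zero_of_mem_slitBall hwc)
      · exact (sub_eq_zero.1 h5).symm
    obtain ⟨w', h3, h4⟩ := (h2.and (self_mem_nhdsWithin : ∀ᶠ w' in 𝓝[≠] w, w' ∈ ({w}ᶜ : Set ℂ))).exists
    exact h4 h3
  rw [htid] at hev
  exact hev

theorem Free.eqOn_Ico [T2Space S] {D D' : Set ℂ} {f g : ℂ → S} (hf : q.Free D f) (hg : q.Free D' g)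
    {a b : ℂ} (hD : ∀ t : ℝ, 0 ≤ t → t < 1 → a + t * (b - a) ∈ D)
    (hD' : ∀ t : ℝ, 0 ≤ t → t < 1 → a + t * (b - a) ∈ D') (he : f =ᶠ[𝓝 a] g) :
    ∀ t : ℝ, 0 ≤ t → t < 1 → f (a + t * (b - a)) = g (a + t * (b - a)) := by
  intro t h0 h1
  set A : Set ℂ := (fun t : ℝ => a + t * (b - a)) '' Ico 0 1
  have hA : A ⊆ D ∩ D' := by
    rintro _ ⟨t, ht, rfl⟩
    exact ⟨hD t ht.1 ht.2, hD' t ht.1 ht.2⟩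
  refine (hf.mono (hA.trans inter_subset_left)).eqOn (hg.mono (hA.trans inter_subset_right))
    (isPreconnected_Ico.image _ (by fun_prop)) (p := a) ⟨0, by simp, by simp⟩
    (nhdsWithin_le_nhds he) ⟨t, ⟨h0, h1⟩, rfl⟩

/-- The end point `b` need not lie in either domain, so a flat map can be compared with a cone germ
at the cone point itself. -/
theorem Free.eq_endpoint [T2Space S] {D D' : Set ℂ} {f g : ℂ → S} (hf : q.Free D f)
    (hg : q.Free D' g) {a b : ℂ} (hD : ∀ t : ℝ, 0 ≤ t → t < 1 → a + t * (b - a) ∈ D)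
    (hD' : ∀ t : ℝ, 0 ≤ t → t < 1 → a + t * (b - a) ∈ D') (he : f =ᶠ[𝓝 a] g)
    (hfc : ContinuousWithinAt f D b) (hgc : ContinuousWithinAt g D' b) : f b = g b := by
  have h1 : Tendsto (fun t : ℝ => a + t * (b - a)) (𝓝[<] 1) (𝓝 b) := by
    have : ContinuousAt (fun t : ℝ => a + t * (b - a)) 1 := by fun_prop
    have h2 := this.tendsto
    simp only [Complex.ofReal_one, one_mul, add_sub_cancel] at h2
    exact h2.mono_left nhdsWithin_le_nhds
  have hI : ∀ᶠ t : ℝ in 𝓝[<] 1, 0 ≤ t ∧ t < 1 := by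
    filter_upwards [Ioo_mem_nhdsLT (zero_lt_one' ℝ)] with t ht using ⟨ht.1.le, ht.2⟩
  have hfl := (hfc.tendsto.comp (tendsto_nhdsWithin_iff.2 ⟨h1, hI.mono fun t ht => hD t ht.1 ht.2⟩))
  have hgl := (hgc.tendsto.comp (tendsto_nhdsWithin_iff.2 ⟨h1, hI.mono fun t ht => hD' t ht.1 ht.2⟩))
  refine tendsto_nhds_unique (hfl.congr' ?_) hgl
  filter_upwards [hI] with t ht
  exact hf.eqOn_Ico hg hD hD' he t ht.1 ht.2

/-- The cone germ seen from a nearby point. -/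
theorem IsConeChart.exists_germ {z : S} {k : ℕ} {φ : OpenPartialHomeomorph S ℂ}
    (h : q.IsConeChart z k φ) (hz : z ∈ q.Z) {ρ : ℝ} (hρ : ∀ u ζ : ℂ, u ≠ 0 → ζ ^ k = u ^ 2 →
      (∀ w, ‖w‖ < ρ → coneGerm φ k u ζ w ∈ φ.source ∧
        φ (coneGerm φ k u ζ w) = ζ * (w / u) ^ ((2 : ℂ) / k)) ∧
      q.Free (slitBall u ρ) (coneGerm φ k u ζ)) {η : ℝ} (hη : 0 < η) (hηρ : η ≤ ρ) :
    ∃ O ∈ 𝓝 z, ∀ D f w, IsOpen D → q.Free D f → w ∈ D → f w ∈ O → ∃ c ζ : ℂ, w - c ≠ 0 ∧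
      ‖w - c‖ < η ∧ ζ ^ k = (w - c) ^ 2 ∧
      f =ᶠ[𝓝 w] fun w' => coneGerm φ k (w - c) ζ (w' - c) := by
  have hk := h.one_le
  have hev : ∀ᶠ p in 𝓝 z, p ∈ φ.source ∧ ‖φ p‖ ^ k < η ^ 2 := by
    refine (φ.open_source.mem_nhds h.mem_source |> fun h => (h : ∀ᶠ x in 𝓝 z, _)).and ?_
    have : ContinuousAt (fun p => ‖φ p‖ ^ k) z := ((φ.continuousAt h.mem_source).norm).pow k
    refine this.eventually_lt continuousAt_const ?_
    simp only [h.map_eq, norm_zero, zero_pow (by omega : k ≠ 0)]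
    positivity
  refine ⟨_, hev, fun D f w hD hf hw hO => ?_⟩
  obtain ⟨c, hc⟩ := h.exists_center hD hf hw hO.1
  have h0 := h.apply_ne_zero hz (hf.notMem hw) hO.1
  have hc0 := hc.self_of_nhds
  have hwc : w - c ≠ 0 := by
    intro h1
    rw [h1] at hc0
    simp at hc0
    exact h0 hc0.1
  have hlt : ‖w - c‖ < η := by
    refine lt_of_pow_lt_pow_left₀ 2 hη.le ?_
    rw [← norm_pow, ← hc0, norm_pow]
    exact hO.2
  obtain ⟨ζ, h1, h2⟩ := h.eventuallyEq_coneGerm hρ hD hf hw hO.1 hwc hc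
    ⟨hlt.trans_le hηρ, by rw [div_self hwc]; simp⟩
  exact ⟨c, ζ, hwc, hlt, h1, h2⟩

theorem slitBall_ray {u : ℂ} (hu : u ≠ 0) {ρ : ℝ} (hρ : ‖u‖ < ρ) {t : ℝ} (h0 : 0 ≤ t)
    (h1 : t < 1) : u + t * (0 - u) ∈ slitBall u ρ := by
  have h2 : u + t * (0 - u) = ((1 - t : ℝ) : ℂ) * u := by push_cast; ring
  have h3 : (0 : ℝ) < 1 - t := by linarith
  refine ⟨?_, ?_⟩
  · rw [h2, norm_mul, Complex.norm_real, Real.norm_of_nonneg h3.le]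
    nlinarith [norm_nonneg u]
  · rw [h2, mul_div_assoc, div_self hu, mul_one]
    exact Complex.ofReal_mem_slitPlane.2 h3

/-- If `f w` is close to `z`, then `f` is a cone germ whose centre `c` is within `R` of `w`. A flat
disc of radius `R` would contain `c` and map it to the marked point `z`. -/
theorem exists_nhds_no_disc [T2Space S] {z : S} (hz : z ∈ q.Z) {R : ℝ} (hR : 0 < R) :
    ∃ O ∈ 𝓝 z, ∀ f w, q.Free (Metric.ball w R) f → f w ∉ O := by
  obtain ⟨k, φ, h⟩ := exists_coneChart hz
  obtain ⟨ρ, hρ0, hρ⟩ := h.exists_radius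
  obtain ⟨O, hO, hO'⟩ := h.exists_germ hz hρ (lt_min hR hρ0) (min_le_right _ _)
  refine ⟨O, hO, fun f w hf hfw => ?_⟩
  obtain ⟨c, ζ, hwc, hlt, hζ, he⟩ := hO' _ f w Metric.isOpen_ball hf (Metric.mem_ball_self hR) hfw
  have ht : IsHalfTranslation (fun w => w - c) :=
    ⟨1, -c, Or.inl rfl, fun z => by ring⟩
  have hfree := Free.comp (hρ _ ζ hwc hζ).2 ht
  have hcb : c ∈ Metric.ball w R := by
    rw [Metric.mem_ball, dist_comm, dist_eq_norm]
    exact hlt.trans_le (min_le_left _ _)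
  have := hf.eq_endpoint hfree (a := w) (b := c) (fun t h0 h1 => ?_) (fun t h0 h1 => ?_) he
    (IsFlatMap.continuousOn hf c hcb) ?_
  · apply hf.notMem hcb
    rw [this, sub_self, h.coneGerm_zero]
    exact hz
  · have := (convex_ball w R).add_smul_sub_mem (Metric.mem_ball_self hR) hcb ⟨h0, h1.le⟩
    simpa using this
  · have := slitBall_ray hwc (hlt.trans_le (min_le_right _ _)) h0 h1
    rw [mem_preimage]
    convert this using 1
    ring
  · have h1 := h.continuousAt_coneGerm_zero (w - c) ζ
    refine (ContinuousAt.comp (g := coneGerm φ k (w - c) ζ) ?_ (by fun_prop)).continuousWithinAt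
    simpa using h1

end HalfTranslationStructure

/-! ### The view of the surface from an unmarked point. -/

namespace HalfTranslationStructure

variable {S : Type*} [TopologicalSpace S] {q : HalfTranslationStructure S}

/-- A chosen cone index at each marked point. -/
noncomputable def coneIndex (q : HalfTranslationStructure S) (z : q.Z) : ℕ :=
  (exists_coneChart z.2).choose

/-- A chosen cone chart at each marked point. -/
noncomputable def coneChart (q : HalfTranslationStructure S) (z : q.Z) :
    OpenPartialHomeomorph S ℂ :=
  (exists_coneChart z.2).choose_spec.choose

theorem isConeChart_coneChart (z : q.Z) : q.IsConeChart z (q.coneIndex z) (q.coneChart z) :=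
  (exists_coneChart z.2).choose_spec.choose_spec

/-- The surface as seen from a base point `w₀` placed in the plane: the flat map `f` is the
developing of the surface along straight segments issuing from `w₀`. It is defined on the star
domain `D` and extends to the set `V` of marked points which are visible from the base point. -/
structure Sky (q : HalfTranslationStructure S) (w₀ : ℂ) (f : ℂ → S) (D V : Set ℂ) : Prop where
  base : w₀ ∈ D
  isOpen : IsOpen D
  star : StarConvex ℝ w₀ D
  mem_V : ∀ κ, κ ∈ V ↔ κ ∉ D ∧ ∀ t : ℝ, 0 ≤ t → t < 1 → w₀ + t * (κ - w₀) ∈ D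
  free : q.Free D f
  map_V : ∀ κ ∈ V, f κ ∈ q.Z
  cont : ContinuousOn f (D ∪ V)
  isolated : ∀ κ ∈ V, ∃ δ > 0, ∀ w ∈ Metric.ball κ δ, w ∈ V → w = κ
  germ : ∀ κ (hκ : κ ∈ V), ∀ᶠ w in 𝓝[D] κ, f w ∈ (q.coneChart ⟨f κ, map_V κ hκ⟩).source ∧
    q.coneChart ⟨f κ, map_V κ hκ⟩ (f w) ^ q.coneIndex ⟨f κ, map_V κ hκ⟩ = (w - κ) ^ 2

/-- Take the union of all convex open neighbourhoods of `w₀` to which the germ extends. Two of them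
meet in a convex set containing `w₀`, so the extensions agree and there is no monodromy. -/
theorem exists_maximal_domain [T2Space S] {N₀ : Set ℂ} {f₀ : ℂ → S} {w₀ : ℂ} (hN₀ : IsOpen N₀)
    (hw₀ : w₀ ∈ N₀) (hf₀ : q.Free N₀ f₀) : ∃ (D : Set ℂ) (f : ℂ → S), w₀ ∈ D ∧ IsOpen D ∧
      StarConvex ℝ w₀ D ∧ q.Free D f ∧ f =ᶠ[𝓝 w₀] f₀ ∧
      (∀ N G, IsOpen N → Convex ℝ N → w₀ ∈ N → q.Free N G → G =ᶠ[𝓝 w₀] f → N ⊆ D ∧ EqOn f G N) ∧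
      ∀ w ∈ D, ∃ N ⊆ D, IsOpen N ∧ Convex ℝ N ∧ w₀ ∈ N ∧ w ∈ N := by
  classical
  let P : Set ℂ → (ℂ → S) → Prop := fun N G =>
    IsOpen N ∧ Convex ℝ N ∧ w₀ ∈ N ∧ q.Free N G ∧ G =ᶠ[𝓝 w₀] f₀
  let D : Set ℂ := {w | ∃ N G, P N G ∧ w ∈ N}
  let f : ℂ → S := fun w => if h : ∃ N G, P N G ∧ w ∈ N then h.choose_spec.choose w else f₀ w
  have hsub : ∀ N G, P N G → N ⊆ D := fun N G h w hw => ⟨N, G, h, hw⟩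
  have heq : ∀ N G, P N G → EqOn f G N := by
    intro N G h w hw
    have hex : ∃ N G, P N G ∧ w ∈ N := ⟨N, G, h, hw⟩
    have h1 : f w = hex.choose_spec.choose w := dif_pos hex
    rw [h1]
    obtain ⟨⟨ho, hc, hb, hf, he⟩, hw'⟩ := hex.choose_spec.choose_spec
    exact (hf.mono inter_subset_left).eqOn (h.2.2.2.1.mono inter_subset_right)
      (hc.inter h.2.1).isPreconnected (p := w₀) ⟨hb, h.2.2.1⟩
      (nhdsWithin_le_nhds (he.trans h.2.2.2.2.symm)) ⟨hw', hw⟩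
  obtain ⟨r, hr, hb⟩ := Metric.isOpen_iff.1 hN₀ w₀ hw₀
  have hP₀ : P (Metric.ball w₀ r) f₀ :=
    ⟨Metric.isOpen_ball, convex_ball _ _, Metric.mem_ball_self hr, hf₀.mono hb, EventuallyEq.rfl⟩
  have hff : f =ᶠ[𝓝 w₀] f₀ := by
    filter_upwards [Metric.ball_mem_nhds w₀ hr] with w hw using heq _ _ hP₀ hw
  refine ⟨D, f, hsub _ _ hP₀ (Metric.mem_ball_self hr), ?_, ?_, ?_, hff, ?_, ?_⟩
  · refine isOpen_iff_mem_nhds.2 fun w ⟨N, G, h, hw⟩ => ?_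
    exact Filter.mem_of_superset (h.1.mem_nhds hw) (hsub N G h)
  · refine starConvex_iff_segment_subset.2 fun w ⟨N, G, h, hw⟩ => ?_
    exact (h.2.1.segment_subset h.2.2.1 hw).trans (hsub N G h)
  · refine Free.of_eventuallyEq fun w ⟨N, G, h, hw⟩ => ⟨N, G, h.2.2.2.1, hw, heq N G h hw,
      nhdsWithin_le_nhds ?_⟩
    filter_upwards [h.1.mem_nhds hw] with w' hw' using ⟨hw', heq N G h hw'⟩
  · intro N G ho hc hb hf he
    have : P N G := ⟨ho, hc, hb, hf, he.trans hff⟩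
    exact ⟨hsub N G this, heq N G this⟩
  · rintro w ⟨N, G, h, hw⟩
    exact ⟨N, hsub N G h, h.1, h.2.1, h.2.2.1, hw⟩

/-- `N ∪ N'` need not be convex. But `N ∩ N'` is star-shaped about `w₁`, so the maps glue, and a
thin neighbourhood of the segment is a convex set on which the glued map lives. -/
theorem mem_maximal_domain_of_tube [T2Space S] {D N N' : Set ℂ} {f G : ℂ → S} {w₀ w₁ w : ℂ}
    (hf : q.Free D f)
    (hmax : ∀ N G, IsOpen N → Convex ℝ N → w₀ ∈ N → q.Free N G → G =ᶠ[𝓝 w₀] f →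
      N ⊆ D ∧ EqOn f G N)
    (hND : N ⊆ D) (hN : IsOpen N) (hNc : Convex ℝ N) (h0 : w₀ ∈ N) (h1 : w₁ ∈ N)
    (hN' : IsOpen N') (hs : StarConvex ℝ w₁ N') (h1' : w₁ ∈ N') (hG : q.Free N' G)
    (he : G =ᶠ[𝓝 w₁] f) (hseg : segment ℝ w₀ w ⊆ N ∪ N') :
    w ∈ D ∧ (w ∈ N' → f w = G w) := by
  have hpre : IsPreconnected (N ∩ N') := by
    have : StarConvex ℝ w₁ (N ∩ N') := (hNc h1).inter hs
    exact (this.isPathConnected ⟨h1, h1'⟩).isConnected.isPreconnected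
  have heq : EqOn f G (N ∩ N') :=
    ((hf.mono hND).mono inter_subset_left).eqOn (hG.mono inter_subset_right) hpre ⟨h1, h1'⟩
      (nhdsWithin_le_nhds he.symm)
  obtain ⟨F, hF, hF1, hF2⟩ := (hf.mono hND).glue hG hN hN' heq
  have hcpt : IsCompact (segment ℝ w₀ w) := by
    rw [segment_eq_image]
    exact isCompact_Icc.image (by fun_prop)
  obtain ⟨δ, hδ, hδ'⟩ := hcpt.exists_thickening_subset_open (hN.union hN') hseg
  have hself := Metric.self_subset_thickening hδ (segment ℝ w₀ w)
  obtain ⟨h3, h4⟩ := hmax _ F Metric.isOpen_thickening ((convex_segment w₀ w).thickening δ)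
    (hself (left_mem_segment ℝ _ _)) (hF.mono hδ') (by
      filter_upwards [hN.mem_nhds h0] with x hx using hF1 hx)
  have hw := hself (right_mem_segment ℝ w₀ w)
  exact ⟨h3 hw, fun h => by rw [h4 hw, hF2 h]⟩

theorem starConvex_slitBall {u : ℂ} (hu : u ≠ 0) {ρ : ℝ} (hρ : ‖u‖ < ρ) (c : ℂ) :
    StarConvex ℝ (c + u) ((fun w => w - c) ⁻¹' slitBall u ρ) := by
  intro w hw a b ha hb hab
  have hab' : (a : ℂ) + b = 1 := by exact_mod_cast hab
  have h1 : a • (c + u) + b • w - c = a • u + b • (w - c) := by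
    simp only [Complex.real_smul]
    linear_combination (c) * hab'
  change a • (c + u) + b • w - c ∈ slitBall u ρ
  rw [h1]
  constructor
  · have := convex_ball (0 : ℂ) ρ (x := u) (by simpa using hρ) (y := w - c) (by simpa using hw.1)
      ha hb hab
    simpa using this
  · have h2 : (a • u + b • (w - c)) / u = a • (1 : ℂ) + b • ((w - c) / u) := by
      simp only [Complex.real_smul]; field_simp
    rw [h2]
    exact Complex.starConvex_one_slitPlane hw.2 ha hb hab

/-- Continuation along a ray is stopped only by a marked point. By compactness `f` accumulates at
some `p` along the ray. If `p` were unmarked, a disc of uniform size would carry the extension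
across `κ`. So `p` is marked and `f` becomes a cone germ, whose centre must be `κ` and whose slit
points away from `w₀`. -/
theorem exists_visible_germ [T2Space S] [CompactSpace S] {D : Set ℂ} {f : ℂ → S} {w₀ κ : ℂ}
    (hD : IsOpen D) (h0D : w₀ ∈ D)
    (hf : q.Free D f)
    (hmax : ∀ N G, IsOpen N → Convex ℝ N → w₀ ∈ N → q.Free N G → G =ᶠ[𝓝 w₀] f →
      N ⊆ D ∧ EqOn f G N)
    (hloc : ∀ w ∈ D, ∃ N ⊆ D, IsOpen N ∧ Convex ℝ N ∧ w₀ ∈ N ∧ w ∈ N)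
    (hκ : κ ∉ D) (hray : ∀ t : ℝ, 0 ≤ t → t < 1 → w₀ + t * (κ - w₀) ∈ D) :
    ∃ z : q.Z, ∃ g : ℂ → S, ∃ δ > 0, g κ = z ∧ ContinuousAt g κ ∧
      (∀ w ∈ Metric.ball κ δ, (w - κ) / (w₀ - κ) ∈ Complex.slitPlane → w ∈ D ∧ f w = g w) ∧
      ∀ w ∈ Metric.ball κ δ, g w ∈ (q.coneChart z).source ∧
        q.coneChart z (g w) ^ q.coneIndex z = (w - κ) ^ 2 := by
  have hne : w₀ ≠ κ := fun h => hκ (h ▸ h0D)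
  set γ : ℝ → ℂ := fun t => w₀ + t * (κ - w₀) with hγ
  have hγ1 : Tendsto γ (𝓝[<] 1) (𝓝 κ) := by
    have : ContinuousAt γ 1 := by fun_prop
    have h2 := this.tendsto
    simp only [hγ, Complex.ofReal_one, one_mul, add_sub_cancel] at h2
    exact h2.mono_left nhdsWithin_le_nhds
  have hI : ∀ᶠ t : ℝ in 𝓝[<] 1, 0 ≤ t ∧ t < 1 := by
    filter_upwards [Ioo_mem_nhdsLT (zero_lt_one' ℝ)] with t ht using ⟨ht.1.le, ht.2⟩
  have hsegsub : ∀ t : ℝ, 0 ≤ t → t < 1 → ∀ x ∈ segment ℝ w₀ κ, x ∈ segment ℝ w₀ (γ t) ∨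
      ∃ s : ℝ, t ≤ s ∧ s ≤ 1 ∧ x = γ s := by
    intro t h0 h1 x hx
    rw [segment_eq_image'] at hx
    obtain ⟨s, hs, rfl⟩ := hx
    rcases le_total s t with h | h
    · left
      rcases eq_or_lt_of_le h0 with h0 | h0
      · subst h0
        have : s = 0 := le_antisymm h hs.1
        subst this; simp [left_mem_segment]
      · rw [segment_eq_image']
        refine ⟨s / t, ⟨by have := hs.1; positivity, div_le_one_of_le₀ h h0.le⟩, ?_⟩
        simp only [hγ, Complex.real_smul]
        have : (t : ℂ) ≠ 0 := by exact_mod_cast h0.ne'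
        push_cast; field_simp; ring
    · right
      exact ⟨s, h, hs.2, by simp [hγ]⟩
  obtain ⟨p, -, hp⟩ := isCompact_univ (X := S) (f := map (fun t => f (γ t)) (𝓝[<] (1 : ℝ))) (by simp)
  have hfreq : ∀ O ∈ 𝓝 p, ∃ᶠ t in 𝓝[<] (1 : ℝ), f (γ t) ∈ O := fun O hO =>
    (mapClusterPt_iff_frequently.1 hp) O hO
  by_cases hpZ : p ∈ q.Z
  swap
  · exfalso
    obtain ⟨O, hO, r, hr, -, -, hO'⟩ := exists_uniform_disc hpZ
    obtain ⟨t, h1, h2, h3⟩ := ((hfreq O hO).and_eventually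
      (hI.and (hγ1.eventually (Metric.ball_mem_nhds κ hr)))).exists
    obtain ⟨G, hG, hGe⟩ := hO' D f (γ t) hD hf (hray t h2.1 h2.2) h1
    obtain ⟨N, hND, hN, hNc, h0N, h1N⟩ := hloc _ (hray t h2.1 h2.2)
    refine hκ (mem_maximal_domain_of_tube (N := N) (N' := Metric.ball (γ t) r) hf hmax hND hN hNc
      h0N h1N Metric.isOpen_ball ((convex_ball _ _) (Metric.mem_ball_self hr))
      (Metric.mem_ball_self hr) hG hGe ?_).1
    intro x hx
    rcases hsegsub t h2.1 h2.2 x hx with h | ⟨s, hs, hs1, rfl⟩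
    · exact Or.inl (hNc.segment_subset h0N h1N h)
    · right
      have hκb : κ ∈ Metric.ball (γ t) r := by
        rw [Metric.mem_ball, dist_comm]; exact h3
      rw [Metric.mem_ball, dist_eq_norm] at hκb ⊢
      have e1 : γ s - γ t = ((s - t : ℝ) : ℂ) * (κ - w₀) := by simp only [hγ]; push_cast; ring
      have e2 : κ - γ t = ((1 - t : ℝ) : ℂ) * (κ - w₀) := by simp only [hγ]; push_cast; ring
      rw [e1, norm_mul, Complex.norm_real, Real.norm_of_nonneg (by linarith)]
      rw [e2, norm_mul, Complex.norm_real, Real.norm_of_nonneg (by linarith [h2.2])] at hκb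
      have : (s - t) * ‖κ - w₀‖ ≤ (1 - t) * ‖κ - w₀‖ := by gcongr
      linarith
  · have h := q.isConeChart_coneChart ⟨p, hpZ⟩
    set k := q.coneIndex ⟨p, hpZ⟩
    set φ := q.coneChart ⟨p, hpZ⟩
    obtain ⟨ρ, hρ0, hρ⟩ := h.exists_radius
    obtain ⟨O, hO, hO'⟩ := h.exists_germ hpZ hρ (η := ρ / 4) (by positivity) (by linarith)
    obtain ⟨t, h1, h2, h3⟩ := ((hfreq O hO).and_eventually
      (hI.and (hγ1.eventually (Metric.ball_mem_nhds κ (by positivity : 0 < ρ / 4))))).exists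
    obtain ⟨c, ζ, hwc, hlt, hζ, he⟩ := hO' D f (γ t) hD hf (hray t h2.1 h2.2) h1
    obtain ⟨N, hND, hN, hNc, h0N, h1N⟩ := hloc _ (hray t h2.1 h2.2)
    set u := γ t - c with hu
    obtain ⟨hsrc, hfree⟩ := hρ u ζ hwc hζ
    have ht : IsHalfTranslation (fun w => w - c) := ⟨1, -c, Or.inl rfl, fun z => by ring⟩
    have hG := Free.comp hfree ht
    have hN' : IsOpen ((fun w => w - c) ⁻¹' slitBall u ρ) :=
      (isOpen_slitBall _ _).preimage (by fun_prop)
    have hs' : StarConvex ℝ (γ t) ((fun w => w - c) ⁻¹' slitBall u ρ) := by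
      have := starConvex_slitBall hwc (by linarith : ‖u‖ < ρ) c
      rwa [hu, add_sub_cancel] at this
    have h1' : γ t ∈ (fun w => w - c) ⁻¹' slitBall u ρ :=
      ⟨by change ‖γ t - c‖ < ρ; linarith, by
        change (γ t - c) / u ∈ _
        rw [← hu, div_self hwc]; simp⟩
    have hconvcont : ContinuousAt (fun w => coneGerm φ k u ζ (w - c)) c := by
      refine ContinuousAt.comp (g := coneGerm φ k u ζ) ?_ (by fun_prop)
      rw [sub_self]
      exact h.continuousAt_coneGerm_zero u ζ
    have htube := fun w => mem_maximal_domain_of_tube (w := w) hf hmax hND hN hNc h0N h1N hN' hs' h1'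
      hG he.symm
    -- If `κ` is off the slit of the germ, the germ extends `f` across `κ`. If it is on the slit,
    -- then `c` lies on the ray before `κ`, hence in `D`, and `f c` would be marked.
    have hcκ : c = κ := by
      by_contra hcκ
      have hκc : ‖κ - c‖ < ρ / 2 := by
        have e1 : κ - c = -(γ t - κ) + (γ t - c) := by ring
        rw [e1]
        refine (norm_add_le _ _).trans_lt ?_
        rw [norm_neg, ← dist_eq_norm]
        have : dist (γ t) κ < ρ / 4 := h3
        linarith
      by_cases hsl : (κ - c) / u ∈ Complex.slitPlane
      · refine hκ (htube κ ?_).1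
        intro x hx
        rcases hsegsub t h2.1 h2.2 x hx with h | ⟨s, hs, hs1, rfl⟩
        · exact Or.inl (hNc.segment_subset h0N h1N h)
        · right
          have hκN : κ ∈ (fun w => w - c) ⁻¹' slitBall u ρ :=
            ⟨by change ‖κ - c‖ < ρ; linarith, hsl⟩
          refine starConvex_iff_segment_subset.1 hs' hκN ?_
          rw [segment_eq_image']
          have h4 : (0 : ℝ) < 1 - t := by linarith [h2.2]
          refine ⟨(s - t) / (1 - t), ⟨div_nonneg (by linarith) h4.le,
            div_le_one_of_le₀ (by linarith) h4.le⟩, ?_⟩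
          simp only [hγ, Complex.real_smul]
          have : ((1 : ℂ) - t) ≠ 0 := by exact_mod_cast h4.ne'
          push_cast; field_simp; ring
      · rw [Complex.mem_slitPlane_iff_not_le_zero, not_not] at hsl
        obtain ⟨hre, him⟩ := Complex.le_def.1 hsl
        simp only [Complex.zero_re, Complex.zero_im] at hre him
        obtain ⟨σ, hσ⟩ : ∃ σ : ℝ, (κ - c) / u = -(σ : ℂ) :=
          ⟨-((κ - c) / u).re, by apply Complex.ext <;> simp [him]⟩
        have hσ' : κ - c = -(σ : ℂ) * u := by rw [← hσ]; field_simp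
        have hσ0 : 0 < σ := by
          have : 0 ≤ σ := by
            rw [hσ] at hre; simpa using hre
          rcases eq_or_lt_of_le this with h5 | h5
          · exfalso
            rw [← h5] at hσ'
            simp at hσ'
            exact hcκ (sub_eq_zero.1 hσ').symm
          · exact h5
        have hσ1 : (1 : ℂ) + σ ≠ 0 := by
          have : (1 : ℝ) + σ ≠ 0 := by positivity
          exact_mod_cast this
        have hcD : c ∈ D := by
          have e1 : c = γ ((1 + σ * t) / (1 + σ)) := by
            simp only [hγ]
            push_cast
            have : κ - c = -(σ : ℂ) * (w₀ + t * (κ - w₀) - c) := hσ'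
            field_simp
            linear_combination -this
          rw [e1]
          refine hray _ ?_ ?_
          · have := h2.1; positivity
          · rw [div_lt_one (by positivity)]
            nlinarith [h2.2]
        have := hf.eq_endpoint hG (a := γ t) (b := c) (fun s h0 h1 => ?_) (fun s h0 h1 => ?_) he
          (IsFlatMap.continuousOn hf c hcD) hconvcont.continuousWithinAt
        · apply hf.notMem hcD
          rw [this, sub_self, h.coneGerm_zero]
          exact hpZ
        · have e1 : γ t + s * (c - γ t) = γ (t + s * ((1 + σ * t) / (1 + σ) - t)) := by
            simp only [hγ]
            push_cast
            have h6 : κ - c = -(σ : ℂ) * (w₀ + t * (κ - w₀) - c) := hσ'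
            field_simp
            linear_combination (-(s : ℂ)) * h6
          rw [e1]
          have e2 : (1 + σ * t) / (1 + σ) - t = (1 - t) / (1 + σ) := by field_simp; ring
          have h7 : (1 - t) / (1 + σ) < 1 - t := by
            rw [div_lt_iff₀ (by positivity)]; nlinarith [h2.2]
          have h8 : 0 < (1 - t) / (1 + σ) := div_pos (by linarith [h2.2]) (by positivity)
          rw [e2]
          refine hray _ ?_ ?_
          · have := h2.1; positivity
          · nlinarith
        · have := slitBall_ray hwc (by linarith : ‖u‖ < ρ) h0 h1
          rw [mem_preimage]
          convert this using 1
          simp only [hu]; ring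
    subst hcκ
    have ht1 : (0 : ℝ) < 1 - t := by linarith [h2.2]
    have hu' : u = ((1 - t : ℝ) : ℂ) * (w₀ - c) := by
      simp only [hu, hγ]; push_cast; ring
    have hcpt : IsCompact (segment ℝ w₀ (γ t)) := by
      rw [segment_eq_image]
      exact isCompact_Icc.image (by fun_prop)
    obtain ⟨δ, hδ, hδ'⟩ := hcpt.exists_thickening_subset_open hN (hNc.segment_subset h0N h1N)
    -- The bound `δ` keeps the part of the segment from `w₀` to `w` before parameter `t` in `N`. The
    -- bound `ρ / 4`, together with `‖u‖ < ρ / 4`, keeps the rest in the disc of the germ.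
    refine ⟨⟨p, hpZ⟩, fun w => coneGerm φ k u ζ (w - c), min δ (ρ / 4), by positivity, ?_,
      hconvcont, ?_, ?_⟩
    · simp only [sub_self]; exact h.coneGerm_zero u ζ
    · intro w hw hwsl
      have hw1 : ‖w - c‖ < δ := by
        rw [← dist_eq_norm]; exact (lt_of_lt_of_le hw (min_le_left _ _))
      have hw2 : ‖w - c‖ < ρ / 4 := by
        rw [← dist_eq_norm]; exact (lt_of_lt_of_le hw (min_le_right _ _))
      have key : ∀ s : ℝ, t ≤ s → s ≤ 1 → w₀ + s * (w - w₀) ∈ (fun w => w - c) ⁻¹' slitBall u ρ ∨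
          s ≤ 0 := by
        intro s hs hs1
        by_cases hs0 : s ≤ 0
        · exact Or.inr hs0
        left
        push Not at hs0
        have e1 : w₀ + s * (w - w₀) - c = ((1 - s : ℝ) : ℂ) * (w₀ - c) + s * (w - c) := by
          push_cast; ring
        change w₀ + s * (w - w₀) - c ∈ slitBall u ρ
        rw [e1]
        have hwc0 : w₀ - c ≠ 0 := sub_ne_zero.2 hne
        constructor
        · refine (norm_add_le _ _).trans_lt ?_
          have a1 : ‖((1 - s : ℝ) : ℂ) * (w₀ - c)‖ ≤ ‖u‖ := by
            rw [hu', norm_mul, norm_mul, Complex.norm_real, Complex.norm_real,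
              Real.norm_of_nonneg (by linarith), Real.norm_of_nonneg ht1.le]
            gcongr
          have a2 : ‖(s : ℂ) * (w - c)‖ ≤ ‖w - c‖ := by
            rw [norm_mul, Complex.norm_real, Real.norm_of_nonneg hs0.le]
            exact mul_le_of_le_one_left (norm_nonneg _) hs1
          linarith
        · have e2 : (((1 - s : ℝ) : ℂ) * (w₀ - c) + s * (w - c)) / u
              = (((1 - s) / (1 - t) : ℝ) : ℂ) + ((s / (1 - t) : ℝ) : ℂ) * ((w - c) / (w₀ - c)) := by
            rw [hu']
            have : ((1 : ℂ) - t) ≠ 0 := by exact_mod_cast ht1.ne'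
            push_cast
            field_simp
          rw [e2]
          have a3 : 0 ≤ (1 - s) / (1 - t) := div_nonneg (by linarith) ht1.le
          have a4 : 0 < s / (1 - t) := div_pos hs0 ht1
          rcases hwsl with h5 | h5
          · left
            simp only [Complex.add_re, Complex.ofReal_re, Complex.re_ofReal_mul]
            positivity
          · right
            simp only [Complex.add_im, Complex.ofReal_im, Complex.im_ofReal_mul, zero_add]
            positivity
      have hseg : segment ℝ w₀ w ⊆ N ∪ (fun w => w - c) ⁻¹' slitBall u ρ := by
        intro x hx
        rw [segment_eq_image'] at hx
        obtain ⟨s, hs, rfl⟩ := hx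
        simp only [Complex.real_smul]
        by_cases hst : t ≤ s
        · rcases key s hst hs.2 with h5 | h5
          · exact Or.inr h5
          · have : s = 0 := le_antisymm h5 hs.1
            subst this
            left; simpa using h0N
        · left
          apply hδ'
          push Not at hst
          rw [Metric.mem_thickening_iff]
          refine ⟨γ s, ?_, ?_⟩
          · rw [segment_eq_image']
            have htpos : 0 < t := lt_of_le_of_lt hs.1 hst
            refine ⟨s / t, ⟨div_nonneg hs.1 htpos.le, div_le_one_of_le₀ hst.le htpos.le⟩, ?_⟩
            simp only [hγ, Complex.real_smul]
            have : (t : ℂ) ≠ 0 := by exact_mod_cast htpos.ne'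
            push_cast; field_simp; ring
          · rw [dist_eq_norm]
            have : w₀ + s * (w - w₀) - γ s = s * (w - c) := by simp only [hγ]; ring
            rw [this, norm_mul, Complex.norm_real, Real.norm_of_nonneg hs.1]
            exact (mul_le_of_le_one_left (norm_nonneg _) hs.2).trans_lt hw1
      obtain ⟨a1, a2⟩ := htube w hseg
      refine ⟨a1, a2 ?_⟩
      rcases key 1 h2.2.le le_rfl with h5 | h5
      · simpa using h5
      · norm_num at h5
    · intro w hw
      have hw2 : ‖w - c‖ < ρ := by
        rw [← dist_eq_norm]
        have := lt_of_lt_of_le hw (min_le_right δ (ρ / 4))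
        linarith
      obtain ⟨a1, a2⟩ := hsrc (w - c) hw2
      exact ⟨a1, by rw [a2, coneGerm_arg_pow h.one_le hwc hζ]⟩

/-- The map is extended to `V` by the marked points found there. A star domain contains nothing
behind a visible point (`hslit`), so near `κ` all of `D` lies where the cone germ computes the map.
This gives continuity at `V` and the relation `germ`, and the germ also shows that visible points
are isolated. -/
theorem exists_sky [T2Space S] [CompactSpace S] {N₀ : Set ℂ} {f₀ : ℂ → S} {w₀ : ℂ}
    (hN₀ : IsOpen N₀) (hw₀ : w₀ ∈ N₀) (hf₀ : q.Free N₀ f₀) :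
    ∃ f D V, q.Sky w₀ f D V ∧ f =ᶠ[𝓝 w₀] f₀ := by
  classical
  obtain ⟨D, f, h0, hD, hstar, hf, he, hmax, hloc⟩ := exists_maximal_domain hN₀ hw₀ hf₀
  let V : Set ℂ := {κ | κ ∉ D ∧ ∀ t : ℝ, 0 ≤ t → t < 1 → w₀ + t * (κ - w₀) ∈ D}
  have H : ∀ κ : V, _ := fun κ => exists_visible_germ hD h0 hf hmax hloc κ.2.1 κ.2.2
  choose z g δ hδ hgz hgc hgD hgcone using H
  let F : ℂ → S := fun w => if h : w ∈ V then z ⟨w, h⟩ else f w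
  have hFV : ∀ κ (h : κ ∈ V), F κ = z ⟨κ, h⟩ := fun κ h => dif_pos h
  have hFD : ∀ w ∈ D, F w = f w := fun w hw => dif_neg fun h => h.1 hw
  have hslit : ∀ κ ∈ V, ∀ w ∈ D, (w - κ) / (w₀ - κ) ∈ Complex.slitPlane := by
    intro κ hκ w hw
    by_contra hsl
    have hne : w₀ - κ ≠ 0 := sub_ne_zero.2 fun h => hκ.1 (h ▸ h0)
    rw [Complex.mem_slitPlane_iff_not_le_zero, not_not] at hsl
    obtain ⟨hre, him⟩ := Complex.le_def.1 hsl
    simp only [Complex.zero_re, Complex.zero_im] at hre him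
    obtain ⟨σ, hσ⟩ : ∃ σ : ℝ, (w - κ) / (w₀ - κ) = -(σ : ℂ) :=
      ⟨-((w - κ) / (w₀ - κ)).re, by apply Complex.ext <;> simp [him]⟩
    have hσ0 : 0 ≤ σ := by rw [hσ] at hre; simpa using hre
    have hσ' : w - κ = -(σ : ℂ) * (w₀ - κ) := by rw [← hσ]; field_simp
    apply hκ.1
    refine starConvex_iff_segment_subset.1 hstar hw ?_
    rw [segment_eq_image']
    refine ⟨1 / (1 + σ), ⟨by positivity, div_le_one_of_le₀ (by linarith) (by positivity)⟩, ?_⟩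
    have : (1 : ℂ) + σ ≠ 0 := by
      have : (1 : ℝ) + σ ≠ 0 := by positivity
      exact_mod_cast this
    simp only [Complex.real_smul]
    push_cast
    field_simp
    linear_combination hσ'
  have hisol : ∀ κ (h : κ ∈ V), ∀ w ∈ Metric.ball κ (δ ⟨κ, h⟩), w ∈ V → w = κ := by
    intro κ hκ w hw hwV
    by_contra hwκ
    have hne : w₀ - κ ≠ 0 := sub_ne_zero.2 fun h => hκ.1 (h ▸ h0)
    by_cases hsl : (w - κ) / (w₀ - κ) ∈ Complex.slitPlane
    · exact hwV.1 (hgD ⟨κ, hκ⟩ w hw hsl).1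
    · rw [Complex.mem_slitPlane_iff_not_le_zero, not_not] at hsl
      obtain ⟨hre, him⟩ := Complex.le_def.1 hsl
      simp only [Complex.zero_re, Complex.zero_im] at hre him
      obtain ⟨σ, hσ⟩ : ∃ σ : ℝ, (w - κ) / (w₀ - κ) = -(σ : ℂ) :=
        ⟨-((w - κ) / (w₀ - κ)).re, by apply Complex.ext <;> simp [him]⟩
      have hσ' : w - κ = -(σ : ℂ) * (w₀ - κ) := by rw [← hσ]; field_simp
      have hσ0 : 0 < σ := by
        have : 0 ≤ σ := by rw [hσ] at hre; simpa using hre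
        rcases eq_or_lt_of_le this with h5 | h5
        · rw [← h5] at hσ'
          simp at hσ'
          exact absurd (sub_eq_zero.1 hσ') hwκ
        · exact h5
      apply hκ.1
      have h5 := hwV.2 (1 / (1 + σ)) (by positivity) (by rw [div_lt_one (by positivity)]; linarith)
      convert h5 using 1
      have : (1 : ℂ) + σ ≠ 0 := by
        have : (1 : ℝ) + σ ≠ 0 := by positivity
        exact_mod_cast this
      push_cast
      field_simp
      linear_combination -hσ'
  have hFfree : q.Free D F := hf.congr hFD
  refine ⟨F, D, V, ?_, ?_⟩
  · refine { base := h0, isOpen := hD, star := hstar, mem_V := fun κ => Iff.rfl, free := hFfree, map_V := fun κ h => ?_, cont := ?_, isolated := fun κ h => ⟨_, hδ _, hisol κ h⟩, germ := fun κ hκ => ?_ }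
    · rw [hFV κ h]; exact (z _).2
    · rintro w (hw | hw)
      · refine ContinuousAt.continuousWithinAt ?_
        exact (IsFlatMap.continuousOn hFfree).continuousAt (hD.mem_nhds hw)
      · have h1 : F w = g ⟨w, hw⟩ w := by rw [hFV w hw]; exact (hgz ⟨w, hw⟩).symm
        refine (hgc ⟨w, hw⟩).continuousWithinAt.congr_of_eventuallyEq ?_ h1
        rw [EventuallyEq, eventually_nhdsWithin_iff]
        filter_upwards [Metric.ball_mem_nhds w (hδ ⟨w, hw⟩)] with w' hw' hmem
        rcases hmem with h2 | h2
        · rw [hFD w' h2]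
          exact (hgD ⟨w, hw⟩ w' hw' (hslit w hw w' h2)).2
        · rw [hisol w hw w' hw' h2, h1]
    · have h1 : (⟨F κ, by rw [hFV κ hκ]; exact (z _).2⟩ : q.Z) = z ⟨κ, hκ⟩ :=
        Subtype.ext (hFV κ hκ)
      rw [h1, eventually_nhdsWithin_iff]
      filter_upwards [Metric.ball_mem_nhds κ (hδ ⟨κ, hκ⟩)] with w hw hwD
      have h2 : F w = g ⟨κ, hκ⟩ w := by
        rw [hFD w hwD]; exact (hgD ⟨κ, hκ⟩ w hw (hslit κ hκ w hwD)).2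
      rw [h2]
      exact hgcone ⟨κ, hκ⟩ w hw
  · filter_upwards [he, hD.mem_nhds h0] with w h1 h2
    rw [hFD w h2, h1]

end HalfTranslationStructure

/-! ### Plane geometry of a star domain and its visible points. -/

/-- The planar data of a view of a surface: a star domain `D` about `w₀` and the discrete set `V`
of the obstructing points which are visible from `w₀`. -/
structure StarView (w₀ : ℂ) (D V : Set ℂ) : Prop where
  base : w₀ ∈ D
  isOpen : IsOpen D
  star : StarConvex ℝ w₀ D
  mem_V : ∀ κ, κ ∈ V ↔ κ ∉ D ∧ ∀ t : ℝ, 0 ≤ t → t < 1 → w₀ + t * (κ - w₀) ∈ D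
  isolated : ∀ κ ∈ V, ∃ δ > 0, ∀ w ∈ Metric.ball κ δ, w ∈ V → w = κ

namespace StarView

variable {w₀ : ℂ} {D V : Set ℂ}

theorem notMem (s : StarView w₀ D V) {κ : ℂ} (h : κ ∈ V) : κ ∉ D := ((s.mem_V κ).1 h).1

/-- The visible point is the first one outside `D` on the way from `w₀` to `w`. -/
theorem exists_visible (s : StarView w₀ D V) {w : ℂ} (hw : w ∉ D) :
    ∃ t : ℝ, 0 < t ∧ t ≤ 1 ∧ w₀ + t * (w - w₀) ∈ V := by
  have hA : IsCompact (Icc (0 : ℝ) 1 ∩ {t : ℝ | w₀ + t * (w - w₀) ∉ D}) := by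
    refine isCompact_Icc.inter_right ?_
    exact s.isOpen.isClosed_compl.preimage (by fun_prop : Continuous fun t : ℝ => w₀ + t * (w - w₀))
  obtain ⟨t, ⟨ht, htD⟩, hmin⟩ := hA.exists_isLeast ⟨1, by simp, by simpa using hw⟩
  have ht0 : 0 < t := by
    rcases eq_or_lt_of_le ht.1 with h | h
    · exfalso; subst h; apply htD; simpa using s.base
    · exact h
  refine ⟨t, ht0, ht.2, (s.mem_V _).2 ⟨htD, fun r hr hr1 => ?_⟩⟩
  by_contra hcon
  have h1 : w₀ + r * (w₀ + t * (w - w₀) - w₀) = w₀ + ((r * t : ℝ) : ℂ) * (w - w₀) := by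
    push_cast; ring
  rw [h1] at hcon
  have := hmin ⟨⟨mul_nonneg hr ht0.le, by nlinarith [ht.2]⟩, hcon⟩
  nlinarith

/-- A point of `C` outside `D` would have a visible point before it, still in `C`. This is the main
tool for enlarging rectangles: only visible points can obstruct. -/
theorem subset_of_disjoint (s : StarView w₀ D V) {C : Set ℂ} (hC : StarConvex ℝ w₀ C)
    (hV : ∀ w ∈ C, w ∉ V) : C ⊆ D := by
  intro w hw
  by_contra hwD
  obtain ⟨t, h0, h1, h2⟩ := s.exists_visible hwD
  refine hV _ ?_ h2
  refine starConvex_iff_segment_subset.1 hC hw ?_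
  rw [segment_eq_image']
  exact ⟨t, ⟨h0.le, h1⟩, by simp⟩

/-- Visible points outside `K` cannot accumulate at `K`: not at a point of `D`, which is open and
misses `V`, and not at a point of `V`, which is isolated. -/
theorem exists_thickening (s : StarView w₀ D V) {K : Set ℂ} (hK : IsCompact K) (hKD : K ⊆ D ∪ V) :
    ∃ ε > 0, ∀ w ∈ V, (∃ x ∈ K, dist w x < ε) → w ∈ K := by
  have h1 : K ⊆ (closure (V \ K))ᶜ := by
    intro x hx hcl
    rcases hKD hx with h | h
    · obtain ⟨w, hw, hw'⟩ := mem_closure_iff_nhds.1 hcl D (s.isOpen.mem_nhds h)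
      exact s.notMem hw'.1 hw
    · obtain ⟨δ, hδ, hiso⟩ := s.isolated x h
      obtain ⟨w, hw, hw'⟩ := mem_closure_iff_nhds.1 hcl _ (Metric.ball_mem_nhds x hδ)
      exact hw'.2 (hiso w hw hw'.1 ▸ hx)
  obtain ⟨ε, hε, hsub⟩ := hK.exists_thickening_subset_open isClosed_closure.isOpen_compl h1
  refine ⟨ε, hε, fun w hw ⟨x, hx, hd⟩ => ?_⟩
  by_contra hwK
  exact hsub (Metric.mem_thickening_iff.2 ⟨x, hx, hd⟩) (subset_closure ⟨hw, hwK⟩)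

theorem mem_of_convex (_s : StarView w₀ D V) {C : Set ℂ} (hC : Convex ℝ C) (hCo : IsOpen C)
    (h0 : w₀ ∈ C) {κ : ℂ} (hκ : κ ∈ closure C) {t : ℝ} (ht : 0 ≤ t) (ht1 : t < 1) :
    w₀ + t * (κ - w₀) ∈ C := by
  rcases eq_or_lt_of_le ht with h | h
  · rw [← h]; simpa using h0
  have := hC.openSegment_interior_closure_subset_interior (hCo.interior_eq.symm ▸ h0) hκ
  rw [hCo.interior_eq] at this
  apply this
  rw [openSegment_eq_image']
  exact ⟨t, ⟨h, ht1⟩, by simp⟩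

theorem closure_subset (s : StarView w₀ D V) {C : Set ℂ} (hC : Convex ℝ C) (hCo : IsOpen C)
    (h0 : w₀ ∈ C) (hCD : C ⊆ D) : closure C ⊆ D ∪ V := by
  intro κ hκ
  by_cases h : κ ∈ D
  · exact Or.inl h
  · exact Or.inr ((s.mem_V κ).2 ⟨h, fun t ht ht1 => hCD (s.mem_of_convex hC hCo h0 hκ ht ht1)⟩)

/-- Take the first point outside `D` on the segment after leaving `κ`. Isolation of `κ` keeps the
search away from `κ` itself. -/
theorem exists_next (s : StarView w₀ D V) {κ κ' : ℂ} (hκ : κ ∈ V) (hκ' : κ' ∈ V) (hne : κ ≠ κ')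
    (hseg : segment ℝ κ κ' ⊆ D ∪ V) :
    ∃ κ'' ∈ V, κ'' ≠ κ ∧ κ'' ∈ segment ℝ κ κ' ∧ openSegment ℝ κ κ'' ⊆ D := by
  obtain ⟨δ, hδ, hiso⟩ := s.isolated κ hκ
  have hn : 0 < ‖κ' - κ‖ := norm_pos_iff.2 (sub_ne_zero.2 hne.symm)
  have hA : IsCompact (Icc (min 1 (δ / ‖κ' - κ‖)) 1 ∩ {t : ℝ | κ + t * (κ' - κ) ∉ D}) := by
    refine isCompact_Icc.inter_right ?_
    exact s.isOpen.isClosed_compl.preimage (by fun_prop : Continuous fun t : ℝ => κ + t * (κ' - κ))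
  have hmemseg : ∀ t : ℝ, 0 ≤ t → t ≤ 1 → κ + t * (κ' - κ) ∈ segment ℝ κ κ' := by
    intro t h0 h1
    rw [segment_eq_image']
    exact ⟨t, ⟨h0, h1⟩, by simp⟩
  obtain ⟨t, ⟨ht, htD⟩, hmin⟩ := hA.exists_isLeast
    ⟨1, ⟨min_le_left _ _, le_rfl⟩, by simpa using s.notMem hκ'⟩
  have ht0 : 0 < t := lt_of_lt_of_le (lt_min one_pos (by positivity)) ht.1
  have hV : κ + t * (κ' - κ) ∈ V := (hseg (hmemseg t ht0.le ht.2)).resolve_left htD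
  have hsub : κ' - κ ≠ 0 := sub_ne_zero.2 hne.symm
  refine ⟨_, hV, ?_, hmemseg t ht0.le ht.2, ?_⟩
  · intro h
    have : (t : ℂ) * (κ' - κ) = 0 := by linear_combination h
    rcases mul_eq_zero.1 this with h | h
    · exact ht0.ne' (by exact_mod_cast h)
    · exact hsub h
  · intro w hw
    rw [openSegment_eq_image'] at hw
    obtain ⟨r, hr, rfl⟩ := hw
    have e : κ + r • (κ + t * (κ' - κ) - κ) = κ + ((r * t : ℝ) : ℂ) * (κ' - κ) := by
      simp only [Complex.real_smul]; push_cast; ring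
    simp only [e]
    have hrt : 0 < r * t := mul_pos hr.1 ht0
    have hrt1 : r * t < t := by nlinarith [hr.2]
    by_contra hcon
    have hVr := (hseg (hmemseg (r * t) hrt.le (by linarith [ht.2]))).resolve_left hcon
    by_cases hc : min 1 (δ / ‖κ' - κ‖) ≤ r * t
    · have := hmin ⟨⟨hc, by linarith [ht.2]⟩, hcon⟩
      linarith
    · push Not at hc
      have h2 : r * t < δ / ‖κ' - κ‖ := hc.trans_le (min_le_right _ _)
      rw [lt_div_iff₀ hn] at h2
      have h3 := hiso _ (by
        rw [Metric.mem_ball, dist_eq_norm, add_sub_cancel_left, norm_mul, Complex.norm_real,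
          Real.norm_of_nonneg hrt.le]
        exact h2) hVr
      have : ((r * t : ℝ) : ℂ) * (κ' - κ) = 0 := by linear_combination h3
      rcases mul_eq_zero.1 this with h | h
      · exact hrt.ne' (by exact_mod_cast h)
      · exact hsub h

/-- An infinite `K` would accumulate at some `κ`. Since all windows contain the same ball about
`w₀`, every point of the ray towards `κ` lies in the window of a nearby point of `K`. So `κ` is in
`D` or in `V`, and neither admits accumulation of visible points. -/
theorem finite_of_windows (s : StarView w₀ D V) {K : Set ℂ} (hKV : K ⊆ V)
    (hKb : Bornology.IsBounded K) {r : ℝ} (hr : 0 < r)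
    (hW : ∀ κ ∈ K, ∃ W ⊆ D, Convex ℝ W ∧ IsOpen W ∧ Metric.ball w₀ r ⊆ W ∧ κ ∈ closure W) :
    K.Finite := by
  by_contra hinf
  obtain ⟨κ, -, hacc⟩ := Set.Infinite.exists_accPt_of_subset_isCompact (K := closure K) hinf
    hKb.isCompact_closure subset_closure
  have hfr := accPt_iff_frequently_nhdsNE.1 hacc
  have hmem : κ ∈ D ∪ V := by
    by_cases h : κ ∈ D
    · exact Or.inl h
    refine Or.inr ((s.mem_V κ).2 ⟨h, fun t ht ht1 => ?_⟩)
    rcases eq_or_lt_of_le ht with h0 | h0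
    · rw [← h0]; simpa using s.base
    have h1t : 0 < 1 - t := by linarith
    obtain ⟨κ', hκ', hd⟩ := (hfr.and_eventually (mem_nhdsWithin_of_mem_nhds (Metric.ball_mem_nhds κ
      (by positivity : 0 < r * (1 - t) / t)))).exists
    obtain ⟨W, hWD, hWc, hWo, hb, hcl⟩ := hW κ' hκ'
    -- The point at parameter `t` from `w₀` to `κ` is also the point at parameter `t` from this
    -- point of the ball to `κ'`.
    have hv : w₀ + ((t / (1 - t) : ℝ) : ℂ) * (κ - κ') ∈ W := by
      apply hb
      rw [Metric.mem_ball, dist_eq_norm, add_sub_cancel_left, norm_mul, Complex.norm_real,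
        Real.norm_of_nonneg (by positivity), ← dist_eq_norm, dist_comm]
      have : dist κ' κ < r * (1 - t) / t := hd
      calc t / (1 - t) * dist κ' κ < t / (1 - t) * (r * (1 - t) / t) := by gcongr
        _ = r := by field_simp
    have := hWc.openSegment_interior_closure_subset_interior (hWo.interior_eq.symm ▸ hv) hcl
    rw [hWo.interior_eq] at this
    apply hWD
    apply this
    rw [openSegment_eq_image']
    refine ⟨t, ⟨h0, ht1⟩, ?_⟩
    simp only [Complex.real_smul]
    have : (1 : ℂ) - t ≠ 0 := by exact_mod_cast h1t.ne'
    push_cast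
    field_simp
    ring
  rcases hmem with h | h
  · obtain ⟨κ', hκ', hd⟩ := (hfr.and_eventually
      (mem_nhdsWithin_of_mem_nhds (s.isOpen.mem_nhds h))).exists
    exact s.notMem (hKV hκ') hd
  · obtain ⟨δ, hδ, hiso⟩ := s.isolated κ h
    obtain ⟨κ', hκ', hd, hne⟩ := (hfr.and_eventually
      (inter_mem (mem_nhdsWithin_of_mem_nhds (Metric.ball_mem_nhds κ hδ))
        (self_mem_nhdsWithin : ({κ}ᶜ : Set ℂ) ∈ 𝓝[≠] κ))).exists
    exact hne (hiso κ' hd (hKV hκ'))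

end StarView

/-! ### Views of Keane surfaces: growing windows, third vertices, and edges that do not cross. -/

/-- A view of a Keane surface: in addition, no two obstructing points are joined by a horizontal or
vertical segment, and there are no half-infinite vertical strips. -/
structure KeaneView (w₀ : ℂ) (D V : Set ℂ) : Prop extends StarView w₀ D V where
  hor : ∀ κ ∈ V, ∀ κ' ∈ V, κ ≠ κ' → κ.im = κ'.im → ¬ openSegment ℝ κ κ' ⊆ D
  vert : ∀ κ ∈ V, ∀ κ' ∈ V, κ ≠ κ' → κ.re = κ'.re → ¬ openSegment ℝ κ κ' ⊆ D
  up : ∀ x₀ x₁ y : ℝ, x₀ < x₁ → ¬ Ioo x₀ x₁ ×ℂ Ioi y ⊆ D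
  down : ∀ x₀ x₁ y : ℝ, x₀ < x₁ → ¬ Ioo x₀ x₁ ×ℂ Iio y ⊆ D

/-- The segment from `P` to `Q` spans a rectangle in `D` which has the same height, and width more
than one, while the width of the segment is at most one. -/
def Spans (D : Set ℂ) (P Q : ℂ) : Prop :=
  ∃ x₀ x₁ : ℝ, 1 < x₁ - x₀ ∧ P.re ∈ Icc x₀ x₁ ∧ Q.re ∈ Icc x₀ x₁ ∧ |P.re - Q.re| ≤ 1 ∧
    P.re ≠ Q.re ∧ P.im ≠ Q.im ∧ Ioo x₀ x₁ ×ℂ uIoo P.im Q.im ⊆ D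

/-- The three points lie in the closure of a rectangle in `D`. -/
def Boxed (D : Set ℂ) (P Q R : ℂ) : Prop :=
  ∃ x₀ x₁ y₀ y₁ : ℝ, P ∈ Icc x₀ x₁ ×ℂ Icc y₀ y₁ ∧ Q ∈ Icc x₀ x₁ ×ℂ Icc y₀ y₁ ∧
    R ∈ Icc x₀ x₁ ×ℂ Icc y₀ y₁ ∧ Ioo x₀ x₁ ×ℂ Ioo y₀ y₁ ⊆ D

theorem Spans.symm {D : Set ℂ} {P Q : ℂ} (h : Spans D P Q) : Spans D Q P := by
  obtain ⟨x₀, x₁, h1, h2, h3, h4, h5, h6, h7⟩ := h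
  exact ⟨x₀, x₁, h1, h3, h2, by rwa [abs_sub_comm], h5.symm, h6.symm, by rwa [uIoo_comm]⟩

theorem isOpen_rect (x₀ x₁ y₀ y₁ : ℝ) : IsOpen (Ioo x₀ x₁ ×ℂ Ioo y₀ y₁) :=
  isOpen_Ioo.reProdIm isOpen_Ioo

theorem convex_reProdIm {I J : Set ℝ} (hI : Convex ℝ I) (hJ : Convex ℝ J) :
    Convex ℝ (I ×ℂ J) := by
  intro x hx y hy a b ha hb hab
  rw [Complex.mem_reProdIm] at hx hy ⊢
  simp only [Complex.add_re, Complex.add_im, Complex.smul_re, Complex.smul_im]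
  exact ⟨hI hx.1 hy.1 ha hb hab, hJ hx.2 hy.2 ha hb hab⟩

theorem convex_rect (x₀ x₁ y₀ y₁ : ℝ) : Convex ℝ (Ioo x₀ x₁ ×ℂ Ioo y₀ y₁) :=
  convex_reProdIm (convex_Ioo _ _) (convex_Ioo _ _)

theorem closure_rect {x₀ x₁ y₀ y₁ : ℝ} (hx : x₀ < x₁) (hy : y₀ < y₁) :
    closure (Ioo x₀ x₁ ×ℂ Ioo y₀ y₁) = Icc x₀ x₁ ×ℂ Icc y₀ y₁ := by
  rw [Complex.closure_reProdIm, closure_Ioo hx.ne, closure_Ioo hy.ne]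

namespace KeaneView

variable {w₀ : ℂ} {D V : Set ℂ}

/-- The closure of `C` lies in `D ∪ V`, so the segment from `κ` to `κ'` can be cut at the first
visible point after `κ`, which has the same height. That contradicts `hor`. -/
theorem false_of_horizontal (s : KeaneView w₀ D V) {C : Set ℂ} (hC : Convex ℝ C) (hCo : IsOpen C)
    (h0 : w₀ ∈ C) (hCD : C ⊆ D) {κ κ' : ℂ} (hκ : κ ∈ V) (hκ' : κ' ∈ V) (hκC : κ ∈ closure C)
    (hκC' : κ' ∈ closure C) (hne : κ ≠ κ') (him : κ.im = κ'.im) : False := by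
  obtain ⟨κ'', h1, h2, h3, h4⟩ := s.exists_next hκ hκ' hne
    ((hC.closure.segment_subset hκC hκC').trans (s.closure_subset hC hCo h0 hCD))
  refine s.hor κ hκ κ'' h1 h2.symm ?_ h4
  rw [segment_eq_image'] at h3
  obtain ⟨t, -, rfl⟩ := h3
  simp [him]

theorem false_of_vertical (s : KeaneView w₀ D V) {C : Set ℂ} (hC : Convex ℝ C) (hCo : IsOpen C)
    (h0 : w₀ ∈ C) (hCD : C ⊆ D) {κ κ' : ℂ} (hκ : κ ∈ V) (hκ' : κ' ∈ V) (hκC : κ ∈ closure C)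
    (hκC' : κ' ∈ closure C) (hne : κ ≠ κ') (hre : κ.re = κ'.re) : False := by
  obtain ⟨κ'', h1, h2, h3, h4⟩ := s.exists_next hκ hκ' hne
    ((hC.closure.segment_subset hκC hκC').trans (s.closure_subset hC hCo h0 hCD))
  refine s.vert κ hκ κ'' h1 h2.symm ?_ h4
  rw [segment_eq_image'] at h3
  obtain ⟨t, -, rfl⟩ := h3
  simp [hre]

/-- Raise the top side as far as `D` allows. The height is bounded by `up`, and without a visible
point over `J` on the limiting side a thickening would permit more. The freedom in `J` decides which
vertical sides take part. -/
theorem exists_raise (s : KeaneView w₀ D V) {x₀ x₁ y₀ y₁ : ℝ} {J : Set ℝ} (hJ : Convex ℝ J)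
    (hJ1 : Ioo x₀ x₁ ⊆ J) (hJ2 : J ⊆ Icc x₀ x₁) (h0 : w₀ ∈ Ioo x₀ x₁ ×ℂ Ioo y₀ y₁)
    (hD : J ×ℂ Ioo y₀ y₁ ⊆ D) :
    ∃ h ≥ y₁, J ×ℂ Ioo y₀ h ⊆ D ∧ ∃ c ∈ V, c.re ∈ J ∧ c.im = h := by
  rw [Complex.mem_reProdIm] at h0
  have hx : x₀ < x₁ := h0.1.1.trans h0.1.2
  have hy : y₀ < y₁ := h0.2.1.trans h0.2.2
  set A : Set ℝ := {h | y₁ ≤ h ∧ J ×ℂ Ioo y₀ h ⊆ D} with hA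
  have hy1A : y₁ ∈ A := ⟨le_rfl, hD⟩
  have hbdd : BddAbove A := by
    by_contra hub
    rw [not_bddAbove_iff] at hub
    refine s.up x₀ x₁ y₀ hx fun w hw => ?_
    rw [Complex.mem_reProdIm] at hw
    obtain ⟨h, hh, hlt⟩ := hub w.im
    exact hh.2 (Complex.mem_reProdIm.2 ⟨hJ1 hw.1, hw.2, hlt⟩)
  have hle : y₁ ≤ sSup A := le_csSup hbdd hy1A
  have hsub : J ×ℂ Ioo y₀ (sSup A) ⊆ D := by
    intro w hw
    rw [Complex.mem_reProdIm] at hw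
    obtain ⟨h, hh, hlt⟩ := exists_lt_of_lt_csSup ⟨_, hy1A⟩ hw.2.2
    exact hh.2 (Complex.mem_reProdIm.2 ⟨hw.1, hw.2.1, hlt⟩)
  refine ⟨sSup A, hle, hsub, ?_⟩
  by_contra hcon
  push Not at hcon
  have hrect : Ioo x₀ x₁ ×ℂ Ioo y₀ (sSup A) ⊆ D := fun w hw => by
    rw [Complex.mem_reProdIm] at hw
    exact hsub (Complex.mem_reProdIm.2 ⟨hJ1 hw.1, hw.2⟩)
  have hcl := s.closure_subset (convex_rect x₀ x₁ y₀ (sSup A)) (isOpen_rect _ _ _ _)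
    (Complex.mem_reProdIm.2 ⟨h0.1, h0.2.1, h0.2.2.trans_le hle⟩) hrect
  rw [closure_rect hx (hy.trans_le hle)] at hcl
  obtain ⟨ε, hε, hth⟩ := s.exists_thickening (isCompact_Icc.reProdIm isCompact_Icc) hcl
  have : sSup A + ε ∈ A := by
    refine ⟨by linarith, s.subset_of_disjoint ?_ ?_⟩
    · refine (convex_reProdIm hJ (convex_Ioo _ _)).starConvex (Complex.mem_reProdIm.2 ⟨hJ1 h0.1, h0.2.1, ?_⟩)
      linarith [h0.2.2]
    · intro w hw hwV
      rw [Complex.mem_reProdIm] at hw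
      by_cases hlt : w.im < sSup A
      · exact s.notMem hwV (hsub (Complex.mem_reProdIm.2 ⟨hw.1, hw.2.1, hlt⟩))
      push Not at hlt
      have h3 := hth w hwV ⟨⟨w.re, sSup A⟩, Complex.mem_reProdIm.2 ⟨hJ2 hw.1, by
        change y₀ ≤ sSup A; linarith, le_rfl⟩, by
        rw [Complex.dist_of_re_eq (show w.re = (⟨w.re, sSup A⟩ : ℂ).re from rfl), Real.dist_eq, abs_of_nonneg (by linarith)]
        linarith [hw.2.2]⟩
      rw [Complex.mem_reProdIm] at h3
      exact hcon w hwV hw.1 (le_antisymm h3.2.2 hlt)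
  have := le_csSup hbdd this
  linarith

theorem exists_widen_left (s : StarView w₀ D V) {x₀ x₁ y₀ y₁ : ℝ}
    (h0 : w₀ ∈ Ioo x₀ x₁ ×ℂ Ioo y₀ y₁) (hD : Ioo x₀ x₁ ×ℂ Ioo y₀ y₁ ⊆ D)
    (hV : ∀ c ∈ V, c.re = x₀ → c.im ∉ Ioo y₀ y₁) :
    ∃ δ > 0, Ioo (x₀ - δ) x₁ ×ℂ Ioo y₀ y₁ ⊆ D := by
  have hcl := s.closure_subset (convex_rect _ _ _ _) (isOpen_rect _ _ _ _) h0 hD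
  rw [Complex.mem_reProdIm] at h0
  rw [closure_rect (h0.1.1.trans h0.1.2) (h0.2.1.trans h0.2.2)] at hcl
  obtain ⟨ε, hε, hth⟩ := s.exists_thickening (isCompact_Icc.reProdIm isCompact_Icc) hcl
  refine ⟨ε, hε, s.subset_of_disjoint ((convex_rect _ _ _ _).starConvex ?_) ?_⟩
  · exact Complex.mem_reProdIm.2 ⟨⟨by linarith [h0.1.1], h0.1.2⟩, h0.2⟩
  · intro w hw hwV
    rw [Complex.mem_reProdIm] at hw
    by_cases hlt : x₀ < w.re
    · exact s.notMem hwV (hD (Complex.mem_reProdIm.2 ⟨⟨hlt, hw.1.2⟩, hw.2⟩))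
    push Not at hlt
    have h3 := hth w hwV ⟨⟨x₀, w.im⟩, Complex.mem_reProdIm.2 ⟨⟨le_rfl, by
        change x₀ ≤ x₁; linarith [h0.1.1, h0.1.2]⟩, hw.2.1.le, hw.2.2.le⟩, by
        rw [Complex.dist_of_im_eq (show w.im = (⟨x₀, w.im⟩ : ℂ).im from rfl), Real.dist_eq, abs_of_nonpos (by change w.re - x₀ ≤ 0; linarith)]
        change -(w.re - x₀) < ε
        linarith [hw.1.1]⟩
    rw [Complex.mem_reProdIm] at h3
    exact hV w hwV (le_antisymm hlt h3.1.1) hw.2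

/-- Reflections in the axes and the half-turn preserve the setting, so the constructions need only
be done for one slope and one side. -/
theorem comp (s : KeaneView w₀ D V) (L : ℂ ≃ₗᵢ[ℝ] ℂ) {a b : ℝ} (ha : a = 1 ∨ a = -1)
    (hb : b = 1 ∨ b = -1) (hre : ∀ w, (L w).re = a * w.re) (him : ∀ w, (L w).im = b * w.im) :
    KeaneView (L.symm w₀) (L ⁻¹' D) (L ⁻¹' V) := by
  have hlin : ∀ (t : ℝ) (κ : ℂ), L (L.symm w₀ + t * (κ - L.symm w₀)) = w₀ + t * (L κ - w₀) := by
    intro t κ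
    have : (t : ℂ) * (κ - L.symm w₀) = t • (κ - L.symm w₀) := by simp
    rw [this, map_add, map_smul, map_sub, L.apply_symm_apply, Complex.real_smul]
  have himg : ∀ κ κ', openSegment ℝ κ κ' ⊆ L ⁻¹' D → openSegment ℝ (L κ) (L κ') ⊆ D := by
    intro κ κ' h w hw
    rw [openSegment_eq_image'] at hw
    obtain ⟨t, ht, rfl⟩ := hw
    have := h (show κ + t • (κ' - κ) ∈ openSegment ℝ κ κ' by
      rw [openSegment_eq_image']; exact ⟨t, ht, rfl⟩)
    rwa [mem_preimage, map_add, map_smul, map_sub] at this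
  have hrect : ∀ w, L.symm w = ⟨a * w.re, b * w.im⟩ := by
    intro w
    apply L.injective
    rw [L.apply_symm_apply]
    apply Complex.ext
    · rw [hre]; rcases ha with rfl | rfl <;> simp
    · rw [him]; rcases hb with rfl | rfl <;> simp
  have hpre : ∀ (A : Set ℂ), A ⊆ L ⁻¹' D → ∀ w, L.symm w ∈ A → w ∈ D := by
    intro A hA w hw
    have := hA hw
    rwa [mem_preimage, L.apply_symm_apply] at this
  refine { base := by simpa using s.base, isOpen := s.isOpen.preimage L.continuous, star := ?_, mem_V := ?_, isolated := ?_, hor := ?_, vert := ?_, up := ?_, down := ?_ }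
  · intro w hw x y hx hy hxy
    rw [mem_preimage, map_add, map_smul, map_smul, L.apply_symm_apply]
    exact s.star hw hx hy hxy
  · intro κ
    simp only [mem_preimage, hlin]
    exact s.mem_V (L κ)
  · intro κ hκ
    obtain ⟨δ, hδ, h⟩ := s.isolated _ hκ
    refine ⟨δ, hδ, fun w hw hwV => L.injective (h _ ?_ hwV)⟩
    rw [Metric.mem_ball, L.isometry.dist_eq]
    exact hw
  · intro κ hκ κ' hκ' hne h hsub
    exact s.hor _ hκ _ hκ' (L.injective.ne hne) (by rw [him, him, h]) (himg _ _ hsub)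
  · intro κ hκ κ' hκ' hne h hsub
    exact s.vert _ hκ _ hκ' (L.injective.ne hne) (by rw [hre, hre, h]) (himg _ _ hsub)
  · intro x₀ x₁ y hx hsub
    have h1 := hpre _ hsub
    simp only [hrect, Complex.mem_reProdIm, mem_Ioo, mem_Ioi] at h1
    rcases ha with rfl | rfl <;> rcases hb with rfl | rfl
    · exact s.up x₀ x₁ y hx fun w hw => h1 w (by
        simp only [Complex.mem_reProdIm, mem_Ioo, mem_Ioi] at hw; simpa using hw)
    · exact s.down x₀ x₁ (-y) hx fun w hw => h1 w (by
        simp only [Complex.mem_reProdIm, mem_Ioo, mem_Iio] at hw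
        refine ⟨⟨?_, ?_⟩, ?_⟩ <;> linarith [hw.1.1, hw.1.2, hw.2])
    · exact s.up (-x₁) (-x₀) y (by linarith) fun w hw => h1 w (by
        simp only [Complex.mem_reProdIm, mem_Ioo, mem_Ioi] at hw
        refine ⟨⟨?_, ?_⟩, ?_⟩ <;> linarith [hw.1.1, hw.1.2, hw.2])
    · exact s.down (-x₁) (-x₀) (-y) (by linarith) fun w hw => h1 w (by
        simp only [Complex.mem_reProdIm, mem_Ioo, mem_Iio] at hw
        refine ⟨⟨?_, ?_⟩, ?_⟩ <;> linarith [hw.1.1, hw.1.2, hw.2])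
  · intro x₀ x₁ y hx hsub
    have h1 := hpre _ hsub
    simp only [hrect, Complex.mem_reProdIm, mem_Ioo, mem_Iio] at h1
    rcases ha with rfl | rfl <;> rcases hb with rfl | rfl
    · exact s.down x₀ x₁ y hx fun w hw => h1 w (by
        simp only [Complex.mem_reProdIm, mem_Ioo, mem_Iio] at hw; simpa using hw)
    · exact s.up x₀ x₁ (-y) hx fun w hw => h1 w (by
        simp only [Complex.mem_reProdIm, mem_Ioo, mem_Ioi] at hw
        refine ⟨⟨?_, ?_⟩, ?_⟩ <;> linarith [hw.1.1, hw.1.2, hw.2])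
    · exact s.down (-x₁) (-x₀) y (by linarith) fun w hw => h1 w (by
        simp only [Complex.mem_reProdIm, mem_Ioo, mem_Iio] at hw
        refine ⟨⟨?_, ?_⟩, ?_⟩ <;> linarith [hw.1.1, hw.1.2, hw.2])
    · exact s.up (-x₁) (-x₀) (-y) (by linarith) fun w hw => h1 w (by
        simp only [Complex.mem_reProdIm, mem_Ioo, mem_Ioi] at hw
        refine ⟨⟨?_, ?_⟩, ?_⟩ <;> linarith [hw.1.1, hw.1.2, hw.2])

end KeaneView

theorem mem_openSegment_re_im {P Q w : ℂ} (h : w ∈ openSegment ℝ P Q) :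
    ∃ t : ℝ, 0 < t ∧ t < 1 ∧ w.re = P.re + t * (Q.re - P.re) ∧ w.im = P.im + t * (Q.im - P.im) := by
  rw [openSegment_eq_image'] at h
  obtain ⟨t, ht, rfl⟩ := h
  exact ⟨t, ht.1, ht.2, by simp, by simp⟩

namespace KeaneView

variable {w₀ : ℂ} {D V : Set ℂ}

/-- Push the left side of the window outwards, but not past `Q.re - 1`, beyond which a new vertex
would be too far from `Q`. If a visible point is met on the way, it is the third vertex, and the
window has only grown. Otherwise take the rectangle of width one that ends at `Q` and raise it until
a visible point is met. -/
theorem exists_apex_of_lt (s : KeaneView w₀ D V) {P Q : ℂ} (hP : P ∈ V) (hQ : Q ∈ V)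
    (h0 : w₀ ∈ openSegment ℝ P Q) (hre : P.re < Q.re) (him : P.im < Q.im) (hs : Spans D P Q) :
    ∃ A ∈ V, Anticlockwise P Q A ∧ Spans D P A ∧ Spans D Q A ∧ Boxed D P Q A := by
  obtain ⟨x₀, x₁, hw, ⟨hPx₀, hPx₁⟩, ⟨hQx₀, hQx₁⟩, habs, -, -, hD⟩ := hs
  rw [uIoo_of_lt him] at hD
  obtain ⟨t, ht0, ht1, htre, htim⟩ := mem_openSegment_re_im h0
  have hr0 : P.re < w₀.re := by nlinarith
  have hr1 : w₀.re < Q.re := by nlinarith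
  have hi0 : P.im < w₀.im := by nlinarith
  have hi1 : w₀.im < Q.im := by nlinarith
  have hwid : Q.re - P.re ≤ 1 := by
    rw [abs_sub_comm] at habs
    exact (le_abs_self _).trans habs
  have caseB : ∀ δ > 0, Ioo (Q.re - 1 - δ) x₁ ×ℂ Ioo P.im Q.im ⊆ D →
      ∃ A ∈ V, Anticlockwise P Q A ∧ Spans D P A ∧ Spans D Q A ∧ Boxed D P Q A := by
    intro δ hδ hDδ
    have hw0 : w₀ ∈ Ioo (Q.re - 1) Q.re ×ℂ Ioo P.im Q.im :=
      Complex.mem_reProdIm.2 ⟨⟨by linarith, hr1⟩, hi0, hi1⟩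
    -- `Ico` omits the side through `Q`, so `Q` itself does not stop the raising. It includes the
    -- left side, which therefore stays in `D` and can afterwards be moved outwards to make the
    -- width exceed one.
    obtain ⟨h, hh, hDh, c, hcV, hcre, hcim⟩ := s.exists_raise (x₀ := Q.re - 1) (x₁ := Q.re)
      (y₀ := P.im) (y₁ := Q.im) (J := Ico (Q.re - 1) Q.re) (convex_Ico _ _) Ioo_subset_Ico_self
      Ico_subset_Icc_self hw0 (fun w hw => hDδ (by
        rw [Complex.mem_reProdIm] at hw ⊢
        exact ⟨⟨by linarith [hw.1.1], by linarith [hw.1.2]⟩, hw.2⟩))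
    have hrect : Ioo (Q.re - 1) Q.re ×ℂ Ioo P.im h ⊆ D := fun w hw => by
      rw [Complex.mem_reProdIm] at hw
      exact hDh (Complex.mem_reProdIm.2 ⟨Ioo_subset_Ico_self hw.1, hw.2⟩)
    have hw0' : w₀ ∈ Ioo (Q.re - 1) Q.re ×ℂ Ioo P.im h :=
      Complex.mem_reProdIm.2 ⟨⟨by linarith, hr1⟩, hi0, by linarith⟩
    have hcl := closure_rect (x₀ := Q.re - 1) (x₁ := Q.re) (y₀ := P.im) (y₁ := h) (by linarith)
      (by linarith)
    have hPcl : P ∈ Icc (Q.re - 1) Q.re ×ℂ Icc P.im h :=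
      Complex.mem_reProdIm.2 ⟨⟨by linarith, by linarith⟩, le_rfl, by linarith⟩
    have hQcl : Q ∈ Icc (Q.re - 1) Q.re ×ℂ Icc P.im h :=
      Complex.mem_reProdIm.2 ⟨⟨by linarith, by linarith⟩, by linarith, by linarith⟩
    have hccl : c ∈ Icc (Q.re - 1) Q.re ×ℂ Icc P.im h :=
      Complex.mem_reProdIm.2 ⟨⟨hcre.1, hcre.2.le⟩, by linarith, by linarith⟩
    have hcQ : c.im ≠ Q.im := by
      intro he
      exact s.false_of_horizontal (convex_rect _ _ _ _) (isOpen_rect _ _ _ _) hw0' hrect hcV hQ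
        (hcl ▸ hccl) (hcl ▸ hQcl) (fun h => by rw [h] at hcre; exact lt_irrefl _ hcre.2) he
    have hcP : c.re ≠ P.re := by
      intro he
      exact s.false_of_vertical (convex_rect _ _ _ _) (isOpen_rect _ _ _ _) hw0' hrect hcV hP
        (hcl ▸ hccl) (hcl ▸ hPcl) (fun h => by rw [h] at hcim; linarith) he
    have hhQ : Q.im < h := lt_of_le_of_ne hh (fun h => hcQ (by rw [hcim, h]))
    obtain ⟨δ', hδ', hwide⟩ := exists_widen_left s.toStarView hw0' hrect (fun v hv hvre hvim =>
      s.notMem hv (hDh (Complex.mem_reProdIm.2 ⟨by rw [hvre]; exact ⟨le_rfl, by linarith⟩, hvim⟩)))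
    refine ⟨c, hcV, ?_, ⟨Q.re - 1 - δ', Q.re, by linarith, ⟨by linarith, by linarith⟩,
      ⟨by linarith [hcre.1], hcre.2.le⟩, ?_, hcP.symm, by linarith, ?_⟩,
      ⟨Q.re - 1 - δ', Q.re, by linarith, ⟨by linarith, by linarith⟩,
      ⟨by linarith [hcre.1], hcre.2.le⟩, ?_, hcre.2.ne', hcQ.symm, ?_⟩,
      ⟨Q.re - 1, Q.re, P.im, h, hPcl, hQcl, hccl, hrect⟩⟩
    · unfold Anticlockwise
      have h1 := hcre.2
      simp only [Complex.sub_re, Complex.sub_im]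
      rw [hcim]
      nlinarith [mul_pos (sub_pos.2 hre) (sub_pos.2 hhQ), mul_pos (sub_pos.2 him) (sub_pos.2 h1)]
    · rw [abs_le]; constructor <;> linarith [hcre.1, hcre.2]
    · rw [uIoo_of_lt (by linarith), hcim]; exact hwide
    · rw [abs_le]; constructor <;> linarith [hcre.1, hcre.2]
    · rw [uIoo_of_lt (by linarith), hcim]
      intro w hw
      apply hwide
      rw [Complex.mem_reProdIm] at hw ⊢
      exact ⟨hw.1, by linarith [hw.2.1], hw.2.2⟩
  by_cases hx0 : x₀ < Q.re - 1
  · exact caseB (Q.re - 1 - x₀) (by linarith) (by simpa using hD)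
  push Not at hx0
  set X : Set ℝ := {x | Q.re - 1 ≤ x ∧ x ≤ x₀ ∧ Ioo x x₁ ×ℂ Ioo P.im Q.im ⊆ D} with hX
  have hx0X : x₀ ∈ X := ⟨hx0, le_rfl, hD⟩
  have hbdd : BddBelow X := ⟨Q.re - 1, fun x hx => hx.1⟩
  have hXle : sInf X ≤ x₀ := csInf_le hbdd hx0X
  have hXge : Q.re - 1 ≤ sInf X := le_csInf ⟨_, hx0X⟩ fun x hx => hx.1
  have hXD : Ioo (sInf X) x₁ ×ℂ Ioo P.im Q.im ⊆ D := by
    intro w hw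
    rw [Complex.mem_reProdIm] at hw
    obtain ⟨x, hx, hlt⟩ := exists_lt_of_csInf_lt ⟨_, hx0X⟩ hw.1.1
    exact hx.2.2 (Complex.mem_reProdIm.2 ⟨⟨hlt, hw.1.2⟩, hw.2⟩)
  have hw0' : w₀ ∈ Ioo (sInf X) x₁ ×ℂ Ioo P.im Q.im :=
    Complex.mem_reProdIm.2 ⟨⟨by linarith, by linarith⟩, hi0, hi1⟩
  by_cases hex : ∃ c ∈ V, c.re = sInf X ∧ c.im ∈ Ioo P.im Q.im
  swap
  · push Not at hex
    obtain ⟨δ, hδ, hwide⟩ := exists_widen_left s.toStarView hw0' hXD hex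
    have : sInf X = Q.re - 1 := by
      refine le_antisymm ?_ hXge
      by_contra hlt
      push Not at hlt
      have hmem : max (Q.re - 1) (sInf X - δ) ∈ X := by
        refine ⟨le_max_left _ _, max_le (by linarith) (by linarith), fun w hw => hwide ?_⟩
        rw [Complex.mem_reProdIm] at hw ⊢
        exact ⟨⟨(le_max_right _ _).trans_lt hw.1.1, hw.1.2⟩, hw.2⟩
      have := csInf_le hbdd hmem
      rcases le_max_iff.1 this with h | h <;> linarith
    exact caseB δ hδ (by rwa [this] at hwide)
  obtain ⟨c, hcV, hcre, hcim⟩ := hex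
  have hcl := closure_rect (x₀ := sInf X) (x₁ := x₁) (y₀ := P.im) (y₁ := Q.im) (by linarith) him
  have hPcl : P ∈ Icc (sInf X) x₁ ×ℂ Icc P.im Q.im :=
    Complex.mem_reProdIm.2 ⟨⟨by linarith, by linarith⟩, le_rfl, by linarith⟩
  have hQcl : Q ∈ Icc (sInf X) x₁ ×ℂ Icc P.im Q.im :=
    Complex.mem_reProdIm.2 ⟨⟨by linarith, by linarith⟩, by linarith, by linarith⟩
  have hccl : c ∈ Icc (sInf X) x₁ ×ℂ Icc P.im Q.im :=
    Complex.mem_reProdIm.2 ⟨⟨by linarith, by linarith⟩, hcim.1.le, hcim.2.le⟩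
  have hcP : c.re ≠ P.re := by
    intro he
    exact s.false_of_vertical (convex_rect _ _ _ _) (isOpen_rect _ _ _ _) hw0' hXD hcV hP
      (hcl ▸ hccl) (hcl ▸ hPcl) (fun h => by rw [h] at hcim; exact lt_irrefl _ hcim.1) he
  refine ⟨c, hcV, ?_, ⟨sInf X, x₁, by linarith, ⟨by linarith, by linarith⟩, ⟨by linarith, by linarith⟩,
    ?_, hcP.symm, hcim.1.ne, ?_⟩, ⟨sInf X, x₁, by linarith, ⟨by linarith, by linarith⟩,
    ⟨by linarith, by linarith⟩, ?_, by linarith, hcim.2.ne', ?_⟩,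
    ⟨sInf X, x₁, P.im, Q.im, hPcl, hQcl, hccl, hXD⟩⟩
  · unfold Anticlockwise
    simp only [Complex.sub_re, Complex.sub_im]
    nlinarith [mul_pos (sub_pos.2 hre) (sub_pos.2 hcim.1),
      mul_nonneg (sub_pos.2 him).le (by linarith : 0 ≤ P.re - c.re)]
  · rw [abs_le]; constructor <;> linarith
  · rw [uIoo_of_lt hcim.1]
    intro w hw
    apply hXD
    rw [Complex.mem_reProdIm] at hw ⊢
    exact ⟨hw.1, hw.2.1, hw.2.2.trans hcim.2⟩
  · rw [abs_le]; constructor <;> linarith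
  · rw [uIoo_of_gt hcim.2]
    intro w hw
    apply hXD
    rw [Complex.mem_reProdIm] at hw ⊢
    exact ⟨hw.1, hcim.1.trans hw.2.1, hw.2.2⟩

theorem _root_.Spans.comp {D : Set ℂ} {P Q : ℂ} {L : ℂ → ℂ} {a b : ℝ} (ha : a = 1 ∨ a = -1)
    (hb : b = 1 ∨ b = -1) (hre : ∀ w, (L w).re = a * w.re) (him : ∀ w, (L w).im = b * w.im)
    (h : Spans D (L P) (L Q)) : Spans (L ⁻¹' D) P Q := by
  obtain ⟨x₀, x₁, h1, h2, h3, h4, h5, h6, h7⟩ := h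
  simp only [hre, him] at h2 h3 h4 h5 h6 h7
  have hsub : ∀ w, a * w.re ∈ Ioo x₀ x₁ → w.im ∈ uIoo P.im Q.im → L w ∈ D := by
    intro w hw1 hw2
    apply h7
    rw [Complex.mem_reProdIm, hre, him]
    refine ⟨hw1, ?_⟩
    rcases hb with rfl | rfl
    · simpa using hw2
    · rw [uIoo, mem_Ioo, inf_lt_iff, lt_sup_iff] at hw2 ⊢
      rcases hw2 with ⟨hl | hl, hr | hr⟩ <;> constructor <;> first | (left; linarith) | (right; linarith)
  rcases ha with rfl | rfl
  · refine ⟨x₀, x₁, h1, by simpa using h2, by simpa using h3, by simpa using h4, by simpa using h5, ?_,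
      fun w hw => ?_⟩
    · intro h; apply h6; rw [h]
    · rw [Complex.mem_reProdIm] at hw
      exact hsub w (by simpa using hw.1) hw.2
  · refine ⟨-x₁, -x₀, by linarith, ⟨by linarith [h2.2], by linarith [h2.1]⟩,
      ⟨by linarith [h3.2], by linarith [h3.1]⟩, ?_, by simpa using h5, ?_, fun w hw => ?_⟩
    · rw [abs_sub_comm]; convert h4 using 2; ring
    · intro h; apply h6; rw [h]
    · rw [Complex.mem_reProdIm] at hw
      exact hsub w ⟨by linarith [hw.1.2], by linarith [hw.1.1]⟩ hw.2

theorem _root_.Boxed.comp {D : Set ℂ} {P Q R : ℂ} {L : ℂ → ℂ} {a b : ℝ} (ha : a = 1 ∨ a = -1)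
    (hb : b = 1 ∨ b = -1) (hre : ∀ w, (L w).re = a * w.re) (him : ∀ w, (L w).im = b * w.im)
    (h : Boxed D (L P) (L Q) (L R)) : Boxed (L ⁻¹' D) P Q R := by
  obtain ⟨x₀, x₁, y₀, y₁, h1, h2, h3, h4⟩ := h
  have key : ∀ w, L w ∈ Ioo x₀ x₁ ×ℂ Ioo y₀ y₁ → L w ∈ D := fun w hw => h4 hw
  simp only [Complex.mem_reProdIm, hre, him, mem_Icc, mem_Ioo] at h1 h2 h3 key
  rcases ha with rfl | rfl <;> rcases hb with rfl | rfl
  · refine ⟨x₀, x₁, y₀, y₁, ?_, ?_, ?_, fun w hw => key w ?_⟩ <;>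
      simp only [Complex.mem_reProdIm, mem_Icc, mem_Ioo] at * <;>
      refine ⟨⟨?_, ?_⟩, ?_, ?_⟩ <;> linarith
  · refine ⟨x₀, x₁, -y₁, -y₀, ?_, ?_, ?_, fun w hw => key w ?_⟩ <;>
      simp only [Complex.mem_reProdIm, mem_Icc, mem_Ioo] at * <;>
      refine ⟨⟨?_, ?_⟩, ?_, ?_⟩ <;> linarith
  · refine ⟨-x₁, -x₀, y₀, y₁, ?_, ?_, ?_, fun w hw => key w ?_⟩ <;>
      simp only [Complex.mem_reProdIm, mem_Icc, mem_Ioo] at * <;>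
      refine ⟨⟨?_, ?_⟩, ?_, ?_⟩ <;> linarith
  · refine ⟨-x₁, -x₀, -y₁, -y₀, ?_, ?_, ?_, fun w hw => key w ?_⟩ <;>
      simp only [Complex.mem_reProdIm, mem_Icc, mem_Ioo] at * <;>
      refine ⟨⟨?_, ?_⟩, ?_, ?_⟩ <;> linarith

theorem openSegment_comp {L : ℂ ≃ₗᵢ[ℝ] ℂ} {w P Q : ℂ} (h : w ∈ openSegment ℝ (L P) (L Q)) :
    L.symm w ∈ openSegment ℝ P Q := by
  rw [openSegment_eq_image'] at h ⊢
  obtain ⟨t, ht, rfl⟩ := h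
  refine ⟨t, ht, ?_⟩
  apply L.injective
  simp only [map_add, map_smul, map_sub, L.apply_symm_apply]

theorem exists_apex_of_im_lt (s : KeaneView w₀ D V) {P Q : ℂ} (hP : P ∈ V) (hQ : Q ∈ V)
    (h0 : w₀ ∈ openSegment ℝ P Q) (him : P.im < Q.im) (hs : Spans D P Q) :
    ∃ A ∈ V, Anticlockwise P Q A ∧ Spans D P A ∧ Spans D Q A ∧ Boxed D P Q A := by
  have hne : P.re ≠ Q.re := by
    obtain ⟨_, _, _, _, _, _, h, _⟩ := hs
    exact h
  rcases lt_or_gt_of_ne hne with hre | hre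
  · exact s.exists_apex_of_lt hP hQ h0 hre him hs
  -- Conjugation makes the slope positive and reverses orientation, so the left of `P Q` becomes the
  -- left of the reflected segment run from the image of `Q` to that of `P`.
  · have hr : ∀ w, (Complex.conjLIE w).re = 1 * w.re := by simp
    have hi : ∀ w, (Complex.conjLIE w).im = -1 * w.im := by simp
    have hcc : ∀ w, Complex.conjLIE (Complex.conjLIE w) = w := fun w => by simp
    have s' := s.comp Complex.conjLIE (Or.inl rfl) (Or.inr rfl) hr hi
    have hs' : Spans (Complex.conjLIE ⁻¹' D) (Complex.conjLIE Q) (Complex.conjLIE P) :=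
      Spans.comp (Or.inl rfl) (Or.inr rfl) hr hi (by rw [hcc, hcc]; exact hs.symm)
    obtain ⟨A, hA, h1, h2, h3, h4⟩ := s'.exists_apex_of_lt (P := Complex.conjLIE Q)
      (Q := Complex.conjLIE P) (by rw [mem_preimage, hcc]; exact hQ)
      (by rw [mem_preimage, hcc]; exact hP)
      (openSegment_comp (by rw [hcc, hcc, openSegment_symm]; exact h0)) (by simpa using hre)
      (by simpa using him) hs'
    have hsub : Complex.conjLIE ⁻¹' (Complex.conjLIE ⁻¹' D) = D := by
      ext w; simp
    refine ⟨Complex.conjLIE A, hA, ?_, ?_, ?_, ?_⟩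
    · unfold Anticlockwise at h1 ⊢
      simp only [Complex.sub_re, Complex.sub_im, hr, hi] at h1 ⊢
      linarith
    · rw [← hsub]; exact Spans.comp (Or.inl rfl) (Or.inr rfl) hr hi (by rw [hcc]; exact h3)
    · rw [← hsub]; exact Spans.comp (Or.inl rfl) (Or.inr rfl) hr hi (by rw [hcc]; exact h2)
    · rw [← hsub]
      obtain ⟨a, b, c, d, e1, e2, e3, e4⟩ := h4
      exact Boxed.comp (Or.inl rfl) (Or.inr rfl) hr hi (by
        rw [hcc]; exact ⟨a, b, c, d, e2, e1, e3, e4⟩)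

/-- The Delaunay triangle on the left of an edge. -/
theorem exists_apex (s : KeaneView w₀ D V) {P Q : ℂ} (hP : P ∈ V) (hQ : Q ∈ V)
    (h0 : w₀ ∈ openSegment ℝ P Q) (hs : Spans D P Q) :
    ∃ A ∈ V, Anticlockwise P Q A ∧ Spans D P A ∧ Spans D Q A ∧ Boxed D P Q A := by
  have hne : P.im ≠ Q.im := by
    obtain ⟨_, _, _, _, _, _, _, h, _⟩ := hs
    exact h
  rcases lt_or_gt_of_ne hne with him | him
  · exact s.exists_apex_of_im_lt hP hQ h0 him hs
  · have hr : ∀ w, (LinearIsometryEquiv.neg ℝ (E := ℂ) w).re = -1 * w.re := by simp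
    have hi : ∀ w, (LinearIsometryEquiv.neg ℝ (E := ℂ) w).im = -1 * w.im := by simp
    set L := LinearIsometryEquiv.neg ℝ (E := ℂ)
    have hcc : ∀ w, L (L w) = w := fun w => by simp [L]
    have s' := s.comp L (Or.inr rfl) (Or.inr rfl) hr hi
    have hs' : Spans (L ⁻¹' D) (L P) (L Q) :=
      Spans.comp (Or.inr rfl) (Or.inr rfl) hr hi (by rw [hcc, hcc]; exact hs)
    obtain ⟨A, hA, h1, h2, h3, h4⟩ := s'.exists_apex_of_im_lt (P := L P)
      (Q := L Q) (by rw [mem_preimage, hcc]; exact hP)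
      (by rw [mem_preimage, hcc]; exact hQ)
      (openSegment_comp (by rw [hcc, hcc]; exact h0))
      (by simp only [hi]; linarith) hs'
    have hsub : L ⁻¹' (L ⁻¹' D) = D := by
      ext w; rw [mem_preimage, mem_preimage, hcc]
    refine ⟨L A, hA, ?_, ?_, ?_, ?_⟩
    · unfold Anticlockwise at h1 ⊢
      simp only [Complex.sub_re, Complex.sub_im, hr, hi] at h1 ⊢
      linarith
    · rw [← hsub]; exact Spans.comp (Or.inr rfl) (Or.inr rfl) hr hi (by rw [hcc]; exact h2)
    · rw [← hsub]; exact Spans.comp (Or.inr rfl) (Or.inr rfl) hr hi (by rw [hcc]; exact h3)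
    · rw [← hsub]
      exact Boxed.comp (Or.inr rfl) (Or.inr rfl) hr hi (by rw [hcc]; exact h4)

/-- Here `m` and `m'` are reciprocals of slopes: above `w₀` the first segment runs to the left of
the second, below to the right. The lower of the two upper ends has its height within the other
window, so it must lie horizontally outside of it; the same holds for the lower ends. Equal heights
are excluded by the absence of horizontal saddle connections. If both inner ends belong to one
segment, it is wider than the other window. If they belong to different segments, the inequalities
become equalities and two visible points lie on a vertical line. -/
theorem false_of_crossing (s : KeaneView w₀ D V) {α β α' β' m m' X₁ X₂ X₁' X₂' : ℝ}
    (hα : 0 < α) (hβ : 0 < β) (hα' : 0 < α') (hβ' : 0 < β') (hm : m < m')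
    (hP : ⟨w₀.re - α * m, w₀.im - α⟩ ∈ V) (hQ : ⟨w₀.re + β * m, w₀.im + β⟩ ∈ V)
    (hP' : ⟨w₀.re - α' * m', w₀.im - α'⟩ ∈ V) (hQ' : ⟨w₀.re + β' * m', w₀.im + β'⟩ ∈ V)
    (hX : 1 < X₂ - X₁) (hX' : 1 < X₂' - X₁')
    (hPX : w₀.re - α * m ∈ Icc X₁ X₂) (hQX : w₀.re + β * m ∈ Icc X₁ X₂)
    (hPX' : w₀.re - α' * m' ∈ Icc X₁' X₂') (hQX' : w₀.re + β' * m' ∈ Icc X₁' X₂')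
    (hw : |w₀.re - α * m - (w₀.re + β * m)| ≤ 1) (hw' : |w₀.re - α' * m' - (w₀.re + β' * m')| ≤ 1)
    (h0 : w₀.re ∈ Ioo X₁ X₂) (h0' : w₀.re ∈ Ioo X₁' X₂')
    (hD : Ioo X₁ X₂ ×ℂ Ioo (w₀.im - α) (w₀.im + β) ⊆ D)
    (hD' : Ioo X₁' X₂' ×ℂ Ioo (w₀.im - α') (w₀.im + β') ⊆ D) : False := by
  have hmem : w₀ ∈ Ioo X₁ X₂ ×ℂ Ioo (w₀.im - α) (w₀.im + β) :=
    Complex.mem_reProdIm.2 ⟨h0, by linarith, by linarith⟩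
  have hmem' : w₀ ∈ Ioo X₁' X₂' ×ℂ Ioo (w₀.im - α') (w₀.im + β') :=
    Complex.mem_reProdIm.2 ⟨h0', by linarith, by linarith⟩
  have hcl := closure_rect (x₀ := X₁) (x₁ := X₂) (y₀ := w₀.im - α) (y₁ := w₀.im + β)
    (h0.1.trans h0.2) (by linarith)
  have hcl' := closure_rect (x₀ := X₁') (x₁ := X₂') (y₀ := w₀.im - α') (y₁ := w₀.im + β')
    (h0'.1.trans h0'.2) (by linarith)
  -- the upper end points
  have htop : (β ≤ β' → w₀.re + β * m ≤ X₁') ∧ (β' ≤ β → X₂ ≤ w₀.re + β' * m') := by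
    constructor
    · intro hle
      by_contra hlt
      push Not at hlt
      have h1 : β * m < β * m' := mul_lt_mul_of_pos_left hm hβ
      rcases eq_or_lt_of_le hle with heq | hlt'
      · subst heq
        have hQcl : (⟨w₀.re + β * m, w₀.im + β⟩ : ℂ) ∈
            closure (Ioo X₁' X₂' ×ℂ Ioo (w₀.im - α') (w₀.im + β)) := by
          rw [hcl', Complex.mem_reProdIm]
          exact ⟨⟨hlt.le, by change w₀.re + β * m ≤ X₂'; linarith [hQX'.2]⟩,
            ⟨by change w₀.im - α' ≤ w₀.im + β; linarith, le_rfl⟩⟩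
        have hQcl' : (⟨w₀.re + β * m', w₀.im + β⟩ : ℂ) ∈
            closure (Ioo X₁' X₂' ×ℂ Ioo (w₀.im - α') (w₀.im + β)) := by
          rw [hcl', Complex.mem_reProdIm]
          exact ⟨hQX', ⟨by change w₀.im - α' ≤ w₀.im + β; linarith, le_rfl⟩⟩
        exact s.false_of_horizontal (convex_rect _ _ _ _) (isOpen_rect _ _ _ _) hmem' hD' hQ hQ'
          hQcl hQcl' (fun h => by have := congrArg Complex.re h; simp at this; rcases this with h | h <;> linarith) rfl
      · refine s.notMem hQ (hD' (Complex.mem_reProdIm.2 ⟨⟨hlt, ?_⟩, ?_, ?_⟩))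
        · change w₀.re + β * m < X₂'
          by_cases hm0 : 0 ≤ m'
          · have : β * m' ≤ β' * m' := by gcongr
            linarith [hQX'.2]
          · push Not at hm0
            have : β * m' ≤ 0 := mul_nonpos_of_nonneg_of_nonpos hβ.le hm0.le
            linarith [h0'.2]
        · change w₀.im - α' < w₀.im + β; linarith
        · change w₀.im + β < w₀.im + β'; linarith
    · intro hle
      by_contra hlt
      push Not at hlt
      have h1 : β' * m < β' * m' := mul_lt_mul_of_pos_left hm hβ'
      rcases eq_or_lt_of_le hle with heq | hlt'
      · subst heq
        have hQcl : (⟨w₀.re + β' * m, w₀.im + β'⟩ : ℂ) ∈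
            closure (Ioo X₁ X₂ ×ℂ Ioo (w₀.im - α) (w₀.im + β')) := by
          rw [hcl, Complex.mem_reProdIm]
          exact ⟨hQX, ⟨by change w₀.im - α ≤ w₀.im + β'; linarith, le_rfl⟩⟩
        have hQcl' : (⟨w₀.re + β' * m', w₀.im + β'⟩ : ℂ) ∈
            closure (Ioo X₁ X₂ ×ℂ Ioo (w₀.im - α) (w₀.im + β')) := by
          rw [hcl, Complex.mem_reProdIm]
          exact ⟨⟨by change X₁ ≤ w₀.re + β' * m'; linarith [hQX.1], hlt.le⟩,
            ⟨by change w₀.im - α ≤ w₀.im + β'; linarith, le_rfl⟩⟩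
        exact s.false_of_horizontal (convex_rect _ _ _ _) (isOpen_rect _ _ _ _) hmem hD hQ hQ'
          hQcl hQcl' (fun h => by have := congrArg Complex.re h; simp at this; rcases this with h | h <;> linarith) rfl
      · refine s.notMem hQ' (hD (Complex.mem_reProdIm.2 ⟨⟨?_, hlt⟩, ?_, ?_⟩))
        · change X₁ < w₀.re + β' * m'
          by_cases hm0 : 0 ≤ m
          · have : 0 ≤ β' * m := by positivity
            linarith [h0.1]
          · push Not at hm0
            have : β * m ≤ β' * m := by nlinarith
            linarith [hQX.1]
        · change w₀.im - α < w₀.im + β'; linarith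
        · change w₀.im + β' < w₀.im + β; linarith
  -- the lower end points
  have hbot : (α' ≤ α → w₀.re - α' * m' ≤ X₁) ∧ (α ≤ α' → X₂' ≤ w₀.re - α * m) := by
    constructor
    · intro hle
      by_contra hlt
      push Not at hlt
      have h1 : α' * m < α' * m' := mul_lt_mul_of_pos_left hm hα'
      rcases eq_or_lt_of_le hle with heq | hlt'
      · subst heq
        have hQcl : (⟨w₀.re - α' * m, w₀.im - α'⟩ : ℂ) ∈
            closure (Ioo X₁ X₂ ×ℂ Ioo (w₀.im - α') (w₀.im + β)) := by
          rw [hcl, Complex.mem_reProdIm]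
          exact ⟨hPX, ⟨le_rfl, by change w₀.im - α' ≤ w₀.im + β; linarith⟩⟩
        have hQcl' : (⟨w₀.re - α' * m', w₀.im - α'⟩ : ℂ) ∈
            closure (Ioo X₁ X₂ ×ℂ Ioo (w₀.im - α') (w₀.im + β)) := by
          rw [hcl, Complex.mem_reProdIm]
          exact ⟨⟨hlt.le, by change w₀.re - α' * m' ≤ X₂; linarith [hPX.2]⟩,
            ⟨le_rfl, by change w₀.im - α' ≤ w₀.im + β; linarith⟩⟩
        exact s.false_of_horizontal (convex_rect _ _ _ _) (isOpen_rect _ _ _ _) hmem hD hP hP'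
          hQcl hQcl' (fun h => by have := congrArg Complex.re h; simp at this; rcases this with h | h <;> linarith) rfl
      · refine s.notMem hP' (hD (Complex.mem_reProdIm.2 ⟨⟨hlt, ?_⟩, ?_, ?_⟩))
        · change w₀.re - α' * m' < X₂
          by_cases hm0 : 0 ≤ m
          · have : 0 ≤ α' * m := by positivity
            linarith [h0.2]
          · push Not at hm0
            have : α * m ≤ α' * m := by nlinarith
            linarith [hPX.2]
        · change w₀.im - α < w₀.im - α'; linarith
        · change w₀.im - α' < w₀.im + β; linarith
    · intro hle
      by_contra hlt
      push Not at hlt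
      have h1 : α * m < α * m' := mul_lt_mul_of_pos_left hm hα
      rcases eq_or_lt_of_le hle with heq | hlt'
      · subst heq
        have hQcl : (⟨w₀.re - α * m, w₀.im - α⟩ : ℂ) ∈
            closure (Ioo X₁' X₂' ×ℂ Ioo (w₀.im - α) (w₀.im + β')) := by
          rw [hcl', Complex.mem_reProdIm]
          exact ⟨⟨by change X₁' ≤ w₀.re - α * m; linarith [hPX'.1], hlt.le⟩,
            ⟨le_rfl, by change w₀.im - α ≤ w₀.im + β'; linarith⟩⟩
        have hQcl' : (⟨w₀.re - α * m', w₀.im - α⟩ : ℂ) ∈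
            closure (Ioo X₁' X₂' ×ℂ Ioo (w₀.im - α) (w₀.im + β')) := by
          rw [hcl', Complex.mem_reProdIm]
          exact ⟨hPX', ⟨le_rfl, by change w₀.im - α ≤ w₀.im + β'; linarith⟩⟩
        exact s.false_of_horizontal (convex_rect _ _ _ _) (isOpen_rect _ _ _ _) hmem' hD' hP hP'
          hQcl hQcl' (fun h => by have := congrArg Complex.re h; simp at this; rcases this with h | h <;> linarith) rfl
      · refine s.notMem hP (hD' (Complex.mem_reProdIm.2 ⟨⟨?_, hlt⟩, ?_, ?_⟩))
        · change X₁' < w₀.re - α * m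
          by_cases hm0 : 0 ≤ m'
          · have : α * m' ≤ α' * m' := by gcongr
            linarith [hPX'.1]
          · push Not at hm0
            have : α * m' ≤ 0 := mul_nonpos_of_nonneg_of_nonpos hα.le hm0.le
            linarith [h0'.1]
        · change w₀.im - α' < w₀.im - α; linarith
        · change w₀.im - α < w₀.im + β'; linarith
  rcases le_total β β' with hb | hb <;> rcases le_total α α' with ha | ha
  · have h1 := htop.1 hb
    have h2 := hbot.2 ha
    have h3 := (le_abs_self _).trans hw
    linarith
  · have h1 := htop.1 hb
    have h2 := hbot.1 ha
    have e1 : w₀.re + β * m = w₀.re - α' * m' := by linarith [hPX'.1, hQX.1]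
    have hQcl : (⟨w₀.re + β * m, w₀.im + β⟩ : ℂ) ∈
        closure (Ioo X₁ X₂ ×ℂ Ioo (w₀.im - α) (w₀.im + β)) := by
      rw [hcl, Complex.mem_reProdIm]
      exact ⟨hQX, ⟨by change w₀.im - α ≤ w₀.im + β; linarith, le_rfl⟩⟩
    have hPcl : (⟨w₀.re - α' * m', w₀.im - α'⟩ : ℂ) ∈
        closure (Ioo X₁ X₂ ×ℂ Ioo (w₀.im - α) (w₀.im + β)) := by
      rw [hcl, Complex.mem_reProdIm]
      exact ⟨by rw [← e1]; exact hQX, ⟨by change w₀.im - α ≤ w₀.im - α'; linarith,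
        by change w₀.im - α' ≤ w₀.im + β; linarith⟩⟩
    exact s.false_of_vertical (convex_rect _ _ _ _) (isOpen_rect _ _ _ _) hmem hD hQ hP' hQcl hPcl
      (fun h => by have := congrArg Complex.im h; simp only at this; linarith) e1
  · have h1 := htop.2 hb
    have h2 := hbot.2 ha
    have e1 : w₀.re + β' * m' = w₀.re - α * m := by linarith [hQX'.2, hPX.2]
    have hQcl : (⟨w₀.re + β' * m', w₀.im + β'⟩ : ℂ) ∈
        closure (Ioo X₁ X₂ ×ℂ Ioo (w₀.im - α) (w₀.im + β)) := by
      rw [hcl, Complex.mem_reProdIm]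
      exact ⟨by rw [e1]; exact hPX, ⟨by change w₀.im - α ≤ w₀.im + β'; linarith,
        by change w₀.im + β' ≤ w₀.im + β; linarith⟩⟩
    have hPcl : (⟨w₀.re - α * m, w₀.im - α⟩ : ℂ) ∈
        closure (Ioo X₁ X₂ ×ℂ Ioo (w₀.im - α) (w₀.im + β)) := by
      rw [hcl, Complex.mem_reProdIm]
      exact ⟨hPX, ⟨le_rfl, by change w₀.im - α ≤ w₀.im + β; linarith⟩⟩
    exact s.false_of_vertical (convex_rect _ _ _ _) (isOpen_rect _ _ _ _) hmem hD hQ' hP hQcl hPcl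
      (fun h => by have := congrArg Complex.im h; simp only at this; linarith) e1
  · have h1 := htop.2 hb
    have h2 := hbot.1 ha
    have h3 := (neg_le_abs _).trans hw'
    linarith

/-- Different slopes are excluded by `false_of_crossing`. For equal slopes neither segment can be
longer on either side of `w₀`, since an end of the shorter one would be inside the other window. -/
theorem eq_of_crossing (s : KeaneView w₀ D V) {P Q P' Q' : ℂ} (hP : P ∈ V) (hQ : Q ∈ V)
    (hP' : P' ∈ V) (hQ' : Q' ∈ V) (him : P.im < Q.im) (him' : P'.im < Q'.im)
    (h0 : w₀ ∈ openSegment ℝ P Q) (h0' : w₀ ∈ openSegment ℝ P' Q') (hs : Spans D P Q)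
    (hs' : Spans D P' Q') : P = P' ∧ Q = Q' := by
  have key : ∀ P Q : ℂ, P.im < Q.im → w₀ ∈ openSegment ℝ P Q → Spans D P Q →
      ∃ α β m X₁ X₂ : ℝ, 0 < α ∧ 0 < β ∧ P = ⟨w₀.re - α * m, w₀.im - α⟩ ∧
        Q = ⟨w₀.re + β * m, w₀.im + β⟩ ∧ 1 < X₂ - X₁ ∧ w₀.re - α * m ∈ Icc X₁ X₂ ∧
        w₀.re + β * m ∈ Icc X₁ X₂ ∧ |w₀.re - α * m - (w₀.re + β * m)| ≤ 1 ∧ w₀.re ∈ Ioo X₁ X₂ ∧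
        Ioo X₁ X₂ ×ℂ Ioo (w₀.im - α) (w₀.im + β) ⊆ D := by
    intro P Q him h0 hs
    obtain ⟨x₀, x₁, hw, hPx, hQx, habs, hne, -, hD⟩ := hs
    rw [uIoo_of_lt him] at hD
    obtain ⟨t, ht0, ht1, htre, htim⟩ := mem_openSegment_re_im h0
    have hd : 0 < Q.im - P.im := by linarith
    have e1 : P = ⟨w₀.re - (t * (Q.im - P.im)) * ((Q.re - P.re) / (Q.im - P.im)),
        w₀.im - t * (Q.im - P.im)⟩ := by
      apply Complex.ext
      · simp only; field_simp; linarith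
      · simp only; linarith
    have e2 : Q = ⟨w₀.re + ((1 - t) * (Q.im - P.im)) * ((Q.re - P.re) / (Q.im - P.im)),
        w₀.im + (1 - t) * (Q.im - P.im)⟩ := by
      apply Complex.ext
      · simp only; field_simp; linarith
      · simp only; linarith
    have e1r := congrArg Complex.re e1
    have e1i := congrArg Complex.im e1
    have e2r := congrArg Complex.re e2
    have e2i := congrArg Complex.im e2
    simp only at e1r e1i e2r e2i
    refine ⟨t * (Q.im - P.im), (1 - t) * (Q.im - P.im), (Q.re - P.re) / (Q.im - P.im), x₀, x₁,
      by positivity, mul_pos (by linarith) hd, e1, e2, hw, ?_, ?_, ?_, ?_, ?_⟩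
    · rw [← e1r]; exact hPx
    · rw [← e2r]; exact hQx
    · rw [← e1r, ← e2r]; exact habs
    · rcases lt_or_gt_of_ne hne with h | h
      · constructor <;> nlinarith [hPx.1, hPx.2, hQx.1, hQx.2]
      · constructor <;> nlinarith [hPx.1, hPx.2, hQx.1, hQx.2]
    · rw [← e1i, ← e2i]; exact hD
  obtain ⟨α, β, m, X₁, X₂, hα, hβ, rfl, rfl, hX, hPX, hQX, hw, h0X, hD⟩ := key P Q him h0 hs
  obtain ⟨α', β', m', X₁', X₂', hα', hβ', rfl, rfl, hX', hPX', hQX', hw', h0X', hD'⟩ :=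
    key P' Q' him' h0' hs'
  rcases lt_trichotomy m m' with hm | hm | hm
  · exact (s.false_of_crossing hα hβ hα' hβ' hm hP hQ hP' hQ' hX hX' hPX hQX hPX' hQX' hw hw' h0X
      h0X' hD hD').elim
  · subst hm
    have hseg : ∀ {α β α' β' X₁ X₂ : ℝ}, 0 < α → 0 < β → 0 < α' → 0 < β' →
        (⟨w₀.re - α' * m, w₀.im - α'⟩ : ℂ) ∈ V → (⟨w₀.re + β' * m, w₀.im + β'⟩ : ℂ) ∈ V →
        w₀.re - α * m ∈ Icc X₁ X₂ → w₀.re + β * m ∈ Icc X₁ X₂ → w₀.re ∈ Ioo X₁ X₂ →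
        Ioo X₁ X₂ ×ℂ Ioo (w₀.im - α) (w₀.im + β) ⊆ D → α ≤ α' ∧ β ≤ β' := by
      intro α β α' β' X₁ X₂ hα hβ hα' hβ' hP' hQ' hPX hQX h0X hD
      constructor
      · by_contra hlt
        push Not at hlt
        refine s.notMem hP' (hD (Complex.mem_reProdIm.2 ⟨?_, ?_, ?_⟩))
        · change w₀.re - α' * m ∈ Ioo X₁ X₂
          rcases le_total 0 m with hm | hm
          · have h1 : 0 ≤ α' * m := by positivity
            have h2 : α' * m ≤ α * m := by gcongr
            rcases eq_or_lt_of_le hm with hm | hm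
            · rw [← hm] at *; simpa using h0X
            · have h2 : α' * m < α * m := by gcongr
              constructor <;> linarith [hPX.1, h0X.2]
          · have h1 : α' * m ≤ 0 := mul_nonpos_of_nonneg_of_nonpos hα'.le hm
            rcases eq_or_lt_of_le hm with hm | hm
            · rw [hm] at *; simpa using h0X
            · have h2 : α * m < α' * m := by nlinarith
              constructor <;> linarith [hPX.2, h0X.1]
        · change w₀.im - α < w₀.im - α'; linarith
        · change w₀.im - α' < w₀.im + β; linarith
      · by_contra hlt
        push Not at hlt
        refine s.notMem hQ' (hD (Complex.mem_reProdIm.2 ⟨?_, ?_, ?_⟩))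
        · change w₀.re + β' * m ∈ Ioo X₁ X₂
          rcases le_total 0 m with hm | hm
          · have h1 : 0 ≤ β' * m := by positivity
            rcases eq_or_lt_of_le hm with hm | hm
            · rw [← hm] at *; simpa using h0X
            · have h2 : β' * m < β * m := by gcongr
              constructor <;> linarith [hQX.2, h0X.1]
          · have h1 : β' * m ≤ 0 := mul_nonpos_of_nonneg_of_nonpos hβ'.le hm
            rcases eq_or_lt_of_le hm with hm | hm
            · rw [hm] at *; simpa using h0X
            · have h2 : β * m < β' * m := by nlinarith
              constructor <;> linarith [hQX.1, h0X.2]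
        · change w₀.im - α < w₀.im + β'; linarith
        · change w₀.im + β' < w₀.im + β; linarith
    obtain ⟨h1, h2⟩ := hseg hα hβ hα' hβ' hP' hQ' hPX hQX h0X hD
    obtain ⟨h3, h4⟩ := hseg hα' hβ' hα hβ hP hQ hPX' hQX' h0X' hD'
    have e1 : α = α' := le_antisymm h1 h3
    have e2 : β = β' := le_antisymm h2 h4
    subst e1 e2
    exact ⟨rfl, rfl⟩
  · exact (s.false_of_crossing hα' hβ' hα hβ hm hP' hQ' hP hQ hX' hX hPX' hQX' hPX hQX hw' hw h0X'
      h0X hD' hD).elim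

end KeaneView

/-! ### Flat segments, figures fitting into a view, and the absence of large flat discs. -/

namespace HalfTranslationStructure

variable {S : Type*} [TopologicalSpace S] {q : HalfTranslationStructure S}

theorem isHalfTranslation_add (c : ℂ) : IsHalfTranslation (fun z => z + c) :=
  ⟨1, c, Or.inl rfl, fun z => by ring⟩

theorem isHalfTranslation_sub_left (c : ℂ) : IsHalfTranslation (fun z => c - z) :=
  ⟨-1, c, Or.inr rfl, fun z => by ring⟩

theorem _root_.IsHalfTranslation.cases {h : ℂ → ℂ} (H : IsHalfTranslation h) {a b : ℂ}
    (hab : h a = b) : (∀ z, h z = z + (b - a)) ∨ ∀ z, h z = a + b - z := by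
  obtain ⟨ε, c, rfl | rfl, hz⟩ := H
  · left; intro z; rw [hz] at hab ⊢; linear_combination hab
  · right; intro z; rw [hz] at hab ⊢; linear_combination hab

/-- A flat map does not fold: it is not invariant under a half turn about a point of its domain. -/
theorem Free.not_fold {D : Set ℂ} {f : ℂ → S} (hf : q.Free D f) (hD : Convex ℝ D) {a b : ℂ}
    (ha : a ∈ D) (hb : b ∈ D) (hab : a ≠ b) :
    ¬ ∀ w ∈ D, a + b - w ∈ D → f w = f (a + b - w) := by
  intro h
  set m : ℂ := a + ((1 / 2 : ℝ)) • (b - a) with hm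
  have hmD : m ∈ D := hD.add_smul_sub_mem ha hb ⟨by norm_num, by norm_num⟩
  obtain ⟨U, hU, hinj⟩ := hf.injOn_nhds hmD
  have hpt : ∀ t : ℝ, t ∈ Icc (0:ℝ) 1 → a + t • (b - a) ∈ D := fun t ht =>
    hD.add_smul_sub_mem ha hb ht
  have hcont : Tendsto (fun t : ℝ => a + t • (b - a)) (𝓝 (1 / 2)) (𝓝 m) := by
    apply Continuous.tendsto'
    · fun_prop
    · rfl
  have hcont' : Tendsto (fun t : ℝ => a + (1 - t) • (b - a)) (𝓝 (1 / 2)) (𝓝 m) := by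
    apply Continuous.tendsto'
    · fun_prop
    · rw [hm]; norm_num
  have h01 : ∀ᶠ t : ℝ in 𝓝 (1 / 2), t ∈ Icc (0:ℝ) 1 := Icc_mem_nhds (by norm_num) (by norm_num)
  have e1 : ∀ᶠ t : ℝ in 𝓝 (1 / 2), a + t • (b - a) ∈ U :=
    (tendsto_nhdsWithin_iff.2 ⟨hcont, h01.mono fun t ht => hpt t ht⟩).eventually hU
  have e2 : ∀ᶠ t : ℝ in 𝓝 (1 / 2), a + (1 - t) • (b - a) ∈ U :=
    (tendsto_nhdsWithin_iff.2 ⟨hcont', h01.mono fun t ht =>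
      hpt (1 - t) ⟨by linarith [ht.2], by linarith [ht.1]⟩⟩).eventually hU
  have e3 : ∃ᶠ t : ℝ in 𝓝 (1 / 2), t ≠ 1 / 2 := by
    have : ∀ᶠ t : ℝ in 𝓝[≠] (1 / 2), t ≠ 1 / 2 := eventually_mem_nhdsWithin
    exact this.frequently.filter_mono nhdsWithin_le_nhds
  -- The half-turn exchanges parameters `t` and `1 - t`. Close to the midpoint local injectivity
  -- forces the two points to coincide, although `t ≠ 1 / 2`.
  obtain ⟨t, ht, h1, h2, h3⟩ := (e3.and_eventually (e1.and (e2.and h01))).exists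
  have heq : a + b - (a + t • (b - a)) = a + (1 - t) • (b - a) := by
    simp only [Complex.real_smul]; push_cast; ring
  have := h _ (hpt t h3) (by
    rw [heq]; exact hpt (1 - t) ⟨by linarith [h3.2], by linarith [h3.1]⟩)
  rw [heq] at this
  have := hinj h1 h2 this
  have hz : ((2 * t - 1 : ℝ) : ℂ) * (b - a) = 0 := by
    simp only [Complex.real_smul] at this; push_cast at this ⊢; linear_combination this
  rcases mul_eq_zero.1 hz with h0 | h0
  · have := Complex.ofReal_eq_zero.1 h0
    exact ht (by linarith)
  · exact hab (sub_eq_zero.1 h0).symm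

/-- A flat segment with marked end points is embedded. -/
theorem IsFlatMap.injOn_openSegment [T2Space S] {P Q : ℂ} {f : ℂ → S}
    (hf : q.IsFlatMap (segment ℝ P Q) {P, Q} f) (hPQ : P ≠ Q) : InjOn f (openSegment ℝ P Q) := by
  have hO : openSegment ℝ P Q ⊆ segment ℝ P Q \ {P, Q} := by
    intro w hw
    refine ⟨openSegment_subset_segment ℝ P Q hw, ?_⟩
    rintro (rfl | rfl)
    · exact hPQ ((left_mem_openSegment_iff).1 hw)
    · exact hPQ ((right_mem_openSegment_iff).1 hw)
  have hfree : q.Free (openSegment ℝ P Q) f := hf.free.mono hO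
  have hpt : ∀ t : ℝ, 0 < t → t < 1 → P + t • (Q - P) ∈ openSegment ℝ P Q := fun t h0 h1 => by
    rw [openSegment_eq_image']; exact ⟨t, ⟨h0, h1⟩, rfl⟩
  -- a shift towards `Q` is impossible
  have key : ∀ s : ℝ, 0 < s → s < 1 → ¬ ∀ w ∈ openSegment ℝ P Q,
      w + s • (Q - P) ∈ openSegment ℝ P Q → f w = f (w + s • (Q - P)) := by
    intro s hs hs1 h
    set x : ℂ := P + (1 - s) • (Q - P)
    have hx : x ∈ openSegment ℝ P Q := hpt _ (by linarith) (by linarith)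
    have hev : ∀ᶠ t : ℝ in 𝓝[<] (1 - s), 0 < t ∧ t < 1 - s := by
      filter_upwards [Ioo_mem_nhdsLT (show (0:ℝ) < 1 - s by linarith)] with t ht using ht
    have hT1 : Tendsto (fun t : ℝ => P + t • (Q - P)) (𝓝[<] (1 - s))
        (𝓝[segment ℝ P Q] x) := by
      refine tendsto_nhdsWithin_iff.2 ⟨(Continuous.tendsto' (by fun_prop) _ _ rfl).mono_left
        nhdsWithin_le_nhds, hev.mono fun t ht =>
        openSegment_subset_segment ℝ P Q (hpt t ht.1 (by linarith [ht.2]))⟩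
    have hT2 : Tendsto (fun t : ℝ => P + t • (Q - P) + s • (Q - P)) (𝓝[<] (1 - s))
        (𝓝[segment ℝ P Q] Q) := by
      refine tendsto_nhdsWithin_iff.2 ⟨(Continuous.tendsto' (by fun_prop) _ _ ?_).mono_left
        nhdsWithin_le_nhds, hev.mono fun t ht => ?_⟩
      · simp only [Complex.real_smul]; push_cast; ring
      · rw [add_assoc, ← add_smul]
        exact openSegment_subset_segment ℝ P Q (hpt _ (by linarith [ht.1]) (by linarith [ht.2]))
    have l1 := (hf.continuousOn x (openSegment_subset_segment ℝ P Q hx)).tendsto.comp hT1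
    have l2 := (hf.continuousOn Q (right_mem_segment ℝ P Q)).tendsto.comp hT2
    have heq : f x = f Q := by
      refine tendsto_nhds_unique (l1.congr' ?_) l2
      filter_upwards [hev] with t ht
      refine h _ (hpt t ht.1 (by linarith [ht.2])) ?_
      rw [add_assoc, ← add_smul]
      exact hpt _ (by linarith [ht.1]) (by linarith [ht.2])
    exact hfree.notMem hx (heq ▸ hf.vertices Q (by simp))
  intro a ha b hb hab
  by_contra hne
  have hconv : Convex ℝ (openSegment ℝ P Q) := convex_openSegment P Q
  obtain ⟨h, hh, hhab, heq⟩ := hfree.overlap hfree hconv hconv ha hb hab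
  -- A double point makes the segment overlap itself by a translation or by a half-turn. A
  -- translation would identify an interior point with the marked end in the limit, and a half-turn
  -- is a fold.
  rcases hh.cases hhab with hz | hz
  · obtain ⟨t, ht, rfl⟩ := (openSegment_eq_image' ℝ P Q ▸ ha :)
    obtain ⟨t', ht', rfl⟩ := (openSegment_eq_image' ℝ P Q ▸ hb :)
    have htt : t ≠ t' := fun h => hne (by rw [h])
    have e : P + t' • (Q - P) - (P + t • (Q - P)) = (t' - t) • (Q - P) := by
      rw [sub_smul]; abel
    rcases lt_or_gt_of_ne htt with hlt | hlt
    · refine key (t' - t) (by linarith) (by linarith [ht.1, ht'.2]) fun w hw hw' => ?_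
      have hhw : h w = w + (t' - t) • (Q - P) := by rw [hz, e]
      rw [← hhw] at hw' ⊢
      exact heq ⟨hw, hw'⟩
    · refine key (t - t') (by linarith) (by linarith [ht'.1, ht.2]) fun w hw hw' => ?_
      have hhw : h (w + (t - t') • (Q - P)) = w := by
        rw [hz, e, add_assoc, ← add_smul]; simp
      have := heq (x := w + (t - t') • (Q - P)) ⟨hw', by rw [mem_preimage, hhw]; exact hw⟩
      simp only [hhw] at this
      exact this.symm
  · refine hfree.not_fold hconv ha hb hne fun w hw hw' => ?_
    have := heq (x := w) ⟨hw, by rw [mem_preimage, hz]; exact hw'⟩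
    simpa only [hz] using this

theorem IsFlatMap.isSaddleConnection [T2Space S] {P Q : ℂ} {f : ℂ → S}
    (hf : q.IsFlatMap (segment ℝ P Q) {P, Q} f) (hPQ : P ≠ Q) :
    q.IsSaddleConnection (f '' segment ℝ P Q) (Q - P) := by
  have hinj := hf.injOn_openSegment hPQ
  have hh := isHalfTranslation_add P
  have e1 : (fun z => z + P) ⁻¹' segment ℝ P Q = segment ℝ 0 (Q - P) := by
    have := hh.image_segment 0 (Q - P)
    simp only [zero_add, sub_add_cancel] at this
    rw [← this, preimage_image_eq _ hh.injective]
  have e2 : (fun z => z + P) ⁻¹' openSegment ℝ P Q = openSegment ℝ 0 (Q - P) := by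
    have := hh.image_openSegment 0 (Q - P)
    simp only [zero_add, sub_add_cancel] at this
    rw [← this, preimage_image_eq _ hh.injective]
  have e3 : (fun z => z + P) ⁻¹' {P, Q} = {0, Q - P} := by
    ext z; simp [eq_sub_iff_add_eq]
  refine ⟨sub_ne_zero.2 hPQ.symm, fun z => f (z + P), ?_, ?_, ?_⟩
  · have := hf.comp hh
    rwa [e1, e3] at this
  · rw [← e2]
    intro a ha b hb hab
    exact hh.injective (hinj ha hb hab)
  · have := hh.image_segment 0 (Q - P)
    simp only [zero_add, sub_add_cancel] at this
    rw [← this, image_image]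

namespace Sky

variable {w₀ : ℂ} {f : ℂ → S} {D V : Set ℂ}

theorem starView (s : q.Sky w₀ f D V) : StarView w₀ D V where
  base := s.base
  isOpen := s.isOpen
  star := s.star
  mem_V := s.mem_V
  isolated := s.isolated

theorem flatMap (s : q.Sky w₀ f D V) {K : Set ℂ} (hK : K ⊆ D ∪ V) : q.IsFlatMap K (K ∩ V) f where
  continuousOn := s.cont.mono hK
  vertices p hp := s.map_V p hp.2
  rest p hp := s.free.notMem ((hK hp.1).resolve_right fun h => hp.2 ⟨hp.1, h⟩)
  flat p hp ψ hψ hs := by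
    have hpD : p ∈ D := (hK hp.1).resolve_right fun h => hp.2 ⟨hp.1, h⟩
    obtain ⟨h, hh, he⟩ := s.free.chart_of_mem hpD hψ hs
    rw [s.isOpen.nhdsWithin_eq hpD] at he
    exact ⟨h, hh, (he.filter_mono nhdsWithin_le_nhds).mono fun w hw => hw.2⟩

theorem flatMap_segment (s : q.Sky w₀ f D V) {P Q : ℂ} (hP : P ∈ V) (hQ : Q ∈ V)
    (h : openSegment ℝ P Q ⊆ D) : q.IsFlatMap (segment ℝ P Q) {P, Q} f := by
  have hsub : segment ℝ P Q ⊆ D ∪ V := by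
    rw [← insert_endpoints_openSegment]
    rintro w (rfl | rfl | hw)
    exacts [Or.inr hP, Or.inr hQ, Or.inl (h hw)]
  refine (s.flatMap hsub).mono subset_rfl ?_ ?_
  · rintro w (rfl | rfl)
    exacts [⟨left_mem_segment ℝ _ _, hP⟩, ⟨right_mem_segment ℝ _ _, hQ⟩]
  · rintro w ⟨-, hw, hwV⟩
    rw [← insert_endpoints_openSegment] at hw
    rcases hw with rfl | rfl | hw
    · simp
    · simp
    · exact (s.starView.notMem hwV (h hw)).elim

/-- Every flat figure which is star-shaped about the base point, with its vertices as tips, sits in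
the view from that point. -/
theorem fit [T2Space S] (s : q.Sky w₀ f D V) {K VT : Set ℂ} {g : ℂ → S}
    (hg : q.IsFlatMap K VT g)
    (hstar : ∀ k ∈ K, ∀ t : ℝ, 0 ≤ t → t < 1 → w₀ + t * (k - w₀) ∈ K \ VT)
    (he : g =ᶠ[𝓝[K \ VT] w₀] f) : K \ VT ⊆ D ∧ K ∩ VT ⊆ V ∧ EqOn f g K := by
  have key : ∀ k ∈ K, (∀ t : ℝ, 0 ≤ t → t < 1 → w₀ + t * (k - w₀) ∈ D) → k ∈ D ∪ V →
      f k = g k := by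
    intro k hk hD hkDV
    set σ : Set ℂ := (fun t : ℝ => w₀ + t * (k - w₀)) '' Ico 0 1 with hσ
    have hσK : σ ⊆ K \ VT := by
      rintro _ ⟨t, ht, rfl⟩; exact hstar k hk t ht.1 ht.2
    have hσD : σ ⊆ D := by
      rintro _ ⟨t, ht, rfl⟩; exact hD t ht.1 ht.2
    have h0σ : w₀ ∈ σ := ⟨0, ⟨le_rfl, one_pos⟩, by simp⟩
    have hpre : IsPreconnected σ := isPreconnected_Ico.image _ (by fun_prop)
    have heq : EqOn g f σ := (hg.free.mono hσK).eqOn (s.free.mono hσD) hpre h0σ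
      (he.filter_mono (nhdsWithin_mono _ hσK))
    have hT : Tendsto (fun t : ℝ => w₀ + t * (k - w₀)) (𝓝[<] 1) (𝓝 k) :=
      (Continuous.tendsto' (by fun_prop) _ _ (by simp)).mono_left nhdsWithin_le_nhds
    have hev : ∀ᶠ t : ℝ in 𝓝[<] 1, w₀ + t * (k - w₀) ∈ σ := by
      filter_upwards [Ioo_mem_nhdsLT (show (0:ℝ) < 1 by norm_num)] with t ht
      exact ⟨t, ⟨ht.1.le, ht.2⟩, rfl⟩
    have l1 := (s.cont k hkDV).tendsto.comp
      (tendsto_nhdsWithin_iff.2 ⟨hT, hev.mono fun t ht => Or.inl (hσD ht)⟩)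
    have l2 := (hg.continuousOn k hk).tendsto.comp
      (tendsto_nhdsWithin_iff.2 ⟨hT, hev.mono fun t ht => (hσK ht).1⟩)
    exact tendsto_nhds_unique (l1.congr' (hev.mono fun t ht => (heq ht).symm)) l2
  -- Were `k` hidden behind a visible point, that point would be a non-vertex of `K` with a marked
  -- image.
  have hDV : ∀ k ∈ K, k ∈ D ∪ V := by
    intro k hk
    by_cases hkD : k ∈ D
    · exact Or.inl hkD
    obtain ⟨t, ht0, ht1, htV⟩ := s.starView.exists_visible hkD
    rcases eq_or_lt_of_le ht1 with rfl | ht1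
    · right; simpa using htV
    · exfalso
      have hmem := hstar k hk t ht0.le ht1
      have := key _ hmem.1 ((s.mem_V _).1 htV).2 (Or.inr htV)
      exact hg.rest _ hmem (this ▸ s.map_V _ htV)
  have hEq : EqOn f g K := by
    intro k hk
    refine key k hk ?_ (hDV k hk)
    rcases hDV k hk with h | h
    · intro t h0 h1
      have := s.star h (by linarith : 0 ≤ 1 - t) h0 (by ring)
      convert this using 1
      simp only [Complex.real_smul]; push_cast; ring
    · exact ((s.mem_V k).1 h).2
  refine ⟨fun k hk => (hDV k hk.1).resolve_right fun h => ?_, fun k hk =>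
    (hDV k hk.1).resolve_left fun h => ?_, hEq⟩
  · exact hg.rest k hk (hEq hk.1 ▸ s.map_V k h)
  · exact s.free.notMem h ((hEq hk.1).symm ▸ hg.vertices k hk.2)

theorem fit_convex [T2Space S] (s : q.Sky w₀ f D V) {C : Set ℂ} {g : ℂ → S}
    (hg : q.Free C g) (hC : Convex ℝ C) (h0 : w₀ ∈ C)
    (he : g =ᶠ[𝓝[C] w₀] f) : C ⊆ D ∧ EqOn f g C := by
  obtain ⟨h1, -, h3⟩ := s.fit hg (fun k hk t ht ht1 => ⟨by
    have := hC.add_smul_sub_mem h0 hk ⟨ht, ht1.le⟩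
    simpa using this, by simp⟩) (by simpa using he)
  exact ⟨by simpa using h1, h3⟩

end Sky

/-- `K` may be thin, such as a segment. So the view is built from a full disc around the image point
and then aligned with `g` along `K`. -/
theorem exists_sky_of_free [T2Space S] [CompactSpace S] {K : Set ℂ} {g : ℂ → S} {w₀ : ℂ}
    (hg : q.Free K g) (h0 : w₀ ∈ K) : ∃ f D V, q.Sky w₀ f D V ∧ g =ᶠ[𝓝[K] w₀] f := by
  obtain ⟨N, hN, r, hr, -, hG, -⟩ := exists_uniform_disc (hg.notMem h0)
  obtain ⟨G, hGf, hG0⟩ := hG _ (mem_of_mem_nhds hN) w₀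
  obtain ⟨h, hh, hh0, he⟩ := hg.align hGf h0 (Metric.mem_ball_self hr) hG0.symm
  have hpre : h ⁻¹' Metric.ball w₀ r = Metric.ball w₀ r := by
    conv_lhs => rw [← hh0]
    exact hh.preimage_ball w₀ r
  rw [hpre] at he
  have hfr := hGf.comp hh
  rw [hpre] at hfr
  obtain ⟨f, D, V, hs, hf⟩ := exists_sky Metric.isOpen_ball (Metric.mem_ball_self hr) hfr
  refine ⟨f, D, V, hs, ?_⟩
  rw [nhdsWithin_inter_of_mem' (mem_nhdsWithin_of_mem_nhds (Metric.ball_mem_nhds w₀ hr))] at he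
  filter_upwards [he, hf.filter_mono nhdsWithin_le_nhds] with w h1 h2
  rw [h1, h2]

/-- A compact connected half-translation surface with marked points does not contain arbitrarily
large flat discs. -/
theorem exists_radius_no_disc [T2Space S] [CompactSpace S] [ConnectedSpace S]
    (q : HalfTranslationStructure S) :
    ∃ R > 0, ∀ f w, ¬ q.Free (Metric.ball w R) f := by
  by_contra! H
  -- `A` consists of the centres of arbitrarily large discs. Moving a centre inside a chart costs a
  -- bounded amount of radius, so `A` is open and closed, and it contains a limit of centres of
  -- growing discs. By connectedness it is everything, although centres of discs stay away from
  -- marked points.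
  set A : Set S := {p | ∀ R > 0, ∃ f w, q.Free (Metric.ball w R) f ∧ f w = p} with hA
  have local_const : ∀ p ∉ q.Z, ∃ U ∈ 𝓝 p, ∃ r > 0, ∀ x ∈ U, ∀ y ∈ U, ∀ R > 2 * r,
      (∃ f w, q.Free (Metric.ball w R) f ∧ f w = x) →
      ∃ f w, q.Free (Metric.ball w (R - 2 * r)) f ∧ f w = y := by
    intro p hp
    obtain ⟨N, hN, r, hr, -, hG, -⟩ := exists_uniform_disc hp
    obtain ⟨G, hGf, hG0⟩ := hG _ (mem_of_mem_nhds hN) 0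
    refine ⟨G '' Metric.ball 0 r, hG0 ▸ hGf.image_mem_nhds Metric.isOpen_ball
      (Metric.mem_ball_self hr) (Metric.ball_mem_nhds _ hr), r, hr, ?_⟩
    rintro _ ⟨u, hu, rfl⟩ _ ⟨u', hu', rfl⟩ R hR ⟨f, w, hf, hfw⟩
    have hRpos : 0 < R := by linarith
    obtain ⟨h, hh, hhu, he⟩ := hGf.overlap hf (convex_ball _ _) (convex_ball _ _) hu
      (Metric.mem_ball_self hRpos) hfw.symm
    have hd : dist (h u') w < 2 * r := by
      rw [← hhu, hh.dist_eq]
      have := dist_triangle_right u' u 0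
      rw [Metric.mem_ball] at hu hu'
      linarith
    refine ⟨f, h u', hf.mono (Metric.ball_subset_ball' (by linarith)), ?_⟩
    exact (he ⟨hu', by rw [mem_preimage, Metric.mem_ball]; linarith⟩).symm
  have notZ : ∀ p, (∀ U ∈ 𝓝 p, ∃ f w, q.Free (Metric.ball w 1) f ∧ f w ∈ U) → p ∉ q.Z := by
    intro p hp hz
    obtain ⟨O, hO, hno⟩ := exists_nhds_no_disc hz one_pos
    obtain ⟨f, w, hf, hfw⟩ := hp O hO
    exact hno f w hf hfw
  have hne : A.Nonempty := by
    choose f w hf using fun n : ℕ => H (n + 1) (by positivity)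
    obtain ⟨p, hp⟩ := exists_clusterPt_of_compactSpace (map (fun n => f n (w n)) atTop)
    have hfreq : ∀ U ∈ 𝓝 p, ∃ᶠ n in atTop, f n (w n) ∈ U := fun U hU =>
      mapClusterPt_iff_frequently.1 hp U hU
    have hpZ : p ∉ q.Z := notZ p fun U hU => by
      obtain ⟨n, hn⟩ := (hfreq U hU).exists
      exact ⟨f n, w n, (hf n).mono (Metric.ball_subset_ball (by linarith [n.cast_nonneg (α := ℝ)])), hn⟩
    obtain ⟨U, hU, r, hr, hloc⟩ := local_const p hpZ
    refine ⟨p, fun R hR => ?_⟩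
    obtain ⟨n, hnU, hn⟩ := ((hfreq U hU).and_eventually
      (eventually_ge_atTop ⌈R + 2 * r⌉₊)).exists
    have hn' : R + 2 * r ≤ n := (Nat.le_ceil _).trans (by exact_mod_cast hn)
    obtain ⟨g, v, hg, hgv⟩ := hloc _ hnU p (mem_of_mem_nhds hU) (n + 1) (by linarith)
      ⟨f n, w n, hf n, rfl⟩
    exact ⟨g, v, hg.mono (Metric.ball_subset_ball (by linarith)), hgv⟩
  have hAZ : ∀ p ∈ closure A, p ∉ q.Z := by
    intro p hp
    refine notZ p fun U hU => ?_
    obtain ⟨x, hxU, hxA⟩ := mem_closure_iff_nhds.1 hp U hU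
    obtain ⟨f, w, hf, hfw⟩ := hxA 1 one_pos
    exact ⟨f, w, hf, hfw ▸ hxU⟩
  have hmove : ∀ p ∈ closure A, ∃ U ∈ 𝓝 p, U ⊆ A := by
    intro p hp
    obtain ⟨U, hU, r, hr, hloc⟩ := local_const p (hAZ p hp)
    obtain ⟨x, hxU, hxA⟩ := mem_closure_iff_nhds.1 hp U hU
    refine ⟨U, hU, fun y hy R hR => ?_⟩
    obtain ⟨g, v, hg, hgv⟩ := hloc x hxU y hy (R + 2 * r) (by linarith) (hxA _ (by linarith))
    exact ⟨g, v, hg.mono (Metric.ball_subset_ball (by linarith)), hgv⟩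
  have hclopen : IsClopen A := by
    refine ⟨isClosed_of_closure_subset fun p hp => ?_, isOpen_iff_mem_nhds.2 fun p hp => ?_⟩
    · obtain ⟨U, hU, hUA⟩ := hmove p hp
      exact hUA (mem_of_mem_nhds hU)
    · obtain ⟨U, hU, hUA⟩ := hmove p (subset_closure hp)
      exact mem_of_superset hU hUA
  have huniv := hclopen.eq_univ hne
  obtain ⟨z, hz⟩ := q.nonempty_Z
  exact hAZ z (subset_closure (huniv ▸ mem_univ z)) hz

/-- A flat map on a convex open set which is invariant under a translation extends to the union of
the translates. -/
theorem Free.exists_periodic {C : Set ℂ} {f : ℂ → S} {c : ℂ} (hf : q.Free C f) (hC : Convex ℝ C)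
    (hCo : IsOpen C) (hper : ∀ w ∈ C, w + c ∈ C → f (w + c) = f w) :
    ∃ F, q.Free {w | ∃ k : ℤ, w + k * c ∈ C} F ∧ EqOn F f C ∧
      ∀ w, (∃ k : ℤ, w + k * c ∈ C) → F (w + c) = F w := by
  classical
  have step : ∀ (n : ℕ) (w : ℂ), w ∈ C → w + n * c ∈ C → f (w + n * c) = f w := by
    intro n
    induction n with
    | zero => intro w _ _; simp
    | succ n ih =>
      intro w hw hw'
      have hmid : w + n * c ∈ C := by
        have := hC.add_smul_sub_mem hw hw' (t := n / (n + 1)) ⟨by positivity, by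
          rw [div_le_one (by positivity)]; linarith⟩
        convert this using 1
        have : (n + 1 : ℂ) ≠ 0 := by exact_mod_cast n.succ_ne_zero
        simp only [Complex.real_smul]; push_cast; field_simp; ring
      have e : w + (n + 1 : ℕ) * c = w + n * c + c := by push_cast; ring
      rw [e] at hw' ⊢
      rw [hper _ hmid hw', ih w hw hmid]
  have stepZ : ∀ (k l : ℤ) (w : ℂ), w + k * c ∈ C → w + l * c ∈ C → f (w + k * c) = f (w + l * c) := by
    intro k l w hk hl
    rcases le_total k l with h | h
    · obtain ⟨n, rfl⟩ := Int.le.dest h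
      have e : w + (k + n : ℤ) * c = w + k * c + n * c := by push_cast; ring
      rw [e] at hl ⊢
      exact (step n _ hk hl).symm
    · obtain ⟨n, rfl⟩ := Int.le.dest h
      have e : w + (l + n : ℤ) * c = w + l * c + n * c := by push_cast; ring
      rw [e] at hk ⊢
      exact step n _ hl hk
  set F : ℂ → S := fun w => if h : ∃ k : ℤ, w + k * c ∈ C then f (w + h.choose * c) else f w with hF
  have hFk : ∀ (k : ℤ) (w : ℂ), w + k * c ∈ C → F w = f (w + k * c) := by
    intro k w hk
    have hex : ∃ k : ℤ, w + k * c ∈ C := ⟨k, hk⟩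
    simp only [hF, dif_pos hex]
    exact stepZ _ _ _ hex.choose_spec hk
  refine ⟨F, Free.of_eventuallyEq fun w hw => ?_, fun w hw => ?_, fun w hw => ?_⟩
  · obtain ⟨k, hk⟩ := hw
    refine ⟨(fun z => z + k * c) ⁻¹' C, fun z => f (z + k * c),
      hf.comp (isHalfTranslation_add _), hk, hFk k w hk, ?_⟩
    have : ∀ᶠ z in 𝓝 w, z + k * c ∈ C :=
      (hCo.preimage (by fun_prop : Continuous fun z : ℂ => z + k * c)).mem_nhds hk
    exact (this.mono fun z hz => ⟨hz, hFk k z hz⟩).filter_mono nhdsWithin_le_nhds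
  · have := hFk 0 w (by simpa using hw)
    simpa using this
  · obtain ⟨k, hk⟩ := hw
    have e : w + c + (k - 1 : ℤ) * c = w + k * c := by push_cast; ring
    rw [hFk k w hk, hFk (k - 1) (w + c) (by rw [e]; exact hk), e]

end HalfTranslationStructure

/-! ### A Keane surface contains no infinite vertical strip. -/

namespace HalfTranslationStructure

variable {S : Type*} [TopologicalSpace S] {q : HalfTranslationStructure S}

theorem Sky.not_openSegment_of_vertical [T2Space S] (hv : q.VerticallyKeane) {w₀ : ℂ} {f : ℂ → S}
    {D V : Set ℂ} (s : q.Sky w₀ f D V) : ∀ κ ∈ V, ∀ κ' ∈ V, κ ≠ κ' → κ.re = κ'.re →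
      ¬ openSegment ℝ κ κ' ⊆ D := by
  intro κ hκ κ' hκ' hne hre hD
  exact hv ⟨_, _, (s.flatMap_segment hκ hκ' hD).isSaddleConnection hne, by simp [hre]⟩

theorem Sky.not_openSegment_of_horizontal [T2Space S] (hh : q.HorizontallyKeane) {w₀ : ℂ}
    {f : ℂ → S} {D V : Set ℂ} (s : q.Sky w₀ f D V) : ∀ κ ∈ V, ∀ κ' ∈ V, κ ≠ κ' → κ.im = κ'.im →
      ¬ openSegment ℝ κ κ' ⊆ D := by
  intro κ hκ κ' hκ' hne him hD
  exact hh ⟨_, _, (s.flatMap_segment hκ hκ' hD).isSaddleConnection hne, by simp [him]⟩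

theorem ball_subset_reProdIm (w : ℂ) (R : ℝ) :
    Metric.ball w R ⊆ Ioo (w.re - R) (w.re + R) ×ℂ Ioo (w.im - R) (w.im + R) := by
  intro z hz
  rw [Metric.mem_ball, dist_eq_norm] at hz
  have h1 := (Complex.abs_re_le_norm (z - w)).trans_lt hz
  have h2 := (Complex.abs_im_le_norm (z - w)).trans_lt hz
  rw [Complex.sub_re, abs_lt] at h1
  rw [Complex.sub_im, abs_lt] at h2
  rw [Complex.mem_reProdIm]
  exact ⟨⟨by linarith, by linarith⟩, by linarith, by linarith⟩

/-- There is no infinite vertical flat cylinder. -/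
theorem not_free_vertical_periodic [T2Space S] [CompactSpace S] [ConnectedSpace S]
    (hv : q.VerticallyKeane) {x₀ x₁ T : ℝ} (hx : x₀ < x₁) (hT : 0 < T) {f₀ : ℂ → S}
    (hf₀ : q.Free (Ioo x₀ x₁ ×ℂ univ) f₀)
    (hper : ∀ w ∈ Ioo x₀ x₁ ×ℂ univ, f₀ (w + T * Complex.I) = f₀ w) : False := by
  have hconv : ∀ a b : ℝ, Convex ℝ (Ioo a b ×ℂ univ) := fun a b =>
    convex_reProdIm (convex_Ioo _ _) convex_univ
  have hopen : ∀ a b : ℝ, IsOpen (Ioo a b ×ℂ univ) := fun a b => isOpen_Ioo.reProdIm isOpen_univ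
  obtain ⟨m, hm0, hm1⟩ := exists_between hx
  have hmem : ∀ a < m, (⟨m, 0⟩ : ℂ) ∈ Ioo a x₁ ×ℂ univ := fun a ha =>
    Complex.mem_reProdIm.2 ⟨⟨ha, hm1⟩, mem_univ _⟩
  obtain ⟨f, D, V, s, he⟩ := exists_sky_of_free hf₀ (hmem x₀ hm0)
  obtain ⟨hD0, heq0⟩ := s.fit_convex hf₀ (hconv _ _) (hmem x₀ hm0) he
  -- The left side of the cylinder is pushed outwards as far as possible; the absence of large discs
  -- bounds it. A marked point on the limiting side has a vertical translate there as well, which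
  -- yields a vertical saddle connection.
  set X : Set ℝ := {x | x ≤ x₀ ∧ Ioo x x₁ ×ℂ univ ⊆ D} with hX
  have hx0X : x₀ ∈ X := ⟨le_rfl, hD0⟩
  have hbdd : BddBelow X := by
    by_contra hnb
    obtain ⟨R, hR, hno⟩ := exists_radius_no_disc q
    rw [not_bddBelow_iff] at hnb
    obtain ⟨x, hx, hxlt⟩ := hnb (m - 2 * R)
    refine hno f ⟨m - R, 0⟩ (s.free.mono ((ball_subset_reProdIm _ _).trans fun w hw => hx.2 ?_))
    rw [Complex.mem_reProdIm] at hw ⊢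
    exact ⟨⟨by linarith [hw.1.1], by linarith [hw.1.2]⟩, mem_univ _⟩
  have hXle : sInf X ≤ x₀ := csInf_le hbdd hx0X
  have hXD : Ioo (sInf X) x₁ ×ℂ univ ⊆ D := by
    intro w hw
    rw [Complex.mem_reProdIm] at hw
    obtain ⟨x, hx, hlt⟩ := exists_lt_of_csInf_lt ⟨_, hx0X⟩ hw.1.1
    exact hx.2 (Complex.mem_reProdIm.2 ⟨⟨hlt, hw.1.2⟩, hw.2⟩)
  have hshift : ∀ a b : ℝ, ∀ w ∈ Ioo a b ×ℂ univ, w + T * Complex.I ∈ Ioo a b ×ℂ univ := by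
    intro a b w hw
    rw [Complex.mem_reProdIm] at hw ⊢
    simpa using hw.1
  -- `f` is periodic
  have hperD : ∀ C ⊆ D, Convex ℝ C → ⟨m, 0⟩ ∈ C → IsOpen C →
      ∀ w ∈ C, (∀ w ∈ C, w + T * Complex.I ∈ D) → f (w + T * Complex.I) = f w := by
    intro C hCD hC h0 hCo w hw hsh
    refine (((s.free.comp (isHalfTranslation_add (T * Complex.I))).mono (D' := C) hsh).eqOn
      (s.free.mono hCD) hC.isPreconnected h0 ?_) hw
    filter_upwards [mem_nhdsWithin_of_mem_nhds ((hopen x₀ x₁).mem_nhds (hmem x₀ hm0))] with w hw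
    rw [heq0 hw, heq0 (hshift _ _ w hw), hper w hw]
  have hXm : sInf X < m := by linarith
  have hperX : ∀ w ∈ Ioo (sInf X) x₁ ×ℂ univ, f (w + T * Complex.I) = f w := fun w hw =>
    hperD _ hXD (hconv _ _) (hmem _ hXm) (hopen _ _) w hw fun w hw => hXD (hshift _ _ w hw)
  have hcl := s.starView.closure_subset (hconv _ _) (hopen _ _) (hmem _ hXm) hXD
  rw [Complex.closure_reProdIm, closure_Ioo (by linarith), closure_univ] at hcl
  by_cases hex : ∃ c ∈ V, c.re = sInf X ∧ c.im ∈ Ioo (-(2 * T)) (2 * T)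
  · obtain ⟨κ, hκ, hκre, -⟩ := hex
    have hκcl : ∀ y : ℝ, (⟨sInf X, y⟩ : ℂ) ∈ Icc (sInf X) x₁ ×ℂ univ := fun y =>
      Complex.mem_reProdIm.2 ⟨⟨le_rfl, by change sInf X ≤ x₁; linarith⟩, mem_univ _⟩
    have hκe : κ = ⟨sInf X, κ.im⟩ := Complex.ext hκre rfl
    have hκe' : κ + T * Complex.I = ⟨sInf X, κ.im + T⟩ := by
      apply Complex.ext <;> simp [hκre]
    have hκcl' : κ ∈ closure (Ioo (sInf X) x₁ ×ℂ univ) := by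
      rw [Complex.closure_reProdIm, closure_Ioo (by linarith), closure_univ, hκe]; exact hκcl _
    have hκ' : κ + T * Complex.I ∈ V := by
      refine (hcl (by rw [hκe']; exact hκcl _)).resolve_left fun h => s.free.notMem h ?_
      have hne : (𝓝[Ioo (sInf X) x₁ ×ℂ univ] κ).NeBot := mem_closure_iff_nhdsWithin_neBot.1 hκcl'
      have l1 : Tendsto f (𝓝[Ioo (sInf X) x₁ ×ℂ univ] κ) (𝓝 (f κ)) :=
        (s.cont κ (Or.inr hκ)).tendsto.mono_left (nhdsWithin_mono _ fun w hw => Or.inl (hXD hw))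
      have hT : Tendsto (fun w : ℂ => w + T * Complex.I) (𝓝[Ioo (sInf X) x₁ ×ℂ univ] κ)
          (𝓝[D ∪ V] (κ + T * Complex.I)) := by
        refine tendsto_nhdsWithin_iff.2 ⟨(Continuous.tendsto (by fun_prop) κ).mono_left
          nhdsWithin_le_nhds, ?_⟩
        filter_upwards [self_mem_nhdsWithin] with w hw
        exact Or.inl (hXD (hshift _ _ w hw))
      have l2 := (s.cont _ (Or.inl h)).tendsto.comp hT
      have : f (κ + T * Complex.I) = f κ := by
        refine tendsto_nhds_unique (l2.congr' ?_) l1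
        filter_upwards [self_mem_nhdsWithin] with w hw using hperX w hw
      rw [this]
      exact s.map_V κ hκ
    have hne : κ ≠ κ + T * Complex.I := by
      intro h
      have := congrArg Complex.im h
      simp at this
      exact hT.ne' this
    obtain ⟨κ'', h1, h2, h3, h4⟩ := s.starView.exists_next hκ hκ' hne (by
      refine Subset.trans ?_ hcl
      refine (convex_reProdIm (convex_Icc _ _) convex_univ).segment_subset ?_ ?_
      · rw [hκe]; exact hκcl _
      · rw [hκe']; exact hκcl _)
    refine s.not_openSegment_of_vertical hv κ hκ κ'' h1 h2.symm ?_ h4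
    rw [segment_eq_image'] at h3
    obtain ⟨t, -, rfl⟩ := h3
    simp
  -- With no visible point on the open part of the side four periods long, that part can be moved
  -- outwards. Extending periodically then gives a wider cylinder.
  · push Not at hex
    have hrect : Ioo (sInf X) x₁ ×ℂ Ioo (-(2 * T)) (2 * T) ⊆ D := fun w hw => hXD (by
      rw [Complex.mem_reProdIm] at hw ⊢; exact ⟨hw.1, mem_univ _⟩)
    obtain ⟨δ, hδ, hwide⟩ := KeaneView.exists_widen_left s.starView (Complex.mem_reProdIm.2
      ⟨⟨hXm, hm1⟩, by change -(2 * T) < 0; linarith, by change 0 < 2 * T; linarith⟩) hrect hex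
    set C := Ioo (sInf X - δ) x₁ ×ℂ Ioo (-(2 * T)) (2 * T) with hC
    set C' := Ioo (sInf X - δ) x₁ ×ℂ Ioo (-(2 * T)) T with hC'
    have hC'C : C' ⊆ C := fun w hw => by
      rw [Complex.mem_reProdIm] at hw ⊢
      exact ⟨hw.1, hw.2.1, by linarith [hw.2.2]⟩
    have hC'sh : ∀ w ∈ C', w + T * Complex.I ∈ C := fun w hw => by
      rw [Complex.mem_reProdIm] at hw ⊢
      simp only [Complex.add_re, Complex.add_im, Complex.mul_re, Complex.mul_im, Complex.ofReal_re,
        Complex.ofReal_im, Complex.I_re, Complex.I_im, mem_Ioo] at hw ⊢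
      exact ⟨⟨by linarith [hw.1.1], by linarith [hw.1.2]⟩, by linarith [hw.2.1], by linarith [hw.2.2]⟩
    have h0C' : (⟨m, 0⟩ : ℂ) ∈ C' := Complex.mem_reProdIm.2
      ⟨⟨by change sInf X - δ < m; linarith, hm1⟩, by change -(2 * T) < 0; linarith, hT⟩
    have hperC : ∀ w ∈ C, w + T * Complex.I ∈ C → f (w + T * Complex.I) = f w := by
      intro w hw hw'
      refine hperD C' (hC'C.trans hwide) (convex_rect _ _ _ _) h0C' (isOpen_rect _ _ _ _) w ?_
        fun w hw => hwide (hC'sh w hw)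
      rw [Complex.mem_reProdIm] at hw hw' ⊢
      have := hw'.2.2
      simp only [Complex.add_im, Complex.mul_im, Complex.ofReal_re,
        Complex.ofReal_im, Complex.I_re, Complex.I_im] at this
      exact ⟨hw.1, hw.2.1, by linarith⟩
    obtain ⟨F, hF, hFf, -⟩ := (s.free.mono hwide).exists_periodic (convex_rect _ _ _ _)
      (isOpen_rect _ _ _ _) hperC
    have hsub : Ioo (sInf X - δ) x₁ ×ℂ univ ⊆ {w | ∃ k : ℤ, w + k * (T * Complex.I) ∈ C} := by
      intro w hw
      rw [Complex.mem_reProdIm] at hw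
      refine ⟨-⌊w.im / T⌋, Complex.mem_reProdIm.2 ?_⟩
      simp only [Complex.add_re, Complex.add_im, Complex.mul_re, Complex.mul_im, Complex.ofReal_re,
        Complex.ofReal_im, Complex.I_re, Complex.I_im, mem_Ioo, Int.cast_neg, Complex.neg_re,
        Complex.neg_im, Complex.intCast_re, Complex.intCast_im]
      have h1 := Int.floor_le (w.im / T)
      have h2 := Int.lt_floor_add_one (w.im / T)
      rw [le_div_iff₀ hT] at h1
      rw [div_lt_iff₀ hT] at h2
      exact ⟨⟨by linarith [hw.1.1], by linarith [hw.1.2]⟩, by linarith, by linarith⟩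
    have hδm : sInf X - δ < m := by linarith
    have := (s.fit_convex (hF.mono hsub) (hconv _ _) (hmem _ hδm) (by
      have : C' ∈ 𝓝 (⟨m, 0⟩ : ℂ) := (isOpen_rect _ _ _ _).mem_nhds h0C'
      filter_upwards [mem_nhdsWithin_of_mem_nhds this] with w hw
      exact hFf (hC'C hw))).1
    have := csInf_le hbdd (show sInf X - δ ∈ X from ⟨by linarith, this⟩)
    linarith

/-- There is no infinite flat vertical half-strip. -/
theorem not_free_strip_up [T2Space S] [CompactSpace S] [ConnectedSpace S]
    (hv : q.VerticallyKeane) {x₀ x₁ y : ℝ} (hx : x₀ < x₁) {f : ℂ → S} :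
    ¬ q.Free (Ioo x₀ x₁ ×ℂ Ioi y) f := by
  intro hf
  set C := Ioo x₀ x₁ ×ℂ Ioi y with hC
  have hconv : Convex ℝ C := convex_reProdIm (convex_Ioo _ _) (convex_Ioi _)
  have hopen : IsOpen C := isOpen_Ioo.reProdIm isOpen_Ioi
  set ρ := (x₁ - x₀) / 2 with hρ
  have hρ0 : 0 < ρ := by rw [hρ]; linarith
  set a : ℕ → ℂ := fun n => ⟨(x₀ + x₁) / 2, y + ρ + n⟩ with ha
  have haC : ∀ n, Metric.ball (a n) ρ ⊆ C := fun n => (ball_subset_reProdIm _ _).trans fun w hw => by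
    rw [Complex.mem_reProdIm] at hw ⊢
    simp only [ha, mem_Ioo, mem_Ioi] at hw ⊢
    have := n.cast_nonneg (α := ℝ)
    exact ⟨⟨by linarith [hw.1.1], by linarith [hw.1.2]⟩, by linarith [hw.2.1]⟩
  have haC' : ∀ n, a n ∈ C := fun n => haC n (Metric.mem_ball_self hρ0)
  obtain ⟨p, hp⟩ := exists_clusterPt_of_compactSpace (map (fun n => f (a n)) atTop)
  have hfreq : ∀ U ∈ 𝓝 p, ∃ᶠ n in atTop, f (a n) ∈ U := fun U hU =>
    mapClusterPt_iff_frequently.1 hp U hU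
  have hpZ : p ∉ q.Z := by
    intro hz
    obtain ⟨O, hO, hno⟩ := exists_nhds_no_disc hz hρ0
    obtain ⟨n, hn⟩ := (hfreq O hO).exists
    exact hno f (a n) (hf.mono (haC n)) hn
  obtain ⟨N, hN, r, hr, -, hG, -⟩ := exists_uniform_disc hpZ
  obtain ⟨G, hGf, hG0⟩ := hG _ (mem_of_mem_nhds hN) 0
  set r' := min r (ρ / 2) with hr'
  have hr'0 : 0 < r' := lt_min hr (by linarith)
  have hU : G '' Metric.ball 0 r' ∈ 𝓝 p := hG0 ▸ hGf.image_mem_nhds Metric.isOpen_ball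
    (Metric.mem_ball_self hr) (Metric.ball_mem_nhds _ hr'0)
  obtain ⟨n, u, hu, hun⟩ := (hfreq _ hU).exists
  -- `k` is so much larger than `n` that `a k` lies above the disc of radius `ρ` about `a n`. The
  -- return found below therefore goes upwards.
  obtain ⟨k, ⟨v, hv', hvk⟩, hnk⟩ := ((hfreq _ hU).and_eventually
    (eventually_ge_atTop (n + ⌈ρ⌉₊ + 1))).exists
  have hkn : (n : ℝ) + ρ + 1 ≤ k := by
    have h1 := Nat.le_ceil ρ
    have h2 : ((n + ⌈ρ⌉₊ + 1 : ℕ) : ℝ) ≤ k := by exact_mod_cast hnk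
    push_cast at h2
    linarith
  have hr'r : Metric.ball (0 : ℂ) r' ⊆ Metric.ball 0 r := Metric.ball_subset_ball (min_le_left _ _)
  obtain ⟨h, hh, hhu, heq⟩ := hGf.overlap hf (convex_ball _ _) hconv (hr'r hu) (haC' n) hun
  have hd : dist (h v) (a n) < ρ := by
    rw [← hhu, hh.dist_eq]
    have := dist_triangle_right v u 0
    have h2 := min_le_right r (ρ / 2)
    rw [Metric.mem_ball] at hu hv'
    linarith
  have hbC : h v ∈ C := haC n hd
  have hfb : f (h v) = f (a k) := by
    have := heq (x := v) ⟨hr'r hv', hbC⟩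
    rw [← hvk]; exact this.symm
  have hbox := ball_subset_reProdIm _ _ (Metric.mem_ball.2 hd)
  rw [Complex.mem_reProdIm] at hbox
  simp only [ha, mem_Ioo] at hbox
  set b := h v with hb
  have hne : b ≠ a k := by
    intro h
    have := congrArg Complex.im h
    simp only [ha] at this
    linarith [hbox.2.2]
  -- The strip meets itself through a half-turn, excluded as a fold, or through a translation by
  -- `c`. The translates of the strip then contain large discs if `c` is oblique and a vertical
  -- cylinder if `c` is vertical.
  obtain ⟨h', hh', hh'b, heq'⟩ := hf.overlap hf hconv hconv hbC (haC' k) hfb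
  rcases hh'.cases hh'b with hz | hz
  swap
  · refine hf.not_fold hconv hbC (haC' k) hne fun w hw hw' => ?_
    have := heq' (x := w) ⟨hw, by rw [mem_preimage, hz]; exact hw'⟩
    simpa only [hz] using this
  set c := a k - b with hc
  have hper : ∀ w ∈ C, w + c ∈ C → f (w + c) = f w := by
    intro w hw hw'
    have := heq' (x := w) ⟨hw, by rw [mem_preimage, hz]; exact hw'⟩
    simpa only [hz] using this.symm
  have hcim : 0 < c.im := by
    simp only [hc, ha, Complex.sub_im]; linarith [hbox.2.2]
  have hcre : |c.re| < x₁ - x₀ := by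
    simp only [hc, ha, Complex.sub_re]
    rw [abs_lt]; constructor <;> linarith [hbox.1.1, hbox.1.2]
  obtain ⟨F, hF, -, hFper⟩ := hf.exists_periodic hconv hopen hper
  rcases lt_trichotomy c.re 0 with hlt | h0 | hgt
  · obtain ⟨R, hR, hno⟩ := exists_radius_no_disc q
    refine hno F ⟨x₁ + R, |y| + R⟩ (hF.mono ((ball_subset_reProdIm _ _).trans fun w hw => ?_))
    rw [Complex.mem_reProdIm] at hw
    simp only [mem_Ioo] at hw
    set t := (x₁ - w.re) / c.re with ht
    have ht0 : 0 ≤ t := div_nonneg_of_nonpos (by linarith [hw.1.1]) hlt.le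
    have htc : t * c.re = x₁ - w.re := div_mul_cancel₀ _ hlt.ne
    have h1 := Int.floor_le t
    have h2 := Int.lt_floor_add_one t
    have h3 : (0 : ℝ) ≤ ⌊t⌋ := by exact_mod_cast Int.floor_nonneg.2 ht0
    rw [abs_lt] at hcre
    refine ⟨⌊t⌋ + 1, Complex.mem_reProdIm.2 ⟨⟨?_, ?_⟩, ?_⟩⟩
    · simp only [Complex.add_re, Complex.mul_re, Int.cast_add, Int.cast_one, Complex.intCast_re,
        Complex.one_re, Complex.add_im, Complex.intCast_im, Complex.one_im]
      nlinarith
    · simp only [Complex.add_re, Complex.mul_re, Int.cast_add, Int.cast_one, Complex.intCast_re,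
        Complex.one_re, Complex.add_im, Complex.intCast_im, Complex.one_im]
      nlinarith
    · simp only [Complex.add_re, Complex.mul_im, Int.cast_add, Int.cast_one, Complex.intCast_re,
        Complex.one_re, Complex.add_im, Complex.intCast_im, Complex.one_im, mem_Ioi]
      have := le_abs_self y
      nlinarith [hw.2.1]
  · have hce : c = c.im * Complex.I := by apply Complex.ext <;> simp [h0]
    have hsub : Ioo x₀ x₁ ×ℂ univ ⊆ {w | ∃ k : ℤ, w + k * c ∈ C} := by
      intro w hw
      rw [Complex.mem_reProdIm] at hw
      obtain ⟨n, hn⟩ := exists_nat_gt ((y - w.im) / c.im)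
      rw [div_lt_iff₀ hcim] at hn
      refine ⟨n, Complex.mem_reProdIm.2 ?_⟩
      simp only [Complex.add_re, Complex.mul_re, Complex.add_im, Complex.mul_im, Int.cast_natCast,
        Complex.natCast_re, Complex.natCast_im, h0, mem_Ioo, mem_Ioi]
      exact ⟨⟨by linarith [hw.1.1], by linarith [hw.1.2]⟩, by linarith⟩
    refine not_free_vertical_periodic hv hx hcim (hF.mono hsub) fun w hw => ?_
    rw [← hce]
    exact hFper w (hsub hw)
  · obtain ⟨R, hR, hno⟩ := exists_radius_no_disc q
    refine hno F ⟨x₀ - R, |y| + R⟩ (hF.mono ((ball_subset_reProdIm _ _).trans fun w hw => ?_))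
    rw [Complex.mem_reProdIm] at hw
    simp only [mem_Ioo] at hw
    set t := (x₀ - w.re) / c.re with ht
    have ht0 : 0 ≤ t := div_nonneg (by linarith [hw.1.2]) hgt.le
    have htc : t * c.re = x₀ - w.re := div_mul_cancel₀ _ hgt.ne'
    have h1 := Int.floor_le t
    have h2 := Int.lt_floor_add_one t
    have h3 : (0 : ℝ) ≤ ⌊t⌋ := by exact_mod_cast Int.floor_nonneg.2 ht0
    rw [abs_lt] at hcre
    refine ⟨⌊t⌋ + 1, Complex.mem_reProdIm.2 ⟨⟨?_, ?_⟩, ?_⟩⟩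
    · simp only [Complex.add_re, Complex.mul_re, Int.cast_add, Int.cast_one, Complex.intCast_re,
        Complex.one_re, Complex.add_im, Complex.intCast_im, Complex.one_im]
      nlinarith
    · simp only [Complex.add_re, Complex.mul_re, Int.cast_add, Int.cast_one, Complex.intCast_re,
        Complex.one_re, Complex.add_im, Complex.intCast_im, Complex.one_im]
      nlinarith
    · simp only [Complex.add_re, Complex.mul_im, Int.cast_add, Int.cast_one, Complex.intCast_re,
        Complex.one_re, Complex.add_im, Complex.intCast_im, Complex.one_im, mem_Ioi]
      have := le_abs_self y
      nlinarith [hw.2.1]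

theorem Sky.keaneView [T2Space S] [CompactSpace S] [ConnectedSpace S] (hq : q.IsKeane) {w₀ : ℂ}
    {f : ℂ → S} {D V : Set ℂ} (s : q.Sky w₀ f D V) : KeaneView w₀ D V where
  toStarView := s.starView
  hor := s.not_openSegment_of_horizontal hq.1
  vert := s.not_openSegment_of_vertical hq.2
  up x₀ x₁ y hx h := not_free_strip_up hq.2 hx (s.free.mono h)
  down x₀ x₁ y hx h := by
    refine not_free_strip_up hq.2 (x₀ := -x₁) (x₁ := -x₀) (y := -y) (by linarith)
      ((s.free.comp (isHalfTranslation_sub_left 0)).mono fun w hw => h ?_)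
    rw [Complex.mem_reProdIm] at hw ⊢
    simp only [mem_Ioo, mem_Ioi, mem_Iio, zero_sub, Complex.neg_re, Complex.neg_im] at hw ⊢
    exact ⟨⟨by linarith [hw.1.2], by linarith [hw.1.1]⟩, by linarith [hw.2]⟩

end HalfTranslationStructure

/-! ### Oriented area and plane triangles. -/

/-- Twice the signed area of the triangle `P Q w`. -/
def orient (P Q w : ℂ) : ℝ := (Q - P).re * (w - P).im - (Q - P).im * (w - P).re

theorem orient_rotate (P Q R : ℂ) : orient Q R P = orient P Q R := by
  simp only [orient, Complex.sub_re, Complex.sub_im]; ring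

theorem orient_swap (P Q R : ℂ) : orient Q P R = -orient P Q R := by
  simp only [orient, Complex.sub_re, Complex.sub_im]; ring

theorem orient_add (P Q R w : ℂ) : orient P Q w + orient Q R w + orient R P w = orient P Q R := by
  simp only [orient, Complex.sub_re, Complex.sub_im]; ring

theorem orient_self_right (P Q : ℂ) : orient P Q Q = 0 := by
  simp only [orient, Complex.sub_re, Complex.sub_im]; ring

theorem orient_self_left (P Q : ℂ) : orient P Q P = 0 := by
  simp only [orient, Complex.sub_re, Complex.sub_im]; ring

theorem orient_combo (P Q x y : ℂ) {a b : ℝ} (hab : a + b = 1) :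
    orient P Q (a • x + b • y) = a * orient P Q x + b * orient P Q y := by
  simp only [orient, Complex.sub_re, Complex.sub_im, Complex.add_re, Complex.add_im,
    Complex.smul_re, Complex.smul_im, smul_eq_mul]
  obtain rfl : b = 1 - a := by linarith
  ring

theorem continuous_orient (P Q : ℂ) : Continuous (orient P Q) := by
  unfold orient; fun_prop

theorem orient_eq_zero_of_mem_openSegment {P Q w : ℂ} (h : w ∈ openSegment ℝ P Q) :
    orient P Q w = 0 := by
  obtain ⟨a, b, -, -, hab, rfl⟩ := h
  rw [orient_combo P Q P Q hab, orient_self_left, orient_self_right]; ring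

namespace Anticlockwise

variable {P Q R w : ℂ}

theorem rotate (h : Anticlockwise P Q R) : Anticlockwise Q R P := by
  change 0 < orient Q R P; rw [orient_rotate]; exact h

theorem ne (h : Anticlockwise P Q R) : P ≠ Q := by
  rintro rfl; simp [Anticlockwise] at h

theorem barycentric (h : Anticlockwise P Q R) (w : ℂ) :
    w = (orient Q R w / orient P Q R) • P + (orient R P w / orient P Q R) • Q +
      (orient P Q w / orient P Q R) • R := by
  have h0 : (orient P Q R) ≠ 0 := ne_of_gt h
  apply Complex.ext
  · simp only [Complex.add_re, Complex.smul_re, smul_eq_mul]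
    field_simp
    simp only [orient, Complex.sub_re, Complex.sub_im]
    ring
  · simp only [Complex.add_im, Complex.smul_im, smul_eq_mul]
    field_simp
    simp only [orient, Complex.sub_re, Complex.sub_im]
    ring

theorem mem_planeTriangle (h : Anticlockwise P Q R) : w ∈ planeTriangle P Q R ↔
    0 ≤ orient P Q w ∧ 0 ≤ orient Q R w ∧ 0 ≤ orient R P w := by
  have hΔ : 0 < orient P Q R := h
  constructor
  · intro hw
    have hc : ∀ A B : ℂ, Convex ℝ {w | 0 ≤ orient A B w} := by
      intro A B x hx y hy a b ha hb hab
      rw [mem_ofPred_eq, orient_combo _ _ _ _ hab]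
      exact add_nonneg (mul_nonneg ha hx) (mul_nonneg hb hy)
    refine convexHull_min (t := {w | 0 ≤ orient P Q w ∧ 0 ≤ orient Q R w ∧ 0 ≤ orient R P w}) ?_
      ((hc P Q).inter ((hc Q R).inter (hc R P))) hw
    rintro x (rfl | rfl | rfl)
    · exact ⟨(orient_self_left _ _).ge, (orient_rotate x Q R ▸ hΔ.le), (orient_self_right _ _).ge⟩
    · exact ⟨(orient_self_right _ _).ge, (orient_self_left _ _).ge, by
        rw [orient_rotate x R P, orient_rotate]; exact hΔ.le⟩
    · exact ⟨hΔ.le, (orient_self_right _ _).ge, (orient_self_left _ _).ge⟩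
  · rintro ⟨h1, h2, h3⟩
    rw [h.barycentric w]
    have hs : Convex ℝ (planeTriangle P Q R) := convex_convexHull _ _
    have hv : ∀ x ∈ ({P, Q, R} : Set ℂ), x ∈ planeTriangle P Q R := fun x hx =>
      subset_convexHull _ _ hx
    have := hs.sum_mem (t := Finset.univ) (w := ![orient Q R w / orient P Q R,
      orient R P w / orient P Q R, orient P Q w / orient P Q R]) (z := ![P, Q, R]) ?_ ?_ ?_
    · simpa [Fin.sum_univ_three] using this
    · intro i _
      fin_cases i <;> simp <;> positivity
    · have := orient_add P Q R w
      simp [Fin.sum_univ_three]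
      field_simp
      linarith
    · intro i _
      fin_cases i
      · exact hv _ (by simp)
      · exact hv _ (by simp)
      · exact hv _ (by simp)

theorem mem_interior (h : Anticlockwise P Q R) : w ∈ interior (planeTriangle P Q R) ↔
    0 < orient P Q w ∧ 0 < orient Q R w ∧ 0 < orient R P w := by
  constructor
  · intro hw
    have key : ∀ A B : ℂ, A ≠ B → (∀ z ∈ planeTriangle P Q R, 0 ≤ orient A B z) →
        0 < orient A B w := by
      intro A B hAB hz
      refine lt_of_le_of_ne (hz w (interior_subset hw)) fun h0 => ?_
      -- `Complex.I * (B - A)` points to the left of the directed side, so a small step against it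
      -- from an interior point with `orient A B w = 0` would make `orient` negative inside the
      -- triangle.
      have hT : Tendsto (fun t : ℝ => w - t * (Complex.I * (B - A))) (𝓝[>] 0) (𝓝 w) :=
        (Continuous.tendsto' (by fun_prop) _ _ (by simp)).mono_left nhdsWithin_le_nhds
      obtain ⟨t, htT, ht0⟩ := ((hT.eventually (mem_interior_iff_mem_nhds.1 hw)).and
        eventually_mem_nhdsWithin).exists
      have h1 := hz _ htT
      have h2 : orient A B (w - t * (Complex.I * (B - A))) =
          orient A B w - t * Complex.normSq (B - A) := by
        simp only [orient, Complex.sub_re, Complex.sub_im, Complex.mul_re, Complex.mul_im,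
          Complex.I_re, Complex.I_im, Complex.ofReal_re, Complex.ofReal_im, Complex.normSq_apply]
        ring
      rw [h2, ← h0] at h1
      have h3 : 0 < Complex.normSq (B - A) := Complex.normSq_pos.2 (sub_ne_zero.2 hAB.symm)
      have := mul_pos (show 0 < t from ht0) h3
      linarith
    exact ⟨key P Q h.ne fun z hz => (h.mem_planeTriangle.1 hz).1,
      key Q R h.rotate.ne fun z hz => (h.mem_planeTriangle.1 hz).2.1,
      key R P h.rotate.rotate.ne fun z hz => (h.mem_planeTriangle.1 hz).2.2⟩
  · intro hw
    have ho : IsOpen {w | 0 < orient P Q w ∧ 0 < orient Q R w ∧ 0 < orient R P w} :=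
      (isOpen_lt continuous_const (continuous_orient P Q)).inter
        ((isOpen_lt continuous_const (continuous_orient Q R)).inter
          (isOpen_lt continuous_const (continuous_orient R P)))
    exact interior_maximal (fun z hz =>
      h.mem_planeTriangle.2 ⟨hz.1.le, hz.2.1.le, hz.2.2.le⟩) ho hw

theorem mem_segment_of_orient_eq_zero (h : Anticlockwise P Q R) (hw : w ∈ planeTriangle P Q R)
    (h0 : orient P Q w = 0) : w ∈ segment ℝ P Q := by
  have hΔ : 0 < orient P Q R := h
  obtain ⟨h1, h2, h3⟩ := h.mem_planeTriangle.1 hw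
  refine ⟨orient Q R w / orient P Q R, orient R P w / orient P Q R, by positivity, by positivity,
    ?_, ?_⟩
  · have := orient_add P Q R w
    field_simp; linarith
  · have := h.barycentric w
    rw [h0] at this
    simpa using this.symm

theorem mem_side (h : Anticlockwise P Q R) (hw : w ∈ planeTriangle P Q R)
    (hi : w ∉ interior (planeTriangle P Q R)) :
    w ∈ segment ℝ P Q ∨ w ∈ segment ℝ Q R ∨ w ∈ segment ℝ R P := by
  obtain ⟨h1, h2, h3⟩ := h.mem_planeTriangle.1 hw
  rw [h.mem_interior] at hi
  have hr : planeTriangle Q R P = planeTriangle P Q R := by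
    unfold planeTriangle; congr 1; ext; simp; tauto
  have hr' : planeTriangle R P Q = planeTriangle P Q R := by
    unfold planeTriangle; congr 1; ext; simp; tauto
  by_cases e1 : orient P Q w = 0
  · exact Or.inl (h.mem_segment_of_orient_eq_zero hw e1)
  by_cases e2 : orient Q R w = 0
  · exact Or.inr (Or.inl (h.rotate.mem_segment_of_orient_eq_zero (hr ▸ hw) e2))
  by_cases e3 : orient R P w = 0
  · exact Or.inr (Or.inr (h.rotate.rotate.mem_segment_of_orient_eq_zero (hr' ▸ hw) e3))
  exact (hi ⟨lt_of_le_of_ne h1 (Ne.symm e1), lt_of_le_of_ne h2 (Ne.symm e2),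
    lt_of_le_of_ne h3 (Ne.symm e3)⟩).elim

theorem eq_vertex (h : Anticlockwise P Q R) (hw : w ∈ planeTriangle P Q R)
    (hΔ : orient P Q R ≤ orient Q R w) : w = P := by
  obtain ⟨h1, h2, h3⟩ := h.mem_planeTriangle.1 hw
  have h0 : 0 < orient P Q R := h
  have := orient_add P Q R w
  have e1 : orient P Q w = 0 := by linarith
  have e2 : orient R P w = 0 := by linarith
  have e3 : orient Q R w = orient P Q R := by linarith
  have := h.barycentric w
  rw [e1, e2, e3, div_self h0.ne'] at this
  simpa using this

end Anticlockwise

theorem planeTriangle_rotate (P Q R : ℂ) : planeTriangle Q R P = planeTriangle P Q R := by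
  unfold planeTriangle; congr 1; ext; simp; tauto

theorem convex_planeTriangle (P Q R : ℂ) : Convex ℝ (planeTriangle P Q R) := convex_convexHull _ _

theorem isCompact_planeTriangle (P Q R : ℂ) : IsCompact (planeTriangle P Q R) :=
  (Set.toFinite _).isCompact_convexHull _

theorem vertices_subset (P Q R : ℂ) : {P, Q, R} ⊆ planeTriangle P Q R := subset_convexHull _ _

theorem segment_subset_planeTriangle (P Q R : ℂ) : segment ℝ P Q ⊆ planeTriangle P Q R :=
  (convex_planeTriangle P Q R).segment_subset (vertices_subset _ _ _ (by simp))
    (vertices_subset _ _ _ (by simp))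

namespace Anticlockwise

variable {P Q R w : ℂ}

theorem segment_disjoint (h : Anticlockwise P Q R) :
    Disjoint (segment ℝ P Q) (interior (planeTriangle P Q R)) := by
  rw [Set.disjoint_left]
  rintro x ⟨a, b, -, -, hab, rfl⟩ hx
  have := (h.mem_interior.1 hx).1
  rw [orient_combo P Q P Q hab, orient_self_left, orient_self_right] at this
  simp at this

/-- On the triangle `orient Q R` is maximal only at `P`, so `P` is an extreme point and a segment
starting elsewhere cannot run through it. -/
theorem not_vertex_aux (h : Anticlockwise P Q R) {w₀ k : ℂ} (hw : w₀ ∈ planeTriangle P Q R)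
    (hk : k ∈ planeTriangle P Q R) (hne : w₀ ≠ P) {t : ℝ} (ht : 0 ≤ t) (ht1 : t < 1) :
    w₀ + t * (k - w₀) ≠ P := by
  intro he
  have e : w₀ + t * (k - w₀) = (1 - t) • w₀ + t • k := by
    simp only [Complex.real_smul]; push_cast; ring
  have h1 := orient_combo Q R w₀ k (show (1 - t) + t = 1 by ring)
  rw [← e, he, orient_rotate] at h1
  have b : ∀ z ∈ planeTriangle P Q R, orient Q R z ≤ orient P Q R := by
    intro z hz
    obtain ⟨h1, h2, h3⟩ := h.mem_planeTriangle.1 hz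
    linarith [orient_add P Q R z]
  have b1 := b _ hw
  have b2 := b _ hk
  refine hne (h.eq_vertex hw ?_)
  by_contra hlt
  push Not at hlt
  nlinarith

theorem star (h : Anticlockwise P Q R) {w₀ : ℂ} (hw : w₀ ∈ planeTriangle P Q R \ {P, Q, R}) :
    ∀ k ∈ planeTriangle P Q R, ∀ t : ℝ, 0 ≤ t → t < 1 →
      w₀ + t * (k - w₀) ∈ planeTriangle P Q R \ {P, Q, R} := by
  intro k hk t ht ht1
  refine ⟨?_, ?_⟩
  · have := (convex_planeTriangle P Q R).add_smul_sub_mem hw.1 hk ⟨ht, ht1.le⟩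
    simpa using this
  · have hw2 := hw.2
    simp only [mem_insert_iff, mem_singleton_iff, not_or] at hw2 ⊢
    refine ⟨h.not_vertex_aux hw.1 hk hw2.1 ht ht1,
      h.rotate.not_vertex_aux ?_ ?_ hw2.2.1 ht ht1,
      h.rotate.rotate.not_vertex_aux ?_ ?_ hw2.2.2 ht ht1⟩
    · rw [planeTriangle_rotate]; exact hw.1
    · rw [planeTriangle_rotate]; exact hk
    · rw [planeTriangle_rotate, planeTriangle_rotate]; exact hw.1
    · rw [planeTriangle_rotate, planeTriangle_rotate]; exact hk

theorem interior_notMem_vertices (h : Anticlockwise P Q R)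
    (hw : w ∈ interior (planeTriangle P Q R)) : w ∈ planeTriangle P Q R \ {P, Q, R} := by
  refine ⟨interior_subset hw, ?_⟩
  obtain ⟨h1, h2, h3⟩ := h.mem_interior.1 hw
  rintro (rfl | rfl | rfl)
  · simp [orient_self_left] at h1
  · simp [orient_self_right] at h1
  · simp [orient_self_left] at h3

theorem interior_nonempty (h : Anticlockwise P Q R) :
    (interior (planeTriangle P Q R)).Nonempty := by
  have hΔ : 0 < orient P Q R := h
  refine ⟨(1/3 : ℝ) • P + (2/3 : ℝ) • ((1/2 : ℝ) • Q + (1/2 : ℝ) • R), h.mem_interior.2 ?_⟩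
  have e1 := orient_rotate P Q R
  have e2 := orient_rotate Q R P
  refine ⟨?_, ?_, ?_⟩ <;> rw [orient_combo _ _ _ _ (by norm_num), orient_combo _ _ _ _ (by norm_num)]
  · rw [orient_self_left, orient_self_right]; linarith
  · rw [orient_self_left, orient_self_right]; linarith
  · rw [orient_self_left, orient_self_right]; linarith

theorem openSegment_notMem_vertices (h : Anticlockwise P Q R) (hw : w ∈ openSegment ℝ P Q) :
    w ∈ planeTriangle P Q R \ {P, Q, R} := by
  refine ⟨segment_subset_planeTriangle P Q R (openSegment_subset_segment ℝ _ _ hw), ?_⟩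
  rintro (rfl | rfl | rfl)
  · exact h.ne ((left_mem_openSegment_iff).1 hw)
  · exact h.ne ((right_mem_openSegment_iff).1 hw)
  · have := orient_eq_zero_of_mem_openSegment hw
    exact (ne_of_gt h) this

/-- Points just to the left of a side are in the interior. -/
theorem eventually_mem_interior (h : Anticlockwise P Q R) (hw : w ∈ openSegment ℝ P Q) :
    ∀ᶠ t : ℝ in 𝓝[>] 0, w + t * (Complex.I * (Q - P)) ∈ interior (planeTriangle P Q R) := by
  have hΔ : 0 < orient P Q R := h
  obtain ⟨a, b, ha, hb, hab, rfl⟩ := hw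
  have e1 := orient_rotate P Q R
  have e2 := orient_rotate Q R P
  have hT : Tendsto (fun t : ℝ => a • P + b • Q + t * (Complex.I * (Q - P))) (𝓝[>] 0)
      (𝓝 (a • P + b • Q)) :=
    (Continuous.tendsto' (by fun_prop) _ _ (by simp)).mono_left nhdsWithin_le_nhds
  have h2 : 0 < orient Q R (a • P + b • Q) := by
    rw [orient_combo _ _ _ _ hab, orient_self_left, e1]
    have := mul_pos ha hΔ
    linarith
  have h3 : 0 < orient R P (a • P + b • Q) := by
    rw [orient_combo _ _ _ _ hab, orient_self_right, e2, e1]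
    have := mul_pos hb hΔ
    linarith
  filter_upwards [hT.eventually (((continuous_orient Q R).tendsto _).eventually (lt_mem_nhds h2)),
    hT.eventually (((continuous_orient R P).tendsto _).eventually (lt_mem_nhds h3)),
    eventually_mem_nhdsWithin] with t h2 h3 ht
  refine h.mem_interior.2 ⟨?_, h2, h3⟩
  have e : orient P Q (a • P + b • Q + t * (Complex.I * (Q - P))) =
      orient P Q (a • P + b • Q) + t * Complex.normSq (Q - P) := by
    simp only [orient, Complex.sub_re, Complex.sub_im, Complex.mul_re, Complex.mul_im,
      Complex.add_re, Complex.add_im,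
      Complex.I_re, Complex.I_im, Complex.ofReal_re, Complex.ofReal_im, Complex.normSq_apply]
    ring
  rw [e, orient_combo _ _ _ _ hab, orient_self_left, orient_self_right]
  have h3 : 0 < Complex.normSq (Q - P) := Complex.normSq_pos.2 (sub_ne_zero.2 h.ne.symm)
  have := mul_pos (show 0 < t from ht) h3
  linarith

end Anticlockwise

theorem IsHalfTranslation.map_line {h : ℂ → ℂ} (H : IsHalfTranslation h) (a b : ℂ) (t : ℝ) :
    h (a + t * (b - a)) = h a + t * (h b - h a) := by
  obtain ⟨ε, c, -, hz⟩ := H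
  simp only [hz]; ring

theorem IsHalfTranslation.orient {h : ℂ → ℂ} (H : IsHalfTranslation h) (a b w : ℂ) :
    orient (h a) (h b) (h w) = orient a b w := by
  obtain ⟨ε, c, rfl | rfl, hz⟩ := H <;> simp only [hz, _root_.orient, Complex.sub_re,
    Complex.sub_im, Complex.add_re, Complex.add_im, one_mul, neg_one_mul, Complex.neg_re,
    Complex.neg_im] <;> ring

theorem IsHalfTranslation.sub_eq {h : ℂ → ℂ} (H : IsHalfTranslation h) (a b : ℂ) :
    h b - h a = b - a ∨ h b - h a = -(b - a) := by
  obtain ⟨ε, c, rfl | rfl, hz⟩ := H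
  · left; simp only [hz]; ring
  · right; simp only [hz]; ring

theorem IsHalfTranslation.anticlockwise {h : ℂ → ℂ} (H : IsHalfTranslation h) {P Q R : ℂ} :
    Anticlockwise (h P) (h Q) (h R) ↔ Anticlockwise P Q R := by
  change 0 < _root_.orient _ _ _ ↔ 0 < _root_.orient _ _ _
  rw [H.orient]

theorem IsHalfTranslation.preimage_planeTriangle {h : ℂ → ℂ} (H : IsHalfTranslation h) {P Q R : ℂ}
    (hT : Anticlockwise P Q R) :
    h ⁻¹' planeTriangle (h P) (h Q) (h R) = planeTriangle P Q R := by
  ext w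
  rw [mem_preimage, (H.anticlockwise.2 hT).mem_planeTriangle, hT.mem_planeTriangle, H.orient,
    H.orient, H.orient]

theorem IsHalfTranslation.image_interior {h : ℂ → ℂ} (H : IsHalfTranslation h) {P Q R : ℂ}
    (hT : Anticlockwise P Q R) :
    h '' interior (planeTriangle P Q R) = interior (planeTriangle (h P) (h Q) (h R)) := by
  obtain ⟨h', -, -, hh'⟩ := H.exists_inverse
  ext w
  rw [(H.anticlockwise.2 hT).mem_interior]
  constructor
  · rintro ⟨z, hz, rfl⟩
    rw [H.orient, H.orient, H.orient]
    exact hT.mem_interior.1 hz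
  · intro hw
    rw [← hh' w, H.orient, H.orient, H.orient] at hw
    exact ⟨h' w, hT.mem_interior.2 hw, hh' w⟩

/-! ### Windows and rays of visible points. -/

/-- Half-translations preserve windows. -/
theorem Spans.exists_window {D' : Set ℂ} {P' Q' : ℂ} (hs : Spans D' P' Q') :
    ∃ W ⊆ D', IsOpen W ∧ Convex ℝ W ∧ openSegment ℝ P' Q' ⊆ W ∧
      ∀ (h : ℂ → ℂ) (D : Set ℂ) (P Q : ℂ), IsHalfTranslation h → h P = P' → h Q = Q' →
        (∀ w, h w ∈ W → w ∈ D) → Spans D P Q := by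
  obtain ⟨x₀, x₁, h1, h2, h3, h4, h5, h6, h7⟩ := hs
  refine ⟨_, h7, isOpen_Ioo.reProdIm isOpen_Ioo, convex_rect _ _ _ _, ?_, ?_⟩
  · rintro _ ⟨a, b, ha, hb, hab, rfl⟩
    rw [Complex.mem_reProdIm]
    simp only [Complex.add_re, Complex.smul_re, Complex.add_im, Complex.smul_im, smul_eq_mul]
    obtain rfl : b = 1 - a := by linarith
    constructor
    · rcases lt_or_gt_of_ne h5 with h | h
      · constructor <;> nlinarith [h2.1, h2.2, h3.1, h3.2]
      · constructor <;> nlinarith [h2.1, h2.2, h3.1, h3.2]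
    · rcases lt_or_gt_of_ne h6 with h | h
      · rw [uIoo_of_lt h]; constructor <;> nlinarith
      · rw [uIoo_of_gt h]; constructor <;> nlinarith
  · rintro h D P Q ⟨ε, c, rfl | rfl, hz⟩ rfl rfl hW
    · simp only [hz, one_mul, Complex.add_re, Complex.add_im, mem_Icc] at h2 h3 h4 h5 h6 hW
      refine ⟨x₀ - c.re, x₁ - c.re, by linarith, ⟨by linarith, by linarith⟩,
        ⟨by linarith, by linarith⟩, by simpa using h4, by simpa using h5, by simpa using h6,
        fun w hw => hW w ?_⟩
      rw [Complex.mem_reProdIm] at hw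
      rw [Complex.mem_reProdIm]
      simp only [Complex.add_re, Complex.add_im]
      refine ⟨⟨by linarith [hw.1.1], by linarith [hw.1.2]⟩, ?_⟩
      rcases le_total P.im Q.im with h | h
      · rw [uIoo_of_le h] at hw
        rw [uIoo_of_le (by linarith)]
        exact ⟨by linarith [hw.2.1], by linarith [hw.2.2]⟩
      · rw [uIoo_of_ge h] at hw
        rw [uIoo_of_ge (by linarith)]
        exact ⟨by linarith [hw.2.1], by linarith [hw.2.2]⟩
    · simp only [hz, neg_one_mul, Complex.add_re, Complex.add_im, mem_Icc, Complex.neg_re,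
        Complex.neg_im] at h2 h3 h4 h5 h6 hW
      refine ⟨c.re - x₁, c.re - x₀, by linarith, ⟨by linarith, by linarith⟩,
        ⟨by linarith, by linarith⟩, ?_, by simpa using h5, by simpa using h6,
        fun w hw => hW w ?_⟩
      · rw [abs_sub_comm]; convert h4 using 2; ring
      rw [Complex.mem_reProdIm] at hw
      rw [Complex.mem_reProdIm]
      simp only [Complex.add_re, Complex.add_im, Complex.neg_re, Complex.neg_im]
      refine ⟨⟨by linarith [hw.1.2], by linarith [hw.1.1]⟩, ?_⟩
      rcases le_total P.im Q.im with h | h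
      · rw [uIoo_of_le h] at hw
        rw [uIoo_of_ge (by linarith)]
        exact ⟨by linarith [hw.2.2], by linarith [hw.2.1]⟩
      · rw [uIoo_of_ge h] at hw
        rw [uIoo_of_le (by linarith)]
        exact ⟨by linarith [hw.2.2], by linarith [hw.2.1]⟩

/-- A visible point hides everything behind it on its ray. -/
theorem StarView.eq_of_ray {w₀ P Q : ℂ} {D V : Set ℂ} (s : StarView w₀ D V) (hP : P ∈ V) (hQ : Q ∈ V)
    {t : ℝ} (ht : 0 < t) (h : Q = w₀ + t * (P - w₀)) : Q = P := by
  rcases lt_trichotomy t 1 with h1 | h1 | h1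
  · exact (s.notMem hQ (h ▸ ((s.mem_V P).1 hP).2 t ht.le h1)).elim
  · rw [h, h1]; simp
  · refine (s.notMem hP ?_).elim
    have := ((s.mem_V Q).1 hQ).2 t⁻¹ (inv_nonneg.2 ht.le) (inv_lt_one_of_one_lt₀ h1)
    convert this using 1
    have : (t : ℂ) ≠ 0 := by exact_mod_cast ht.ne'
    rw [h]; push_cast; field_simp; ring

theorem StarView.openSegment_subset {w₀ P Q : ℂ} {D V : Set ℂ} (s : StarView w₀ D V) (hP : P ∈ V)
    (hQ : Q ∈ V) (h0 : w₀ ∈ openSegment ℝ P Q) : openSegment ℝ P Q ⊆ D := by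
  rw [openSegment_eq_image'] at h0 ⊢
  obtain ⟨t, ht, rfl⟩ := h0
  rintro _ ⟨u, hu, rfl⟩
  rcases le_total u t with h | h
  · have := ((s.mem_V P).1 hP).2 ((t - u) / t) (div_nonneg (by linarith) ht.1.le)
      ((div_lt_one ht.1).2 (by linarith [hu.1]))
    convert this using 1
    have : (t : ℂ) ≠ 0 := by exact_mod_cast ht.1.ne'
    simp only [Complex.real_smul]; push_cast; field_simp; ring
  · have h1 : 0 < 1 - t := by linarith [ht.2]
    have := ((s.mem_V Q).1 hQ).2 ((u - t) / (1 - t)) (div_nonneg (by linarith) h1.le)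
      ((div_lt_one h1).2 (by linarith [hu.2]))
    convert this using 1
    have : (1 - t : ℂ) ≠ 0 := by exact_mod_cast h1.ne'
    simp only [Complex.real_smul]; push_cast; field_simp; ring

/-- Two segments through the base point between visible points are equal if they overlap. -/
theorem StarView.endpoints_eq {w₀ P Q P' Q' y : ℂ} {D V : Set ℂ} (s : StarView w₀ D V) (hP : P ∈ V)
    (hQ : Q ∈ V) (hP' : P' ∈ V) (hQ' : Q' ∈ V) (h0 : w₀ ∈ openSegment ℝ P Q)
    (h0' : w₀ ∈ openSegment ℝ P' Q') (hy : y ∈ segment ℝ P Q) (hy' : y ∈ segment ℝ P' Q')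
    (hne : y ≠ w₀) : P = P' ∧ Q = Q' ∨ P = Q' ∧ Q = P' := by
  have dir : ∀ P Q : ℂ, w₀ ∈ openSegment ℝ P Q → y ∈ segment ℝ P Q → ∃ a b : ℝ, 0 < a ∧ 0 < b ∧
      (P = w₀ - a * (y - w₀) ∧ Q = w₀ + b * (y - w₀) ∨
       P = w₀ + b * (y - w₀) ∧ Q = w₀ - a * (y - w₀)) := by
    intro P Q h0 hy
    rw [openSegment_eq_image'] at h0
    rw [segment_eq_image'] at hy
    obtain ⟨t, ht, rfl⟩ := h0
    obtain ⟨u, hu, rfl⟩ := hy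
    have hut : u ≠ t := fun h => hne (by rw [h])
    simp only [Complex.real_smul]
    rcases lt_or_gt_of_ne hut with h | h
    · have h1 : (t - u : ℂ) ≠ 0 := by
        rw [← Complex.ofReal_sub]; exact_mod_cast (by linarith : (t - u : ℝ) ≠ 0)
      refine ⟨(1 - t) / (t - u), t / (t - u), div_pos (by linarith [ht.2]) (by linarith),
        div_pos ht.1 (by linarith), Or.inr ⟨?_, ?_⟩⟩ <;> push_cast <;> field_simp <;> ring
    · have h1 : (u - t : ℂ) ≠ 0 := by
        rw [← Complex.ofReal_sub]; exact_mod_cast (by linarith : (u - t : ℝ) ≠ 0)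
      refine ⟨t / (u - t), (1 - t) / (u - t), div_pos ht.1 (by linarith),
        div_pos (by linarith [ht.2]) (by linarith), Or.inl ⟨?_, ?_⟩⟩ <;>
        push_cast <;> field_simp <;> ring
  have same : ∀ (c c' : ℝ) (X X' : ℂ), 0 < c * c' → X ∈ V → X' ∈ V → X = w₀ + c * (y - w₀) →
      X' = w₀ + c' * (y - w₀) → X = X' := by
    intro c c' X X' hcc hX hX' e e'
    have hc' : c' ≠ 0 := fun h => by simp [h] at hcc
    refine s.eq_of_ray hX' hX (t := c / c') (by
      rw [div_eq_mul_inv]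
      have : c * c'⁻¹ = c * c' * (c'⁻¹) ^ 2 := by field_simp
      rw [this]; positivity) ?_
    have : (c' : ℂ) ≠ 0 := by exact_mod_cast hc'
    rw [e, e']; push_cast; field_simp; ring
  obtain ⟨a, b, ha, hb, hPQ⟩ := dir P Q h0 hy
  obtain ⟨a', b', ha', hb', hPQ'⟩ := dir P' Q' h0' hy'
  have haa : 0 < -a * -a' := by rw [neg_mul_neg]; positivity
  have hbb : 0 < b * b' := by positivity
  have en : ∀ c : ℝ, w₀ - c * (y - w₀) = w₀ + ((-c : ℝ) : ℂ) * (y - w₀) := fun c => by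
    push_cast; ring
  simp only [en] at hPQ hPQ'
  rcases hPQ with ⟨e1, e2⟩ | ⟨e1, e2⟩ <;> rcases hPQ' with ⟨e3, e4⟩ | ⟨e3, e4⟩
  · exact Or.inl ⟨same _ _ _ _ haa hP hP' e1 e3, same _ _ _ _ hbb hQ hQ' e2 e4⟩
  · exact Or.inr ⟨same _ _ _ _ haa hP hQ' e1 e4, same _ _ _ _ hbb hQ hP' e2 e3⟩
  · exact Or.inr ⟨same _ _ _ _ hbb hP hQ' e1 e4, same _ _ _ _ haa hQ hP' e2 e3⟩
  · exact Or.inl ⟨same _ _ _ _ hbb hP hP' e1 e3, same _ _ _ _ haa hQ hQ' e2 e4⟩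

/-! ### The edges: saddle connections spanning a window. -/

namespace HalfTranslationStructure

variable {S : Type*} [TopologicalSpace S] {q : HalfTranslationStructure S}

theorem exists_sky_at [T2Space S] [CompactSpace S] {p : S} (hp : p ∉ q.Z) (w₀ : ℂ) :
    ∃ f D V, q.Sky w₀ f D V ∧ f w₀ = p := by
  obtain ⟨N, hN, r, hr, -, hG, -⟩ := exists_uniform_disc hp
  obtain ⟨G, hGf, hG0⟩ := hG _ (mem_of_mem_nhds hN) w₀
  obtain ⟨f, D, V, s, he⟩ := exists_sky Metric.isOpen_ball (Metric.mem_ball_self hr) hGf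
  exact ⟨f, D, V, s, he.self_of_nhds.trans hG0⟩

namespace Sky

variable {w₀ : ℂ} {f : ℂ → S} {D V : Set ℂ}

/-- `fit` for a figure drawn elsewhere in the plane: only the image points need agree, and alignment
supplies the half-translation that moves the figure into the view. -/
theorem fit_of_eq [T2Space S] (s : q.Sky w₀ f D V) {K VT : Set ℂ} {g : ℂ → S} {w : ℂ}
    (hg : q.IsFlatMap K VT g) (hw : w ∈ K \ VT)
    (hstar : ∀ k ∈ K, ∀ t : ℝ, 0 ≤ t → t < 1 → w + t * (k - w) ∈ K \ VT) (he : g w = f w₀) :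
    ∃ h, IsHalfTranslation h ∧ h w₀ = w ∧ (∀ z, h z ∈ K \ VT → z ∈ D) ∧
      (∀ z, h z ∈ K → h z ∈ VT → z ∈ V) ∧ ∀ z, h z ∈ K → f z = g (h z) := by
  obtain ⟨h, hh, h0, hev⟩ := s.free.align hg.free s.base hw he.symm
  obtain ⟨h1, h2, h3⟩ := s.fit (hg.comp hh) (fun k hk t ht ht1 => by
    rw [← preimage_sdiff, mem_preimage, hh.map_line, h0]
    exact hstar _ hk t ht ht1) (by
    rw [inter_comm, nhdsWithin_inter_of_mem' (mem_nhdsWithin_of_mem_nhds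
      (s.isOpen.mem_nhds s.base))] at hev
    exact hev.mono fun w hw => hw.symm)
  exact ⟨h, hh, h0, fun z hz => h1 hz, fun z hz hz' => h2 ⟨hz, hz'⟩, fun z hz => h3 hz⟩

/-- Segments through the base point between visible points are determined by their images. -/
theorem endpoints_eq_of_image_eq [T2Space S] (s : q.Sky w₀ f D V) {P Q P' Q' : ℂ} (hP : P ∈ V)
    (hQ : Q ∈ V) (hP' : P' ∈ V) (hQ' : Q' ∈ V) (h0 : w₀ ∈ openSegment ℝ P Q)
    (h0' : w₀ ∈ openSegment ℝ P' Q')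
    (he : f '' segment ℝ P Q ⊆ f '' segment ℝ P' Q') : P = P' ∧ Q = Q' ∨ P = Q' ∧ Q = P' := by
  obtain ⟨U, hU, hinj⟩ := s.free.injOn_nhds s.base
  rw [s.isOpen.nhdsWithin_eq s.base] at hU
  have hPQ : P ≠ Q := by
    rintro rfl
    rw [openSegment_same] at h0
    exact s.starView.notMem hP (h0 ▸ s.base)
  have hPQ' : P' ≠ Q' := by
    rintro rfl
    rw [openSegment_same] at h0'
    exact s.starView.notMem hP' (h0' ▸ s.base)
  have hO' := s.starView.openSegment_subset hP' hQ' h0'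
  have hflat := s.flatMap_segment hP' hQ' hO'
  have hinj' := hflat.injOn_openSegment hPQ'
  -- points of `[P', Q']` outside `U` have images away from `f w₀`
  have hcomp : IsCompact (segment ℝ P' Q' \ interior U) := by
    refine IsCompact.diff ?_ isOpen_interior
    rw [segment_eq_image]
    exact isCompact_Icc.image (by fun_prop)
  have himg : IsCompact (f '' (segment ℝ P' Q' \ interior U)) :=
    hcomp.image_of_continuousOn (hflat.continuousOn.mono sdiff_subset)
  have hw0 : f w₀ ∉ f '' (segment ℝ P' Q' \ interior U) := by
    rintro ⟨y, ⟨hy, hyU⟩, hfy⟩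
    rw [← insert_endpoints_openSegment] at hy
    rcases hy with rfl | rfl | hy
    · exact s.free.notMem s.base (hfy ▸ s.map_V _ hP')
    · exact s.free.notMem s.base (hfy ▸ s.map_V _ hQ')
    · exact hyU (hinj' hy h0' hfy ▸ mem_interior_iff_mem_nhds.2 hU)
  have hfc : ContinuousAt f w₀ := s.free.continuousOn.continuousAt (s.isOpen.mem_nhds s.base)
  have hev : ∀ᶠ y in 𝓝 w₀, y ∈ U ∧ f y ∉ f '' (segment ℝ P' Q' \ interior U) :=
    (eventually_mem_set.2 hU).and (hfc.eventually (himg.isClosed.isOpen_compl.mem_nhds hw0))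
  obtain ⟨t, ht, hwt⟩ := (openSegment_eq_image' ℝ P Q ▸ h0 :)
  have hT : Tendsto (fun u : ℝ => w₀ + u • (Q - P)) (𝓝[>] 0) (𝓝 w₀) :=
    (Continuous.tendsto' (by fun_prop) _ _ (by simp)).mono_left nhdsWithin_le_nhds
  -- A point of `[P, Q]` just past `w₀` has its image on the other edge, and there it can only be
  -- the image of a point near `w₀`. Local injectivity makes these two points equal, so the segments
  -- share a second point.
  obtain ⟨u, ⟨huU, hu⟩, hu0, hu1⟩ := ((hT.eventually hev).and
    (Ioo_mem_nhdsGT (show 0 < 1 - t by linarith [ht.2]))).exists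
  have hy : w₀ + u • (Q - P) ∈ segment ℝ P Q := by
    rw [segment_eq_image']
    refine ⟨t + u, ⟨by linarith [ht.1], by linarith⟩, ?_⟩
    simp only [← hwt, add_smul, add_assoc]
  obtain ⟨y', hy', hyy'⟩ := he ⟨_, hy, rfl⟩
  have hy'U : y' ∈ interior U := by
    by_contra h
    exact hu ⟨y', ⟨hy', h⟩, hyy'⟩
  have := hinj huU (interior_subset hy'U) hyy'.symm
  refine s.starView.endpoints_eq hP hQ hP' hQ' h0 h0' hy (this ▸ hy') ?_
  intro h
  have : u • (Q - P) = 0 := by simpa using h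
  rcases smul_eq_zero.1 this with h | h
  · exact hu0.ne' h
  · exact hPQ (sub_eq_zero.1 h).symm

end Sky

theorem segment_star {P Q w : ℂ} (hw : w ∈ openSegment ℝ P Q) (hPQ : P ≠ Q) :
    w ∈ segment ℝ P Q \ {P, Q} ∧ ∀ k ∈ segment ℝ P Q, ∀ t : ℝ, 0 ≤ t → t < 1 →
      w + t * (k - w) ∈ segment ℝ P Q \ {P, Q} := by
  have hO : ∀ w ∈ openSegment ℝ P Q, w ∈ segment ℝ P Q \ {P, Q} := by
    intro w hw
    refine ⟨openSegment_subset_segment ℝ P Q hw, ?_⟩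
    rintro (rfl | rfl)
    · exact hPQ ((left_mem_openSegment_iff).1 hw)
    · exact hPQ ((right_mem_openSegment_iff).1 hw)
  refine ⟨hO w hw, fun k hk t ht ht1 => hO _ ?_⟩
  obtain ⟨a, b, ha, hb, hab, rfl⟩ := hw
  obtain ⟨a', b', ha', hb', hab', rfl⟩ := hk
  refine ⟨(1 - t) * a + t * a', (1 - t) * b + t * b', ?_, ?_, ?_, ?_⟩
  · have := mul_pos (by linarith : 0 < 1 - t) ha
    positivity
  · have := mul_pos (by linarith : 0 < 1 - t) hb
    positivity
  · linear_combination (1 - t) * hab + t * hab'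
  · simp only [Complex.real_smul]; push_cast; ring

/-- Seen from an interior point of the common image, both parametrisations become the same segment
through the base point, and each differs from it by a half-translation. Hence colour, width and
height of an edge do not depend on the parametrisation. -/
theorem IsFlatMap.holonomy_eq [T2Space S] [CompactSpace S] {P Q : ℂ} {f : ℂ → S}
    (hf : q.IsFlatMap (segment ℝ P Q) {P, Q} f) (hPQ : P ≠ Q) {P' Q' : ℂ} {g : ℂ → S}
    (hg : q.IsFlatMap (segment ℝ P' Q') {P', Q'} g) (hPQ' : P' ≠ Q')
    (he : f '' segment ℝ P Q = g '' segment ℝ P' Q') : Q' - P' = Q - P ∨ Q' - P' = -(Q - P) := by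
  obtain ⟨w, hw⟩ : (openSegment ℝ P Q).Nonempty := ⟨_, midpoint_mem_openSegment P Q⟩
  obtain ⟨hwK, hstar⟩ := segment_star hw hPQ
  obtain ⟨F, D, V, s, hF⟩ := exists_sky_at (hf.rest w hwK) w
  obtain ⟨h, hh, h0, -, hV, heq⟩ := s.fit_of_eq hf hwK hstar hF.symm
  obtain ⟨w', hw', hww'⟩ : f w ∈ g '' segment ℝ P' Q' := he ▸ ⟨w, hwK.1, rfl⟩
  have hw'' : w' ∈ openSegment ℝ P' Q' := by
    rw [← insert_endpoints_openSegment] at hw'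
    rcases hw' with rfl | rfl | hy
    · exact (hf.rest w hwK (hww' ▸ hg.vertices _ (by simp))).elim
    · exact (hf.rest w hwK (hww' ▸ hg.vertices _ (by simp))).elim
    · exact hy
  obtain ⟨hwK', hstar'⟩ := segment_star hw'' hPQ'
  obtain ⟨k, hk, k0, -, hkV, hkeq⟩ := s.fit_of_eq hg hwK' hstar' (hww'.trans hF.symm)
  have mk : ∀ {h : ℂ → ℂ} {f : ℂ → S} {P Q w' : ℂ}, IsHalfTranslation h → h w = w' →
      w' ∈ openSegment ℝ P Q → (∀ z, h z ∈ segment ℝ P Q → h z ∈ ({P, Q} : Set ℂ) → z ∈ V) →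
      (∀ z, h z ∈ segment ℝ P Q → F z = f (h z)) → ∃ P₁ Q₁, h P₁ = P ∧ h Q₁ = Q ∧ P₁ ∈ V ∧ Q₁ ∈ V ∧
        w ∈ openSegment ℝ P₁ Q₁ ∧ F '' segment ℝ P₁ Q₁ = f '' segment ℝ P Q := by
    intro h f P Q w' hh h0 hw' hV heq
    obtain ⟨h', hh', hl, hr⟩ := hh.exists_inverse
    refine ⟨h' P, h' Q, hr _, hr _, hV _ (by rw [hr]; exact left_mem_segment _ _ _) (by simp [hr]),
      hV _ (by rw [hr]; exact right_mem_segment _ _ _) (by simp [hr]), ?_, ?_⟩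
    · rw [← hh'.image_openSegment]; exact ⟨w', hw', by rw [← h0, hl]⟩
    · rw [← hh'.image_segment, image_image]
      refine image_congr fun z hz => ?_
      rw [heq _ (by rwa [hr]), hr]
  obtain ⟨P₁, Q₁, rfl, rfl, hP₁, hQ₁, hw1, e1⟩ := mk hh h0 hw hV heq
  obtain ⟨P₂, Q₂, rfl, rfl, hP₂, hQ₂, hw2, e2⟩ := mk hk k0 hw'' hkV hkeq
  have r1 := hh.sub_eq P₁ Q₁
  have r2 := hk.sub_eq P₂ Q₂
  rcases s.endpoints_eq_of_image_eq hP₁ hQ₁ hP₂ hQ₂ hw1 hw2 (by rw [e1, e2, he]) with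
    ⟨rfl, rfl⟩ | ⟨rfl, rfl⟩
  · rcases r1 with r1 | r1 <;> rcases r2 with r2 | r2 <;> rw [r1, r2] <;> simp
  · rcases r1 with r1 | r1 <;> rcases r2 with r2 | r2 <;> rw [r1, r2] <;> simp

theorem IsFlatMap.isRed_iff [T2Space S] [CompactSpace S] {P Q : ℂ} {f : ℂ → S}
    (hf : q.IsFlatMap (segment ℝ P Q) {P, Q} f) (hPQ : P ≠ Q) :
    q.IsRed (f '' segment ℝ P Q) ↔ 0 < (Q - P).re * (Q - P).im := by
  have hs : ∀ v : ℂ, 0 < slopeOf v ↔ 0 < v.re * v.im := fun v => by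
    rw [slopeOf, div_pos_iff, mul_pos_iff]; tauto
  constructor
  · rintro ⟨v, ⟨hv, g, hg, -, he⟩, hsl⟩
    have := hf.holonomy_eq hPQ hg (Ne.symm hv) he
    rw [hs] at hsl
    simp only [sub_zero] at this
    rcases this with rfl | rfl
    · exact hsl
    · simpa only [Complex.neg_re, Complex.neg_im, neg_mul_neg] using hsl
  · intro h
    exact ⟨_, hf.isSaddleConnection hPQ, (hs _).2 h⟩

theorem IsFlatMap.isBlue_iff [T2Space S] [CompactSpace S] {P Q : ℂ} {f : ℂ → S}
    (hf : q.IsFlatMap (segment ℝ P Q) {P, Q} f) (hPQ : P ≠ Q) :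
    q.IsBlue (f '' segment ℝ P Q) ↔ (Q - P).re * (Q - P).im < 0 := by
  have hs : ∀ v : ℂ, slopeOf v < 0 ↔ v.re * v.im < 0 := fun v => by
    rw [slopeOf, div_neg_iff, mul_neg_iff]; tauto
  constructor
  · rintro ⟨v, ⟨hv, g, hg, -, he⟩, hsl⟩
    have := hf.holonomy_eq hPQ hg (Ne.symm hv) he
    rw [hs] at hsl
    simp only [sub_zero] at this
    rcases this with rfl | rfl
    · exact hsl
    · simpa only [Complex.neg_re, Complex.neg_im, neg_mul_neg] using hsl
  · intro h
    exact ⟨_, hf.isSaddleConnection hPQ, (hs _).2 h⟩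

/-- The saddle connections of width at most one which span a flat rectangle of width more than one:
the edges of the balanced veering triangulation. -/
def delaunayEdges (q : HalfTranslationStructure S) : Set (Set S) :=
  {e | ∃ w₀ f D V P Q, q.Sky w₀ f D V ∧ P ∈ V ∧ Q ∈ V ∧ w₀ ∈ openSegment ℝ P Q ∧ Spans D P Q ∧
    e = f '' segment ℝ P Q}

theorem _root_.Spans.ne {D : Set ℂ} {P Q : ℂ} (h : Spans D P Q) : P ≠ Q := by
  obtain ⟨_, _, _, _, _, _, h, _⟩ := h
  rintro rfl; exact h rfl

/-- A window with the two ends of its segment is star-shaped about each of its points with the ends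
as tips, as `fit` requires for changing the base point. -/
theorem window_star {W : Set ℂ} {P Q w : ℂ} (hW : IsOpen W) (hWc : Convex ℝ W)
    (hseg : openSegment ℝ P Q ⊆ W) (hP : P ∉ W) (hQ : Q ∉ W) (hw : w ∈ W) : w ∈ (W ∪ {P, Q}) \ {P, Q} ∧
      ∀ k ∈ W ∪ {P, Q}, ∀ t : ℝ, 0 ≤ t → t < 1 → w + t * (k - w) ∈ (W ∪ {P, Q}) \ {P, Q} := by
  have hsub : ∀ w ∈ W, w ∈ (W ∪ {P, Q}) \ {P, Q} := by
    intro w hw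
    refine ⟨Or.inl hw, ?_⟩
    rintro (rfl | rfl)
    exacts [hP hw, hQ hw]
  refine ⟨hsub w hw, fun k hk t ht ht1 => hsub _ ?_⟩
  have hkcl : k ∈ closure W := by
    rcases hk with hk | rfl | rfl
    · exact subset_closure hk
    · exact closure_mono hseg (closure_openSegment (𝕜 := ℝ) k Q ▸ left_mem_segment _ _ _)
    · exact closure_mono hseg (closure_openSegment (𝕜 := ℝ) P k ▸ right_mem_segment _ _ _)
  have := hWc.openSegment_interior_closure_subset_interior (hW.interior_eq.symm ▸ hw) hkcl
  rcases eq_or_lt_of_le ht with rfl | ht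
  · simpa using hw
  · refine hW.interior_eq ▸ this ⟨1 - t, t, by linarith, ht, by ring, ?_⟩
    simp only [Complex.real_smul]; push_cast; ring

theorem Sky.flatMap_window {w₀ : ℂ} {f : ℂ → S} {D V : Set ℂ} (s : q.Sky w₀ f D V) {W : Set ℂ} {P Q : ℂ} (hW : W ⊆ D) (hP : P ∈ V)
    (hQ : Q ∈ V) : q.IsFlatMap (W ∪ {P, Q}) {P, Q} f := by
  refine (s.flatMap (K := W ∪ {P, Q}) ?_).mono subset_rfl ?_ ?_
  · rintro w (hw | rfl | rfl)
    exacts [Or.inl (hW hw), Or.inr hP, Or.inr hQ]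
  · rintro w (rfl | rfl)
    exacts [⟨Or.inr (by simp), hP⟩, ⟨Or.inr (by simp), hQ⟩]
  · rintro w ⟨-, hw | hw, hwV⟩
    · exact (s.starView.notMem hwV (hW hw)).elim
    · exact hw

/-- A window seen from a base point is seen from every base point inside it. -/
theorem Sky.exists_spans_of_mem [T2Space S] {w₀ : ℂ} {f : ℂ → S} {D V : Set ℂ}
    (s : q.Sky w₀ f D V) {w₁ : ℂ} {g : ℂ → S} {D' V' : Set ℂ} (s' : q.Sky w₁ g D' V') {P Q : ℂ}
    (hP : P ∈ V') (hQ : Q ∈ V') (hs : Spans D' P Q) {w : ℂ} (hw : w ∈ openSegment ℝ P Q)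
    (he : g w = f w₀) : ∃ h P₁ Q₁, IsHalfTranslation h ∧ h P₁ = P ∧ h Q₁ = Q ∧ h w₀ = w ∧
      P₁ ∈ V ∧ Q₁ ∈ V ∧ w₀ ∈ openSegment ℝ P₁ Q₁ ∧ Spans D P₁ Q₁ ∧
      ∀ z ∈ segment ℝ P₁ Q₁, f z = g (h z) := by
  obtain ⟨W₀, hW₀, hW₀o, hW₀c, hW₀s, hW₀t⟩ := hs.exists_window
  have hPW : P ∉ W₀ := fun h => s'.starView.notMem hP (hW₀ h)
  have hQW : Q ∉ W₀ := fun h => s'.starView.notMem hQ (hW₀ h)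
  obtain ⟨hwK, hstar⟩ := window_star hW₀o hW₀c hW₀s hPW hQW (hW₀s hw)
  obtain ⟨h, hh, h0, hD, hV, heq⟩ := s.fit_of_eq (s'.flatMap_window hW₀ hP hQ) hwK hstar he
  obtain ⟨h', hh', hl, hr⟩ := hh.exists_inverse
  refine ⟨h, h' P, h' Q, hh, hr _, hr _, h0, hV _ (by simp [hr]) (by simp [hr]),
    hV _ (by simp [hr]) (by simp [hr]), ?_, ?_, ?_⟩
  · rw [← hh'.image_openSegment]; exact ⟨w, hw, by rw [← h0, hl]⟩
  · refine hW₀t h D _ _ hh (hr _) (hr _) fun z hz => hD z ?_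
    exact (window_star hW₀o hW₀c hW₀s hPW hQW hz).1
  · intro z hz
    refine heq z ?_
    rw [← hh'.image_segment] at hz
    obtain ⟨y, hy, rfl⟩ := hz
    rw [hr]
    rw [← insert_endpoints_openSegment] at hy
    rcases hy with rfl | rfl | hy
    · simp
    · simp
    · exact Or.inl (hW₀s hy)

theorem _root_.IsHalfTranslation.image_segment_eq {S : Type*} {f g : ℂ → S} {h : ℂ → ℂ} (hh : IsHalfTranslation h) {P Q : ℂ}
    (he : ∀ z ∈ segment ℝ P Q, f z = g (h z)) : f '' segment ℝ P Q = g '' segment ℝ (h P) (h Q) := by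
  rw [← hh.image_segment, image_image]
  exact image_congr he

/-- An edge through the image of the base point is seen from the base point. -/
theorem Sky.exists_of_mem_delaunayEdges [T2Space S] {w₀ : ℂ} {f : ℂ → S} {D V : Set ℂ}
    (s : q.Sky w₀ f D V) {e : Set S} (he : e ∈ q.delaunayEdges) (h0 : f w₀ ∈ e) :
    ∃ P ∈ V, ∃ Q ∈ V, P.im < Q.im ∧ w₀ ∈ openSegment ℝ P Q ∧ Spans D P Q ∧
      e = f '' segment ℝ P Q := by
  obtain ⟨w₁, g, D', V', P, Q, s', hP, hQ, -, hs, rfl⟩ := he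
  obtain ⟨w, hw, hww⟩ := h0
  have hw' : w ∈ openSegment ℝ P Q := by
    rw [← insert_endpoints_openSegment] at hw
    rcases hw with rfl | rfl | hw
    · exact (s.free.notMem s.base (hww ▸ s'.map_V _ hP)).elim
    · exact (s.free.notMem s.base (hww ▸ s'.map_V _ hQ)).elim
    · exact hw
  obtain ⟨h, P₁, Q₁, hh, rfl, rfl, -, hP₁, hQ₁, hw₁, hs₁, heq⟩ :=
    s.exists_spans_of_mem s' hP hQ hs hw' hww
  have him : P₁.im ≠ Q₁.im := by
    obtain ⟨_, _, _, _, _, _, _, h, _⟩ := hs₁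
    exact h
  rcases lt_or_gt_of_ne him with hlt | hlt
  · exact ⟨P₁, hP₁, Q₁, hQ₁, hlt, hw₁, hs₁, (hh.image_segment_eq heq).symm⟩
  · refine ⟨Q₁, hQ₁, P₁, hP₁, hlt, by rwa [openSegment_symm], hs₁.symm, ?_⟩
    rw [segment_symm ℝ Q₁, hh.image_segment_eq heq]

theorem Sky.spans_of_mem [T2Space S] {w₀ : ℂ} {f : ℂ → S} {D V : Set ℂ}
    (s : q.Sky w₀ f D V) {P Q : ℂ} (hP : P ∈ V) (hQ : Q ∈ V) (h0 : w₀ ∈ openSegment ℝ P Q)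
    (he : f '' segment ℝ P Q ∈ q.delaunayEdges) : Spans D P Q := by
  obtain ⟨P', hP', Q', hQ', -, h0', hs, heq⟩ := s.exists_of_mem_delaunayEdges he
    ⟨w₀, openSegment_subset_segment ℝ P Q h0, rfl⟩
  rcases s.endpoints_eq_of_image_eq hP hQ hP' hQ' h0 h0' heq.subset with ⟨rfl, rfl⟩ | ⟨rfl, rfl⟩
  exacts [hs, hs.symm]

/-- The base point in `delaunayEdges` is to lie on the segment. A window seen from anywhere else is
also seen from the midpoint of its segment. -/
theorem Sky.mem_delaunayEdges [T2Space S] [CompactSpace S] {w₀ : ℂ} {f : ℂ → S} {D V : Set ℂ}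
    (s : q.Sky w₀ f D V) {P Q : ℂ} (hP : P ∈ V) (hQ : Q ∈ V) (hs : Spans D P Q) :
    f '' segment ℝ P Q ∈ q.delaunayEdges := by
  obtain ⟨W, hWD, -, -, hWs, -⟩ := hs.exists_window
  obtain ⟨w, hw⟩ : (openSegment ℝ P Q).Nonempty := ⟨_, midpoint_mem_openSegment P Q⟩
  obtain ⟨g, D', V', s', hg⟩ := exists_sky_at (s.free.notMem (hWD (hWs hw))) w
  obtain ⟨h, P₁, Q₁, hh, rfl, rfl, -, hP₁, hQ₁, hw₁, hs₁, heq⟩ :=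
    s'.exists_spans_of_mem s hP hQ hs hw hg.symm
  exact ⟨w, g, D', V', P₁, Q₁, s', hP₁, hQ₁, hw₁, hs₁, (hh.image_segment_eq heq).symm⟩

/-- Edges do not cross. -/
theorem eq_of_mem_delaunayEdges [T2Space S] [CompactSpace S] [ConnectedSpace S] (hq : q.IsKeane)
    {e e' : Set S} (he : e ∈ q.delaunayEdges) (he' : e' ∈ q.delaunayEdges) {p : S} (hp : p ∈ e)
    (hp' : p ∈ e') (hpZ : p ∉ q.Z) : e = e' := by
  obtain ⟨f, D, V, s, rfl⟩ := exists_sky_at hpZ 0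
  obtain ⟨P, hP, Q, hQ, him, h0, hs, rfl⟩ := s.exists_of_mem_delaunayEdges he hp
  obtain ⟨P', hP', Q', hQ', him', h0', hs', rfl⟩ := s.exists_of_mem_delaunayEdges he' hp'
  obtain ⟨rfl, rfl⟩ := (s.keaneView hq).eq_of_crossing hP hQ hP' hQ' him him' h0 h0' hs hs'
  rfl

theorem exists_isSaddleConnection_of_mem_delaunayEdges [T2Space S] {e : Set S}
    (he : e ∈ q.delaunayEdges) : ∃ v, q.IsSaddleConnection e v := by
  obtain ⟨w₀, f, D, V, P, Q, s, hP, hQ, h0, hs, rfl⟩ := he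
  exact ⟨_, (s.flatMap_segment hP hQ (s.starView.openSegment_subset hP hQ h0)).isSaddleConnection
    hs.ne⟩

end HalfTranslationStructure

/-! ### Triangles whose sides are edges: interiors are embedded, and equal or disjoint. -/

namespace HalfTranslationStructure

variable {S : Type*} [TopologicalSpace S] {q : HalfTranslationStructure S}

/-- A flat triangle whose sides are edges. -/
structure IsDelaunayTriangle (q : HalfTranslationStructure S) (f : ℂ → S) (P Q R : ℂ) : Prop where
  anticlockwise : Anticlockwise P Q R
  flatMap : q.IsFlatMap (planeTriangle P Q R) {P, Q, R} f
  side₁ : f '' segment ℝ P Q ∈ q.delaunayEdges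
  side₂ : f '' segment ℝ Q R ∈ q.delaunayEdges
  side₃ : f '' segment ℝ R P ∈ q.delaunayEdges

theorem IsDelaunayTriangle.rotate {f : ℂ → S} {P Q R : ℂ} (h : q.IsDelaunayTriangle f P Q R) :
    q.IsDelaunayTriangle f Q R P where
  anticlockwise := h.anticlockwise.rotate
  flatMap := by
    rw [planeTriangle_rotate, show ({Q, R, P} : Set ℂ) = {P, Q, R} by ext; simp; tauto]
    exact h.flatMap
  side₁ := h.side₂
  side₂ := h.side₃
  side₃ := h.side₁

theorem IsFlatMap.segment_of_triangle {f : ℂ → S} {P Q R : ℂ} (hT : Anticlockwise P Q R)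
    (hf : q.IsFlatMap (planeTriangle P Q R) {P, Q, R} f) :
    q.IsFlatMap (segment ℝ P Q) {P, Q} f := by
  refine hf.mono (segment_subset_planeTriangle P Q R) (by simp [insert_subset_iff]) ?_
  rintro w ⟨hw, hwV⟩
  rw [← insert_endpoints_openSegment] at hw
  rcases hw with rfl | rfl | hw
  · simp
  · simp
  · exact ((hT.openSegment_notMem_vertices hw).2 hwV).elim

namespace Sky

variable {w₀ : ℂ} {f : ℂ → S} {D V : Set ℂ}

/-- A flat triangle through the image of the base point, other than at a vertex, is seen from the
base point. -/
theorem fit_triangle [T2Space S] (s : q.Sky w₀ f D V) {P Q R w : ℂ} {g : ℂ → S}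
    (hT : Anticlockwise P Q R) (hg : q.IsFlatMap (planeTriangle P Q R) {P, Q, R} g)
    (hw : w ∈ planeTriangle P Q R \ {P, Q, R}) (he : g w = f w₀) :
    ∃ h P₁ Q₁ R₁, IsHalfTranslation h ∧ h P₁ = P ∧ h Q₁ = Q ∧ h R₁ = R ∧ h w₀ = w ∧
      P₁ ∈ V ∧ Q₁ ∈ V ∧ R₁ ∈ V ∧ Anticlockwise P₁ Q₁ R₁ ∧
      planeTriangle P₁ Q₁ R₁ \ {P₁, Q₁, R₁} ⊆ D ∧
      (∀ z ∈ planeTriangle P₁ Q₁ R₁, f z = g (h z)) ∧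
      ∀ z, z ∈ planeTriangle P₁ Q₁ R₁ ↔ h z ∈ planeTriangle P Q R := by
  obtain ⟨h, hh, h0, hD, hV, heq⟩ := s.fit_of_eq hg hw (hT.star hw) he
  obtain ⟨h', hh', hl, hr⟩ := hh.exists_inverse
  have hT' : Anticlockwise (h' P) (h' Q) (h' R) := hh'.anticlockwise.2 hT
  have hiff : ∀ z, z ∈ planeTriangle (h' P) (h' Q) (h' R) ↔ h z ∈ planeTriangle P Q R := by
    intro z
    have := hh.preimage_planeTriangle hT'
    rw [hr, hr, hr] at this
    rw [← this]; rfl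
  have hv : ∀ X ∈ ({P, Q, R} : Set ℂ), h' X ∈ V := fun X hX => hV _ (by
    rw [hr]; exact vertices_subset _ _ _ hX) (by rwa [hr])
  refine ⟨h, h' P, h' Q, h' R, hh, hr _, hr _, hr _, h0, hv _ (by simp), hv _ (by simp),
    hv _ (by simp), hT', fun z hz => hD z ⟨(hiff z).1 hz.1, ?_⟩, fun z hz => heq z ((hiff z).1 hz),
    hiff⟩
  intro hzv
  apply hz.2
  rcases hzv with h | h | h
  · left; rw [← h, hl]
  · right; left; rw [← h, hl]
  · right; right; rw [mem_singleton_iff, ← mem_singleton_iff.1 h, hl]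

theorem flatMap_triangle (s : q.Sky w₀ f D V) {P Q R : ℂ} (hP : P ∈ V) (hQ : Q ∈ V) (hR : R ∈ V)
    (hD : planeTriangle P Q R \ {P, Q, R} ⊆ D) :
    q.IsFlatMap (planeTriangle P Q R) {P, Q, R} f := by
  have hv : ({P, Q, R} : Set ℂ) ⊆ V := by
    rintro x (rfl | rfl | rfl) <;> assumption
  refine (s.flatMap fun w hw => ?_).mono subset_rfl (fun w hw =>
    ⟨vertices_subset _ _ _ hw, hv hw⟩) fun w hw => ?_
  · by_cases h : w ∈ ({P, Q, R} : Set ℂ)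
    · exact Or.inr (hv h)
    · exact Or.inl (hD ⟨hw, h⟩)
  · by_contra h
    exact s.starView.notMem hw.2.2 (hD ⟨hw.1, h⟩)

/-- A Delaunay triangle through the image of the base point is seen from the base point. -/
theorem fit_delaunayTriangle [T2Space S] (s : q.Sky w₀ f D V) {P Q R w : ℂ} {g : ℂ → S}
    (hT : q.IsDelaunayTriangle g P Q R)
    (hw : w ∈ planeTriangle P Q R \ {P, Q, R}) (he : g w = f w₀) :
    ∃ h P₁ Q₁ R₁, IsHalfTranslation h ∧ h P₁ = P ∧ h Q₁ = Q ∧ h R₁ = R ∧ h w₀ = w ∧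
      P₁ ∈ V ∧ Q₁ ∈ V ∧ R₁ ∈ V ∧ q.IsDelaunayTriangle f P₁ Q₁ R₁ ∧
      planeTriangle P₁ Q₁ R₁ \ {P₁, Q₁, R₁} ⊆ D ∧
      (∀ z ∈ planeTriangle P₁ Q₁ R₁, f z = g (h z)) ∧
      ∀ z, z ∈ planeTriangle P₁ Q₁ R₁ ↔ h z ∈ planeTriangle P Q R := by
  obtain ⟨h, P₁, Q₁, R₁, hh, rfl, rfl, rfl, h0, hP, hQ, hR, hT₁, hD, heq, hiff⟩ :=
    s.fit_triangle hT.anticlockwise hT.flatMap hw he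
  have hc := convex_planeTriangle P₁ Q₁ R₁
  have vP := vertices_subset P₁ Q₁ R₁ (show P₁ ∈ _ by simp)
  have vQ := vertices_subset P₁ Q₁ R₁ (show Q₁ ∈ _ by simp)
  have vR := vertices_subset P₁ Q₁ R₁ (show R₁ ∈ _ by simp)
  refine ⟨h, P₁, Q₁, R₁, hh, rfl, rfl, rfl, h0, hP, hQ, hR,
    ⟨hT₁, s.flatMap_triangle hP hQ hR hD, ?_, ?_, ?_⟩, hD, heq, hiff⟩
  · rw [hh.image_segment_eq fun z hz => heq z (hc.segment_subset vP vQ hz)]; exact hT.side₁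
  · rw [hh.image_segment_eq fun z hz => heq z (hc.segment_subset vQ vR hz)]; exact hT.side₂
  · rw [hh.image_segment_eq fun z hz => heq z (hc.segment_subset vR vP hz)]; exact hT.side₃

theorem image_interior_eq {S : Type*} {f g : ℂ → S} {h : ℂ → ℂ} (hh : IsHalfTranslation h)
    {P Q R : ℂ} (hT : Anticlockwise P Q R) (he : ∀ z ∈ planeTriangle P Q R, f z = g (h z)) :
    f '' interior (planeTriangle P Q R) = g '' interior (planeTriangle (h P) (h Q) (h R)) := by
  rw [← hh.image_interior hT, image_image]
  exact image_congr fun z hz => he z (interior_subset hz)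

theorem eq_of_edges [T2Space S] [CompactSpace S] [ConnectedSpace S] (hq : q.IsKeane)
    (s : q.Sky w₀ f D V) {P Q P' Q' : ℂ} (hP : P ∈ V)
    (hQ : Q ∈ V) (hP' : P' ∈ V) (hQ' : Q' ∈ V) (h0 : w₀ ∈ openSegment ℝ P Q)
    (h0' : w₀ ∈ openSegment ℝ P' Q') (he : f '' segment ℝ P Q ∈ q.delaunayEdges)
    (he' : f '' segment ℝ P' Q' ∈ q.delaunayEdges) : P = P' ∧ Q = Q' ∨ P = Q' ∧ Q = P' :=
  s.endpoints_eq_of_image_eq hP hQ hP' hQ' h0 h0' (eq_of_mem_delaunayEdges hq he he'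
    ⟨w₀, openSegment_subset_segment ℝ _ _ h0, rfl⟩ ⟨w₀, openSegment_subset_segment ℝ _ _ h0', rfl⟩
    (s.free.notMem s.base)).subset

theorem rebase_segment [T2Space S] (s : q.Sky w₀ f D V) {w₁ : ℂ} {g : ℂ → S} {D' V' : Set ℂ}
    (s' : q.Sky w₁ g D' V') {P Q : ℂ} (hPQ : P ≠ Q) (hf : q.IsFlatMap (segment ℝ P Q) {P, Q} f)
    (h1 : w₁ ∈ openSegment ℝ P Q) (h1D : w₁ ∈ D) (he : f =ᶠ[𝓝[D] w₁] g) :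
    P ∈ V' ∧ Q ∈ V' ∧ f '' segment ℝ P Q = g '' segment ℝ P Q := by
  obtain ⟨hwK, hstar⟩ := segment_star h1 hPQ
  rw [s.isOpen.nhdsWithin_eq h1D] at he
  obtain ⟨-, hV, heq⟩ := s'.fit hf hstar (he.filter_mono nhdsWithin_le_nhds)
  exact ⟨hV ⟨left_mem_segment _ _ _, by simp⟩, hV ⟨right_mem_segment _ _ _, by simp⟩,
    (image_congr heq).symm⟩

end Sky

theorem subset_interior_of_preconnected {A : Set ℂ} {P Q R : ℂ} (hA : IsPreconnected A)
    (hne : (A ∩ interior (planeTriangle P Q R)).Nonempty)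
    (h : ∀ y ∈ A, y ∈ planeTriangle P Q R → y ∈ interior (planeTriangle P Q R)) :
    A ⊆ interior (planeTriangle P Q R) := by
  refine hA.subset_left_of_subset_union isOpen_interior
    (isCompact_planeTriangle P Q R).isClosed.isOpen_compl
    (disjoint_compl_right.mono_left interior_subset) (fun y hy => ?_) hne
  by_cases hyT : y ∈ planeTriangle P Q R
  · exact Or.inl (h y hy hyT)
  · exact Or.inr hyT

/-- Edges do not enter the interior of a Delaunay triangle. -/
theorem IsDelaunayTriangle.notMem_edge [T2Space S] [CompactSpace S] [ConnectedSpace S]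
    (hq : q.IsKeane) {g : ℂ → S} {P Q R w : ℂ} (hT : q.IsDelaunayTriangle g P Q R)
    (hw : w ∈ interior (planeTriangle P Q R)) {e : Set S} (he : e ∈ q.delaunayEdges) : g w ∉ e := by
  intro hwe
  have hwv := hT.anticlockwise.interior_notMem_vertices hw
  obtain ⟨f, D, V, s, hf⟩ := exists_sky_at (hT.flatMap.rest w hwv) w
  obtain ⟨h, P, Q, R, hh, rfl, rfl, rfl, h0, hP, hQ, hR, hT, hD, heq, hiff⟩ :=
    s.fit_delaunayTriangle hT hwv hf.symm
  have hw : w ∈ interior (planeTriangle P Q R) := by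
    obtain ⟨z, hz, hzw⟩ := (hh.image_interior hT.anticlockwise).symm ▸ hw
    rwa [← hh.injective (hzw.trans h0.symm)]
  obtain ⟨P', hP', Q', hQ', -, h0', hs', rfl⟩ := s.exists_of_mem_delaunayEdges he (hf ▸ hwe)
  have hO := s.starView.openSegment_subset hP' hQ' h0'
  have hiD : interior (planeTriangle P Q R) ⊆ D := fun y hy =>
    hD (hT.anticlockwise.interior_notMem_vertices hy)
  -- Seen from a common point, a side and the given edge coincide because edges do not cross. But no
  -- side contains the interior point `w`.
  have hside : ∀ A B C : ℂ, q.IsDelaunayTriangle f A B C → A ∈ V → B ∈ V →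
      planeTriangle A B C = planeTriangle P Q R → planeTriangle A B C \ {A, B, C} ⊆ D →
      ∀ x ∈ openSegment ℝ A B, x ∉ openSegment ℝ P' Q' := by
    intro A B C hABC hA hB hTe hD x hx hx'
    have hxD : x ∈ D := hD (hABC.anticlockwise.openSegment_notMem_vertices hx)
    obtain ⟨f', D', V', s', hf'⟩ := exists_sky_of_free s.free hxD
    obtain ⟨hA', hB', e1⟩ := s.rebase_segment s' hABC.anticlockwise.ne
      (hABC.flatMap.segment_of_triangle hABC.anticlockwise) hx hxD hf'
    obtain ⟨hP'', hQ'', e2⟩ := s.rebase_segment s' hs'.ne (s.flatMap_segment hP' hQ' hO) hx' hxD hf'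
    have hdis := Set.disjoint_left.1 hABC.anticlockwise.segment_disjoint
    rw [hTe] at hdis
    rcases s'.eq_of_edges hq hA' hB' hP'' hQ'' hx hx' (e1 ▸ hABC.side₁) (e2 ▸ he) with
      ⟨rfl, rfl⟩ | ⟨rfl, rfl⟩
    · exact hdis (openSegment_subset_segment ℝ _ _ h0') hw
    · exact hdis (openSegment_subset_segment ℝ _ _ (openSegment_symm ℝ A B ▸ h0')) hw
  -- On the way from `w` to an end of the edge no side is crossed. The end is therefore in the
  -- triangle, and visible points of the triangle are its vertices.
  have hvert : ∀ X ∈ V, (∀ t : ℝ, 0 < t → t < 1 → w + t * (X - w) ∈ openSegment ℝ P' Q') →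
      X = P ∨ X = Q ∨ X = R := by
    intro X hX hXo
    by_contra hXv
    have hsub : segment ℝ w X ⊆ interior (planeTriangle P Q R) := by
      refine subset_interior_of_preconnected (convex_segment w X).isPreconnected
        ⟨w, left_mem_segment _ _ _, hw⟩ fun y hy hyT => ?_
      by_contra hyi
      rw [segment_eq_image'] at hy
      obtain ⟨t, ⟨ht0, ht1⟩, rfl⟩ := hy
      simp only [Complex.real_smul] at hyT hyi
      rcases eq_or_lt_of_le ht0 with rfl | ht0
      · simp [hw] at hyi
      have hyV : w + t * (X - w) ∉ ({P, Q, R} : Set ℂ) := by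
        intro hv
        have : w + t * (X - w) ∈ V := by
          rcases hv with h | h | h <;> rw [h] <;> assumption
        have := s.starView.eq_of_ray hX this ht0 rfl
        rw [this] at hv
        exact hXv hv
      rcases eq_or_lt_of_le ht1 with rfl | ht1
      · refine s.starView.notMem hX (hD ⟨by simpa using hyT, by simpa using hyV⟩)
      have hyo := hXo t ht0 ht1
      simp only [mem_insert_iff, mem_singleton_iff, not_or] at hyV
      have hop : ∀ A B : ℂ, w + t * (X - w) ∈ segment ℝ A B → w + t * (X - w) ≠ A →
          w + t * (X - w) ≠ B → w + t * (X - w) ∈ openSegment ℝ A B := by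
        intro A B h h1 h2
        rw [← insert_endpoints_openSegment] at h
        rcases h with h | h | h
        exacts [(h1 h).elim, (h2 h).elim, h]
      have hr1 := planeTriangle_rotate P Q R
      have hr2 := planeTriangle_rotate Q R P
      have hv1 : ({Q, R, P} : Set ℂ) = {P, Q, R} := by ext; simp; tauto
      have hv2 : ({R, P, Q} : Set ℂ) = {P, Q, R} := by ext; simp; tauto
      rcases hT.anticlockwise.mem_side hyT hyi with h | h | h
      · exact hside P Q R hT hP hQ rfl hD _ (hop _ _ h hyV.1 hyV.2.1) hyo
      · exact hside Q R P hT.rotate hQ hR hr1 (by rwa [hr1, hv1]) _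
          (hop _ _ h hyV.2.1 hyV.2.2) hyo
      · exact hside R P Q hT.rotate.rotate hR hP (hr2.trans hr1) (by rwa [hr2, hr1, hv2]) _
          (hop _ _ h hyV.2.2 hyV.1) hyo
    exact s.starView.notMem hX (hiD (hsub (right_mem_segment _ _ _)))
  have hray : ∀ P' Q' : ℂ, w ∈ openSegment ℝ P' Q' → ∀ t : ℝ, 0 < t → t < 1 →
      w + t * (P' - w) ∈ openSegment ℝ P' Q' := by
    rintro P' Q' ⟨a, b, ha, hb, hab, rfl⟩ t ht ht1
    refine ⟨a + t * (1 - a), b - t * b, ?_, ?_, ?_, ?_⟩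
    · have : 0 < 1 - a := by linarith
      positivity
    · nlinarith
    · obtain rfl : b = 1 - a := by linarith
      ring
    · obtain rfl : b = 1 - a := by linarith
      simp only [Complex.real_smul]; push_cast; ring
  have h1 := hvert P' hP' (hray P' Q' h0')
  have h2 := hvert Q' hQ' fun t ht ht1 => by
    rw [openSegment_symm]; exact hray Q' P' (by rwa [openSegment_symm]) t ht ht1
  have hne := hs'.ne
  have hd1 := Set.disjoint_left.1 hT.anticlockwise.segment_disjoint
  have hd2 := Set.disjoint_left.1 hT.rotate.anticlockwise.segment_disjoint
  have hd3 := Set.disjoint_left.1 hT.rotate.rotate.anticlockwise.segment_disjoint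
  rw [planeTriangle_rotate] at hd2
  rw [planeTriangle_rotate, planeTriangle_rotate] at hd3
  have h0s := openSegment_subset_segment ℝ _ _ h0'
  have h0s' := h0s
  rw [segment_symm] at h0s'
  -- An edge between two vertices of the triangle runs along a side and misses the interior.
  rcases h1 with rfl | rfl | rfl <;> rcases h2 with rfl | rfl | rfl <;>
    first
      | exact hne rfl
      | exact hd1 h0s hw
      | exact hd2 h0s hw
      | exact hd3 h0s hw
      | exact hd1 h0s' hw
      | exact hd2 h0s' hw
      | exact hd3 h0s' hw

/-- The boundary of the second triangle maps into edges, which the connected interior of the first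
one avoids. -/
theorem IsDelaunayTriangle.interior_subset_interior [T2Space S] [CompactSpace S] [ConnectedSpace S]
    (hq : q.IsKeane) {f : ℂ → S} {P Q R P' Q' R' w : ℂ} (hT : q.IsDelaunayTriangle f P Q R)
    (hT' : q.IsDelaunayTriangle f P' Q' R') (hw : w ∈ interior (planeTriangle P Q R))
    (hw' : w ∈ interior (planeTriangle P' Q' R')) :
    interior (planeTriangle P Q R) ⊆ interior (planeTriangle P' Q' R') := by
  refine subset_interior_of_preconnected (convex_planeTriangle P Q R).interior.isPreconnected
    ⟨w, hw, hw'⟩ fun y hy hyT => ?_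
  by_contra hyi
  rcases hT'.anticlockwise.mem_side hyT hyi with h | h | h
  · exact hT.notMem_edge hq hy hT'.side₁ ⟨y, h, rfl⟩
  · exact hT.notMem_edge hq hy hT'.side₂ ⟨y, h, rfl⟩
  · exact hT.notMem_edge hq hy hT'.side₃ ⟨y, h, rfl⟩

theorem IsDelaunayTriangle.interior_eq [T2Space S] [CompactSpace S] [ConnectedSpace S]
    (hq : q.IsKeane) {f : ℂ → S} {P Q R P' Q' R' w : ℂ} (hT : q.IsDelaunayTriangle f P Q R)
    (hT' : q.IsDelaunayTriangle f P' Q' R') (hw : w ∈ interior (planeTriangle P Q R))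
    (hw' : w ∈ interior (planeTriangle P' Q' R')) :
    interior (planeTriangle P Q R) = interior (planeTriangle P' Q' R') :=
  (hT.interior_subset_interior hq hT' hw hw').antisymm (hT'.interior_subset_interior hq hT hw' hw)

/-- The interiors of Delaunay triangles are equal or disjoint. -/
theorem IsDelaunayTriangle.image_eq [T2Space S] [CompactSpace S] [ConnectedSpace S]
    (hq : q.IsKeane) {f g : ℂ → S} {P Q R P' Q' R' : ℂ} (hT : q.IsDelaunayTriangle f P Q R)
    (hT' : q.IsDelaunayTriangle g P' Q' R') {p : S} (hp : p ∈ f '' interior (planeTriangle P Q R))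
    (hp' : p ∈ g '' interior (planeTriangle P' Q' R')) :
    f '' interior (planeTriangle P Q R) = g '' interior (planeTriangle P' Q' R') := by
  obtain ⟨w, hw, rfl⟩ := hp
  obtain ⟨w', hw', hww'⟩ := hp'
  have hwv := hT.anticlockwise.interior_notMem_vertices hw
  have hwv' := hT'.anticlockwise.interior_notMem_vertices hw'
  obtain ⟨F, D, V, s, hF⟩ := exists_sky_at (hT.flatMap.rest w hwv) 0
  obtain ⟨h, P, Q, R, hh, rfl, rfl, rfl, h0, -, -, -, hT₁, -, heq, -⟩ :=
    s.fit_delaunayTriangle hT hwv hF.symm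
  obtain ⟨k, P', Q', R', hk, rfl, rfl, rfl, k0, -, -, -, hT₁', -, heq', -⟩ :=
    s.fit_delaunayTriangle hT' hwv' (hww'.trans hF.symm)
  rw [← Sky.image_interior_eq hh hT₁.anticlockwise heq,
    ← Sky.image_interior_eq hk hT₁'.anticlockwise heq']
  have mem : ∀ {h : ℂ → ℂ} {P Q R w : ℂ}, IsHalfTranslation h → h 0 = w → Anticlockwise P Q R →
      w ∈ interior (planeTriangle (h P) (h Q) (h R)) → (0 : ℂ) ∈ interior (planeTriangle P Q R) := by
    intro h P Q R w hh h0 hT hw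
    obtain ⟨z, hz, hzw⟩ := (hh.image_interior hT).symm ▸ hw
    rwa [← hh.injective (hzw.trans h0.symm)]
  rw [hT₁.interior_eq hq hT₁' (mem hh h0 hT₁.anticlockwise hw) (mem hk k0 hT₁'.anticlockwise hw')]

/-- A double point yields a half-translation that carries the interior of the triangle into itself.
A nonzero translation has unbounded orbits, and a half-turn is a fold. -/
theorem IsDelaunayTriangle.injOn [T2Space S] [CompactSpace S] [ConnectedSpace S]
    (hq : q.IsKeane) {f : ℂ → S} {P Q R : ℂ} (hT : q.IsDelaunayTriangle f P Q R) :
    InjOn f (interior (planeTriangle P Q R)) := by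
  intro a ha b hb hab
  by_contra hne
  set I := interior (planeTriangle P Q R) with hI
  have hconv : Convex ℝ I := (convex_planeTriangle P Q R).interior
  have hfr : q.Free I f := hT.flatMap.free.mono fun y hy =>
    hT.anticlockwise.interior_notMem_vertices hy
  have hva := hT.anticlockwise.interior_notMem_vertices ha
  have hvb := hT.anticlockwise.interior_notMem_vertices hb
  obtain ⟨F, D, V, s, hF⟩ := exists_sky_at (hT.flatMap.rest a hva) 0
  obtain ⟨h, P₁, Q₁, R₁, hh, e1, e2, e3, h0, -, -, -, hT₁, -, heq, -⟩ :=
    s.fit_delaunayTriangle hT hva hF.symm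
  obtain ⟨k, P₂, Q₂, R₂, hk, k1, k2, k3, k0, -, -, -, hT₂, -, keq, -⟩ :=
    s.fit_delaunayTriangle hT hvb (hab.symm.trans hF.symm)
  have i1 := hh.image_interior hT₁.anticlockwise
  have i2 := hk.image_interior hT₂.anticlockwise
  rw [e1, e2, e3, ← hI] at i1
  rw [k1, k2, k3, ← hI] at i2
  have m1 : (0 : ℂ) ∈ interior (planeTriangle P₁ Q₁ R₁) := by
    obtain ⟨z, hz, hza⟩ := (show a ∈ h '' _ from i1.symm ▸ ha)
    rwa [← hh.injective (hza.trans h0.symm)]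
  have m2 : (0 : ℂ) ∈ interior (planeTriangle P₂ Q₂ R₂) := by
    obtain ⟨z, hz, hza⟩ := (show b ∈ k '' _ from i2.symm ▸ hb)
    rwa [← hk.injective (hza.trans k0.symm)]
  have hint := hT₁.interior_eq hq hT₂ m1 m2
  obtain ⟨h', hh', hl, hr⟩ := hh.exists_inverse
  -- `k ∘ h'` maps the triangle to itself
  have hc := hk.comp hh'
  have hca : k (h' a) = b := by rw [← h0, hl, k0]
  have hself : ∀ w ∈ I, k (h' w) ∈ I ∧ f w = f (k (h' w)) := by
    intro w hw
    obtain ⟨z, hz, rfl⟩ := (show w ∈ h '' _ from i1.symm ▸ hw)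
    rw [hl]
    refine ⟨i2 ▸ ⟨z, hint ▸ hz, rfl⟩, ?_⟩
    rw [← heq z (interior_subset hz), ← keq z (interior_subset (hint ▸ hz))]
  rcases hc.cases hca with hz | hz
  · have hn : ∀ n : ℕ, a + n * (b - a) ∈ I := by
      intro n
      induction n with
      | zero => simpa using ha
      | succ n ih =>
        have := (hself _ ih).1
        rw [hz] at this
        convert this using 1
        push_cast; ring
    obtain ⟨r, hr⟩ := ((isCompact_planeTriangle P Q R).isBounded.subset
      interior_subset : Bornology.IsBounded I).subset_ball a
    have hpos : 0 < ‖b - a‖ := norm_pos_iff.2 (sub_ne_zero.2 (Ne.symm hne))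
    obtain ⟨n, hn'⟩ := exists_nat_gt (r / ‖b - a‖)
    rw [div_lt_iff₀ hpos] at hn'
    have := hr (hn n)
    rw [Metric.mem_ball, dist_eq_norm, add_sub_cancel_left, norm_mul, Complex.norm_natCast] at this
    linarith
  · refine hfr.not_fold hconv ha hb hne fun w hw _ => ?_
    rw [← hz]
    exact (hself w hw).2

theorem IsDelaunayTriangle.isFlatTriangle [T2Space S] [CompactSpace S] [ConnectedSpace S]
    (hq : q.IsKeane) {f : ℂ → S} {P Q R : ℂ} (hT : q.IsDelaunayTriangle f P Q R) :
    q.IsFlatTriangle f P Q R := ⟨hT.anticlockwise, hT.flatMap, hT.injOn hq⟩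

theorem planeTriangle_interior_subset_rect {P Q R : ℂ} {x₀ x₁ y₀ y₁ : ℝ}
    (hP : P ∈ Icc x₀ x₁ ×ℂ Icc y₀ y₁) (hQ : Q ∈ Icc x₀ x₁ ×ℂ Icc y₀ y₁)
    (hR : R ∈ Icc x₀ x₁ ×ℂ Icc y₀ y₁) :
    interior (planeTriangle P Q R) ⊆ Ioo x₀ x₁ ×ℂ Ioo y₀ y₁ := by
  have hsub : planeTriangle P Q R ⊆ Icc x₀ x₁ ×ℂ Icc y₀ y₁ := by
    refine convexHull_min ?_ (convex_reProdIm (convex_Icc _ _) (convex_Icc _ _))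
    rintro w (rfl | rfl | rfl) <;> assumption
  have := interior_mono hsub
  rwa [Complex.interior_reProdIm, interior_Icc, interior_Icc] at this

/-- Every edge has a Delaunay triangle on its left. -/
theorem Sky.exists_left_triangle [T2Space S] [CompactSpace S] [ConnectedSpace S] (hq : q.IsKeane)
    {w₀ : ℂ} {f : ℂ → S} {D V : Set ℂ} (s : q.Sky w₀ f D V) {P Q : ℂ} (hP : P ∈ V) (hQ : Q ∈ V)
    (h0 : w₀ ∈ openSegment ℝ P Q) (he : f '' segment ℝ P Q ∈ q.delaunayEdges) :
    ∃ A ∈ V, q.IsDelaunayTriangle f P Q A ∧ planeTriangle P Q A \ {P, Q, A} ⊆ D := by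
  have hs := s.spans_of_mem hP hQ h0 he
  obtain ⟨A, hA, hac, hPA, hQA, x₀, x₁, y₀, y₁, bP, bQ, bA, hbox⟩ :=
    (s.keaneView hq).exists_apex hP hQ h0 hs
  have hO : ∀ {X Y : ℂ}, Spans D X Y → openSegment ℝ X Y ⊆ D := fun h => by
    obtain ⟨W, hW, -, -, hs, -⟩ := h.exists_window
    exact hs.trans hW
  -- The box puts the interior of the triangle in `D`, and the windows of the three sides put the
  -- open sides in `D`.
  have hD : planeTriangle P Q A \ {P, Q, A} ⊆ D := by
    rintro w ⟨hw, hwv⟩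
    simp only [mem_insert_iff, mem_singleton_iff, not_or] at hwv
    by_cases hi : w ∈ interior (planeTriangle P Q A)
    · exact hbox (planeTriangle_interior_subset_rect bP bQ bA hi)
    have hop : ∀ A B : ℂ, w ∈ segment ℝ A B → w ≠ A → w ≠ B → w ∈ openSegment ℝ A B := by
      intro A B h h1 h2
      rw [← insert_endpoints_openSegment] at h
      rcases h with h | h | h
      exacts [(h1 h).elim, (h2 h).elim, h]
    rcases hac.mem_side hw hi with h | h | h
    · exact hO hs (hop _ _ h hwv.1 hwv.2.1)
    · exact hO hQA (hop _ _ h hwv.2.1 hwv.2.2)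
    · exact hO hPA.symm (hop _ _ h hwv.2.2 hwv.1)
  exact ⟨A, hA, ⟨hac, s.flatMap_triangle hP hQ hA hD, he, s.mem_delaunayEdges hQ hA hQA,
    s.mem_delaunayEdges hA hP hPA.symm⟩, hD⟩

end HalfTranslationStructure

/-! ### Edges at a marked point, found above and below horizontal separatrices. -/

namespace KeaneView

variable {w₀ : ℂ} {D V : Set ℂ}

/-- A horizontal separatrix stays in the view, together with a collar. -/
theorem exists_collar (s : KeaneView w₀ D V) {σ : ℝ} (hσ : σ = 1 ∨ σ = -1) (h0 : (0 : ℂ) ∈ V)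
    (him : w₀.im = 0) (hre : 0 < σ * w₀.re) (hre' : σ * w₀.re < 2) :
    ∃ ε > 0, ∀ w : ℂ, 0 < σ * w.re → σ * w.re < 2 → |w.im| < ε → w ∈ D := by
  have hσ2 : σ * σ = 1 := by rcases hσ with rfl | rfl <;> norm_num
  set a := σ * w₀.re with ha
  have hw₀ : w₀ = ⟨σ * a, 0⟩ := by
    apply Complex.ext
    · simp only [ha, ← mul_assoc, hσ2, one_mul]
    · exact him
  -- A first obstruction beyond `w₀` would be joined to `0` by a horizontal saddle connection.
  have hray : ∀ x : ℝ, 0 < x → (⟨σ * x, 0⟩ : ℂ) ∈ D := by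
    intro x hx
    rcases le_or_gt x a with hxa | hxa
    · have := ((s.mem_V 0).1 h0).2 ((a - x) / a) (div_nonneg (by linarith) hre.le)
        ((div_lt_one hre).2 (by linarith))
      convert this using 1
      rw [hw₀]
      apply Complex.ext
      · simp; field_simp; ring
      · simp
    · by_contra hxD
      obtain ⟨t, ht0, ht1, htV⟩ := s.exists_visible hxD
      have e : w₀ + t * (⟨σ * x, 0⟩ - w₀) = ⟨σ * (a + t * (x - a)), 0⟩ := by
        rw [hw₀]
        apply Complex.ext
        · simp; ring
        · simp
      rw [e] at htV
      set y := a + t * (x - a) with hy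
      have hya : a < y := by
        have := mul_pos ht0 (sub_pos.2 hxa); linarith
      have hmem : w₀ ∈ openSegment ℝ 0 (⟨σ * y, 0⟩ : ℂ) := by
        refine ⟨1 - a / y, a / y, by rw [sub_pos, div_lt_one (hre.trans hya)]; exact hya,
          div_pos hre (hre.trans hya), by ring, ?_⟩
        rw [hw₀]
        have : y ≠ 0 := (hre.trans hya).ne'
        apply Complex.ext
        · simp; field_simp
        · simp
      refine s.hor 0 h0 _ htV ?_ (by simp) (s.openSegment_subset h0 htV hmem)
      intro h
      have := congrArg Complex.re h
      simp only [Complex.zero_re] at this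
      have hσ0 : σ ≠ 0 := by rintro rfl; simp at hσ2
      exact (mul_ne_zero hσ0 (hre.trans hya).ne') this.symm
  -- Length two covers all points at horizontal distance at most one from the marked point, which is
  -- all that edges need.
  set K : Set ℂ := (fun x : ℝ => (⟨σ * x, 0⟩ : ℂ)) '' Icc 0 2 with hK
  have hKc : IsCompact K := isCompact_Icc.image (by
    have : (fun x : ℝ => (⟨σ * x, 0⟩ : ℂ)) = fun x : ℝ => ((σ * x : ℝ) : ℂ) := by
      funext x; apply Complex.ext <;> simp
    rw [this]; fun_prop)
  have hKD : K ⊆ D ∪ V := by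
    rintro _ ⟨x, hx, rfl⟩
    rcases eq_or_lt_of_le hx.1 with rfl | hx0
    · right
      convert h0 using 1
      apply Complex.ext <;> simp
    · exact Or.inl (hray x hx0)
  obtain ⟨ε, hε, hth⟩ := s.exists_thickening hKc hKD
  refine ⟨ε, hε, ?_⟩
  have hC : StarConvex ℝ w₀ {w : ℂ | 0 < σ * w.re ∧ σ * w.re < 2 ∧ |w.im| < ε} := by
    rintro y ⟨h1, h2, h3⟩ α β hα hβ hαβ
    have e1 : (α • w₀ + β • y).re = α * w₀.re + β * y.re := by simp
    have e2 : (α • w₀ + β • y).im = β * y.im := by simp [him]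
    refine ⟨?_, ?_, ?_⟩
    · rw [e1]
      rcases eq_or_lt_of_le hα with rfl | hα
      · obtain rfl : β = 1 := by linarith
        simpa using h1
      · have := mul_pos hα hre
        have := mul_nonneg hβ h1.le
        rw [ha] at *
        linarith
    · rw [e1]
      obtain rfl : α = 1 - β := by linarith
      rcases eq_or_lt_of_le hβ with rfl | hβ
      · simpa using hre'
      · have := mul_lt_mul_of_pos_left h2 hβ
        have := mul_le_mul_of_nonneg_left hre'.le hα
        rw [ha] at *
        linarith
    · rw [e2, abs_mul, abs_of_nonneg hβ]
      calc β * |y.im| ≤ 1 * |y.im| := by gcongr; linarith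
        _ < ε := by linarith
  have := s.subset_of_disjoint hC fun w hw hwV => by
    obtain ⟨h1, h2, h3⟩ := hw
    have hmem : (⟨σ * (σ * w.re), 0⟩ : ℂ) ∈ K := ⟨_, ⟨h1.le, h2.le⟩, rfl⟩
    rw [← mul_assoc, hσ2, one_mul] at hmem
    have hwK := hth w hwV ⟨_, hmem, by
      rw [Complex.dist_eq]
      have : w - ⟨w.re, 0⟩ = w.im * Complex.I := by apply Complex.ext <;> simp
      rw [this, norm_mul, Complex.norm_I, mul_one, Complex.norm_real]
      exact h3⟩
    obtain ⟨x, hx, rfl⟩ := hwK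
    simp only [← mul_assoc, hσ2, one_mul] at h1
    exact s.notMem hwV (hray x h1)
  exact fun w h1 h2 h3 => this ⟨h1, h2, h3⟩

/-- There is an edge of positive slope going up from the end point of a separatrix. -/
theorem exists_edge_up (s : KeaneView w₀ D V) (h0 : (0 : ℂ) ∈ V) (him : w₀.im = 0)
    (hre : 0 < w₀.re) (hre' : w₀.re < 1) : ∃ c ∈ V, 0 < c.re ∧ 0 < c.im ∧ Spans D 0 c := by
  obtain ⟨ε, hε, hcol⟩ := s.exists_collar (Or.inl rfl) h0 him (by simpa using hre)
    (by linarith)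
  have hw₀ : ∀ h > 0, w₀ ∈ Ioo 0 1 ×ℂ Ioo (-ε) h := fun h hh =>
    Complex.mem_reProdIm.2 ⟨⟨hre, hre'⟩, by rw [him]; linarith, by rw [him]; exact hh⟩
  -- `Ioc` leaves out the vertical side through `0`, so the marked point `0` does not stop the
  -- raising.
  obtain ⟨h, hh, hD, c, hcV, hcre, hcim⟩ := s.exists_raise (x₀ := 0) (x₁ := 1) (y₀ := -ε) (y₁ := ε)
    (J := Ioc 0 1) (convex_Ioc _ _) Ioo_subset_Ioc_self Ioc_subset_Icc_self (hw₀ ε hε)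
    (fun w hw => by
      rw [Complex.mem_reProdIm] at hw
      exact hcol w (by linarith [hw.1.1]) (by linarith [hw.1.2]) (abs_lt.2 hw.2))
  have hh0 : 0 < h := by linarith
  have hR : Ioo 0 1 ×ℂ Ioo (-ε) h ⊆ D := fun w hw => hD (by
    rw [Complex.mem_reProdIm] at hw ⊢; exact ⟨Ioo_subset_Ioc_self hw.1, hw.2⟩)
  have hcl := s.closure_subset (convex_rect _ _ _ _) (isOpen_rect _ _ _ _) (hw₀ h hh0) hR
  have hcr := closure_rect (x₀ := 0) (x₁ := 1) (y₀ := -ε) (y₁ := h) one_pos (by linarith)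
  set K : Set ℂ := {0} ×ℂ Icc 0 h with hK
  have hKc : IsCompact K := isCompact_singleton.reProdIm isCompact_Icc
  have hKR : K ⊆ closure (Ioo 0 1 ×ℂ Ioo (-ε) h) := fun w hw => by
    rw [hcr]
    rw [Complex.mem_reProdIm] at hw ⊢
    rw [mem_singleton_iff] at hw
    exact ⟨by rw [hw.1]; simp, by linarith [hw.2.1], hw.2.2⟩
  obtain ⟨δ, hδ, hth⟩ := s.exists_thickening hKc (hKR.trans hcl)
  have h0K : (0 : ℂ) ∈ K := Complex.mem_reProdIm.2 ⟨rfl, le_rfl, hh0.le⟩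
  have hKV : ∀ v ∈ V, v ∈ K → v = 0 := by
    intro v hv hvK
    by_contra hne
    refine s.false_of_vertical (convex_rect _ _ _ _) (isOpen_rect _ _ _ _) (hw₀ h hh0) hR hv h0
      (hKR hvK) (hKR h0K) hne ?_
    rw [Complex.mem_reProdIm] at hvK
    exact hvK.1
  -- The raised rectangle has width only one. Its left side carries no visible point besides `0`, so
  -- strictly above the separatrix it can be moved left by `δ`, which makes the window wider than
  -- one. The enlarged region is star-shaped about `w₀` without being convex.
  have hsub := s.subset_of_disjoint (C := Ioo 0 1 ×ℂ Ioo (-ε) h ∪ Ioc (-δ) 0 ×ℂ Ioo 0 h) ?_ ?_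
  · refine ⟨c, hcV, hcre.1, by linarith, -δ, 1, by linarith, ⟨by simpa using hδ.le, by simp⟩,
      ⟨by linarith [hcre.1], hcre.2⟩, ?_, by simpa using hcre.1.ne, by
        rw [hcim]; simpa using hh0.ne, ?_⟩
    · rw [abs_le]; simp only [Complex.zero_re]; constructor <;> linarith [hcre.1, hcre.2]
    · rw [hcim, Complex.zero_im, uIoo_of_lt hh0]
      intro w hw
      apply hsub
      rw [Complex.mem_reProdIm] at hw
      rcases le_or_gt w.re 0 with h | h
      · exact Or.inr (Complex.mem_reProdIm.2 ⟨⟨hw.1.1, h⟩, hw.2⟩)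
      · exact Or.inl (Complex.mem_reProdIm.2 ⟨⟨h, hw.1.2⟩, by linarith [hw.2.1], hw.2.2⟩)
  · rintro y hy α β hα hβ hαβ
    rcases hy with hy | hy
    · exact Or.inl (convex_rect _ _ _ _ (hw₀ h hh0) hy hα hβ hαβ)
    rw [Complex.mem_reProdIm] at hy
    have e1 : (α • w₀ + β • y).re = α * w₀.re + β * y.re := by simp
    have e2 : (α • w₀ + β • y).im = β * y.im := by simp [him]
    rcases eq_or_lt_of_le hβ with rfl | hβ
    · obtain rfl : α = 1 := by linarith
      left; simpa using hw₀ h hh0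
    obtain rfl : α = 1 - β := by linarith
    have hbi : 0 < β * y.im := mul_pos hβ hy.2.1
    have hbi' : β * y.im < h := by nlinarith [hy.2.2, hy.2.1]
    have hbr : -δ < (1 - β) * w₀.re + β * y.re := by
      have h1 := mul_nonneg hα hre.le
      nlinarith [hy.1.1, hy.1.2]
    have hbr' : (1 - β) * w₀.re + β * y.re < 1 := by
      have h1 := mul_nonneg hβ.le (by linarith [hy.1.2] : 0 ≤ -y.re)
      nlinarith
    rcases le_or_gt ((1 - β) * w₀.re + β * y.re) 0 with h | h
    · right
      rw [Complex.mem_reProdIm, e1, e2]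
      exact ⟨⟨hbr, h⟩, hbi, hbi'⟩
    · left
      rw [Complex.mem_reProdIm, e1, e2]
      exact ⟨⟨h, hbr'⟩, by linarith, hbi'⟩
  · rintro v (hv | hv) hvV
    · exact s.notMem hvV (hR hv)
    · rw [Complex.mem_reProdIm] at hv
      have hvK := hth v hvV ⟨⟨0, v.im⟩, Complex.mem_reProdIm.2 ⟨rfl, hv.2.1.le, hv.2.2.le⟩, by
        rw [Complex.dist_eq]
        have : v - ⟨0, v.im⟩ = v.re := by apply Complex.ext <;> simp
        rw [this, Complex.norm_real, Real.norm_eq_abs, abs_lt]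
        exact ⟨hv.1.1, by linarith [hv.1.2]⟩⟩
      have := hKV v hvV hvK
      rw [this] at hv
      simp at hv

theorem exists_edge_down (s : KeaneView w₀ D V) (h0 : (0 : ℂ) ∈ V) (him : w₀.im = 0)
    (hre : 0 < w₀.re) (hre' : w₀.re < 1) : ∃ c ∈ V, 0 < c.re ∧ c.im < 0 ∧ Spans D 0 c := by
  have hr : ∀ w, (Complex.conjLIE w).re = 1 * w.re := by simp
  have hi : ∀ w, (Complex.conjLIE w).im = -1 * w.im := by simp
  have hcc : ∀ w, Complex.conjLIE (Complex.conjLIE w) = w := fun w => by simp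
  have s' := s.comp Complex.conjLIE (Or.inl rfl) (Or.inr rfl) hr hi
  obtain ⟨c, hc, h1, h2, h3⟩ := s'.exists_edge_up (by simpa using h0) (by simpa using him)
    (by simpa using hre) (by simpa using hre')
  refine ⟨Complex.conjLIE c, hc, by simpa using h1, by simpa using h2, ?_⟩
  have hsub : Complex.conjLIE ⁻¹' (Complex.conjLIE ⁻¹' D) = D := by
    ext w; simp
  rw [← hsub]
  exact Spans.comp (Or.inl rfl) (Or.inr rfl) hr hi (by rw [hcc]; simpa using h3)

end KeaneView

namespace HalfTranslationStructure

variable {S : Type*} [TopologicalSpace S] {q : HalfTranslationStructure S}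

/-- A sky on a horizontal separatrix of a cone germ. -/
theorem IsConeChart.exists_side_sky [T2Space S] [CompactSpace S] {z : S} (hz : z ∈ q.Z) {k : ℕ}
    {φ : OpenPartialHomeomorph S ℂ} (h : q.IsConeChart z k φ) {ρ : ℝ} (hρ : 0 < ρ)
    (hfr : ∀ u ζ : ℂ, u ≠ 0 → ζ ^ k = u ^ 2 →
      (∀ w, ‖w‖ < ρ → coneGerm φ k u ζ w ∈ φ.source ∧
        φ (coneGerm φ k u ζ w) = ζ * (w / u) ^ ((2 : ℂ) / k)) ∧
      q.Free (slitBall u ρ) (coneGerm φ k u ζ)) {ζ : ℂ} (hζ : ζ ^ k = -1) {σ : ℝ}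
    (hσ : σ = 1 ∨ σ = -1) :
    ∃ w₀ f D V, q.Sky w₀ f D V ∧ (0 : ℂ) ∈ V ∧ f 0 = z ∧ w₀.im = 0 ∧ 0 < σ * w₀.re ∧
      σ * w₀.re < 1 ∧ ∀ w : ℂ, 0 < σ * w.re → ‖w‖ < ρ →
        w ∈ D ∧ f w = coneGerm φ k Complex.I ζ w := by
  have hσ2 : σ * σ = 1 := by rcases hσ with rfl | rfl <;> norm_num
  set G := coneGerm φ k Complex.I ζ with hG
  have hfree := (hfr Complex.I ζ Complex.I_ne_zero (by rw [hζ, Complex.I_sq])).2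
  set H : Set ℂ := {w | 0 < σ * w.re ∧ ‖w‖ < ρ} with hH
  -- With `u = I` the slit is the downward vertical ray, and the half-disc on either side of the
  -- vertical axis avoids it.
  have hHs : H ⊆ slitBall Complex.I ρ := by
    rintro w ⟨h1, h2⟩
    refine ⟨h2, Or.inr ?_⟩
    rw [Complex.div_I]
    intro h
    simp at h
    rw [h] at h1
    simp at h1
  have hH1 : IsOpen {w : ℂ | 0 < σ * w.re} := isOpen_lt continuous_const (by fun_prop)
  have hHo : IsOpen H := hH1.inter (isOpen_lt continuous_norm continuous_const)
  have h0H : (0 : ℂ) ∉ H := fun h => by simpa using h.1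
  set r := min ρ 1 / 2 with hr
  have hr0 : 0 < r := by positivity
  have hrρ : r < ρ := by have := min_le_left ρ 1; rw [hr]; linarith
  have hr1 : r < 1 := by have := min_le_right ρ 1; rw [hr]; linarith
  set w₀ : ℂ := ((σ * r : ℝ) : ℂ) with hw₀
  have hw₀re : σ * w₀.re = r := by rw [hw₀, Complex.ofReal_re, ← mul_assoc, hσ2, one_mul]
  have hw₀H : w₀ ∈ H := by
    refine ⟨by rw [hw₀re]; exact hr0, ?_⟩
    rw [hw₀, Complex.norm_real, norm_mul, Real.norm_of_nonneg hr0.le]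
    rcases hσ with rfl | rfl <;> simpa using hrρ
  have hflat : q.IsFlatMap (H ∪ {0}) {0} G := by
    have hfH := hfree.mono hHs
    refine ⟨?_, ?_, ?_, ?_⟩
    · rintro w (hw | rfl)
      · exact ((hfH.continuousOn.continuousAt (hHo.mem_nhds hw))).continuousWithinAt
      · exact (h.continuousAt_coneGerm_zero _ _).continuousWithinAt
    · rintro w rfl
      rw [hG, h.coneGerm_zero]; exact hz
    · rintro w ⟨hw | hw, hw0⟩
      · exact hfH.notMem hw
      · exact (hw0 hw).elim
    · rintro w ⟨hw | hw, hw0⟩ ψ hψ hs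
      · obtain ⟨h, hh, he⟩ := hfH.chart_of_mem hw hψ hs
        rw [hHo.nhdsWithin_eq hw] at he
        exact ⟨h, hh, (he.filter_mono nhdsWithin_le_nhds).mono fun w hw => hw.2⟩
      · exact (hw0 hw).elim
  obtain ⟨f, D, V, s, hf⟩ := exists_sky_of_free (hfree.mono hHs) hw₀H
  have hdiff : (H ∪ {0}) \ {0} = H := by
    ext w; constructor
    · rintro ⟨hw | hw, h⟩
      exacts [hw, (h hw).elim]
    · exact fun hw => ⟨Or.inl hw, fun h => h0H (h ▸ hw)⟩
  have hstar : ∀ k ∈ H ∪ {0}, ∀ t : ℝ, 0 ≤ t → t < 1 → w₀ + t * (k - w₀) ∈ (H ∪ {0}) \ {0} := by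
    intro k hk t ht ht1
    rw [hdiff]
    have hk' : 0 ≤ σ * k.re ∧ ‖k‖ < ρ := by
      rcases hk with hk | rfl
      · exact ⟨hk.1.le, hk.2⟩
      · simpa using hρ
    refine ⟨?_, ?_⟩
    · have : σ * (w₀ + t * (k - w₀)).re = (1 - t) * (σ * w₀.re) + t * (σ * k.re) := by
        simp; ring
      rw [this, hw₀re]
      have := mul_pos (by linarith : 0 < 1 - t) hr0
      have := mul_nonneg ht hk'.1
      linarith
    · have := (convex_ball (0 : ℂ) ρ).add_smul_sub_mem (x := w₀) (y := k)
        (by simpa using hw₀H.2) (by simpa using hk'.2) ⟨ht, ht1.le⟩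
      simpa using this
  obtain ⟨h1, h2, h3⟩ := s.fit hflat hstar (by rwa [hdiff])
  refine ⟨w₀, f, D, V, s, h2 ⟨by simp, rfl⟩, ?_, by simp [hw₀], by rw [hw₀re]; exact hr0,
    by rw [hw₀re]; exact hr1, fun w hw hw' =>
      ⟨h1 (by rw [hdiff]; exact ⟨hw, hw'⟩), h3 (Or.inl ⟨hw, hw'⟩)⟩⟩
  rw [h3 (by simp), hG, h.coneGerm_zero]

/-- Every marked point lies on edges of positive and of negative slope. -/
theorem exists_edges_at [T2Space S] [CompactSpace S] [ConnectedSpace S] (hq : q.IsKeane) {z : S}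
    (hz : z ∈ q.Z) : (∃ e ∈ q.delaunayEdges, z ∈ e ∧ q.IsRed e) ∧
      ∃ e ∈ q.delaunayEdges, z ∈ e ∧ q.IsBlue e := by
  obtain ⟨k, φ, h⟩ := exists_coneChart hz
  obtain ⟨ρ, hρ, hfr⟩ := h.exists_radius
  obtain ⟨ζ, hζ⟩ := IsAlgClosed.exists_pow_nat_eq (-1 : ℂ) h.one_le
  obtain ⟨w₀, f, D, V, s, h0, hfz, him, hre, hre', -⟩ :=
    h.exists_side_sky hz hρ hfr hζ (Or.inl rfl)
  rw [one_mul] at hre hre'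
  have sv := s.keaneView hq
  have hO : ∀ {X Y : ℂ}, Spans D X Y → openSegment ℝ X Y ⊆ D := fun h => by
    obtain ⟨W, hW, -, -, hs, -⟩ := h.exists_window
    exact hs.trans hW
  constructor
  · obtain ⟨c, hc, h1, h2, hs⟩ := sv.exists_edge_up h0 him hre hre'
    refine ⟨_, s.mem_delaunayEdges h0 hc hs, ⟨0, left_mem_segment _ _ _, hfz⟩, ?_⟩
    rw [(s.flatMap_segment h0 hc (hO hs)).isRed_iff hs.ne]
    simpa using mul_pos h1 h2
  · obtain ⟨c, hc, h1, h2, hs⟩ := sv.exists_edge_down h0 him hre hre'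
    refine ⟨_, s.mem_delaunayEdges h0 hc hs, ⟨0, left_mem_segment _ _ _, hfz⟩, ?_⟩
    rw [(s.flatMap_segment h0 hc (hO hs)).isBlue_iff hs.ne]
    simpa using mul_neg_of_pos_of_neg h1 h2

end HalfTranslationStructure

/-! ### Finiteness of the set of edges. -/

theorem openSegment_subset_rect {P Q : ℂ} {x₀ x₁ : ℝ} (hP : P.re ∈ Icc x₀ x₁) (hQ : Q.re ∈ Icc x₀ x₁)
    (hre : P.re ≠ Q.re) (him : P.im < Q.im) :
    openSegment ℝ P Q ⊆ Ioo x₀ x₁ ×ℂ Ioo P.im Q.im := by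
  rintro _ ⟨a, b, ha, hb, hab, rfl⟩
  rw [Complex.mem_reProdIm]
  simp only [Complex.add_re, Complex.smul_re, Complex.add_im, Complex.smul_im, smul_eq_mul]
  obtain rfl : b = 1 - a := by linarith
  refine ⟨?_, by nlinarith, by nlinarith⟩
  rcases lt_or_gt_of_ne hre with h | h
  · constructor <;> nlinarith [hP.1, hP.2, hQ.1, hQ.2]
  · constructor <;> nlinarith [hP.1, hP.2, hQ.1, hQ.2]

namespace HalfTranslationStructure

variable {S : Type*} [TopologicalSpace S] {q : HalfTranslationStructure S}

/-- Only finitely many edges ending at the origin have a window around a given point. -/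
theorem Sky.finite_edges_of_base [T2Space S] [CompactSpace S] [ConnectedSpace S] (hq : q.IsKeane)
    {w₀ : ℂ} {f : ℂ → S} {D V : Set ℂ} (s : q.Sky w₀ f D V) {a b ε : ℝ} (ha : a < w₀.re)
    (hb : w₀.re < b) (hy : 0 < w₀.im) (hε : w₀.im < ε) :
    {e | ∃ (c : ℂ) (x₀ x₁ : ℝ) (g : ℂ → S), x₀ ≤ a ∧ b ≤ x₁ ∧ (0 : ℝ) ∈ Icc x₀ x₁ ∧
      c.re ∈ Icc x₀ x₁ ∧ |c.re| ≤ 1 ∧ c.re ≠ 0 ∧ ε ≤ c.im ∧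
      q.IsFlatMap (Ioo x₀ x₁ ×ℂ Ioo 0 c.im ∪ {0, c}) {0, c} g ∧ g =ᶠ[𝓝 w₀] f ∧
      e = g '' segment ℝ 0 c}.Finite := by
  set K : Set ℂ := {c | c ∈ V ∧ ∃ x₀ x₁ : ℝ, x₀ ≤ a ∧ b ≤ x₁ ∧ (0 : ℝ) ∈ Icc x₀ x₁ ∧
    c.re ∈ Icc x₀ x₁ ∧ |c.re| ≤ 1 ∧ c.re ≠ 0 ∧ ε ≤ c.im ∧ Ioo x₀ x₁ ×ℂ Ioo 0 c.im ⊆ D} with hK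
  have hKfin : K.Finite := by
    set r := min (min (w₀.re - a) (b - w₀.re)) (min w₀.im (ε - w₀.im)) with hr
    have hr0 : 0 < r := lt_min (lt_min (by linarith) (by linarith)) (lt_min hy (by linarith))
    refine s.starView.finite_of_windows (fun c hc => hc.1) ?_ hr0 ?_
    -- Windows over `(a, b)` of unbounded height would exhaust a half-infinite vertical strip.
    · have hbd : ∃ H, ∀ c ∈ K, c.im ≤ H := by
        by_contra! hH
        refine (s.keaneView hq).up a b 0 (ha.trans hb) fun w hw => ?_
        rw [Complex.mem_reProdIm] at hw
        obtain ⟨c, ⟨-, x₀, x₁, h1, h2, -, -, -, -, -, h8⟩, hcw⟩ := hH w.im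
        exact h8 (Complex.mem_reProdIm.2
          ⟨⟨h1.trans_lt hw.1.1, hw.1.2.trans_le h2⟩, hw.2, hcw⟩)
      obtain ⟨H, hH⟩ := hbd
      refine (Metric.isBounded_Icc (-1 : ℝ) 1 |>.reProdIm (Metric.isBounded_Icc (0 : ℝ) H)).subset ?_
      intro c hc
      obtain ⟨-, x₀, x₁, -, -, -, -, h5, -, h7, -⟩ := id hc
      exact Complex.mem_reProdIm.2 ⟨abs_le.1 h5, by linarith, hH c hc⟩
    · rintro c ⟨-, x₀, x₁, h1, h2, h3, h4, -, h6, h7, h8⟩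
      refine ⟨_, h8, convex_rect _ _ _ _, isOpen_rect _ _ _ _, ?_, ?_⟩
      · refine (ball_subset_reProdIm _ _).trans fun w hw => ?_
        have r1 : r ≤ w₀.re - a := (min_le_left _ _).trans (min_le_left _ _)
        have r2 : r ≤ b - w₀.re := (min_le_left _ _).trans (min_le_right _ _)
        have r3 : r ≤ w₀.im := (min_le_right _ _).trans (min_le_left _ _)
        have r4 : r ≤ ε - w₀.im := (min_le_right _ _).trans (min_le_right _ _)
        rw [Complex.mem_reProdIm] at hw ⊢
        exact ⟨⟨by linarith [hw.1.1], by linarith [hw.1.2]⟩, by linarith [hw.2.1],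
          by linarith [hw.2.2]⟩
      · rw [closure_rect (by linarith) (by linarith)]
        exact Complex.mem_reProdIm.2 ⟨h4, by linarith, le_rfl⟩
  refine (hKfin.image fun c => f '' segment ℝ 0 c).subset ?_
  rintro e ⟨c, x₀, x₁, g, h1, h2, h3, h4, h5, h6, h7, hg, he, rfl⟩
  have hseg : openSegment ℝ 0 c ⊆ Ioo x₀ x₁ ×ℂ Ioo 0 c.im := by
    have := openSegment_subset_rect (P := 0) (Q := c) (by simpa using h3) h4
      (by simpa using h6.symm) (by simp only [Complex.zero_im]; linarith)
    simpa using this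
  have hw : w₀ ∈ Ioo x₀ x₁ ×ℂ Ioo 0 c.im :=
    Complex.mem_reProdIm.2 ⟨⟨by linarith, by linarith⟩, hy, by linarith⟩
  obtain ⟨-, hstar⟩ := window_star (isOpen_rect _ _ _ _) (convex_rect _ _ _ _) hseg
    (fun h => by simpa using (Complex.mem_reProdIm.1 h).2.1)
    (fun h => by simpa using (Complex.mem_reProdIm.1 h).2.2) hw
  obtain ⟨hD, hV, heq⟩ := s.fit hg hstar (he.filter_mono nhdsWithin_le_nhds)
  refine ⟨c, ⟨hV ⟨by simp, by simp⟩, x₀, x₁, h1, h2, h3, h4, h5, h6, h7, fun w hw => ?_⟩, ?_⟩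
  · refine hD (window_star (isOpen_rect _ _ _ _) (convex_rect _ _ _ _) hseg
      (fun h => by simpa using (Complex.mem_reProdIm.1 h).2.1)
      (fun h => by simpa using (Complex.mem_reProdIm.1 h).2.2) hw).1
  · refine image_congr fun w hw => heq ?_
    rw [← insert_endpoints_openSegment] at hw
    rcases hw with rfl | rfl | hw
    · simp
    · simp
    · exact Or.inl (hseg hw)

/-- The maps cannot be compared at the cone point `0`, which lies outside `A`. Approaching along `t
* v` reaches a point of `A` near which both equal the cone germ `G`. -/
theorem Free.eqOn_of_germ [T2Space S] {A : Set ℂ} {f g G : ℂ → S} {v : ℂ} {σ ρ : ℝ}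
    (hg : q.Free A g) (hf : q.Free A f) (hA : IsPreconnected A) (hσ : ∀ w ∈ A, 0 < σ * w.re)
    (hv : ∀ t : ℝ, 0 < t → t ≤ 1 → t * v ∈ A) (hρ : 0 < ρ)
    (hgG : ∀ᶠ w in 𝓝[A] 0, g w = G w) (hfG : ∀ w : ℂ, 0 < σ * w.re → ‖w‖ < ρ → f w = G w) :
    EqOn g f A := by
  obtain ⟨r, hr, hrA⟩ := Metric.mem_nhdsWithin_iff.1 hgG
  have hT : Tendsto (fun t : ℝ => (t : ℂ) * v) (𝓝[>] 0) (𝓝 0) :=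
    (Continuous.tendsto' (by fun_prop) _ _ (by simp)).mono_left nhdsWithin_le_nhds
  obtain ⟨t, ht, ht0, ht1⟩ := ((hT.eventually (Metric.ball_mem_nhds 0 (lt_min hr hρ))).and
    (Ioc_mem_nhdsGT one_pos)).exists
  have hp := hv t ht0 ht1
  refine hg.eqOn hf hA hp ?_
  filter_upwards [mem_nhdsWithin_of_mem_nhds (Metric.isOpen_ball.mem_nhds ht),
    self_mem_nhdsWithin] with w hw hwA
  have h1 : w ∈ Metric.ball (0 : ℂ) r := Metric.ball_subset_ball (min_le_left _ _) hw
  have h2 : ‖w‖ < ρ := by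
    have := Metric.ball_subset_ball (min_le_right r ρ) hw
    simpa using this
  rw [hfG w (hσ w hwA) h2]
  exact hrA ⟨h1, hwA⟩

/-- The edge `e` issues upwards from the marked point `z` in the sector given by `ζ`. -/
def Emanates (q : HalfTranslationStructure S) (z : q.Z) (ζ : ℂ) (e : Set S) : Prop :=
  ∃ (c : ℂ) (x₀ x₁ : ℝ) (g : ℂ → S), 1 < x₁ - x₀ ∧ (0 : ℝ) ∈ Icc x₀ x₁ ∧ c.re ∈ Icc x₀ x₁ ∧
    |c.re| ≤ 1 ∧ c.re ≠ 0 ∧ 0 < c.im ∧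
    q.IsFlatMap (Ioo x₀ x₁ ×ℂ Ioo 0 c.im ∪ {0, c}) {0, c} g ∧
    (∀ᶠ w in 𝓝[Ioo x₀ x₁ ×ℂ Ioo 0 c.im] 0,
      g w = coneGerm (q.coneChart z) (q.coneIndex z) Complex.I ζ w) ∧
    e = g '' segment ℝ 0 c

/-- Put the lower end at the origin and read off `ζ` from the germ at a nearby point of the segment.
A cone point of angle `k π` has `k` upward vertical directions, which the roots of `ζ ^ k = -1`
label. -/
theorem exists_emanates [T2Space S] {e : Set S}
    (he : e ∈ q.delaunayEdges) : ∃ z : q.Z, ∃ ζ, ζ ^ q.coneIndex z = -1 ∧ q.Emanates z ζ e := by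
  obtain ⟨w₁, f, D, V, P, Q, s, hP, hQ, him, hs, rfl⟩ : ∃ w₀ f D V P Q, q.Sky w₀ f D V ∧ P ∈ V ∧
      Q ∈ V ∧ P.im < Q.im ∧ Spans D P Q ∧ e = f '' segment ℝ P Q := by
    obtain ⟨w₀, f, D, V, P, Q, s, hP, hQ, h0, hs, rfl⟩ := he
    have him : P.im ≠ Q.im := by
      obtain ⟨_, _, _, _, _, _, _, h, _⟩ := hs
      exact h
    rcases lt_or_gt_of_ne him with h | h
    · exact ⟨w₀, f, D, V, P, Q, s, hP, hQ, h, hs, rfl⟩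
    · exact ⟨w₀, f, D, V, Q, P, s, hQ, hP, h, hs.symm, by rw [segment_symm]⟩
  obtain ⟨x₀, x₁, h1, h2, h3, h4, h5, -, hWD⟩ := hs
  rw [uIoo_of_lt him] at hWD
  set z : q.Z := ⟨f P, s.map_V P hP⟩ with hz
  have hcone := q.isConeChart_coneChart z
  obtain ⟨ρ, hρ, hfr⟩ := hcone.exists_radius
  have hgerm := s.germ P hP
  obtain ⟨δ, hδ, hball⟩ := Metric.mem_nhdsWithin_iff.1 hgerm
  set c := Q - P with hc
  have hcim : 0 < c.im := by simp only [hc, Complex.sub_im]; linarith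
  set W : Set ℂ := Ioo (x₀ - P.re) (x₁ - P.re) ×ℂ Ioo 0 c.im with hW
  have hsh : ∀ w, w ∈ W ↔ w + P ∈ Ioo x₀ x₁ ×ℂ Ioo P.im Q.im := by
    intro w
    rw [hW, Complex.mem_reProdIm, Complex.mem_reProdIm]
    simp only [hc, mem_Ioo, Complex.sub_im, Complex.add_re, Complex.add_im]
    constructor <;> rintro ⟨⟨a1, a2⟩, a3, a4⟩ <;> exact ⟨⟨by linarith, by linarith⟩, by linarith,
      by linarith⟩
  have hsegP := openSegment_subset_rect h2 h3 h5 him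
  have hT : Tendsto (fun t : ℝ => (t : ℂ) * c) (𝓝[>] 0) (𝓝 0) :=
    (Continuous.tendsto' (by fun_prop) _ _ (by simp)).mono_left nhdsWithin_le_nhds
  obtain ⟨t, ht, ht0, ht1⟩ := ((hT.eventually (Metric.ball_mem_nhds 0 (lt_min hδ hρ))).and
    (Ioo_mem_nhdsGT one_pos)).exists
  rw [dist_zero_right] at ht
  have htP : P + t * c ∈ openSegment ℝ P Q := by
    rw [openSegment_eq_image']; exact ⟨t, ⟨ht0, ht1⟩, by simp [hc]⟩
  have htD : P + t * c ∈ D := hWD (hsegP htP)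
  have htball : P + t * c ∈ Metric.ball P δ := by
    rw [Metric.mem_ball, dist_eq_norm, add_sub_cancel_left]
    exact ht.trans_le (min_le_left _ _)
  obtain ⟨ζ, hζ, heq⟩ := hcone.eventuallyEq_coneGerm hfr (c := P) (u := Complex.I) s.isOpen s.free htD
    (hball ⟨htball, htD⟩).1 Complex.I_ne_zero (by
      filter_upwards [(Metric.isOpen_ball.inter s.isOpen).mem_nhds ⟨htball, htD⟩] with w hw
      exact (hball hw).2) (by
      rw [add_sub_cancel_left]
      refine ⟨ht.trans_le (min_le_right _ _), Or.inl ?_⟩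
      rw [Complex.div_I]
      simpa using mul_pos ht0 hcim)
  rw [Complex.I_sq] at hζ
  have hflat : q.IsFlatMap (W ∪ {0, c}) {0, c} (fun w => f (w + P)) := by
    have := (s.flatMap_window hWD hP hQ).comp (isHalfTranslation_add P)
    refine (this.mono (D' := W ∪ {0, c}) (V' := {0, c}) ?_ ?_ ?_)
    · rintro w (hw | rfl | rfl)
      · exact Or.inl ((hsh w).1 hw)
      · simp
      · simp [hc]
    · rintro w (rfl | rfl)
      · simp
      · simp [hc]
    · rintro w ⟨-, hw⟩
      rcases hw with hw | hw
      · left; simpa using hw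
      · right; rw [mem_singleton_iff, hc, ← mem_singleton_iff.1 hw]; simp
  refine ⟨z, ζ, hζ, c, x₀ - P.re, x₁ - P.re, fun w => f (w + P), by linarith,
    ⟨by linarith [h2.1], by linarith [h2.2]⟩,
    ⟨by simp only [hc, Complex.sub_re]; linarith [h3.1],
      by simp only [hc, Complex.sub_re]; linarith [h3.2]⟩,
    by rw [abs_sub_comm] at h4; simpa [hc] using h4, ?_, hcim, hflat, ?_, ?_⟩
  · simp only [hc, Complex.sub_re]
    exact sub_ne_zero.2 h5.symm
  · have hA : Convex ℝ (W ∩ Metric.ball 0 ρ) := (convex_rect _ _ _ _).inter (convex_ball _ _)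
    have hAs : W ∩ Metric.ball 0 ρ ⊆ slitBall Complex.I ρ := by
      rintro w ⟨hw, hwρ⟩
      refine ⟨by simpa using hwρ, Or.inl ?_⟩
      rw [Complex.div_I]
      rw [hW, Complex.mem_reProdIm] at hw
      simpa using hw.2.1
    have hfree := (hfr Complex.I ζ Complex.I_ne_zero (by rw [hζ, Complex.I_sq])).2
    have hmem : (t : ℂ) * c ∈ W ∩ Metric.ball 0 ρ := by
      refine ⟨(hsh _).2 ?_, by simpa using ht.trans_le (min_le_right _ _)⟩
      rw [add_comm]; exact hsegP htP
    have hfW : q.Free (W ∩ Metric.ball 0 ρ) (fun w => f (w + P)) :=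
      (s.free.comp (isHalfTranslation_add P)).mono fun w hw => hWD ((hsh w).1 hw.1)
    have := hfW.eqOn (hfree.mono hAs) hA.isPreconnected hmem (by
      have hT' : Tendsto (fun w : ℂ => w + P) (𝓝 ((t : ℂ) * c)) (𝓝 (P + t * c)) :=
        Continuous.tendsto' (by fun_prop) _ _ (add_comm _ _)
      filter_upwards [(hT'.eventually heq).filter_mono nhdsWithin_le_nhds] with w hw
      rw [hw, add_sub_cancel_right])
    filter_upwards [mem_nhdsWithin_of_mem_nhds (Metric.ball_mem_nhds (0 : ℂ) hρ),
      self_mem_nhdsWithin] with w hw hwW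
    exact this ⟨hwW, hw⟩
  · have := (isHalfTranslation_add P).image_segment 0 c
    rw [zero_add, hc, sub_add_cancel] at this
    rw [← this, image_image]

/-- A very low edge would run inside the collar of a horizontal separatrix and end at an unmarked
point, so heights are bounded below. A window wider than one contains a fixed rectangle of width one
half on one side of the marked point. From the centre of that rectangle only finitely many upper
ends are possible (`finite_edges_of_base`). -/
theorem finite_emanates [T2Space S] [CompactSpace S] [ConnectedSpace S] (hq : q.IsKeane)
    (z : q.Z) {ζ : ℂ} (hζ : ζ ^ q.coneIndex z = -1) : {e | q.Emanates z ζ e}.Finite := by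
  have hcone := q.isConeChart_coneChart z
  obtain ⟨ρ, hρ, hfr⟩ := hcone.exists_radius
  -- on each side there is a collar of the horizontal separatrix, and a sky seeing the collar
  have side : ∀ σ : ℝ, σ = 1 ∨ σ = -1 → ∃ (w₁ : ℂ) (f : ℂ → S) (D V : Set ℂ) (ε : ℝ),
      q.Sky w₁ f D V ∧ 0 < ε ∧ (∀ w : ℂ, 0 < σ * w.re → σ * w.re < 2 → |w.im| < ε → w ∈ D) ∧
      ∀ w : ℂ, 0 < σ * w.re → ‖w‖ < ρ →
        f w = coneGerm (q.coneChart z) (q.coneIndex z) Complex.I ζ w := by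
    intro σ hσ
    obtain ⟨w₁, f, D, V, s, h0, -, him, hre, hre', hG⟩ :=
      hcone.exists_side_sky z.2 hρ hfr hζ hσ
    obtain ⟨ε, hε, hcol⟩ := (s.keaneView hq).exists_collar hσ h0 him hre (by linarith)
    exact ⟨w₁, f, D, V, ε, s, hε, hcol, fun w h1 h2 => (hG w h1 h2).2⟩
  have height : ∃ ε > 0, ∀ (c : ℂ) (x₀ x₁ : ℝ) (g : ℂ → S), (0 : ℝ) ∈ Icc x₀ x₁ →
      c.re ∈ Icc x₀ x₁ → |c.re| ≤ 1 → c.re ≠ 0 → 0 < c.im →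
      q.IsFlatMap (Ioo x₀ x₁ ×ℂ Ioo 0 c.im ∪ {0, c}) {0, c} g →
      (∀ᶠ w in 𝓝[Ioo x₀ x₁ ×ℂ Ioo 0 c.im] 0,
        g w = coneGerm (q.coneChart z) (q.coneIndex z) Complex.I ζ w) → ε ≤ c.im := by
    have one : ∀ σ : ℝ, σ = 1 ∨ σ = -1 → ∃ ε > 0, ∀ (c : ℂ) (x₀ x₁ : ℝ) (g : ℂ → S),
        (0 : ℝ) ∈ Icc x₀ x₁ → c.re ∈ Icc x₀ x₁ → |c.re| ≤ 1 → 0 < σ * c.re → 0 < c.im →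
        q.IsFlatMap (Ioo x₀ x₁ ×ℂ Ioo 0 c.im ∪ {0, c}) {0, c} g →
        (∀ᶠ w in 𝓝[Ioo x₀ x₁ ×ℂ Ioo 0 c.im] 0,
          g w = coneGerm (q.coneChart z) (q.coneIndex z) Complex.I ζ w) → ε ≤ c.im := by
      intro σ hσ
      obtain ⟨w₁, f, D, V, ε, s, hε, hcol, hG⟩ := side σ hσ
      refine ⟨ε, hε, fun c x₀ x₁ g h1 h2 h3 h4 h5 hg hgG => ?_⟩
      by_contra! hlt
      have hc0 : c.re ≠ 0 := by rintro h; simp [h] at h4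
      have hσc : σ * c.re < 2 := by
        rw [abs_le] at h3
        rcases hσ with rfl | rfl <;> linarith [h3.1, h3.2]
      have hseg : openSegment ℝ 0 c ⊆ Ioo x₀ x₁ ×ℂ Ioo 0 c.im := by
        have := openSegment_subset_rect (P := 0) (Q := c) (by simpa using h1) h2
          (by simpa using hc0.symm) (by simpa using h5)
        simpa using this
      have hside : ∀ w ∈ openSegment ℝ 0 c, 0 < σ * w.re ∧ σ * w.re < 2 ∧ |w.im| < ε := by
        rintro _ ⟨a, b, ha, hb, hab, rfl⟩
        have hb1 : b < 1 := by linarith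
        simp only [smul_zero, zero_add, Complex.smul_re, Complex.smul_im, smul_eq_mul]
        have e : σ * (b * c.re) = b * (σ * c.re) := by ring
        rw [e]
        refine ⟨by positivity, by nlinarith, ?_⟩
        rw [abs_of_pos (by positivity)]
        nlinarith
      have hsegD : openSegment ℝ 0 c ⊆ D := fun w hw => by
        obtain ⟨a1, a2, a3⟩ := hside w hw
        exact hcol w a1 a2 a3
      have hcD : c ∈ D := hcol c h4 hσc (by rwa [abs_of_pos h5])
      have hWfree : q.Free (Ioo x₀ x₁ ×ℂ Ioo 0 c.im) g := hg.free.mono fun w hw => by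
        refine ⟨Or.inl hw, ?_⟩
        rw [Complex.mem_reProdIm] at hw
        rintro (rfl | rfl)
        · simpa using hw.2.1
        · simpa using hw.2.2
      have hmid : (2⁻¹ : ℝ) • c ∈ openSegment ℝ 0 c :=
        ⟨2⁻¹, 2⁻¹, by norm_num, by norm_num, by norm_num, by simp⟩
      have heq := (hWfree.mono hseg).eqOn_of_germ (s.free.mono hsegD) (v := (2⁻¹ : ℝ) • c)
        (convex_openSegment 0 c).isPreconnected (fun w hw => (hside w hw).1) (fun t ht ht1 => by
          refine ⟨1 - t * 2⁻¹, t * 2⁻¹, by linarith, by positivity, by ring, ?_⟩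
          simp only [Complex.real_smul, mul_zero, zero_add]; push_cast; ring) hρ
        (hgG.filter_mono (nhdsWithin_mono _ hseg)) hG
      have hccl : c ∈ closure (openSegment ℝ 0 c) := by
        rw [closure_openSegment]; exact right_mem_segment _ _ _
      have hne : (𝓝[openSegment ℝ 0 c] c).NeBot := mem_closure_iff_nhdsWithin_neBot.1 hccl
      have l1 : Tendsto g (𝓝[openSegment ℝ 0 c] c) (𝓝 (g c)) :=
        (hg.continuousOn c (by simp)).tendsto.mono_left
          (nhdsWithin_mono _ fun w hw => Or.inl (hseg hw))
      have l2 : Tendsto f (𝓝[openSegment ℝ 0 c] c) (𝓝 (f c)) :=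
        (s.free.continuousOn c hcD).tendsto.mono_left (nhdsWithin_mono _ hsegD)
      have : g c = f c := tendsto_nhds_unique (l1.congr' (by
        filter_upwards [self_mem_nhdsWithin] with w hw using heq hw)) l2
      exact s.free.notMem hcD (this ▸ hg.vertices c (by simp))
    obtain ⟨ε₁, hε₁, H₁⟩ := one 1 (Or.inl rfl)
    obtain ⟨ε₂, hε₂, H₂⟩ := one (-1) (Or.inr rfl)
    refine ⟨min ε₁ ε₂, lt_min hε₁ hε₂, fun c x₀ x₁ g h1 h2 h3 h4 h5 hg hgG => ?_⟩
    rcases lt_or_gt_of_ne h4 with h | h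
    · exact (min_le_right _ _).trans (H₂ c x₀ x₁ g h1 h2 h3 (by linarith) h5 hg hgG)
    · exact (min_le_left _ _).trans (H₁ c x₀ x₁ g h1 h2 h3 (by linarith) h5 hg hgG)
  obtain ⟨ε, hε, hheight⟩ := height
  have fin : ∀ σ : ℝ, σ = 1 ∨ σ = -1 → ∃ F : Set (Set S), F.Finite ∧
      ∀ (c : ℂ) (x₀ x₁ : ℝ) (g : ℂ → S), (0 : ℝ) ∈ Icc x₀ x₁ →
      c.re ∈ Icc x₀ x₁ → |c.re| ≤ 1 → c.re ≠ 0 → 0 < c.im → x₀ ≤ min 0 (σ / 2) →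
      max 0 (σ / 2) ≤ x₁ →
      q.IsFlatMap (Ioo x₀ x₁ ×ℂ Ioo 0 c.im ∪ {0, c}) {0, c} g →
      (∀ᶠ w in 𝓝[Ioo x₀ x₁ ×ℂ Ioo 0 c.im] 0,
        g w = coneGerm (q.coneChart z) (q.coneIndex z) Complex.I ζ w) →
      g '' segment ℝ 0 c ∈ F := by
    intro σ hσ
    obtain ⟨w₁, f, D, V, ε', s, hε', hcol, hG⟩ := side σ hσ
    set η := min ε ε' with hη
    have hη0 : 0 < η := lt_min hε hε'
    set A : Set ℂ := Ioo (min 0 (σ / 2)) (max 0 (σ / 2)) ×ℂ Ioo 0 η with hA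
    have hAσ : ∀ w ∈ A, 0 < σ * w.re ∧ σ * w.re < 2 ∧ |w.im| < ε' := by
      intro w hw
      rw [hA, Complex.mem_reProdIm] at hw
      have h3 : |w.im| < ε' := by
        rw [abs_of_pos hw.2.1]; exact hw.2.2.trans_le (min_le_right _ _)
      rcases hσ with rfl | rfl
      · rw [min_eq_left (by norm_num), max_eq_right (by norm_num)] at hw
        exact ⟨by linarith [hw.1.1], by linarith [hw.1.2], h3⟩
      · rw [min_eq_right (by norm_num), max_eq_left (by norm_num)] at hw
        exact ⟨by linarith [hw.1.2], by linarith [hw.1.1], h3⟩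
    have hAD : A ⊆ D := fun w hw => hcol w (hAσ w hw).1 (hAσ w hw).2.1 (hAσ w hw).2.2
    set b : ℂ := ⟨σ / 4, η / 2⟩ with hb
    have hbA : ∀ t : ℝ, 0 < t → t ≤ 1 → t * b ∈ A := by
      intro t ht ht1
      rw [hA, Complex.mem_reProdIm]
      simp only [hb, Complex.mul_re, Complex.mul_im, Complex.ofReal_re, Complex.ofReal_im, zero_mul,
        sub_zero, add_zero, mem_Ioo]
      refine ⟨?_, by positivity, by nlinarith⟩
      rcases hσ with rfl | rfl
      · rw [min_eq_left (by norm_num), max_eq_right (by norm_num)]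
        constructor <;> linarith
      · rw [min_eq_right (by norm_num), max_eq_left (by norm_num)]
        constructor <;> linarith
    have hbA1 : b ∈ A := by simpa using hbA 1 one_pos le_rfl
    obtain ⟨f', D', V', s', hf'⟩ := exists_sky_of_free s.free (hAD hbA1)
    rw [s.isOpen.nhdsWithin_eq (hAD hbA1)] at hf'
    have hbA2 := Complex.mem_reProdIm.1 hbA1
    refine ⟨_, s'.finite_edges_of_base hq hbA2.1.1 hbA2.1.2 hbA2.2.1 hbA2.2.2, ?_⟩
    intro c x₀ x₁ g h1 h2 h3 h4 h5 h6 h7 hg hgG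
    have hηc : η ≤ c.im := (min_le_left _ _).trans (hheight c x₀ x₁ g h1 h2 h3 h4 h5 hg hgG)
    refine ⟨c, x₀, x₁, g, h6, h7, h1, h2, h3, h4, hηc, hg, ?_, rfl⟩
    have hAW : A ⊆ Ioo x₀ x₁ ×ℂ Ioo 0 c.im := fun w hw => by
      rw [hA, Complex.mem_reProdIm] at hw
      exact Complex.mem_reProdIm.2 ⟨⟨h6.trans_lt hw.1.1, hw.1.2.trans_le h7⟩, hw.2.1,
        hw.2.2.trans_le hηc⟩
    have hWfree : q.Free (Ioo x₀ x₁ ×ℂ Ioo 0 c.im) g := hg.free.mono fun w hw => by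
      refine ⟨Or.inl hw, ?_⟩
      rw [Complex.mem_reProdIm] at hw
      rintro (rfl | rfl)
      · simpa using hw.2.1
      · simpa using hw.2.2
    have heq := (hWfree.mono hAW).eqOn_of_germ (s.free.mono hAD) (v := b)
      (convex_rect _ _ _ _).isPreconnected (fun w hw => (hAσ w hw).1) hbA hρ
      (hgG.filter_mono (nhdsWithin_mono _ hAW)) hG
    have hAo : A ∈ 𝓝 b := (isOpen_rect _ _ _ _).mem_nhds hbA1
    filter_upwards [hAo, hf'] with w hw hw'
    rw [heq hw, hw']
  obtain ⟨F₁, hF₁, H₁⟩ := fin 1 (Or.inl rfl)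
  obtain ⟨F₂, hF₂, H₂⟩ := fin (-1) (Or.inr rfl)
  refine (hF₁.union hF₂).subset ?_
  rintro e ⟨c, x₀, x₁, g, h1, h2, h3, h4, h5, h6, hg, hgG, rfl⟩
  -- An interval around zero longer than one reaches `1 / 2` on the right or `-1 / 2` on the left.
  rcases le_or_gt (1 / 2) x₁ with hx | hx
  · refine Or.inl (H₁ c x₀ x₁ g h2 h3 h4 h5 h6 ?_ ?_ hg hgG)
    · rw [min_eq_left (by norm_num)]; exact h2.1
    · rw [max_eq_right (by norm_num)]; exact hx
  · refine Or.inr (H₂ c x₀ x₁ g h2 h3 h4 h5 h6 ?_ ?_ hg hgG)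
    · rw [min_eq_right (by norm_num)]; linarith
    · rw [max_eq_left (by norm_num)]; exact h2.2

theorem finite_delaunayEdges [T2Space S] [CompactSpace S] [ConnectedSpace S] (hq : q.IsKeane) :
    q.delaunayEdges.Finite := by
  have hZ : Finite q.Z := q.finite_Z
  have hroots : ∀ z : q.Z, {ζ : ℂ | ζ ^ q.coneIndex z = -1}.Finite := by
    intro z
    have hk := (q.isConeChart_coneChart z).one_le
    refine (Polynomial.nthRoots (q.coneIndex z) (-1 : ℂ)).toFinset.finite_toSet.subset fun ζ hζ => ?_
    simp only [Finset.mem_coe, Multiset.mem_toFinset]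
    exact (Polynomial.mem_nthRoots hk).2 hζ
  refine (Set.finite_iUnion fun z : q.Z => (hroots z).biUnion fun ζ hζ =>
    finite_emanates hq z hζ).subset fun e he => ?_
  obtain ⟨z, ζ, hζ, hem⟩ := exists_emanates he
  exact mem_iUnion.2 ⟨z, mem_biUnion hζ hem⟩

end HalfTranslationStructure

/-! ### The faces, the covering property, and the triangulation. -/

theorem isPreconnected_punctured_ball {r : ℝ} (hr : 0 < r) :
    IsPreconnected (Metric.ball (0 : ℂ) r \ {0}) := by
  have : Metric.ball (0 : ℂ) r \ {0} = Complex.exp '' {w | w.re < Real.log r} := by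
    ext w
    constructor
    · rintro ⟨hw, hw0⟩
      have hw0' : w ≠ 0 := hw0
      refine ⟨Complex.log w, ?_, Complex.exp_log hw0'⟩
      rw [mem_ofPred_eq, Complex.log_re]
      exact Real.log_lt_log (norm_pos_iff.2 hw0') (by simpa using hw)
    · rintro ⟨z, hz, rfl⟩
      refine ⟨?_, Complex.exp_ne_zero z⟩
      rw [mem_ball_zero_iff, Complex.norm_exp]
      exact (Real.lt_log_iff_exp_lt hr).1 hz
  rw [this]
  exact (convex_halfSpace_re_lt _).isPreconnected.image _ Complex.continuous_exp.continuousOn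

theorem Anticlockwise.exists_common_interior {P Q A B w : ℂ} (hA : Anticlockwise P Q A)
    (hB : Anticlockwise P Q B) (hw : w ∈ openSegment ℝ P Q) :
    ∃ y, y ∈ interior (planeTriangle P Q A) ∧ y ∈ interior (planeTriangle P Q B) := by
  obtain ⟨t, h1, h2⟩ := ((hA.eventually_mem_interior hw).and (hB.eventually_mem_interior hw)).exists
  exact ⟨_, h1, h2⟩

/-- Two triangles on both sides of a segment form a neighbourhood of its interior points. -/
theorem Anticlockwise.union_mem_nhds {P Q A B w : ℂ} (hA : Anticlockwise P Q A)
    (hB : Anticlockwise Q P B) (hw : w ∈ openSegment ℝ P Q) :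
    planeTriangle P Q A ∪ planeTriangle Q P B ∈ 𝓝 w := by
  have pos : ∀ {P Q A : ℂ}, Anticlockwise P Q A → w ∈ openSegment ℝ P Q →
      0 < orient Q A w ∧ 0 < orient A P w := by
    rintro P Q A hA ⟨a, b, ha, hb, hab, rfl⟩
    have hΔ : 0 < orient P Q A := hA
    have e1 := orient_rotate P Q A
    have e2 := orient_rotate Q A P
    rw [orient_combo _ _ _ _ hab, orient_combo _ _ _ _ hab, orient_self_left, orient_self_right, e1,
      e2, e1]
    have h1 := mul_pos ha hΔ
    have h2 := mul_pos hb hΔ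
    constructor <;> linarith
  have ev : ∀ X Y : ℂ, 0 < orient X Y w → ∀ᶠ y in 𝓝 w, 0 < orient X Y y := fun X Y h =>
    ((continuous_orient X Y).tendsto w).eventually (lt_mem_nhds h)
  obtain ⟨h1, h2⟩ := pos hA hw
  obtain ⟨h3, h4⟩ := pos hB (by rwa [openSegment_symm])
  filter_upwards [ev _ _ h1, ev _ _ h2, ev _ _ h3, ev _ _ h4] with y h1 h2 h3 h4
  rcases le_total 0 (orient P Q y) with h | h
  · exact Or.inl (hA.mem_planeTriangle.2 ⟨h, h1.le, h2.le⟩)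
  · exact Or.inr (hB.mem_planeTriangle.2 ⟨by rw [orient_swap]; linarith, h3.le, h4.le⟩)

theorem Anticlockwise.closure_interior {P Q R : ℂ} (h : Anticlockwise P Q R) :
    closure (interior (planeTriangle P Q R)) = planeTriangle P Q R := by
  rw [(convex_planeTriangle P Q R).closure_interior_eq_closure_of_nonempty_interior
    h.interior_nonempty, (isCompact_planeTriangle P Q R).isClosed.closure_eq]

theorem segment_eq_of_vertices {X Y P Q R : ℂ} (hX : X ∈ ({P, Q, R} : Set ℂ))
    (hY : Y ∈ ({P, Q, R} : Set ℂ)) (hne : X ≠ Y) : segment ℝ X Y = segment ℝ P Q ∨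
      segment ℝ X Y = segment ℝ Q R ∨ segment ℝ X Y = segment ℝ R P := by
  rcases hX with rfl | rfl | rfl <;> rcases hY with rfl | rfl | rfl <;>
    simp_all [segment_symm]

theorem IsHalfTranslation.linear_part {h : ℂ → ℂ} (H : IsHalfTranslation h) :
    (∀ a b, h b - h a = b - a) ∨ ∀ a b, h b - h a = -(b - a) := by
  obtain ⟨ε, c, rfl | rfl, hz⟩ := H
  · left; intro a b; simp only [hz]; ring
  · right; intro a b; simp only [hz]; ring

namespace HalfTranslationStructure

variable {S : Type*} [TopologicalSpace S] {q : HalfTranslationStructure S}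

/-- Equal interiors have equal closures, so `X` lies in the second triangle. Being visible it is
outside `D`, and only the vertices of that triangle can be. -/
theorem StarView.vertex_mem {w₀ : ℂ} {D V : Set ℂ} (s : StarView w₀ D V) {P Q R P' Q' R' : ℂ}
    (hT : Anticlockwise P Q R) (hT' : Anticlockwise P' Q' R')
    (hD' : planeTriangle P' Q' R' \ {P', Q', R'} ⊆ D)
    (heq : interior (planeTriangle P Q R) = interior (planeTriangle P' Q' R')) {X : ℂ}
    (hX : X ∈ ({P, Q, R} : Set ℂ)) (hXV : X ∈ V) : X ∈ ({P', Q', R'} : Set ℂ) := by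
  have hXT : X ∈ planeTriangle P' Q' R' := by
    rw [← hT'.closure_interior, ← heq, hT.closure_interior]
    exact vertices_subset _ _ _ hX
  by_contra h
  exact s.notMem hXV (hD' ⟨hXT, h⟩)

theorem IsFlatTriangle.rotate {f : ℂ → S} {P Q R : ℂ} (h : q.IsFlatTriangle f P Q R) :
    q.IsFlatTriangle f Q R P where
  anticlockwise := h.anticlockwise.rotate
  flatMap := by
    rw [planeTriangle_rotate, show ({Q, R, P} : Set ℂ) = {P, Q, R} by ext; simp; tauto]
    exact h.flatMap
  injOn := by rw [planeTriangle_rotate]; exact h.injOn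

theorem mem_interior_of_view {h : ℂ → ℂ} (hh : IsHalfTranslation h) {P Q R w w₀ : ℂ} (h0 : h w₀ = w)
    (hT : Anticlockwise P Q R) (hw : w ∈ interior (planeTriangle (h P) (h Q) (h R))) :
    w₀ ∈ interior (planeTriangle P Q R) := by
  obtain ⟨z, hz, hzw⟩ := (hh.image_interior hT).symm ▸ hw
  rwa [← hh.injective (hzw.trans h0.symm)]

/-- The sides of a flat triangle which parametrises a face of a triangulation are edges. -/
theorem StraightTriangulation.side_mem [T2Space S] [CompactSpace S] (τ : q.StraightTriangulation)
    {f : ℂ → S} {P Q R : ℂ} (hT : q.IsFlatTriangle f P Q R)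
    (hF : f '' interior (planeTriangle P Q R) ∈ τ.faces) : f '' segment ℝ P Q ∈ τ.edges := by
  obtain ⟨g, P', Q', R', hT', hFe, s₁, s₂, s₃⟩ := τ.face_triangle _ hF
  obtain ⟨w, hw⟩ := hT.anticlockwise.interior_nonempty
  obtain ⟨w', hw', hww'⟩ : f w ∈ g '' interior (planeTriangle P' Q' R') := hFe ▸ ⟨w, hw, rfl⟩
  have hwv := hT.anticlockwise.interior_notMem_vertices hw
  have hwv' := hT'.anticlockwise.interior_notMem_vertices hw'
  obtain ⟨F, D, V, s, hFw⟩ := exists_sky_at (hT.flatMap.rest w hwv) 0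
  obtain ⟨h, P, Q, R, hh, rfl, rfl, rfl, h0, hP, hQ, hR, hT₁, hD, heq, hiff⟩ :=
    s.fit_triangle hT.anticlockwise hT.flatMap hwv hFw.symm
  obtain ⟨k, P', Q', R', hk, rfl, rfl, rfl, k0, hP', hQ', hR', hT₁', hD', keq, kiff⟩ :=
    s.fit_triangle hT'.anticlockwise hT'.flatMap hwv' (hww'.trans hFw.symm)
  have i1 := Sky.image_interior_eq hh hT₁ heq
  have i2 := Sky.image_interior_eq hk hT₁' keq
  have m1 := mem_interior_of_view hh h0 hT₁ hw
  have m2 := mem_interior_of_view hk k0 hT₁' hw'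
  have vmem : ∀ {X Y Z : ℂ}, ∀ x ∈ ({X, Y, Z} : Set ℂ), x ∈ planeTriangle X Y Z := fun {X Y Z} x hx =>
    vertices_subset X Y Z hx
  have c' := convex_planeTriangle P' Q' R'
  rw [← hk.image_segment_eq fun z hz => keq z (c'.segment_subset (vmem _ (by simp))
    (vmem _ (by simp)) hz)] at s₁ s₂ s₃
  -- Edges are disjoint from faces, so the first interior cannot cross the sides of the second
  -- triangle. The reverse inclusion below uses that both interiors map onto the same face and that
  -- `F` is injective on the second one.
  have hsub : interior (planeTriangle P Q R) ⊆ interior (planeTriangle P' Q' R') := by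
    refine subset_interior_of_preconnected (convex_planeTriangle P Q R).interior.isPreconnected
      ⟨0, m1, m2⟩ fun y hy hyT => ?_
    by_contra hyi
    have hyF : F y ∈ f '' interior (planeTriangle (h P) (h Q) (h R)) := i1 ▸ ⟨y, hy, rfl⟩
    rcases hT₁'.mem_side hyT hyi with h | h | h
    · exact Set.disjoint_left.1 (τ.edge_face_disjoint _ s₁ _ hF) ⟨y, h, rfl⟩ hyF
    · exact Set.disjoint_left.1 (τ.edge_face_disjoint _ s₂ _ hF) ⟨y, h, rfl⟩ hyF
    · exact Set.disjoint_left.1 (τ.edge_face_disjoint _ s₃ _ hF) ⟨y, h, rfl⟩ hyF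
  have hinj : InjOn F (interior (planeTriangle P' Q' R')) := by
    intro a ha b hb hab
    rw [keq a (interior_subset ha), keq b (interior_subset hb)] at hab
    have hi := hk.image_interior hT₁'
    exact hk.injective (hT'.injOn (hi ▸ ⟨a, ha, rfl⟩) (hi ▸ ⟨b, hb, rfl⟩) hab)
  have hsub' : interior (planeTriangle P' Q' R') ⊆ interior (planeTriangle P Q R) := by
    refine subset_interior_of_preconnected (convex_planeTriangle P' Q' R').interior.isPreconnected
      ⟨0, m2, m1⟩ fun y hy hyT => ?_
    obtain ⟨x, hx, hxy⟩ : F y ∈ F '' interior (planeTriangle P Q R) := by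
      rw [i1, hFe, ← i2]; exact ⟨y, hy, rfl⟩
    rwa [← hinj (hsub hx) hy hxy]
  have hie := hsub.antisymm hsub'
  have c := convex_planeTriangle P Q R
  rw [← hh.image_segment_eq fun z hz => heq z (c.segment_subset (vmem _ (by simp))
    (vmem _ (by simp)) hz)]
  rcases segment_eq_of_vertices (StarView.vertex_mem s.starView hT₁ hT₁' hD' hie (X := P) (by simp) hP)
    (StarView.vertex_mem s.starView hT₁ hT₁' hD' hie (X := Q) (by simp) hQ) hT₁.ne with h | h | h <;>
    rw [h] <;> assumption

/-- The faces of the balanced veering triangulation. -/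
def delaunayFaces (q : HalfTranslationStructure S) : Set (Set S) :=
  {F | ∃ f P Q R, q.IsDelaunayTriangle f P Q R ∧ F = f '' interior (planeTriangle P Q R)}

/-- At most two faces have a given side. Seen from a point of that side, any triangle on it shares
interior points with the left or the right triangle of `exists_left_triangle`, and so equals it. -/
theorem finite_delaunayFaces [T2Space S] [CompactSpace S] [ConnectedSpace S] (hq : q.IsKeane) :
    q.delaunayFaces.Finite := by
  have key : ∀ e ∈ q.delaunayEdges, ∃ F₁ F₂ : Set S, ∀ g P' Q' R', q.IsDelaunayTriangle g P' Q' R' →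
      g '' segment ℝ P' Q' = e → g '' interior (planeTriangle P' Q' R') ∈ ({F₁, F₂} : Set (Set S)) := by
    intro e he
    obtain ⟨w₀, f, D, V, P, Q, s, hP, hQ, h0, hs, rfl⟩ := id he
    obtain ⟨A, hA, hTA, -⟩ := s.exists_left_triangle hq hP hQ h0 he
    obtain ⟨B, hB, hTB, -⟩ := s.exists_left_triangle hq hQ hP (by rwa [openSegment_symm])
      (by rwa [segment_symm])
    refine ⟨f '' interior (planeTriangle P Q A), f '' interior (planeTriangle Q P B), ?_⟩
    intro g P' Q' R' hT' hge
    obtain ⟨w', hw', hww'⟩ : f w₀ ∈ g '' segment ℝ P' Q' :=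
      hge ▸ ⟨w₀, openSegment_subset_segment ℝ _ _ h0, rfl⟩
    have hw'o : w' ∈ openSegment ℝ P' Q' := by
      have hfs := hT'.flatMap.segment_of_triangle hT'.anticlockwise
      rw [← insert_endpoints_openSegment] at hw'
      rcases hw' with rfl | rfl | hw'
      · exact (s.free.notMem s.base (hww' ▸ hfs.vertices _ (by simp))).elim
      · exact (s.free.notMem s.base (hww' ▸ hfs.vertices _ (by simp))).elim
      · exact hw'
    obtain ⟨h, P₁, Q₁, R₁, hh, rfl, rfl, rfl, rfl, hP₁, hQ₁, hR₁, hT₁, -, heq, -⟩ :=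
      s.fit_delaunayTriangle hT' (hT'.anticlockwise.openSegment_notMem_vertices hw'o) hww'
    have h0₁ : w₀ ∈ openSegment ℝ P₁ Q₁ := by
      rw [← hh.image_openSegment] at hw'o
      obtain ⟨z, hz, hzw⟩ := hw'o
      rwa [← hh.injective hzw]
    have hseg : f '' segment ℝ P₁ Q₁ = f '' segment ℝ P Q := by
      rw [← hge, hh.image_segment_eq fun z hz => heq z (segment_subset_planeTriangle _ _ _ hz)]
    rw [← Sky.image_interior_eq hh hT₁.anticlockwise heq]
    rcases s.endpoints_eq_of_image_eq hP₁ hQ₁ hP hQ h0₁ h0 hseg.subset with ⟨rfl, rfl⟩ | ⟨rfl, rfl⟩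
    · left
      obtain ⟨y, hy, hy'⟩ := hT₁.anticlockwise.exists_common_interior hTA.anticlockwise h0
      rw [hT₁.interior_eq hq hTA hy hy']
    · right
      obtain ⟨y, hy, hy'⟩ := hT₁.anticlockwise.exists_common_interior hTB.anticlockwise h0₁
      rw [mem_singleton_iff, hT₁.interior_eq hq hTB hy hy']
  choose! F₁ F₂ hF using key
  refine ((finite_delaunayEdges hq).biUnion fun e _ => (Set.toFinite {F₁ e, F₂ e})).subset ?_
  rintro _ ⟨f, P, Q, R, hT, rfl⟩
  exact mem_biUnion hT.side₁ (hF _ hT.side₁ f P Q R hT rfl)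

theorem IsDelaunayTriangle.image_subset {f : ℂ → S} {P Q R : ℂ} (hT : q.IsDelaunayTriangle f P Q R) :
    f '' planeTriangle P Q R ⊆ ⋃₀ q.delaunayEdges ∪ ⋃₀ q.delaunayFaces := by
  rintro _ ⟨w, hw, rfl⟩
  by_cases hi : w ∈ interior (planeTriangle P Q R)
  · exact Or.inr ⟨_, ⟨f, P, Q, R, hT, rfl⟩, w, hi, rfl⟩
  · left
    rcases hT.anticlockwise.mem_side hw hi with h | h | h
    exacts [⟨_, hT.side₁, w, h, rfl⟩, ⟨_, hT.side₂, w, h, rfl⟩, ⟨_, hT.side₃, w, h, rfl⟩]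

/-- The union `X` is closed by finiteness. It is a neighbourhood of each of its unmarked points,
because every edge has a triangle on both sides. A punctured neighbourhood of a marked point is
connected and is entered by an edge, and `X` is open and closed in it, so `X` contains it.
Connectedness of `S` finishes. -/
theorem delaunay_cover [T2Space S] [CompactSpace S] [ConnectedSpace S] (hq : q.IsKeane) :
    ⋃₀ q.delaunayEdges ∪ ⋃₀ q.delaunayFaces = univ := by
  set X : Set S := ⋃₀ q.delaunayEdges ∪ ⋃₀ q.delaunayFaces with hX
  have hflat : ∀ e ∈ q.delaunayEdges, ∃ f P Q, P ≠ Q ∧ q.IsFlatMap (segment ℝ P Q) {P, Q} f ∧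
      e = f '' segment ℝ P Q := by
    rintro e ⟨w₀, f, D, V, P, Q, s, hP, hQ, h0, hs, rfl⟩
    exact ⟨f, P, Q, hs.ne, s.flatMap_segment hP hQ (s.starView.openSegment_subset hP hQ h0), rfl⟩
  have hclosed : IsClosed X := by
    have h1 : IsClosed (⋃₀ q.delaunayEdges) := by
      rw [sUnion_eq_biUnion]
      refine Set.Finite.isClosed_biUnion (finite_delaunayEdges hq) fun e he => ?_
      obtain ⟨f, P, Q, -, hf, rfl⟩ := hflat e he
      have hc : IsCompact (segment ℝ P Q) := by
        rw [segment_eq_image]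
        exact isCompact_Icc.image (by fun_prop)
      exact (hc.image_of_continuousOn hf.continuousOn).isClosed
    refine isClosed_of_closure_subset ?_
    rw [hX, closure_union, h1.closure_eq, sUnion_eq_biUnion (s := q.delaunayFaces),
      (finite_delaunayFaces hq).closure_biUnion]
    refine union_subset subset_union_left (iUnion₂_subset ?_)
    rintro _ ⟨f, P, Q, R, hT, rfl⟩
    have hc : IsClosed (f '' planeTriangle P Q R) :=
      ((isCompact_planeTriangle P Q R).image_of_continuousOn hT.flatMap.continuousOn).isClosed
    have := closure_minimal (image_mono (f := f) interior_subset) hc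
    rw [← sUnion_eq_biUnion]
    exact this.trans hT.image_subset
  have hopen : ∀ x ∈ X, x ∉ q.Z → X ∈ 𝓝 x := by
    rintro x (⟨e, he, hxe⟩ | ⟨_, ⟨f, P, Q, R, hT, rfl⟩, w, hw, rfl⟩) hxZ
    · obtain ⟨f, D, V, s, rfl⟩ := exists_sky_at hxZ 0
      obtain ⟨P, hP, Q, hQ, -, h0, hs, rfl⟩ := s.exists_of_mem_delaunayEdges he hxe
      obtain ⟨A, hA, hTA, -⟩ := s.exists_left_triangle hq hP hQ h0 he
      obtain ⟨B, hB, hTB, -⟩ := s.exists_left_triangle hq hQ hP (by rwa [openSegment_symm])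
        (by rwa [segment_symm])
      refine mem_of_superset (s.free.image_mem_nhds s.isOpen s.base
        (hTA.anticlockwise.union_mem_nhds hTB.anticlockwise h0)) ?_
      rw [image_union]
      exact union_subset hTA.image_subset hTB.image_subset
    · have hfr : q.Free (interior (planeTriangle P Q R)) f := hT.flatMap.free.mono fun y hy =>
        hT.anticlockwise.interior_notMem_vertices hy
      refine mem_of_superset (hfr.image_mem_nhds isOpen_interior hw (isOpen_interior.mem_nhds hw)) ?_
      exact (image_mono interior_subset).trans hT.image_subset
  have hopenZ : ∀ z ∈ q.Z, X ∈ 𝓝 z := by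
    intro z hz
    obtain ⟨k, φ, hcone⟩ := exists_coneChart hz
    have hN : φ.source ∩ (q.Z \ {z})ᶜ ∈ 𝓝 z := inter_mem (φ.open_source.mem_nhds hcone.mem_source)
      ((q.finite_Z.subset sdiff_subset).isClosed.isOpen_compl.mem_nhds (by simp))
    have hT0 : φ.target ∩ φ.symm ⁻¹' (φ.source ∩ (q.Z \ {z})ᶜ) ∈ 𝓝 (0 : ℂ) := by
      refine inter_mem (φ.open_target.mem_nhds hcone.zero_mem_target) ?_
      refine (φ.continuousAt_symm hcone.zero_mem_target).preimage_mem_nhds ?_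
      rw [hcone.symm_zero]; exact hN
    obtain ⟨r, hr, hball⟩ := Metric.mem_nhds_iff.1 hT0
    have hpre : IsPreconnected (φ.symm '' (Metric.ball 0 r \ {0})) :=
      (isPreconnected_punctured_ball hr).image _
        (φ.continuousOn_symm.mono fun w hw => (hball hw.1).1)
    have hZ : ∀ x ∈ φ.symm '' (Metric.ball 0 r \ {0}), x ∉ q.Z := by
      rintro _ ⟨w, ⟨hw, hw0⟩, rfl⟩ hxZ
      have h2 := (hball hw).2.2
      have : φ.symm w = z := by
        by_contra h; exact h2 ⟨hxZ, h⟩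
      apply hw0
      rw [mem_singleton_iff, ← φ.right_inv (hball hw).1, this, hcone.map_eq]
    have hnb : φ.symm '' Metric.ball 0 r ∈ 𝓝 z := by
      have := φ.symm.image_mem_nhds (x := 0) hcone.zero_mem_target (Metric.ball_mem_nhds 0 hr)
      rwa [hcone.symm_zero] at this
    obtain ⟨⟨e, he, hze, -⟩, -⟩ := exists_edges_at hq hz
    obtain ⟨f, P, Q, hPQ, hf, hef⟩ := hflat e he
    obtain ⟨y, hy, hyz⟩ : z ∈ f '' segment ℝ P Q := hef ▸ hze
    have hycl : y ∈ closure (openSegment ℝ P Q) := by rwa [closure_openSegment]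
    have hne : (𝓝[openSegment ℝ P Q] y).NeBot := mem_closure_iff_nhdsWithin_neBot.1 hycl
    obtain ⟨v, hvN, hvO⟩ := ((((hf.continuousOn y hy).tendsto.mono_left
      (nhdsWithin_mono _ (openSegment_subset_segment ℝ P Q))).eventually (hyz ▸ hnb)).and
      self_mem_nhdsWithin).exists
    have hvZ : f v ∉ q.Z := hf.rest v (segment_star hvO hPQ).1
    have hvX : f v ∈ X := Or.inl ⟨e, he, hef ▸ ⟨v, openSegment_subset_segment ℝ P Q hvO, rfl⟩⟩
    have hzX : z ∈ X := Or.inl ⟨e, he, hze⟩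
    have hsub : φ.symm '' (Metric.ball 0 r \ {0}) ⊆ interior X := by
      refine hpre.subset_left_of_subset_union isOpen_interior hclosed.isOpen_compl
        (disjoint_compl_right.mono_left interior_subset) (fun x hx => ?_) ?_
      · by_cases hxX : x ∈ X
        · exact Or.inl (mem_interior_iff_mem_nhds.2 (hopen x hxX (hZ x hx)))
        · exact Or.inr hxX
      · obtain ⟨w, hw, hwv⟩ := hvN
        refine ⟨f v, ⟨w, ⟨hw, ?_⟩, hwv⟩, mem_interior_iff_mem_nhds.2 (hopen _ hvX hvZ)⟩
        rintro rfl
        rw [hcone.symm_zero] at hwv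
        exact hvZ (hwv ▸ hz)
    refine mem_of_superset hnb ?_
    rintro _ ⟨w, hw, rfl⟩
    by_cases hw0 : w = 0
    · rw [hw0, hcone.symm_zero]; exact hzX
    · exact interior_subset (hsub ⟨w, ⟨hw, hw0⟩, rfl⟩)
  have hclopen : IsClopen X := ⟨hclosed, isOpen_iff_mem_nhds.2 fun x hx => by
    by_cases hxZ : x ∈ q.Z
    exacts [hopenZ x hxZ, hopen x hx hxZ]⟩
  obtain ⟨z, hz⟩ := q.nonempty_Z
  exact hclopen.eq_univ ⟨z, mem_of_mem_nhds (hopenZ z hz)⟩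

/-- The balanced veering triangulation. -/
def delaunay [T2Space S] [CompactSpace S] [ConnectedSpace S] (hq : q.IsKeane) :
    q.StraightTriangulation where
  edges := q.delaunayEdges
  faces := q.delaunayFaces
  finite_edges := finite_delaunayEdges hq
  finite_faces := finite_delaunayFaces hq
  edge_saddle e he := exists_isSaddleConnection_of_mem_delaunayEdges he
  face_triangle := by
    rintro _ ⟨f, P, Q, R, hT, rfl⟩
    exact ⟨f, P, Q, R, hT.isFlatTriangle hq, rfl, hT.side₁, hT.side₂, hT.side₃⟩
  edges_disjoint e he e' he' hne := by
    refine Set.disjoint_left.2 fun x hx hx' => hne ?_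
    exact eq_of_mem_delaunayEdges hq he he' hx.1 hx'.1 hx.2
  faces_disjoint := by
    rintro _ ⟨f, P, Q, R, hT, rfl⟩ _ ⟨g, P', Q', R', hT', rfl⟩ hne
    refine Set.disjoint_left.2 fun x hx hx' => hne ?_
    exact hT.image_eq hq hT' hx hx'
  edge_face_disjoint := by
    rintro e he _ ⟨f, P, Q, R, hT, rfl⟩
    refine Set.disjoint_left.2 ?_
    rintro _ hx ⟨w, hw, rfl⟩
    exact hT.notMem_edge hq hw he hx
  cover := delaunay_cover hq

/-! ### The constructed triangulation is veering. -/

/-- If `Q` were strictly between the other two vertices in both coordinates, it would be a marked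
point inside the window of the side `R P`. -/
theorem IsDelaunayTriangle.not_between [T2Space S] [CompactSpace S] {f : ℂ → S} {P Q R : ℂ}
    (hT : q.IsDelaunayTriangle f P Q R) (hre : 0 < (Q - P).re * (R - Q).re)
    (him : 0 < (Q - P).im * (R - Q).im) : False := by
  have hw : midpoint ℝ R P ∈ openSegment ℝ R P := midpoint_mem_openSegment R P
  have hwv := hT.rotate.rotate.anticlockwise.openSegment_notMem_vertices hw
  obtain ⟨F, D, V, s, hF⟩ := exists_sky_at (hT.rotate.rotate.flatMap.rest _ hwv) 0
  obtain ⟨h, R₁, P₁, Q₁, hh, rfl, rfl, rfl, h0, hR, hP, hQ, hT₁, -, -, -⟩ :=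
    s.fit_delaunayTriangle hT.rotate.rotate hwv hF.symm
  have h0₁ : 0 ∈ openSegment ℝ R₁ P₁ := by
    rw [← hh.image_openSegment] at hw
    obtain ⟨z, hz, hzw⟩ := hw
    rwa [← hh.injective (hzw.trans h0.symm)]
  obtain ⟨x₀, x₁, -, h2, h3, -, -, -, h7⟩ := s.spans_of_mem hR hP h0₁ hT₁.side₁
  have hre' : 0 < (Q₁ - P₁).re * (R₁ - Q₁).re := by
    rcases hh.linear_part with hz | hz <;> simpa only [hz, Complex.neg_re, neg_mul_neg] using hre
  have him' : 0 < (Q₁ - P₁).im * (R₁ - Q₁).im := by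
    rcases hh.linear_part with hz | hz <;> simpa only [hz, Complex.neg_im, neg_mul_neg] using him
  simp only [Complex.sub_re, Complex.sub_im] at hre' him'
  refine s.starView.notMem hQ (h7 (Complex.mem_reProdIm.2 ⟨?_, ?_⟩))
  · rcases pos_and_pos_or_neg_and_neg_of_mul_pos hre' with ⟨a, b⟩ | ⟨a, b⟩
    · constructor <;> linarith [h2.1, h2.2, h3.1, h3.2]
    · constructor <;> linarith [h2.1, h2.2, h3.1, h3.2]
  · rcases pos_and_pos_or_neg_and_neg_of_mul_pos him' with ⟨a, b⟩ | ⟨a, b⟩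
    · rw [uIoo_of_gt (by linarith)]; constructor <;> linarith
    · rw [uIoo_of_lt (by linarith)]; constructor <;> linarith

/-- Two of the three horizontal increments around the triangle have the same sign. Equal colours
give the corresponding vertical increments equal signs, so `not_between` applies to the common
vertex. The factor `σ` treats both colours at once. -/
theorem IsDelaunayTriangle.not_monochromatic [T2Space S] [CompactSpace S] {f : ℂ → S} {P Q R : ℂ}
    (hT : q.IsDelaunayTriangle f P Q R) {σ : ℝ} (h1 : 0 < σ * ((Q - P).re * (Q - P).im))
    (h2 : 0 < σ * ((R - Q).re * (R - Q).im)) (h3 : 0 < σ * ((P - R).re * (P - R).im)) : False := by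
  have key : ∀ a b c d : ℝ, 0 < σ * (a * b) → 0 < σ * (c * d) → 0 < a * c → 0 < b * d := by
    intro a b c d h1 h2 h3
    have h4 := mul_pos h1 h2
    have e : σ * (a * b) * (σ * (c * d)) = σ ^ 2 * (a * c) * (b * d) := by ring
    rw [e] at h4
    have hσ : 0 < σ ^ 2 := by
      have : σ ≠ 0 := by rintro rfl; simp at h1
      positivity
    exact pos_of_mul_pos_right h4 (mul_pos hσ h3).le
  have c1 : ¬ 0 < (Q - P).re * (R - Q).re := fun h => hT.not_between h (key _ _ _ _ h1 h2 h)
  have c2 : ¬ 0 < (R - Q).re * (P - R).re := fun h => hT.rotate.not_between h (key _ _ _ _ h2 h3 h)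
  have c3 : ¬ 0 < (P - R).re * (Q - P).re := fun h =>
    hT.rotate.rotate.not_between h (key _ _ _ _ h3 h1 h)
  have n1 : (Q - P).re ≠ 0 := by intro h; simp [h] at h1
  have n2 : (R - Q).re ≠ 0 := by intro h; simp [h] at h2
  have n3 : (P - R).re ≠ 0 := by intro h; simp [h] at h3
  rcases lt_or_gt_of_ne n1 with a | a <;> rcases lt_or_gt_of_ne n2 with b | b <;>
    rcases lt_or_gt_of_ne n3 with c | c <;>
    first
      | exact c1 (mul_pos a b)
      | exact c1 (mul_pos_of_neg_of_neg a b)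
      | exact c2 (mul_pos b c)
      | exact c2 (mul_pos_of_neg_of_neg b c)
      | exact c3 (mul_pos c a)
      | exact c3 (mul_pos_of_neg_of_neg c a)

theorem isVeering_delaunay [T2Space S] [CompactSpace S] [ConnectedSpace S] (hq : q.IsKeane) :
    (delaunay hq).IsVeering where
  coloured := by
    rintro e ⟨w₀, f, D, V, P, Q, s, hP, hQ, h0, hs, rfl⟩
    have hf := s.flatMap_segment hP hQ (s.starView.openSegment_subset hP hQ h0)
    rw [hf.isRed_iff hs.ne, hf.isBlue_iff hs.ne]
    obtain ⟨_, _, _, _, _, _, hre, him, _⟩ := hs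
    have h1 : (Q - P).re ≠ 0 := by rw [Complex.sub_re]; exact sub_ne_zero.2 hre.symm
    have h2 : (Q - P).im ≠ 0 := by rw [Complex.sub_im]; exact sub_ne_zero.2 him.symm
    exact (lt_or_gt_of_ne (mul_ne_zero h1 h2)).symm
  triangle f P Q R hT hF := by
    have s₁ := (delaunay hq).side_mem hT hF
    have s₂ := (delaunay hq).side_mem hT.rotate (by rwa [planeTriangle_rotate])
    have s₃ := (delaunay hq).side_mem hT.rotate.rotate
      (by rwa [planeTriangle_rotate, planeTriangle_rotate])
    have hD : q.IsDelaunayTriangle f P Q R := ⟨hT.anticlockwise, hT.flatMap, s₁, s₂, s₃⟩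
    have f₁ := hT.flatMap.segment_of_triangle hT.anticlockwise
    have f₂ := hT.rotate.flatMap.segment_of_triangle hT.rotate.anticlockwise
    have f₃ := hT.rotate.rotate.flatMap.segment_of_triangle hT.rotate.rotate.anticlockwise
    rw [f₁.isRed_iff hT.anticlockwise.ne, f₂.isRed_iff hT.rotate.anticlockwise.ne,
      f₃.isRed_iff hT.rotate.rotate.anticlockwise.ne, f₁.isBlue_iff hT.anticlockwise.ne,
      f₂.isBlue_iff hT.rotate.anticlockwise.ne, f₃.isBlue_iff hT.rotate.rotate.anticlockwise.ne]
    constructor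
    · rintro ⟨h1, h2, h3⟩
      exact hD.not_monochromatic (σ := 1) (by linarith) (by linarith) (by linarith)
    · rintro ⟨h1, h2, h3⟩
      exact hD.not_monochromatic (σ := -1) (by linarith) (by linarith) (by linarith)
  vertex z hz := exists_edges_at hq hz

end HalfTranslationStructure

/-! ### The constructed triangulation is balanced. -/

namespace HalfTranslationStructure

variable {S : Type*} [TopologicalSpace S] {q : HalfTranslationStructure S}

/-- The quadrilateral need not be convex, but it is star-shaped about every interior point of its
diagonal, so `fit` applies to it as a whole. -/
theorem StraightTriangulation.QuadLayout.exists_sky [T2Space S] [CompactSpace S]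
    {τ : q.StraightTriangulation} (L : τ.QuadLayout) {w₀ : ℂ} (h0 : w₀ ∈ openSegment ℝ L.P L.R) :
    ∃ f D V, q.Sky w₀ f D V ∧ L.P ∈ V ∧ L.R ∈ V ∧ L.A ∈ V ∧ L.B ∈ V ∧
      EqOn f L.f (planeTriangle L.P L.R L.A ∪ planeTriangle L.P L.B L.R) := by
  revert h0
  obtain ⟨g, P, R, A, B, hl, hr, -, -, -, hf⟩ := L
  intro h0
  dsimp only at h0 ⊢
  have hl1 := hl.anticlockwise
  have hr1 := hr.anticlockwise.rotate.rotate
  have oA : 0 < orient P R A := hl1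
  have oB : orient P R B < 0 := by
    have : 0 < orient R P B := hr1
    rw [orient_swap] at this; linarith
  have hwl := hl1.openSegment_notMem_vertices h0
  have hwr := hr1.openSegment_notMem_vertices (by rwa [openSegment_symm])
  have hT : planeTriangle R P B = planeTriangle P B R := by
    rw [← planeTriangle_rotate, ← planeTriangle_rotate]
  have hAr : A ∉ planeTriangle P B R := by
    rw [← hT, hr1.mem_planeTriangle, orient_swap]
    exact fun h => by linarith [h.1]
  have hBl : B ∉ planeTriangle P R A := by
    rw [hl1.mem_planeTriangle]
    exact fun h => by linarith [h.1]
  have hstar : ∀ k ∈ planeTriangle P R A ∪ planeTriangle P B R, ∀ t : ℝ, 0 ≤ t → t < 1 →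
      w₀ + t * (k - w₀) ∈ (planeTriangle P R A ∪ planeTriangle P B R) \ {P, R, A, B} := by
    rintro k (hk | hk) t ht ht1
    · have := hl1.star hwl k hk t ht ht1
      refine ⟨Or.inl this.1, ?_⟩
      rintro (h | h | h | h)
      · exact this.2 (Or.inl h)
      · exact this.2 (Or.inr (Or.inl h))
      · exact this.2 (Or.inr (Or.inr h))
      · exact hBl (h ▸ this.1)
    · have := hr1.star hwr k (hT ▸ hk) t ht ht1
      refine ⟨Or.inr (hT ▸ this.1), ?_⟩
      rintro (h | h | h | h)
      · exact this.2 (Or.inr (Or.inl h))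
      · exact this.2 (Or.inl h)
      · exact hAr (h ▸ hT ▸ this.1)
      · exact this.2 (Or.inr (Or.inr h))
  have hw : w₀ ∈ (planeTriangle P R A ∪ planeTriangle P B R) \ {P, R, A, B} := by
    simpa using hstar w₀ (Or.inl hwl.1) 0 le_rfl one_pos
  obtain ⟨f, D, V, s, he⟩ := exists_sky_of_free hf.free hw
  obtain ⟨-, h2, h3⟩ := s.fit hf hstar he
  exact ⟨f, D, V, s, h2 ⟨Or.inl (vertices_subset P R A (by simp)), by simp⟩,
    h2 ⟨Or.inl (vertices_subset P R A (by simp)), by simp⟩,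
    h2 ⟨Or.inl (vertices_subset P R A (by simp)), by simp⟩,
    h2 ⟨Or.inr (vertices_subset P B R (by simp)), by simp⟩, h3⟩

theorem StraightTriangulation.QuadLayout.isFlatMap_sides {τ : q.StraightTriangulation}
    (L : τ.QuadLayout) :
    q.IsFlatMap (segment ℝ L.R L.A) {L.R, L.A} L.f ∧ q.IsFlatMap (segment ℝ L.A L.P) {L.A, L.P} L.f ∧
    q.IsFlatMap (segment ℝ L.P L.B) {L.P, L.B} L.f ∧ q.IsFlatMap (segment ℝ L.B L.R) {L.B, L.R} L.f := by
  have h1 := L.left_triangle.rotate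
  have h2 := h1.rotate
  have h3 := L.right_triangle
  have h4 := h3.rotate
  exact ⟨h1.flatMap.segment_of_triangle h1.anticlockwise,
    h2.flatMap.segment_of_triangle h2.anticlockwise, h3.flatMap.segment_of_triangle h3.anticlockwise,
    h4.flatMap.segment_of_triangle h4.anticlockwise⟩

theorem StraightTriangulation.QuadLayout.backwardFlippable_iff [T2Space S] [CompactSpace S]
    {τ : q.StraightTriangulation} (L : τ.QuadLayout) : L.BackwardFlippable ↔
      0 < (L.A - L.R).re * (L.A - L.R).im ∧ (L.P - L.A).re * (L.P - L.A).im < 0 ∧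
      0 < (L.B - L.P).re * (L.B - L.P).im ∧ (L.R - L.B).re * (L.R - L.B).im < 0 := by
  obtain ⟨h1, h2, h3, h4⟩ := L.isFlatMap_sides
  rw [BackwardFlippable, h1.isRed_iff L.left_triangle.anticlockwise.rotate.ne,
    h2.isBlue_iff L.left_triangle.anticlockwise.rotate.rotate.ne,
    h3.isRed_iff L.right_triangle.anticlockwise.ne,
    h4.isBlue_iff L.right_triangle.anticlockwise.rotate.ne]

theorem StraightTriangulation.QuadLayout.forwardFlippable_iff [T2Space S] [CompactSpace S]
    {τ : q.StraightTriangulation} (L : τ.QuadLayout) : L.ForwardFlippable ↔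
      (L.A - L.R).re * (L.A - L.R).im < 0 ∧ 0 < (L.P - L.A).re * (L.P - L.A).im ∧
      (L.B - L.P).re * (L.B - L.P).im < 0 ∧ 0 < (L.R - L.B).re * (L.R - L.B).im := by
  obtain ⟨h1, h2, h3, h4⟩ := L.isFlatMap_sides
  rw [ForwardFlippable, h1.isBlue_iff L.left_triangle.anticlockwise.rotate.ne,
    h2.isRed_iff L.left_triangle.anticlockwise.rotate.rotate.ne,
    h3.isBlue_iff L.right_triangle.anticlockwise.ne,
    h4.isRed_iff L.right_triangle.anticlockwise.rotate.ne]

/-- The shape of a triangle on the left of `P R` with a side of positive slope at `R` and one of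
negative slope at `P`. -/
theorem apex_of_backward {P R A : ℂ} (h : 0 < orient P R A)
    (h1 : 0 < (A - R).re * (A - R).im) (h2 : (P - A).re * (P - A).im < 0) :
    P.im < R.im ∧ A.im ∈ Ioo P.im R.im ∧ A.re < P.re ∧ A.re < R.re ∨
    R.im < P.im ∧ A.im ∈ Ioo R.im P.im ∧ P.re < A.re ∧ R.re < A.re := by
  simp only [orient, Complex.sub_re, Complex.sub_im] at h h1 h2
  rcases pos_and_pos_or_neg_and_neg_of_mul_pos h1 with ⟨a, b⟩ | ⟨a, b⟩ <;>
  rcases mul_neg_iff.1 h2 with ⟨c, d⟩ | ⟨c, d⟩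
  · nlinarith [mul_pos a (neg_pos.2 d), mul_pos b c]
  · right
    exact ⟨by linarith, ⟨by linarith, by linarith⟩, by linarith, by linarith⟩
  · left
    exact ⟨by linarith, ⟨by linarith, by linarith⟩, by linarith, by linarith⟩
  · nlinarith [mul_pos (neg_pos.2 a) d, mul_pos (neg_pos.2 b) (neg_pos.2 c)]

theorem Sky.not_mem_window [T2Space S] {w₀ : ℂ} {f : ℂ → S} {D V : Set ℂ} (s : q.Sky w₀ f D V)
    {P R A : ℂ} (hA : A ∈ V) {x₀ x₁ : ℝ} (hD : Ioo x₀ x₁ ×ℂ uIoo P.im R.im ⊆ D)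
    (hi : A.im ∈ uIoo P.im R.im) : A.re ≤ x₀ ∨ x₁ ≤ A.re := by
  by_contra! h
  exact s.starView.notMem hA (hD ⟨h, hi⟩)

/-- Every edge has width at most one by definition. If an edge is backward flippable, `A` and `B`
have heights strictly between those of its ends and lie on opposite sides of it. Neither is in the
window, so the window fits horizontally between them. -/
theorem isBalanced_delaunay [T2Space S] [CompactSpace S] [ConnectedSpace S] (hq : q.IsKeane) :
    (delaunay hq).IsBalanced := by
  constructor
  · intro L _
    obtain ⟨w₀, f, D, V, P, Q, s, hP, hQ, h0, hs, he⟩ := L.edge_mem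
    have h1 := L.left_triangle.flatMap.segment_of_triangle L.left_triangle.anticlockwise
    have h2 := s.flatMap_segment hP hQ (s.starView.openSegment_subset hP hQ h0)
    obtain ⟨_, _, _, _, _, hw, -⟩ := id hs
    rw [abs_sub_comm, ← Complex.sub_re] at hw
    rw [StraightTriangulation.QuadLayout.edgeWidth]
    rcases h1.holonomy_eq L.left_triangle.anticlockwise.ne h2 hs.ne he with h | h
    · rwa [← h]
    · rwa [h, Complex.neg_re, abs_neg] at hw
  · intro L hL
    rw [L.backwardFlippable_iff] at hL
    have hm : midpoint ℝ L.P L.R ∈ openSegment ℝ L.P L.R := midpoint_mem_openSegment _ _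
    obtain ⟨f, D, V, s, hP, hR, hA, hB, hE⟩ := L.exists_sky hm
    have he : f '' segment ℝ L.P L.R ∈ q.delaunayEdges := by
      have := L.edge_mem
      rwa [← (hE.mono ((segment_subset_planeTriangle L.P L.R L.A).trans
        subset_union_left)).image_eq] at this
    obtain ⟨x₀, x₁, hx, hPx, hRx, hw, hre, him, hD⟩ := s.spans_of_mem hP hR hm he
    have oA : 0 < orient L.P L.R L.A := L.left_triangle.anticlockwise
    have oB : 0 < orient L.R L.P L.B := L.right_triangle.anticlockwise.rotate.rotate
    have hB' : 0 < (L.B - L.P).re * (L.B - L.P).im := hL.2.2.1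
    have a1 := apex_of_backward oA hL.1 hL.2.1
    have a2 := apex_of_backward oB hL.2.2.1 hL.2.2.2
    rw [StraightTriangulation.QuadLayout.flippedWidth, Complex.sub_re, lt_abs]
    rcases a1 with ⟨i1, i2, i3, i4⟩ | ⟨i1, i2, i3, i4⟩ <;>
      rcases a2 with ⟨j1, j2, j3, j4⟩ | ⟨j1, j2, j3, j4⟩
    · linarith
    · have k1 := s.not_mem_window hA hD (by rwa [uIoo_of_lt i1])
      have k2 := s.not_mem_window hB hD (by rwa [uIoo_of_lt i1])
      right
      rcases k1 with k1 | k1 <;> rcases k2 with k2 | k2 <;> linarith [hPx.1, hPx.2, hRx.1, hRx.2]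
    · have k1 := s.not_mem_window hA hD (by rwa [uIoo_of_gt i1])
      have k2 := s.not_mem_window hB hD (by rwa [uIoo_of_gt i1])
      left
      rcases k1 with k1 | k1 <;> rcases k2 with k2 | k2 <;> linarith [hPx.1, hPx.2, hRx.1, hRx.2]
    · linarith

end HalfTranslationStructure

/-! ### Edges and adjacent faces of an arbitrary straight triangulation, seen from a point. -/

/-- Parametrisations of closed faces need not be injective on the boundary. Along an ultrafilter,
compactness nevertheless gives a convergent choice of preimages. -/
theorem Ultrafilter.exists_lift {ι X Y : Type*} [TopologicalSpace X] [TopologicalSpace Y] [T2Space Y]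
    (U : Ultrafilter ι) {K : Set X} (hK : IsCompact K) {g : X → Y} (hg : ContinuousOn g K)
    {u : ι → Y} {p : Y} (hu : Tendsto u U (𝓝 p)) (hm : ∀ᶠ i in (U : Filter ι), u i ∈ g '' K) :
    ∃ (y : ι → X) (k : X), k ∈ K ∧ Tendsto y U (𝓝[K] k) ∧ g k = p ∧
      ∀ᶠ i in (U : Filter ι), g (y i) = u i := by
  obtain ⟨_, x₀, -, -⟩ := hm.exists
  have : ∀ i, ∃ x, u i ∈ g '' K → x ∈ K ∧ g x = u i := fun i => by
    by_cases h : u i ∈ g '' K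
    · obtain ⟨x, hx⟩ := h
      exact ⟨x, fun _ => hx⟩
    · exact ⟨x₀, fun h' => absurd h' h⟩
  choose y hy using this
  have hyK : ∀ᶠ i in (U : Filter ι), y i ∈ K := hm.mono fun i hi => (hy i hi).1
  have hyg : ∀ᶠ i in (U : Filter ι), g (y i) = u i := hm.mono fun i hi => (hy i hi).2
  obtain ⟨k, hk, hkU⟩ := hK.ultrafilter_le_nhds' (U.map y) hyK
  have ht : Tendsto y U (𝓝[K] k) := tendsto_nhdsWithin_iff.2 ⟨hkU, hyK⟩
  refine ⟨y, k, hk, ht, ?_, hyg⟩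
  exact tendsto_nhds_unique (((hg k hk).tendsto.comp ht).congr' hyg) hu

namespace HalfTranslationStructure

variable {S : Type*} [TopologicalSpace S] {q : HalfTranslationStructure S}

namespace StraightTriangulation

variable (τ : q.StraightTriangulation)

theorem exists_flat_edge {e : Set S} (he : e ∈ τ.edges) :
    ∃ g P Q, P ≠ Q ∧ q.IsFlatMap (segment ℝ P Q) {P, Q} g ∧ e = g '' segment ℝ P Q := by
  obtain ⟨v, hv, g, hg, -, rfl⟩ := τ.edge_saddle e he
  exact ⟨g, 0, v, hv.symm, hg, rfl⟩

theorem isClosed_edge [T2Space S] {e : Set S} (he : e ∈ τ.edges) : IsClosed e := by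
  obtain ⟨g, P, Q, -, hg, rfl⟩ := τ.exists_flat_edge he
  have hc : IsCompact (segment ℝ P Q) := by
    rw [segment_eq_image]
    exact isCompact_Icc.image (by fun_prop)
  exact (hc.image_of_continuousOn hg.continuousOn).isClosed

/-- An edge through the base point is seen as a segment. -/
theorem exists_edge_in_sky [T2Space S] {w₀ : ℂ} {f : ℂ → S} {D V : Set ℂ} (s : q.Sky w₀ f D V)
    {e : Set S} (he : e ∈ τ.edges) (h0 : f w₀ ∈ e) :
    ∃ P ∈ V, ∃ R ∈ V, w₀ ∈ openSegment ℝ P R ∧ e = f '' segment ℝ P R := by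
  obtain ⟨g, P, Q, hne, hg, rfl⟩ := τ.exists_flat_edge he
  obtain ⟨w, hw, hw'⟩ := h0
  have hwv : w ∉ ({P, Q} : Set ℂ) := fun h => s.free.notMem s.base (hw' ▸ hg.vertices w h)
  have hwo : w ∈ openSegment ℝ P Q := mem_openSegment_of_ne_left_right
    (fun h => hwv (Or.inl h.symm)) (fun h => hwv (Or.inr h.symm)) hw
  obtain ⟨h, hh, h0, -, h2, h3⟩ := s.fit_of_eq hg ⟨hw, hwv⟩ (segment_star hwo hne).2 hw'
  obtain ⟨h', -, -, hr⟩ := hh.exists_inverse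
  obtain ⟨P₁, rfl⟩ : ∃ P₁, h P₁ = P := ⟨_, hr P⟩
  obtain ⟨Q₁, rfl⟩ : ∃ Q₁, h Q₁ = Q := ⟨_, hr Q⟩
  refine ⟨P₁, h2 _ (left_mem_segment ℝ _ _) (by simp), Q₁, h2 _ (right_mem_segment ℝ _ _) (by simp),
    ?_, ?_⟩
  · rw [← hh.image_openSegment] at hwo
    obtain ⟨z, hz, hzw⟩ := hwo
    rwa [← hh.injective (hzw.trans h0.symm)]
  · refine (hh.image_segment_eq fun z hz => h3 z ?_).symm
    rw [← hh.image_segment]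
    exact mem_image_of_mem h hz

/-- Otherwise points off the segment, converging to `w₀`, would have preimages on the segment that
also converge to `w₀`, against local injectivity of `f`. -/
theorem eventually_mem_edge [T2Space S] {w₀ : ℂ} {f : ℂ → S} {D V : Set ℂ} (s : q.Sky w₀ f D V)
    {P R : ℂ} (hP : P ∈ V) (hR : R ∈ V) (h0 : w₀ ∈ openSegment ℝ P R) :
    ∀ᶠ x in 𝓝 w₀, f x ∈ f '' segment ℝ P R → x ∈ segment ℝ P R := by
  by_contra hn
  have hfr : ∃ᶠ x in 𝓝 w₀, f x ∈ f '' segment ℝ P R ∧ x ∉ segment ℝ P R :=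
    (not_eventually.1 hn).mono fun x hx => Classical.not_imp.1 hx
  have : (𝓝 w₀ ⊓ 𝓟 {x | f x ∈ f '' segment ℝ P R ∧ x ∉ segment ℝ P R}).NeBot :=
    frequently_iff_neBot.1 hfr
  set U := Ultrafilter.of (𝓝 w₀ ⊓ 𝓟 {x | f x ∈ f '' segment ℝ P R ∧ x ∉ segment ℝ P R}) with hU
  have hU1 := (Ultrafilter.of_le (𝓝 w₀ ⊓ 𝓟 {x | f x ∈ f '' segment ℝ P R ∧ x ∉ segment ℝ P R}))
  have hUn : (U : Filter ℂ) ≤ 𝓝 w₀ := hU1.trans inf_le_left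
  have hUm : ∀ᶠ x in (U : Filter ℂ), f x ∈ f '' segment ℝ P R ∧ x ∉ segment ℝ P R :=
    (hU1.trans inf_le_right) (mem_principal_self _)
  have hPR : P ≠ R := by
    rintro rfl
    rw [openSegment_same] at h0
    exact s.starView.notMem hP (h0 ▸ s.base)
  have hf := s.flatMap_segment hP hR (s.starView.openSegment_subset hP hR h0)
  have hc : IsCompact (segment ℝ P R) := by
    rw [segment_eq_image]
    exact isCompact_Icc.image (by fun_prop)
  have hfc : ContinuousAt f w₀ := (s.cont.continuousAt
    (mem_of_superset (s.isOpen.mem_nhds s.base) subset_union_left))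
  obtain ⟨y, k, hk, hy, hk0, hfy⟩ := U.exists_lift hc hf.continuousOn (hfc.tendsto.mono_left hUn)
    (hUm.mono fun x hx => hx.1)
  have hkw : k = w₀ := by
    have hkv : k ∉ ({P, R} : Set ℂ) := fun h => s.free.notMem s.base (hk0 ▸ hf.vertices k h)
    exact hf.injOn_openSegment hPR (mem_openSegment_of_ne_left_right
      (fun h => hkv (Or.inl h.symm)) (fun h => hkv (Or.inr h.symm)) hk) h0 hk0
  subst hkw
  obtain ⟨N, hN, hinj⟩ := s.free.injOn_nhds s.base
  rw [s.isOpen.nhdsWithin_eq s.base] at hN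
  have hNU : ∀ᶠ x in (U : Filter ℂ), x ∈ N := hUn hN
  have hyN : ∀ᶠ x in (U : Filter ℂ), y x ∈ N ∩ segment ℝ P R :=
    hy.eventually (inter_mem (mem_nhdsWithin_of_mem_nhds hN) self_mem_nhdsWithin)
  obtain ⟨x, ⟨⟨hx1, hx2⟩, hx3⟩, hx4, hx5⟩ := ((hUm.and hfy).and (hNU.and hyN)).exists
  exact hx2 (hinj hx5.1 hx4 hx3 ▸ hx5.2)

/-- This is `exists_left_face` when the lifted points converge to a point of the side `P' Q'`. Edges
are disjoint, so that side is the given edge. The opposite matching of the ends would put the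
triangle on the right, while the points come from the left. -/
theorem exists_left_face_aux [T2Space S] [CompactSpace S] {w₀ : ℂ} {f : ℂ → S} {D V : Set ℂ}
    (s : q.Sky w₀ f D V) {P R : ℂ} (hP : P ∈ V) (hR : R ∈ V) (h0 : w₀ ∈ openSegment ℝ P R)
    (he : f '' segment ℝ P R ∈ τ.edges) {g : ℂ → S} {P' Q' R' k : ℂ}
    (hT : q.IsFlatTriangle g P' Q' R') (hF : g '' interior (planeTriangle P' Q' R') ∈ τ.faces)
    (hk : k ∈ segment ℝ P' Q') (hk0 : g k = f w₀) {U : Ultrafilter ℂ} {y : ℂ → ℂ}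
    (hUn : (U : Filter ℂ) ≤ 𝓝 w₀) (hUo : ∀ᶠ x in (U : Filter ℂ), 0 < orient P R x)
    (hy : Tendsto y U (𝓝[planeTriangle P' Q' R'] k)) (hfy : ∀ᶠ x in (U : Filter ℂ), g (y x) = f x) :
    ∃ A ∈ V, q.IsFlatTriangle f P R A ∧ f '' interior (planeTriangle P R A) ∈ τ.faces ∧
      planeTriangle P R A \ {P, R, A} ⊆ D := by
  have hkv : k ∉ ({P', Q', R'} : Set ℂ) := fun h =>
    s.free.notMem s.base (hk0 ▸ hT.flatMap.vertices k h)
  have hko : k ∈ openSegment ℝ P' Q' := mem_openSegment_of_ne_left_right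
    (fun h => hkv (Or.inl h.symm)) (fun h => hkv (Or.inr (Or.inl h.symm))) hk
  obtain ⟨h, P₁, Q₁, R₁, hh, rfl, rfl, rfl, h0', hP₁, hQ₁, hR₁, hT₁, hD, heq, hiff⟩ :=
    s.fit_triangle hT.anticlockwise hT.flatMap
      ⟨segment_subset_planeTriangle _ _ _ hk, hkv⟩ hk0
  have hint := Sky.image_interior_eq hh hT₁ heq
  have hseg : f '' segment ℝ P₁ Q₁ = g '' segment ℝ (h P₁) (h Q₁) :=
    hh.image_segment_eq fun z hz => heq z (segment_subset_planeTriangle _ _ _ hz)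
  have h01 : w₀ ∈ openSegment ℝ P₁ Q₁ := by
    rw [← hh.image_openSegment] at hko
    obtain ⟨z, hz, hzw⟩ := hko
    rwa [← hh.injective (hzw.trans h0'.symm)]
  have hflat : q.IsFlatTriangle f P₁ Q₁ R₁ := by
    refine ⟨hT₁, s.flatMap_triangle hP₁ hQ₁ hR₁ hD, fun a ha b hb hab => ?_⟩
    have hm : ∀ z ∈ interior (planeTriangle P₁ Q₁ R₁),
        h z ∈ interior (planeTriangle (h P₁) (h Q₁) (h R₁)) := fun z hz =>
      hh.image_interior hT₁ ▸ mem_image_of_mem h hz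
    rw [heq a (interior_subset ha), heq b (interior_subset hb)] at hab
    exact hh.injective (hT.injOn (hm a ha) (hm b hb) hab)
  have hsame : f '' segment ℝ P₁ Q₁ = f '' segment ℝ P R := by
    have h1 := τ.side_mem hT hF
    rw [← hseg] at h1
    by_contra hne
    have := τ.edges_disjoint h1 he hne
    exact Set.disjoint_left.1 this
      ⟨mem_image_of_mem f (openSegment_subset_segment ℝ _ _ h01), s.free.notMem s.base⟩
      ⟨mem_image_of_mem f (openSegment_subset_segment ℝ _ _ h0), s.free.notMem s.base⟩
  rcases s.endpoints_eq_of_image_eq hP₁ hQ₁ hP hR h01 h0 hsame.subset with ⟨rfl, rfl⟩ | ⟨rfl, rfl⟩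
  · exact ⟨R₁, hR₁, hflat, hint ▸ hF, hD⟩
  · exfalso
    obtain ⟨h', hh', hl, hr⟩ := hh.exists_inverse
    obtain ⟨N, hN, hinj⟩ := s.free.injOn_nhds s.base
    rw [s.isOpen.nhdsWithin_eq s.base] at hN
    have hz : Tendsto (fun x => h' (y x)) U (𝓝 w₀) := by
      have := (hh'.continuous.tendsto k).comp (hy.mono_right nhdsWithin_le_nhds)
      rwa [← h0', hl] at this
    have hNU : ∀ᶠ x in (U : Filter ℂ), x ∈ N := hUn hN
    have hzN : ∀ᶠ x in (U : Filter ℂ), h' (y x) ∈ N := hz.eventually hN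
    have hyT : ∀ᶠ x in (U : Filter ℂ), y x ∈ planeTriangle (h P₁) (h Q₁) (h R₁) :=
      hy.eventually self_mem_nhdsWithin
    obtain ⟨x, ⟨⟨hx1, hx2⟩, hx3⟩, hx4, hx5⟩ := (((hUo.and hfy).and hNU).and (hzN.and hyT)).exists
    have hm : h' (y x) ∈ planeTriangle P₁ Q₁ R₁ := (hiff _).2 (by rwa [hr])
    have hxe : h' (y x) = x := hinj hx4 hx3 (by rw [heq _ hm, hr, hx2])
    rw [hxe, hT₁.mem_planeTriangle] at hm
    rw [orient_swap] at hx1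
    linarith [hm.1]

/-- On the left of an edge there is a face. -/
theorem exists_left_face [T2Space S] [CompactSpace S] {w₀ : ℂ} {f : ℂ → S} {D V : Set ℂ}
    (s : q.Sky w₀ f D V) {P R : ℂ} (hP : P ∈ V) (hR : R ∈ V) (h0 : w₀ ∈ openSegment ℝ P R)
    (he : f '' segment ℝ P R ∈ τ.edges) :
    ∃ A ∈ V, q.IsFlatTriangle f P R A ∧ f '' interior (planeTriangle P R A) ∈ τ.faces ∧
      planeTriangle P R A \ {P, R, A} ⊆ D := by
  have hPR : P ≠ R := by
    rintro rfl
    rw [openSegment_same] at h0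
    exact s.starView.notMem hP (h0 ▸ s.base)
  have hfr : ∃ᶠ x in 𝓝 w₀, 0 < orient P R x := by
    have ht : Tendsto (fun t : ℝ => w₀ + t * (Complex.I * (R - P))) (𝓝[>] 0) (𝓝 w₀) := by
      have : Continuous fun t : ℝ => w₀ + t * (Complex.I * (R - P)) := by fun_prop
      simpa using (this.tendsto 0).mono_left nhdsWithin_le_nhds
    refine ht.frequently (Eventually.frequently ?_)
    filter_upwards [self_mem_nhdsWithin] with t ht
    have h1 := orient_eq_zero_of_mem_openSegment h0
    have h2 : 0 < (R - P).re ^ 2 + (R - P).im ^ 2 := by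
      have := Complex.normSq_pos.2 (sub_ne_zero.2 hPR.symm)
      rw [Complex.normSq_apply] at this
      linarith
    have : orient P R (w₀ + t * (Complex.I * (R - P))) =
        orient P R w₀ + t * ((R - P).re ^ 2 + (R - P).im ^ 2) := by
      simp [orient]; ring
    rw [this, h1, zero_add]
    exact mul_pos ht h2
  have : (𝓝 w₀ ⊓ 𝓟 {x | 0 < orient P R x}).NeBot := frequently_iff_neBot.1 hfr
  -- Near `w₀`, points strictly left of the edge lie on no edge, hence in faces. An ultrafilter
  -- converging to `w₀` from the left selects one of these finitely many faces.
  set U := Ultrafilter.of (𝓝 w₀ ⊓ 𝓟 {x | 0 < orient P R x})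
  have hU1 := Ultrafilter.of_le (𝓝 w₀ ⊓ 𝓟 {x | 0 < orient P R x})
  have hUn : (U : Filter ℂ) ≤ 𝓝 w₀ := hU1.trans inf_le_left
  have hUo : ∀ᶠ x in (U : Filter ℂ), 0 < orient P R x :=
    (hU1.trans inf_le_right) (mem_principal_self _)
  have hfc : ContinuousAt f w₀ := (s.cont.continuousAt
    (mem_of_superset (s.isOpen.mem_nhds s.base) subset_union_left))
  have hw : f w₀ ∈ f '' segment ℝ P R := mem_image_of_mem f (openSegment_subset_segment ℝ _ _ h0)
  have hne : ∀ᶠ x in 𝓝 w₀, ∀ e ∈ τ.edges, e ≠ f '' segment ℝ P R → f x ∉ e := by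
    refine (eventually_all_finite τ.finite_edges).2 fun e he' => ?_
    by_cases hee : e = f '' segment ℝ P R
    · exact Eventually.of_forall fun x h => absurd hee h
    · have : f w₀ ∉ e := fun h => Set.disjoint_left.1 (τ.edges_disjoint he' he hee)
        ⟨h, s.free.notMem s.base⟩ ⟨hw, s.free.notMem s.base⟩
      exact (hfc.eventually ((τ.isClosed_edge he').isOpen_compl.mem_nhds this)).mono fun x hx _ => hx
  have hface : ∀ᶠ x in (U : Filter ℂ), f x ∈ ⋃₀ τ.faces := by
    filter_upwards [hUn hne, hUn (eventually_mem_edge s hP hR h0), hUo] with x h1 h2 h3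
    have : f x ∈ ⋃₀ τ.edges ∪ ⋃₀ τ.faces := τ.cover ▸ mem_univ _
    rcases this with ⟨e, he', hxe⟩ | h
    · exfalso
      by_cases hee : e = f '' segment ℝ P R
      · have hx := h2 (hee ▸ hxe)
        have hxo : orient P R x = 0 := by
          obtain ⟨a, b, -, -, hab, rfl⟩ := hx
          rw [orient_combo _ _ _ _ hab, orient_self_left, orient_self_right]; ring
        exact h3.ne' hxo
      · exact h1 e he' hee hxe
    · exact h
  obtain ⟨F, hF, hFU⟩ : ∃ F ∈ τ.faces, f ⁻¹' F ∈ U := by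
    have : f ⁻¹' ⋃₀ τ.faces ∈ U := hface
    rw [preimage_sUnion] at this
    exact (Ultrafilter.finite_biUnion_mem_iff τ.finite_faces).1 this
  obtain ⟨g, P', Q', R', hT, rfl, -⟩ := τ.face_triangle F hF
  obtain ⟨y, k, hk, hy, hk0, hfy⟩ := U.exists_lift (isCompact_planeTriangle P' Q' R')
    hT.flatMap.continuousOn (hfc.tendsto.mono_left hUn)
    (mem_of_superset hFU fun x hx => image_mono interior_subset hx)
  have hki : k ∉ interior (planeTriangle P' Q' R') := fun h =>
    Set.disjoint_left.1 (τ.edge_face_disjoint _ he _ hF) hw (hk0 ▸ mem_image_of_mem g h)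
  rcases hT.anticlockwise.mem_side hk hki with h | h | h
  · exact τ.exists_left_face_aux s hP hR h0 he hT hF h hk0 hUn hUo hy hfy
  · exact τ.exists_left_face_aux s hP hR h0 he hT.rotate (by rwa [planeTriangle_rotate]) h hk0 hUn hUo
      (by rwa [planeTriangle_rotate]) hfy
  · exact τ.exists_left_face_aux s hP hR h0 he hT.rotate.rotate
      (by rwa [planeTriangle_rotate, planeTriangle_rotate]) h hk0 hUn hUo
      (by rwa [planeTriangle_rotate, planeTriangle_rotate]) hfy

end StraightTriangulation

end HalfTranslationStructure

/-! ### Straight paths crossing the triangles of a veering triangulation. -/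

theorem planeTriangle_swap (P Q R : ℂ) : planeTriangle Q P R = planeTriangle P Q R := by
  rw [planeTriangle, planeTriangle, insert_comm]

section Signed

variable {σ : ℝ} {P R A w : ℂ}

theorem mem_planeTriangle_of_sign (hσ : σ = 1 ∨ σ = -1) (h : 0 < σ * orient P R A) :
    w ∈ planeTriangle P R A ↔
      0 ≤ σ * orient P R w ∧ 0 ≤ σ * orient R A w ∧ 0 ≤ σ * orient A P w := by
  rcases hσ with rfl | rfl
  · have hT : Anticlockwise P R A := show 0 < orient P R A by simpa using h
    simpa using hT.mem_planeTriangle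
  · have hT : Anticlockwise R P A := by
      have : 0 < orient R P A := by rw [orient_swap]; linarith
      exact this
    rw [← planeTriangle_swap, hT.mem_planeTriangle, orient_swap R P, orient_swap A P, orient_swap R A]
    constructor <;> rintro ⟨h1, h2, h3⟩ <;> refine ⟨?_, ?_, ?_⟩ <;> linarith

theorem star_of_sign (hσ : σ = 1 ∨ σ = -1) (h : 0 < σ * orient P R A)
    (hw : w ∈ planeTriangle P R A \ {P, R, A}) : ∀ k ∈ planeTriangle P R A, ∀ t : ℝ, 0 ≤ t → t < 1 →
      w + t * (k - w) ∈ planeTriangle P R A \ {P, R, A} := by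
  rcases hσ with rfl | rfl
  · have hT : Anticlockwise P R A := show 0 < orient P R A by simpa using h
    exact hT.star hw
  · have hT : Anticlockwise R P A := by
      have : 0 < orient R P A := by rw [orient_swap]; linarith
      exact this
    rw [← planeTriangle_swap, insert_comm] at hw ⊢
    exact hT.star hw

theorem mem_segment_of_sign (hσ : σ = 1 ∨ σ = -1) (h : 0 < σ * orient P R A)
    (hw : w ∈ planeTriangle P R A) (h0 : orient P R w = 0) : w ∈ segment ℝ P R := by
  rcases hσ with rfl | rfl
  · have hT : Anticlockwise P R A := show 0 < orient P R A by simpa using h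
    exact hT.mem_segment_of_orient_eq_zero hw h0
  · have hT : Anticlockwise R P A := by
      have : 0 < orient R P A := by rw [orient_swap]; linarith
      exact this
    rw [segment_symm]
    exact hT.mem_segment_of_orient_eq_zero (by rwa [planeTriangle_swap])
      (by rw [orient_swap, h0, neg_zero])

end Signed

/-- Of two affine functions that start positive and do not both stay nonnegative, take the first to
vanish. The sign of `a₀ * b₁ - a₁ * b₀` tells which one it is. -/
theorem exists_first_zero {a₀ b₀ a₁ b₁ : ℝ} (ha : 0 < a₀) (hb : 0 < b₀) (h : a₁ < 0 ∨ b₁ < 0) :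
    ∃ t : ℝ, 0 < t ∧ t < 1 ∧
      ((1 - t) * a₀ + t * a₁ = 0 ∧ 0 ≤ (1 - t) * b₀ + t * b₁ ∧ a₁ < 0 ∨
        (1 - t) * b₀ + t * b₁ = 0 ∧ 0 ≤ (1 - t) * a₀ + t * a₁ ∧ b₁ < 0) := by
  have key : ∀ {a₀ b₀ a₁ b₁ : ℝ}, 0 < a₀ → a₁ < 0 → 0 ≤ a₀ * b₁ - a₁ * b₀ →
      ∃ t : ℝ, 0 < t ∧ t < 1 ∧ (1 - t) * a₀ + t * a₁ = 0 ∧ 0 ≤ (1 - t) * b₀ + t * b₁ := by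
    intro a₀ b₀ a₁ b₁ ha ha₁ hc
    have hd : 0 < a₀ - a₁ := by linarith
    refine ⟨a₀ / (a₀ - a₁), div_pos ha hd, (div_lt_one hd).2 (by linarith), by field_simp; ring, ?_⟩
    have : (1 - a₀ / (a₀ - a₁)) * b₀ + a₀ / (a₀ - a₁) * b₁ = (a₀ * b₁ - a₁ * b₀) / (a₀ - a₁) := by
      field_simp; ring
    rw [this]
    exact div_nonneg hc hd.le
  rcases le_total 0 (a₀ * b₁ - a₁ * b₀) with hc | hc
  · have ha₁ : a₁ < 0 := by
      by_contra! h'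
      have hb₁ := h.resolve_left (not_lt.2 h')
      nlinarith [mul_pos ha (neg_pos.2 hb₁), mul_nonneg h' hb.le]
    obtain ⟨t, h1, h2, h3, h4⟩ := key ha ha₁ hc
    exact ⟨t, h1, h2, Or.inl ⟨h3, h4, ha₁⟩⟩
  · by_cases hb₁ : b₁ < 0
    · obtain ⟨t, h1, h2, h3, h4⟩ := key (b₀ := a₀) (b₁ := a₁) hb hb₁ (by linarith)
      exact ⟨t, h1, h2, Or.inr ⟨h3, h4, hb₁⟩⟩
    · have ha₁ := h.resolve_right hb₁
      nlinarith [mul_nonneg ha.le (not_lt.1 hb₁), mul_pos (neg_pos.2 ha₁) hb]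

/-- The position of the third vertex of a triangle on the upper left of a side of positive slope, when
the other two sides do not both have positive slope. -/
theorem apex_cases {px py rx ry ax ay : ℝ} (hx : px < rx) (hy : py < ry)
    (ho : 0 < (rx - px) * (ay - py) - (ry - py) * (ax - px)) (h1 : ax ≠ px) (h2 : ax ≠ rx)
    (h4 : ay ≠ ry) (hc : ¬ (0 < (ax - rx) * (ay - ry) ∧ 0 < (px - ax) * (py - ay))) (h3 : ay ≠ py) :
    ax < px ∧ ry < ay ∨ ax < px ∧ py < ay ∧ ay < ry ∨ px < ax ∧ ax < rx ∧ ry < ay := by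
  rcases lt_or_gt_of_ne h1 with a | a
  · rcases lt_or_gt_of_ne h4 with b | b
    · rcases lt_or_gt_of_ne h3 with c | c
      · exact absurd ⟨mul_pos_of_neg_of_neg (by linarith) (by linarith),
          mul_pos (by linarith) (by linarith)⟩ hc
      · exact Or.inr (Or.inl ⟨a, c, b⟩)
    · exact Or.inl ⟨a, b⟩
  · rcases lt_or_gt_of_ne h4 with b | b
    · exfalso
      have hay : py < ay := by nlinarith [mul_pos (sub_pos.2 hy) (sub_pos.2 a)]
      rcases lt_or_gt_of_ne h2 with c | c
      · exact hc ⟨mul_pos_of_neg_of_neg (by linarith) (by linarith),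
          mul_pos_of_neg_of_neg (by linarith) (by linarith)⟩
      · nlinarith [mul_pos (sub_pos.2 hx) (sub_pos.2 b), mul_pos (sub_pos.2 hy) (sub_pos.2 c)]
    · rcases lt_or_gt_of_ne h2 with c | c
      · exact Or.inr (Or.inr ⟨a, c, b⟩)
      · exact absurd ⟨mul_pos (by linarith) (by linarith),
          mul_pos_of_neg_of_neg (by linarith) (by linarith)⟩ hc

namespace HalfTranslationStructure

variable {S : Type*} [TopologicalSpace S] {q : HalfTranslationStructure S}

theorem IsSaddleConnection.re_ne_zero (hq : q.IsKeane) {e : Set S} {v : ℂ}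
    (h : q.IsSaddleConnection e v) : v.re ≠ 0 ∧ v.im ≠ 0 :=
  ⟨fun h0 => hq.2 ⟨e, v, h, h0⟩, fun h0 => hq.1 ⟨e, v, h, h0⟩⟩

namespace StraightTriangulation

/-- A face of `τ`, seen in the sky as a triangle with vertices `P`, `R`, `A`, anti-clockwise if `σ = 1`
and clockwise if `σ = -1`. -/
structure Wing (τ : q.StraightTriangulation) (f : ℂ → S) (D V : Set ℂ) (σ : ℝ) (P R A : ℂ) :
    Prop where
  sign : σ = 1 ∨ σ = -1
  left : P ∈ V
  right : R ∈ V
  apex : A ∈ V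
  pos : 0 < σ * orient P R A
  sub : planeTriangle P R A \ {P, R, A} ⊆ D
  side₁ : f '' segment ℝ P R ∈ τ.edges
  side₂ : f '' segment ℝ R A ∈ τ.edges
  side₃ : f '' segment ℝ A P ∈ τ.edges
  colour : ∀ c : ℝ, ¬ (0 < c * ((R - P).re * (R - P).im) ∧ 0 < c * ((A - R).re * (A - R).im) ∧
    0 < c * ((P - A).re * (P - A).im))
  re_ne : P.re ≠ R.re ∧ R.re ≠ A.re ∧ A.re ≠ P.re
  im_ne : P.im ≠ R.im ∧ R.im ≠ A.im ∧ A.im ≠ P.im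

variable {τ : q.StraightTriangulation} {f : ℂ → S} {w₀ : ℂ} {D V : Set ℂ} {σ : ℝ} {P R A : ℂ}

theorem Wing.rotate (W : τ.Wing f D V σ P R A) : τ.Wing f D V σ R A P where
  sign := W.sign
  left := W.right
  right := W.apex
  apex := W.left
  pos := by rw [orient_rotate]; exact W.pos
  sub := by
    rw [planeTriangle_rotate, pair_comm A P, insert_comm]
    exact W.sub
  side₁ := W.side₂
  side₂ := W.side₃
  side₃ := W.side₁
  colour c h := W.colour c ⟨h.2.2, h.1, h.2.1⟩
  re_ne := ⟨W.re_ne.2.1, W.re_ne.2.2, W.re_ne.1⟩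
  im_ne := ⟨W.im_ne.2.1, W.im_ne.2.2, W.im_ne.1⟩

theorem Wing.swap (W : τ.Wing f D V σ P R A) : τ.Wing f D V (-σ) R P A where
  sign := by rcases W.sign with rfl | rfl <;> simp
  left := W.right
  right := W.left
  apex := W.apex
  pos := by rw [orient_swap, neg_mul_neg]; exact W.pos
  sub := by
    rw [planeTriangle_swap, insert_comm]
    exact W.sub
  side₁ := by rw [segment_symm]; exact W.side₁
  side₂ := by rw [segment_symm]; exact W.side₃
  side₃ := by rw [segment_symm]; exact W.side₂
  colour c h := by
    refine W.colour c ⟨?_, ?_, ?_⟩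
    · have := h.1; simp only [Complex.sub_re, Complex.sub_im] at this ⊢; linarith
    · have := h.2.2; simp only [Complex.sub_re, Complex.sub_im] at this ⊢; linarith
    · have := h.2.1; simp only [Complex.sub_re, Complex.sub_im] at this ⊢; linarith
  re_ne := ⟨W.re_ne.1.symm, W.re_ne.2.2.symm, W.re_ne.2.1.symm⟩
  im_ne := ⟨W.im_ne.1.symm, W.im_ne.2.2.symm, W.im_ne.2.1.symm⟩

theorem wing_of_face [T2Space S] [CompactSpace S] (hq : q.IsKeane) (hτ : τ.IsVeering)
    (hP : P ∈ V) (hR : R ∈ V) (hA : A ∈ V)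
    (hT : q.IsFlatTriangle f P R A) (hF : f '' interior (planeTriangle P R A) ∈ τ.faces)
    (hD : planeTriangle P R A \ {P, R, A} ⊆ D) : τ.Wing f D V 1 P R A := by
  have f₁ := hT.flatMap.segment_of_triangle hT.anticlockwise
  have f₂ := hT.rotate.flatMap.segment_of_triangle hT.rotate.anticlockwise
  have f₃ := hT.rotate.rotate.flatMap.segment_of_triangle hT.rotate.rotate.anticlockwise
  have n₁ := hT.anticlockwise.ne
  have n₂ := hT.rotate.anticlockwise.ne
  have n₃ := hT.rotate.rotate.anticlockwise.ne
  have z₁ := (f₁.isSaddleConnection n₁).re_ne_zero hq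
  have z₂ := (f₂.isSaddleConnection n₂).re_ne_zero hq
  have z₃ := (f₃.isSaddleConnection n₃).re_ne_zero hq
  simp only [Complex.sub_re, Complex.sub_im, sub_ne_zero] at z₁ z₂ z₃
  have hc := hτ.triangle f P R A hT hF
  rw [f₁.isRed_iff n₁, f₂.isRed_iff n₂, f₃.isRed_iff n₃, f₁.isBlue_iff n₁, f₂.isBlue_iff n₂,
    f₃.isBlue_iff n₃] at hc
  refine ⟨Or.inl rfl, hP, hR, hA, ?_, hD, τ.side_mem hT hF,
    τ.side_mem hT.rotate (by rwa [planeTriangle_rotate]),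
    τ.side_mem hT.rotate.rotate (by rwa [planeTriangle_rotate, planeTriangle_rotate]), ?_,
    ⟨z₁.1.symm, z₂.1.symm, z₃.1.symm⟩, ⟨z₁.2.symm, z₂.2.symm, z₃.2.symm⟩⟩
  · rw [one_mul]; exact hT.anticlockwise
  · rintro c ⟨h1, h2, h3⟩
    rcases lt_trichotomy c 0 with h | rfl | h
    · exact hc.2 ⟨neg_of_mul_pos_right h1 h.le, neg_of_mul_pos_right h2 h.le,
        neg_of_mul_pos_right h3 h.le⟩
    · simp at h1
    · exact hc.1 ⟨pos_of_mul_pos_right h1 h.le, pos_of_mul_pos_right h2 h.le,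
        pos_of_mul_pos_right h3 h.le⟩

theorem exists_wing [T2Space S] [CompactSpace S] (hq : q.IsKeane) (hτ : τ.IsVeering)
    (s : q.Sky w₀ f D V) (hP : P ∈ V) (hR : R ∈ V) (h0 : w₀ ∈ openSegment ℝ P R)
    (he : f '' segment ℝ P R ∈ τ.edges) (hσ : σ = 1 ∨ σ = -1) : ∃ A, τ.Wing f D V σ P R A := by
  rcases hσ with rfl | rfl
  · obtain ⟨A, hA, hT, hF, hD⟩ := τ.exists_left_face s hP hR h0 he
    exact ⟨A, wing_of_face hq hτ hP hR hA hT hF hD⟩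
  · obtain ⟨A, hA, hT, hF, hD⟩ := τ.exists_left_face s hR hP (by rwa [openSegment_symm])
      (by rwa [segment_symm])
    exact ⟨A, (wing_of_face hq hτ hR hP hA hT hF hD).swap⟩

/-- The triangle stays in view from each of its non-vertices. So does a visible point `κ` when the
base point moves along the ray towards it. Thus a straight path to `κ` can be followed from triangle
to triangle. -/
theorem Wing.rebase [T2Space S] [CompactSpace S] (s : q.Sky w₀ f D V) (W : τ.Wing f D V σ P R A)
    {w₁ : ℂ} (hw : w₁ ∈ planeTriangle P R A \ {P, R, A}) :
    ∃ f' D' V', q.Sky w₁ f' D' V' ∧ τ.Wing f' D' V' σ P R A ∧ EqOn f' f (planeTriangle P R A) ∧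
      ∀ κ ∈ V, ∀ t : ℝ, t < 1 → w₁ = w₀ + t * (κ - w₀) → 0 ≤ t → κ ∈ V' := by
  obtain ⟨f', D', V', s', he⟩ := exists_sky_of_free s.free (W.sub hw)
  have hTV : planeTriangle P R A ⊆ D ∪ V := fun z hz => by
    by_cases h : z ∈ ({P, R, A} : Set ℂ)
    · right
      rcases h with rfl | rfl | rfl
      exacts [W.left, W.right, W.apex]
    · exact Or.inl (W.sub ⟨hz, h⟩)
  have hflat : q.IsFlatMap (planeTriangle P R A) {P, R, A} f :=
    s.flatMap_triangle W.left W.right W.apex W.sub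
  obtain ⟨h1, h2, h3⟩ := s'.fit hflat
    (fun k hk t h0 ht => star_of_sign W.sign W.pos hw k hk t h0 ht)
    (he.filter_mono (nhdsWithin_mono _ W.sub))
  have hv := vertices_subset P R A
  have hs : ∀ X ∈ ({P, R, A} : Set ℂ), ∀ Y ∈ ({P, R, A} : Set ℂ),
      f' '' segment ℝ X Y = f '' segment ℝ X Y := fun X hX Y hY =>
    (h3.mono ((convex_planeTriangle P R A).segment_subset (hv hX) (hv hY))).image_eq
  refine ⟨f', D', V', s', ⟨W.sign, h2 ⟨hv (by simp), by simp⟩, h2 ⟨hv (by simp), by simp⟩,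
    h2 ⟨hv (by simp), by simp⟩, W.pos, h1, ?_, ?_, ?_, W.colour, W.re_ne, W.im_ne⟩, h3, ?_⟩
  · rw [hs P (by simp) R (by simp)]; exact W.side₁
  · rw [hs R (by simp) A (by simp)]; exact W.side₂
  · rw [hs A (by simp) P (by simp)]; exact W.side₃
  · intro κ hκ t ht hwt ht0
    have hray := ((s.mem_V κ).1 hκ).2
    have hmem : ∀ r : ℝ, 0 ≤ r → r < 1 → w₁ + r * (κ - w₁) ∈ D := by
      intro r h0 hr
      have : w₁ + r * (κ - w₁) = w₀ + (t + r * (1 - t) : ℝ) * (κ - w₀) := by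
        rw [hwt]; push_cast; ring
      rw [this]
      refine hray _ (by nlinarith) (by nlinarith)
    have hK : segment ℝ w₁ κ \ {κ} ⊆ D := by
      rintro z ⟨hz, hzκ⟩
      rw [segment_eq_image'] at hz
      obtain ⟨r, hr, rfl⟩ := hz
      refine hmem r hr.1 (lt_of_le_of_ne hr.2 ?_)
      rintro rfl
      exact hzκ (by simp)
    have hK' : segment ℝ w₁ κ ⊆ D ∪ V := fun z hz => by
      by_cases h : z = κ
      · exact Or.inr (h ▸ hκ)
      · exact Or.inl (hK ⟨hz, h⟩)
    have hfl : q.IsFlatMap (segment ℝ w₁ κ) {κ} f := (s.flatMap hK').mono Subset.rfl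
      (by rintro z rfl; exact ⟨right_mem_segment ℝ _ _, hκ⟩) (by
        rintro z ⟨hz, -, hzV⟩
        by_contra h
        exact s.starView.notMem hzV (hK ⟨hz, h⟩))
    have hne : w₁ ≠ κ := by
      rintro rfl
      exact s.starView.notMem hκ (W.sub hw)
    refine (s'.fit hfl ?_ (he.filter_mono (nhdsWithin_mono _ hK))).2.1
      ⟨right_mem_segment ℝ _ _, rfl⟩
    intro k hk r h0 hr
    rw [segment_eq_image'] at hk
    obtain ⟨u, hu, rfl⟩ := hk
    have e : w₁ + r * ((w₁ + u • (κ - w₁)) - w₁) = w₁ + (r * u : ℝ) • (κ - w₁) := by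
      simp only [Complex.real_smul]; push_cast; ring
    have hru : r * u < 1 := by nlinarith [hu.1, hu.2]
    dsimp only
    rw [e]
    refine ⟨?_, ?_⟩
    · rw [segment_eq_image']
      exact ⟨r * u, ⟨mul_nonneg h0 hu.1, hru.le⟩, rfl⟩
    · intro h
      have h' : w₁ + (r * u : ℝ) • (κ - w₁) = κ := h
      have : ((1 - r * u : ℝ) : ℂ) * (κ - w₁) = 0 := by
        rw [Complex.real_smul] at h'
        push_cast at h' ⊢
        linear_combination -h'
      rcases mul_eq_zero.1 this with h' | h'
      · have := Complex.ofReal_eq_zero.1 h'; linarith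
      · exact hne (sub_eq_zero.1 h').symm

/-- A segment from a point of the side `P R` to a singularity on the other side of the triangle leaves
the triangle through one of the other two sides. -/
theorem Wing.exists_exit [T2Space S] [CompactSpace S] (s : q.Sky w₀ f D V)
    (W : τ.Wing f D V σ P R A) (h0 : w₀ ∈ openSegment ℝ P R) {κ : ℂ} (hκ : κ ∈ V) (hne : κ ≠ A)
    (ho : 0 < σ * orient P R κ) :
    ∃ w₁ f' D' V', q.Sky w₁ f' D' V' ∧ τ.Wing f' D' V' σ P R A ∧ κ ∈ V' ∧
      (w₁ ∈ openSegment ℝ A R ∧ 0 < σ * orient A R κ ∨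
        w₁ ∈ openSegment ℝ P A ∧ 0 < σ * orient P A κ) := by
  have hP0 : orient P R w₀ = 0 := orient_eq_zero_of_mem_openSegment h0
  have hab : 0 < σ * orient R A w₀ ∧ 0 < σ * orient A P w₀ := by
    obtain ⟨a, b, ha, hb, hab, rfl⟩ := h0
    rw [orient_combo _ _ _ _ hab, orient_combo _ _ _ _ hab, orient_self_left, orient_self_right]
    have h1 := mul_pos ha W.rotate.pos
    have h2 := mul_pos hb W.rotate.rotate.pos
    constructor <;> linarith
  have hκT : κ ∉ planeTriangle P R A := by
    intro hT
    refine s.starView.notMem hκ (W.sub ⟨hT, ?_⟩)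
    rintro (rfl | rfl | h)
    · rw [orient_self_left, mul_zero] at ho; exact ho.false
    · rw [orient_self_right, mul_zero] at ho; exact ho.false
    · exact hne h
  have hneg : σ * orient R A κ < 0 ∨ σ * orient A P κ < 0 := by
    by_contra! h
    exact hκT ((mem_planeTriangle_of_sign W.sign W.pos).2 ⟨ho.le, h.1, h.2⟩)
  obtain ⟨t, ht0, ht1, ht⟩ := exists_first_zero hab.1 hab.2 hneg
  set w₁ := w₀ + t * (κ - w₀) with hw₁
  have hlin : ∀ X Y : ℂ, orient X Y w₁ = (1 - t) * orient X Y w₀ + t * orient X Y κ := by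
    intro X Y
    rw [← orient_combo X Y w₀ κ (a := 1 - t) (b := t) (by ring)]
    congr 1
    simp only [hw₁, Complex.real_smul]; push_cast; ring
  have hw₁D : w₁ ∈ D := ((s.mem_V κ).1 hκ).2 t ht0.le ht1
  have hw₁v : w₁ ∉ ({P, R, A} : Set ℂ) := by
    rintro (h | h | h)
    · exact s.starView.notMem W.left (h ▸ hw₁D)
    · exact s.starView.notMem W.right (h ▸ hw₁D)
    · exact s.starView.notMem W.apex (h ▸ hw₁D)
  have hw₁o : 0 ≤ σ * orient P R w₁ := by
    rw [hlin, hP0]; nlinarith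
  have la : σ * orient R A w₁ = (1 - t) * (σ * orient R A w₀) + t * (σ * orient R A κ) := by
    rw [hlin]; ring
  have lb : σ * orient A P w₁ = (1 - t) * (σ * orient A P w₀) + t * (σ * orient A P κ) := by
    rw [hlin]; ring
  rw [← la, ← lb] at ht
  have hσ0 : σ ≠ 0 := by rcases W.sign with rfl | rfl <;> norm_num
  have hw₁T : w₁ ∈ planeTriangle P R A := by
    rw [mem_planeTriangle_of_sign W.sign W.pos]
    rcases ht with ⟨h1, h2, -⟩ | ⟨h1, h2, -⟩
    exacts [⟨hw₁o, h1.ge, h2⟩, ⟨hw₁o, h2, h1.ge⟩]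
  obtain ⟨f', D', V', s', W', -, hV'⟩ := W.rebase s ⟨hw₁T, hw₁v⟩
  refine ⟨w₁, f', D', V', s', W', hV' κ hκ t ht1 hw₁ ht0.le, ?_⟩
  rcases ht with ⟨h1, -, h3⟩ | ⟨h1, -, h3⟩
  · left
    refine ⟨?_, by rw [orient_swap]; linarith⟩
    have := mem_segment_of_sign W.sign W.rotate.pos (by rwa [planeTriangle_rotate])
      ((mul_eq_zero.1 h1).resolve_left hσ0)
    rw [openSegment_symm]
    exact mem_openSegment_of_ne_left_right (fun h => hw₁v (by simp [h])) (fun h => hw₁v (by simp [h]))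
      this
  · right
    refine ⟨?_, by rw [orient_swap]; linarith⟩
    have := mem_segment_of_sign W.sign W.rotate.rotate.pos
      (by rwa [planeTriangle_rotate, planeTriangle_rotate])
      ((mul_eq_zero.1 h1).resolve_left hσ0)
    rw [openSegment_symm]
    exact mem_openSegment_of_ne_left_right (fun h => hw₁v (by simp [h])) (fun h => hw₁v (by simp [h]))
      this

end StraightTriangulation

end HalfTranslationStructure

/-! ### Empty parts of the bounding boxes of edges and triangles. -/

namespace HalfTranslationStructure

variable {S : Type*} [TopologicalSpace S] {q : HalfTranslationStructure S}

namespace StraightTriangulation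

variable {τ : q.StraightTriangulation} {f : ℂ → S} {w₀ : ℂ} {D V : Set ℂ} {σ : ℝ} {P R A : ℂ}

theorem exists_holonomy [T2Space S] [CompactSpace S] (τ : q.StraightTriangulation) :
    ∃ φ : Set S → ℂ, (∀ e ∈ τ.edges, q.IsSaddleConnection e (φ e)) ∧
      ∀ (f : ℂ → S) (P Q : ℂ), P ≠ Q → q.IsFlatMap (segment ℝ P Q) {P, Q} f →
      f '' segment ℝ P Q ∈ τ.edges → |(Q - P).re| = |(φ (f '' segment ℝ P Q)).re| ∧
        |(Q - P).im| = |(φ (f '' segment ℝ P Q)).im| := by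
  have : ∀ e, ∃ v, e ∈ τ.edges → q.IsSaddleConnection e v := fun e => by
    by_cases h : e ∈ τ.edges
    · obtain ⟨v, hv⟩ := τ.edge_saddle e h
      exact ⟨v, fun _ => hv⟩
    · exact ⟨0, fun h' => absurd h' h⟩
  choose φ hφ using this
  refine ⟨φ, hφ, fun f P Q hne hf he => ?_⟩
  obtain ⟨hv, g, hg, -, hge⟩ := hφ _ he
  rcases hf.holonomy_eq hne hg hv.symm hge with h | h <;> rw [sub_zero] at h <;> rw [h]
  · exact ⟨rfl, rfl⟩
  · simp only [Complex.neg_re, Complex.neg_im, abs_neg, and_self]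

/-- The widths and heights of the edges are bounded below by `δ`. -/
def HasGap (τ : q.StraightTriangulation) (δ : ℝ) : Prop :=
  ∀ (f : ℂ → S) (P Q : ℂ), P ≠ Q → q.IsFlatMap (segment ℝ P Q) {P, Q} f →
    f '' segment ℝ P Q ∈ τ.edges → δ ≤ |Q.re - P.re| ∧ δ ≤ |Q.im - P.im|

theorem exists_hasGap [T2Space S] [CompactSpace S] (hq : q.IsKeane) (τ : q.StraightTriangulation) :
    ∃ δ > 0, τ.HasGap δ := by
  obtain ⟨φ, h1, h2⟩ := τ.exists_holonomy
  have key : ∀ ψ : Set S → ℝ, (∀ e ∈ τ.edges, 0 < ψ e) → ∃ δ > 0, ∀ e ∈ τ.edges, δ ≤ ψ e := by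
    intro ψ hψ
    rcases τ.edges.eq_empty_or_nonempty with h | h
    · exact ⟨1, one_pos, by simp [h]⟩
    · obtain ⟨e, he, hmin⟩ := Set.exists_min_image τ.edges ψ τ.finite_edges h
      exact ⟨ψ e, hψ e he, hmin⟩
  obtain ⟨δ₁, hδ₁, h3⟩ := key (fun e => |(φ e).re|)
    fun e he => abs_pos.2 ((h1 e he).re_ne_zero hq).1
  obtain ⟨δ₂, hδ₂, h4⟩ := key (fun e => |(φ e).im|)
    fun e he => abs_pos.2 ((h1 e he).re_ne_zero hq).2
  refine ⟨min δ₁ δ₂, lt_min hδ₁ hδ₂, fun f P Q hne hf he => ?_⟩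
  obtain ⟨h5, h6⟩ := h2 f P Q hne hf he
  rw [Complex.sub_re] at h5
  rw [Complex.sub_im] at h6
  rw [h5, h6]
  exact ⟨(min_le_left _ _).trans (h3 _ he), (min_le_right _ _).trans (h4 _ he)⟩

theorem Wing.ne (W : τ.Wing f D V σ P R A) : P ≠ R := fun h => W.re_ne.1 (by rw [h])

theorem Wing.openSegment_subset (W : τ.Wing f D V σ P R A) : openSegment ℝ P R ⊆ D := by
  intro z hz
  refine W.sub ⟨segment_subset_planeTriangle _ _ _ (openSegment_subset_segment ℝ _ _ hz), ?_⟩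
  have := (segment_star hz W.ne).1.2
  rintro (h | h | h)
  · exact this (Or.inl h)
  · exact this (Or.inr h)
  · have h0 := orient_eq_zero_of_mem_openSegment hz
    have hp := W.pos
    rw [h] at h0
    rw [h0, mul_zero] at hp
    exact hp.false

theorem Wing.isFlatMap (W : τ.Wing f D V σ P R A) (s : q.Sky w₀ f D V) :
    q.IsFlatMap (segment ℝ P R) {P, R} f :=
  s.flatMap_segment W.left W.right W.openSegment_subset

theorem Wing.gap (W : τ.Wing f D V σ P R A) (s : q.Sky w₀ f D V) {δ : ℝ} (hδ : τ.HasGap δ) :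
    δ ≤ |R.re - P.re| ∧ δ ≤ |R.im - P.im| :=
  hδ f P R W.ne (W.isFlatMap s) W.side₁

theorem le_mul_sub_of_sign {δ a b : ℝ} (hσ : σ = 1 ∨ σ = -1) (h : δ ≤ |b - a|) (hab : σ * a < σ * b) :
    δ ≤ σ * b - σ * a := by
  rcases hσ with rfl | rfl
  · rwa [abs_of_pos (by linarith), ← one_mul b, ← one_mul a] at h
  · rw [abs_of_neg (by linarith)] at h; linarith

theorem sign_mul {σ₁ σ₂ : ℝ} (h₁ : σ₁ = 1 ∨ σ₁ = -1) (h₂ : σ₂ = 1 ∨ σ₂ = -1) :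
    σ₁ * σ₂ = 1 ∨ σ₁ * σ₂ = -1 := by
  rcases h₁ with rfl | rfl <;> rcases h₂ with rfl | rfl <;> norm_num

theorem mul_ne_mul_of_sign {a b : ℝ} (hσ : σ = 1 ∨ σ = -1) (h : a ≠ b) : σ * a ≠ σ * b := by
  rcases hσ with rfl | rfl <;> simpa using h

/-- The half of the rectangle with diagonal an edge `P R`, on the side of the corner `(P.re, R.im)`,
contains no singularity. -/
theorem false_of_corner [T2Space S] [CompactSpace S] (hq : q.IsKeane) (hτ : τ.IsVeering) {δ : ℝ}
    (hδ : τ.HasGap δ) {σ₁ σ₂ : ℝ} (h₁ : σ₁ = 1 ∨ σ₁ = -1) (h₂ : σ₂ = 1 ∨ σ₂ = -1) (n : ℕ) :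
    ∀ {w₀ : ℂ} {f : ℂ → S} {D V : Set ℂ} {P R κ : ℂ}, q.Sky w₀ f D V → P ∈ V → R ∈ V →
      w₀ ∈ openSegment ℝ P R → f '' segment ℝ P R ∈ τ.edges → κ ∈ V →
      σ₁ * P.re < σ₁ * R.re → σ₂ * P.im < σ₂ * R.im → 0 < σ₁ * σ₂ * orient P R κ →
      σ₁ * P.re ≤ σ₁ * κ.re → σ₂ * κ.im ≤ σ₂ * R.im →
      (σ₂ * κ.im - σ₂ * P.im) + (σ₁ * R.re - σ₁ * κ.re) < n * δ → False := by
  have horient : ∀ X Y Z : ℂ, σ₁ * σ₂ * orient X Y Z = (σ₁ * Y.re - σ₁ * X.re) *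
      (σ₂ * Z.im - σ₂ * X.im) - (σ₂ * Y.im - σ₂ * X.im) * (σ₁ * Z.re - σ₁ * X.re) := fun X Y Z => by
    simp only [orient, Complex.sub_re, Complex.sub_im]; ring
  have hbox : ∀ {px py rx ry kx ky : ℝ}, px < rx → py < ry →
      0 < (rx - px) * (ky - py) - (ry - py) * (kx - px) → px ≤ kx → ky ≤ ry → py < ky ∧ kx < rx := by
    intro px py rx ry kx ky hx hy ho h1 h2
    have : 0 < (rx - px) * (ky - py) := by
      nlinarith [mul_nonneg (sub_nonneg.2 hy.le) (sub_nonneg.2 h1)]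
    refine ⟨sub_pos.1 (pos_of_mul_pos_right this (sub_pos.2 hx).le), ?_⟩
    have h3 : 0 < (ry - py) * (rx - kx) := by
      nlinarith [mul_nonneg (sub_nonneg.2 hx.le) (sub_nonneg.2 h2)]
    exact sub_pos.1 (pos_of_mul_pos_right h3 (sub_pos.2 hy).le)
  -- The path from `w₀` to `κ` is followed through the triangles. The vertical distance from `P` to
  -- `κ` plus the horizontal distance from `κ` to `R` is positive, yet it decreases by at least the
  -- gap `δ` at each crossing.
  induction n with
  | zero =>
    intro w₀ f D V P R κ s hP hR h0 he hκ hx hy ho hkx hky hn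
    rw [horient] at ho
    have := hbox hx hy ho hkx hky
    push_cast at hn
    linarith [this.1, this.2]
  | succ n ih =>
    intro w₀ f D V P R κ s hP hR h0 he hκ hx hy ho hkx hky hn
    obtain ⟨A, W⟩ := exists_wing hq hτ s hP hR h0 he (sign_mul h₁ h₂)
    have hoA := W.pos
    have ho' := ho
    rw [horient] at hoA ho'
    obtain ⟨hpk, hkr⟩ := hbox hx hy ho' hkx hky
    have hc := W.colour (σ₁ * σ₂)
    have hcol : ∀ X Y : ℂ, σ₁ * σ₂ * ((Y - X).re * (Y - X).im) =
        (σ₁ * Y.re - σ₁ * X.re) * (σ₂ * Y.im - σ₂ * X.im) := fun X Y => by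
      simp only [Complex.sub_re, Complex.sub_im]; ring
    rw [hcol, hcol, hcol] at hc
    -- After the normalisation by `σ₁` and `σ₂`, the edge has positive slope and `A` lies to its
    -- upper left. Not all three sides have the same colour, which leaves three positions for `A`.
    have hcases := apex_cases hx hy hoA (mul_ne_mul_of_sign h₁ W.re_ne.2.2)
      (mul_ne_mul_of_sign h₁ W.re_ne.2.1.symm) (mul_ne_mul_of_sign h₂ W.im_ne.2.1.symm)
      (fun h => hc ⟨mul_pos (by linarith) (by linarith), h.1, h.2⟩)
      (mul_ne_mul_of_sign h₂ W.im_ne.2.2)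
    have hne : κ ≠ A := by
      rintro rfl
      rcases hcases with h | h | h
      · linarith [h.1]
      · linarith [h.1]
      · linarith [h.2.2]
    push_cast at hn
    obtain ⟨w₁, f', D', V', s', W', hκ', ⟨hw₁, ho₁⟩ | ⟨hw₁, ho₁⟩⟩ := W.exists_exit s h0 hκ hne ho
    -- Leaving through `A R` forces `A` to be left of `P` at a height between the ends. The next
    -- edge is `A R`, and the vertical distance has dropped by the height of `A P`.
    · have ho₂ := ho₁
      rw [horient] at ho₂
      have hay : σ₂ * A.im < σ₂ * R.im := by
        by_contra! h
        have hax : σ₁ * A.re < σ₁ * R.re := by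
          rcases hcases with ⟨h, -⟩ | ⟨h, -⟩ | ⟨-, h, -⟩ <;> linarith
        nlinarith [mul_nonneg (sub_nonneg.2 hax.le) (sub_nonneg.2 hky),
          mul_nonneg (sub_nonneg.2 h) (sub_nonneg.2 hkr.le)]
      obtain ⟨h1, h2, h3⟩ : σ₁ * A.re < σ₁ * P.re ∧ σ₂ * P.im < σ₂ * A.im ∧
          σ₂ * A.im < σ₂ * R.im := by
        rcases hcases with h | h | h
        · linarith [h.2]
        · exact h
        · linarith [h.2.2]
      have hgap := le_mul_sub_of_sign (δ := δ) h₂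
        (by have := (W'.rotate.rotate.gap s' hδ).2; rwa [abs_sub_comm] at this) h2
      refine ih s' W'.apex W'.right hw₁ (by rw [segment_symm]; exact W'.side₂) hκ' (by linarith) h3
        ho₁ (by linarith) hky (by linarith)
    -- Leaving through `P A` forces `A` to be above `R`, horizontally between the ends. The next
    -- edge is `P A`, and the horizontal distance has dropped by the width of `A R`.
    · have ho₂ := ho₁
      rw [horient] at ho₂
      obtain ⟨h1, h2, h3⟩ : σ₁ * P.re < σ₁ * A.re ∧ σ₁ * A.re < σ₁ * R.re ∧
          σ₂ * R.im < σ₂ * A.im := by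
        have hno : σ₁ * A.re < σ₁ * P.re → σ₂ * P.im < σ₂ * A.im → False := fun a b => by
          nlinarith [mul_pos (sub_pos.2 a) (sub_pos.2 hpk),
            mul_nonneg (sub_nonneg.2 b.le) (sub_nonneg.2 hkx)]
        rcases hcases with h | h | h
        · exact (hno h.1 (hy.trans h.2)).elim
        · exact (hno h.1 h.2.1).elim
        · exact h
      have hgap := le_mul_sub_of_sign (δ := δ) h₁
        (by have := (W'.rotate.gap s' hδ).1; rwa [abs_sub_comm] at this) h2
      refine ih s' W'.left W'.apex hw₁ (by rw [segment_symm]; exact W'.side₃) hκ' h1 (by linarith)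
        ho₁ hkx (by linarith) (by linarith)

/-- The third vertex of a triangle whose tallest side is `P R` lies beyond both ends of that side. -/
theorem Wing.apex_lt (W : τ.Wing f D V σ P R A) (h1 : P.im < A.im) (h2 : A.im < R.im) :
    σ * A.re < σ * P.re ∧ σ * A.re < σ * R.re := by
  have ho := W.pos
  have horient : σ * orient P R A = (σ * R.re - σ * P.re) * (A.im - P.im) -
      (R.im - P.im) * (σ * A.re - σ * P.re) := by
    simp only [orient, Complex.sub_re, Complex.sub_im]; ring
  rw [horient] at ho
  have n1 := mul_ne_mul_of_sign W.sign W.re_ne.2.1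
  have n2 := mul_ne_mul_of_sign W.sign W.re_ne.2.2
  have hcol : ∀ c : ℝ, ∀ X Y : ℂ, c * σ * ((Y - X).re * (Y - X).im) =
      c * ((σ * Y.re - σ * X.re) * (Y.im - X.im)) := fun c X Y => by
    simp only [Complex.sub_re, Complex.sub_im]; ring
  have c1 := W.colour (1 * σ)
  have c2 := W.colour (-1 * σ)
  rw [hcol, hcol, hcol] at c1 c2
  have e1 : ¬ (σ * P.re < σ * A.re ∧ σ * A.re < σ * R.re) := fun ⟨a, b⟩ => c1 ⟨
    by rw [one_mul]; exact mul_pos (by linarith) (by linarith),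
    by rw [one_mul]; exact mul_pos_of_neg_of_neg (by linarith) (by linarith),
    by rw [one_mul]; exact mul_pos_of_neg_of_neg (by linarith) (by linarith)⟩
  have e2 : ¬ (σ * R.re < σ * A.re ∧ σ * A.re < σ * P.re) := fun ⟨a, b⟩ => c2 ⟨
    by have := mul_pos (sub_pos.2 (a.trans b)) (sub_pos.2 (h1.trans h2)); linarith,
    by have := mul_pos (sub_pos.2 a) (sub_pos.2 h2); linarith,
    by have := mul_pos (sub_pos.2 b) (sub_pos.2 h1); linarith⟩
  rcases lt_or_gt_of_ne n1 with a | a <;> rcases lt_or_gt_of_ne n2 with b | b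
  · exact absurd ⟨a, b⟩ e2
  · nlinarith [mul_pos (sub_pos.2 a) (sub_pos.2 h1), mul_pos (sub_pos.2 b) (sub_pos.2 h2)]
  · exact ⟨b, a⟩
  · exact absurd ⟨b, a⟩ e1

/-- The part of the bounding box of a triangle with tallest side `P R` on the side of its third vertex
contains no other singularity. -/
theorem Wing.eq_apex [T2Space S] [CompactSpace S] (hq : q.IsKeane) (hτ : τ.IsVeering)
    (s : q.Sky w₀ f D V) (W : τ.Wing f D V σ P R A) (h0 : w₀ ∈ openSegment ℝ P R)
    (h1 : P.im < A.im) (h2 : A.im < R.im) {κ : ℂ} (hκ : κ ∈ V) (ho : 0 < σ * orient P R κ)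
    (hPκ : P.im ≤ κ.im) (hκR : κ.im ≤ R.im) (hre : σ * A.re ≤ σ * κ.re) : κ = A := by
  by_contra hne
  obtain ⟨δ, hδ0, hδ⟩ := exists_hasGap hq τ
  obtain ⟨hAP, hAR⟩ := W.apex_lt h1 h2
  -- A path to another point leaves through a side at `A`. The point is then in the corner at
  -- `(A.re, R.im)` of the box of `A R`, or, upside down with `σ₂ = -1`, at `(A.re, P.im)` in that
  -- of `A P`.
  obtain ⟨w₁, f', D', V', s', W', hκ', ⟨hw₁, ho₁⟩ | ⟨hw₁, ho₁⟩⟩ := W.exists_exit s h0 hκ hne ho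
  · obtain ⟨n, hn⟩ := exists_nat_gt (((1 * κ.im - 1 * A.im) + (σ * R.re - σ * κ.re)) / δ)
    rw [div_lt_iff₀ hδ0] at hn
    exact false_of_corner hq hτ hδ W.sign (Or.inl rfl) n s' W'.apex W'.right hw₁
      (by rw [segment_symm]; exact W'.side₂) hκ' hAR (by linarith) (by rwa [mul_one]) hre
      (by linarith) hn
  · obtain ⟨n, hn⟩ := exists_nat_gt (((-1 * κ.im - -1 * A.im) + (σ * P.re - σ * κ.re)) / δ)
    rw [div_lt_iff₀ hδ0] at hn
    refine false_of_corner hq hτ hδ W.sign (Or.inr rfl) n s' W'.apex W'.left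
      (by rwa [openSegment_symm]) W'.side₃ hκ' hAP (by linarith) ?_ hre (by linarith) hn
    rw [orient_swap]; linarith

end StraightTriangulation

end HalfTranslationStructure

/-! ### Uniqueness of the balanced veering triangulation. -/

theorem mem_openSegment_of_orient_eq_zero {P R w : ℂ} (h : orient P R w = 0) (h1 : P.im < w.im)
    (h2 : w.im < R.im) : w ∈ openSegment ℝ P R := by
  have hd : 0 < R.im - P.im := by linarith
  rw [openSegment_eq_image']
  refine ⟨(w.im - P.im) / (R.im - P.im), ⟨div_pos (by linarith) hd,
    (div_lt_one hd).2 (by linarith)⟩, ?_⟩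
  simp only [orient, Complex.sub_re, Complex.sub_im] at h
  apply Complex.ext
  · simp only [Complex.add_re, Complex.real_smul, Complex.re_ofReal_mul, Complex.sub_re]
    field_simp
    linarith
  · simp only [Complex.add_im, Complex.real_smul, Complex.im_ofReal_mul, Complex.sub_im]
    field_simp
    ring

theorem exists_mem_openSegment_im {P R : ℂ} {y : ℝ} (h1 : P.im < y) (h2 : y < R.im) :
    ∃ w ∈ openSegment ℝ P R, w.im = y := by
  have hd : 0 < R.im - P.im := by linarith
  refine ⟨P + ((y - P.im) / (R.im - P.im) : ℝ) • (R - P), ?_, ?_⟩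
  · rw [openSegment_eq_image']
    exact ⟨_, ⟨div_pos (by linarith) hd, (div_lt_one hd).2 (by linarith)⟩, rfl⟩
  · simp only [Complex.add_im, Complex.real_smul, Complex.im_ofReal_mul, Complex.sub_im]
    field_simp
    ring

namespace HalfTranslationStructure

variable {S : Type*} [TopologicalSpace S] {q : HalfTranslationStructure S}

namespace StraightTriangulation

variable {τ : q.StraightTriangulation} {f : ℂ → S} {w₀ : ℂ} {D V : Set ℂ} {σ : ℝ} {P R A : ℂ}

theorem exists_sky_of_edge [T2Space S] [CompactSpace S] {e : Set S} (he : e ∈ τ.edges) :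
    ∃ w₀ f D V P R, q.Sky w₀ f D V ∧ P ∈ V ∧ R ∈ V ∧ w₀ ∈ openSegment ℝ P R ∧ P ≠ R ∧
      e = f '' segment ℝ P R := by
  obtain ⟨g, P', Q', hne, hg, rfl⟩ := τ.exists_flat_edge he
  have hm : midpoint ℝ P' Q' ∈ openSegment ℝ P' Q' := midpoint_mem_openSegment P' Q'
  have hm' := (segment_star hm hne).1
  obtain ⟨f, D, V, s, hf⟩ := exists_sky_at (hg.rest _ hm') 0
  obtain ⟨P, hP, R, hR, h0, he'⟩ := τ.exists_edge_in_sky s he (hf ▸ mem_image_of_mem g hm'.1)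
  refine ⟨0, f, D, V, P, R, s, hP, hR, h0, ?_, he'⟩
  rintro rfl
  rw [openSegment_same] at h0
  exact s.starView.notMem hP (h0 ▸ s.base)

theorem exists_quadLayout [T2Space S] [CompactSpace S] (hq : q.IsKeane) (hτ : τ.IsVeering)
    (s : q.Sky w₀ f D V) (hP : P ∈ V) (hR : R ∈ V) (h0 : w₀ ∈ openSegment ℝ P R)
    (he : f '' segment ℝ P R ∈ τ.edges) : ∃ L : τ.QuadLayout, L.P = P ∧ L.R = R ∧
      τ.Wing f D V 1 P R L.A ∧ τ.Wing f D V (-1) P R L.B := by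
  obtain ⟨A, hA, hTA, hFA, hDA⟩ := τ.exists_left_face s hP hR h0 he
  obtain ⟨B, hB, hTB, hFB, hDB⟩ := τ.exists_left_face s hR hP (by rwa [openSegment_symm])
    (by rwa [segment_symm])
  have hT : planeTriangle P B R = planeTriangle R P B := planeTriangle_rotate R P B
  have hK : planeTriangle P R A ∪ planeTriangle P B R ⊆ D ∪ V := by
    rintro z (hz | hz)
    · by_cases h : z ∈ ({P, R, A} : Set ℂ)
      · right
        rcases h with rfl | rfl | rfl
        exacts [hP, hR, hA]
      · exact Or.inl (hDA ⟨hz, h⟩)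
    · by_cases h : z ∈ ({R, P, B} : Set ℂ)
      · right
        rcases h with rfl | rfl | rfl
        exacts [hR, hP, hB]
      · exact Or.inl (hDB ⟨hT ▸ hz, h⟩)
  refine ⟨⟨f, P, R, A, B, hTA, hTB.rotate, hFA, hT ▸ hFB, he, (s.flatMap hK).mono Subset.rfl ?_ ?_⟩,
    rfl, rfl, wing_of_face hq hτ hP hR hA hTA hFA hDA,
    (wing_of_face hq hτ hR hP hB hTB hFB hDB).swap⟩
  · rintro z (rfl | rfl | rfl | rfl)
    · exact ⟨Or.inl (vertices_subset _ _ _ (by simp)), hP⟩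
    · exact ⟨Or.inl (vertices_subset _ _ _ (by simp)), hR⟩
    · exact ⟨Or.inl (vertices_subset _ _ _ (by simp)), hA⟩
    · exact ⟨Or.inr (vertices_subset _ _ _ (by simp)), hB⟩
  · rintro z ⟨hz | hz, -, hzV⟩
    · by_contra h
      refine s.starView.notMem hzV (hDA ⟨hz, fun h' => h ?_⟩)
      simp only [mem_insert_iff, mem_singleton_iff] at h' ⊢
      tauto
    · by_contra h
      refine s.starView.notMem hzV (hDB ⟨hT ▸ hz, fun h' => h ?_⟩)
      simp only [mem_insert_iff, mem_singleton_iff] at h' ⊢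
      tauto

/-- The third vertex is horizontally between the ends of a widest side. Were its height not beyond
both ends, on the side where the triangle lies, the triangle would be monochromatic. This fixes the
slopes of the two remaining sides. -/
theorem Wing.forward_of_widest (W : τ.Wing f D V 1 P R A) (h1 : |A.re - R.re| ≤ |R.re - P.re|)
    (h2 : |P.re - A.re| ≤ |R.re - P.re|) :
    (A - R).re * (A - R).im < 0 ∧ 0 < (P - A).re * (P - A).im := by
  have key : ∀ {px py rx ry ax ay : ℝ}, px < ax → ax < rx → ay ≠ py → ay ≠ ry →
      0 < (rx - px) * (ay - py) - (ry - py) * (ax - px) →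
      (∀ c : ℝ, ¬ (0 < c * ((rx - px) * (ry - py)) ∧ 0 < c * ((ax - rx) * (ay - ry)) ∧
        0 < c * ((px - ax) * (py - ay)))) → py < ay ∧ ry < ay := by
    intro px py rx ry ax ay hx hx' n1 n2 ho hc
    rcases lt_or_gt_of_ne n1 with a | a
    · exfalso
      have b : ry < py := by nlinarith [mul_pos (sub_pos.2 (hx.trans hx')) (sub_pos.2 a)]
      have c : ry < ay := by nlinarith [mul_pos (sub_pos.2 hx') (sub_pos.2 b)]
      exact hc (-1) ⟨by nlinarith [mul_pos (sub_pos.2 (hx.trans hx')) (sub_pos.2 b)],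
        by nlinarith [mul_pos (sub_pos.2 hx') (sub_pos.2 c)],
        by nlinarith [mul_pos (sub_pos.2 hx) (sub_pos.2 a)]⟩
    · refine ⟨a, lt_of_not_ge fun b => ?_⟩
      have b := lt_of_le_of_ne b n2
      exact hc 1 ⟨by nlinarith [mul_pos (sub_pos.2 (hx.trans hx')) (sub_pos.2 (a.trans b))],
        by nlinarith [mul_pos (sub_pos.2 hx') (sub_pos.2 b)],
        by nlinarith [mul_pos (sub_pos.2 hx) (sub_pos.2 a)]⟩
  have ho := W.pos
  have hc := W.colour
  simp only [orient, Complex.sub_re, Complex.sub_im, one_mul] at ho hc ⊢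
  rw [abs_le] at h1 h2
  rcases lt_or_gt_of_ne W.re_ne.1 with h | h
  · rw [abs_of_pos (sub_pos.2 h)] at h1 h2
    have a : P.re < A.re := lt_of_le_of_ne (by linarith) W.re_ne.2.2.symm
    have b : A.re < R.re := lt_of_le_of_ne (by linarith) W.re_ne.2.1.symm
    obtain ⟨c, d⟩ := key a b W.im_ne.2.2 W.im_ne.2.1.symm ho hc
    exact ⟨mul_neg_of_neg_of_pos (by linarith) (by linarith),
      mul_pos_of_neg_of_neg (by linarith) (by linarith)⟩
  · rw [abs_of_neg (sub_neg.2 h)] at h1 h2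
    have a : A.re < P.re := lt_of_le_of_ne (by linarith) W.re_ne.2.2
    have b : R.re < A.re := lt_of_le_of_ne (by linarith) W.re_ne.2.1
    obtain ⟨c, d⟩ := key (neg_lt_neg a) (neg_lt_neg b) (neg_injective.ne W.im_ne.2.2)
      (neg_injective.ne W.im_ne.2.1.symm) (by linarith) (fun c hh => hc c (by
        convert hh using 3 <;> ring))
    exact ⟨mul_neg_of_pos_of_neg (by linarith) (by linarith),
      mul_pos (by linarith) (by linarith)⟩

/-- The edges of a balanced veering triangulation have width at most one. -/
theorem width_le_one [T2Space S] [CompactSpace S] (hq : q.IsKeane) (hτ : τ.IsVeering)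
    (hb : τ.IsBalanced) {g : ℂ → S} {X Y : ℂ} (hXY : X ≠ Y)
    (hg : q.IsFlatMap (segment ℝ X Y) {X, Y} g) (he : g '' segment ℝ X Y ∈ τ.edges) :
    |(Y - X).re| ≤ 1 := by
  obtain ⟨φ, -, hφ⟩ := τ.exists_holonomy
  -- A widest edge of the triangulation is a widest side of both adjacent triangles, hence forward
  -- flippable. Balance bounds its width and so all widths.
  obtain ⟨e₀, he₀, hmax⟩ := Set.exists_max_image τ.edges (fun e => |(φ e).re|) τ.finite_edges ⟨_, he⟩
  obtain ⟨w₀, f, D, V, P, R, s, hP, hR, h0, hne, rfl⟩ := exists_sky_of_edge he₀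
  obtain ⟨L, hLP, hLR, WA, WB⟩ := exists_quadLayout hq hτ s hP hR h0 he₀
  have hw : ∀ {σ : ℝ} {P' R' A' : ℂ}, τ.Wing f D V σ P' R' A' → |R'.re - P'.re| ≤ |R.re - P.re| := by
    intro σ P' R' A' W
    have h1 := (hφ f P' R' W.ne (W.isFlatMap s) W.side₁).1
    have h2 := (hφ f P R hne (WA.isFlatMap s) he₀).1
    rw [Complex.sub_re] at h1 h2
    rw [h1, h2]
    exact hmax _ W.side₁
  have h1 := WA.forward_of_widest (hw WA.rotate) (hw WA.rotate.rotate)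
  have WB' : τ.Wing f D V 1 R P L.B := by simpa using WB.swap
  have h2 := WB'.forward_of_widest (by rw [abs_sub_comm P.re]; exact hw WB'.rotate)
    (by rw [abs_sub_comm P.re]; exact hw WB'.rotate.rotate)
  have hL : L.edgeWidth ≤ 1 := hb.1 L (L.forwardFlippable_iff.2 (by
    rw [hLP, hLR]; exact ⟨h1.1, h1.2, h2.1, h2.2⟩))
  rw [QuadLayout.edgeWidth, hLP, hLR, (hφ f P R hne (WA.isFlatMap s) he₀).1] at hL
  rw [(hφ g X Y hXY hg he).1]
  exact (hmax _ he).trans hL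

/-- `A` has a height strictly between those of `P` and `R` but is not in their window, so it lies
beyond it horizontally. The window can be extended sideways up to `A.re`: a marked point in the
added part would be on the side of `A`, hence equal to `A` by `eq_apex`, which the strict
inequalities forbid. -/
theorem Wing.exists_window [T2Space S] [CompactSpace S] (hq : q.IsKeane) (hτ : τ.IsVeering)
    (s : q.Sky w₀ f D V) (W : τ.Wing f D V σ P R A) (h0 : w₀ ∈ openSegment ℝ P R)
    (h1 : P.im < A.im) (h2 : A.im < R.im) (hE : f '' segment ℝ P R ∈ q.delaunayEdges)
    {y₀ y₁ : ℝ} (hy₀ : P.im ≤ y₀) (hy₁ : y₁ ≤ R.im) (hy : w₀.im ∈ Ioo y₀ y₁) :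
    ∃ x₀ x₁ : ℝ, 1 < x₁ - x₀ ∧ P.re ∈ Icc x₀ x₁ ∧ R.re ∈ Icc x₀ x₁ ∧ A.re ∈ Icc x₀ x₁ ∧
      Ioo x₀ x₁ ×ℂ Ioo y₀ y₁ ⊆ D := by
  obtain ⟨x₀, x₁, hx, hPx, hRx, -, -, -, hD⟩ := s.spans_of_mem W.left W.right h0 hE
  have hAx := s.not_mem_window W.apex hD (by rw [uIoo_of_lt (h1.trans h2)]; exact ⟨h1, h2⟩)
  rw [uIoo_of_lt (h1.trans h2)] at hD
  have hre := W.re_ne.1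
  have hlt := W.apex_lt h1 h2
  obtain ⟨t, ht0, ht1, htre, -⟩ := mem_openSegment_re_im h0
  have hconv : ∀ X₀ X₁ : ℝ, P.re ∈ Icc X₀ X₁ → R.re ∈ Icc X₀ X₁ →
      (∀ κ ∈ Ioo X₀ X₁ ×ℂ Ioo y₀ y₁, κ ∉ V) → Ioo X₀ X₁ ×ℂ Ioo y₀ y₁ ⊆ D := by
    intro X₀ X₁ hP hR hV
    refine s.starView.subset_of_disjoint ((convex_rect _ _ _ _).starConvex ⟨?_, hy⟩) hV
    rcases lt_or_gt_of_ne hre with h | h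
    · constructor <;> nlinarith [hP.1, hR.2, mul_pos ht0 (sub_pos.2 h),
        mul_pos (sub_pos.2 ht1) (sub_pos.2 h)]
    · constructor <;> nlinarith [hP.2, hR.1, mul_pos ht0 (sub_pos.2 h),
        mul_pos (sub_pos.2 ht1) (sub_pos.2 h)]
  have horient : ∀ κ : ℂ, orient P R κ = (κ.im - P.im) * (R.re - κ.re) +
      (R.im - κ.im) * (P.re - κ.re) := fun κ => by
    simp only [orient, Complex.sub_re, Complex.sub_im]; ring
  rcases W.sign with rfl | rfl
  · rw [one_mul, one_mul, one_mul] at hlt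
    have hA : A.re ≤ x₀ := hAx.resolve_right (by linarith [hPx.2])
    refine ⟨A.re, x₁, by linarith, ⟨hlt.1.le, hPx.2⟩, ⟨hlt.2.le, hRx.2⟩,
      ⟨le_rfl, by linarith [hPx.2]⟩, hconv _ _ ⟨hlt.1.le, hPx.2⟩ ⟨hlt.2.le, hRx.2⟩ ?_⟩
    rintro κ ⟨hκ, hκi⟩ hκV
    have i1 : P.im < κ.im := hy₀.trans_lt hκi.1
    have i2 : κ.im < R.im := hκi.2.trans_le hy₁
    by_cases hκx : x₀ < κ.re
    · exact s.starView.notMem hκV (hD ⟨⟨hκx, hκ.2⟩, ⟨i1, i2⟩⟩)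
    · refine hκ.1.ne ?_
      have ho : 0 < orient P R κ := by
        rw [horient]
        rcases lt_or_gt_of_ne hre with h | h
        · exact add_pos_of_pos_of_nonneg (mul_pos (by linarith) (by linarith [hPx.1]))
            (mul_nonneg (by linarith) (by linarith [hPx.1]))
        · exact add_pos_of_nonneg_of_pos (mul_nonneg (by linarith) (by linarith [hRx.1]))
            (mul_pos (by linarith) (by linarith [hRx.1]))
      rw [W.eq_apex hq hτ s h0 h1 h2 hκV (by rwa [one_mul]) i1.le i2.le (by linarith [hκ.1])]
  · have hA : x₁ ≤ A.re := hAx.resolve_left (by linarith [hPx.1])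
    refine ⟨x₀, A.re, by linarith, ⟨hPx.1, by linarith⟩, ⟨hRx.1, by linarith⟩,
      ⟨by linarith [hPx.1], le_rfl⟩, hconv _ _ ⟨hPx.1, by linarith⟩ ⟨hRx.1, by linarith⟩ ?_⟩
    rintro κ ⟨hκ, hκi⟩ hκV
    have i1 : P.im < κ.im := hy₀.trans_lt hκi.1
    have i2 : κ.im < R.im := hκi.2.trans_le hy₁
    by_cases hκx : κ.re < x₁
    · exact s.starView.notMem hκV (hD ⟨⟨hκ.1, hκx⟩, ⟨i1, i2⟩⟩)
    · refine hκ.2.ne ?_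
      have ho : 0 < (κ.im - P.im) * (κ.re - R.re) + (R.im - κ.im) * (κ.re - P.re) := by
        rcases lt_or_gt_of_ne hre with h | h
        · exact add_pos_of_nonneg_of_pos (mul_nonneg (by linarith) (by linarith [hRx.2]))
            (mul_pos (by linarith) (by linarith [hRx.2]))
        · exact add_pos_of_pos_of_nonneg (mul_pos (by linarith) (by linarith [hPx.2]))
            (mul_nonneg (by linarith) (by linarith [hPx.2]))
      rw [W.eq_apex hq hτ s h0 h1 h2 hκV (by rw [horient]; linarith) i1.le i2.le
        (by linarith [hκ.2])]

/-- The extended window of the tallest side, cut at the height of `A`, gives below a window for `A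
P` and above one for `R A`. Both widths are bounded by `width_le_one`. -/
theorem Wing.sides_mem [T2Space S] [CompactSpace S] (hq : q.IsKeane) (hτ : τ.IsVeering)
    (hb : τ.IsBalanced) (s : q.Sky w₀ f D V) (W : τ.Wing f D V σ P R A)
    (h1 : P.im < A.im) (h2 : A.im < R.im) (hE : f '' segment ℝ P R ∈ q.delaunayEdges) :
    f '' segment ℝ A P ∈ q.delaunayEdges ∧ f '' segment ℝ R A ∈ q.delaunayEdges := by
  have key : ∀ y₀ y₁, P.im ≤ y₀ → y₁ ≤ R.im → y₀ < y₁ → ∃ w₁ f' D' V', q.Sky w₁ f' D' V' ∧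
      τ.Wing f' D' V' σ P R A ∧ EqOn f' f (planeTriangle P R A) ∧
      ∃ x₀ x₁ : ℝ, 1 < x₁ - x₀ ∧ P.re ∈ Icc x₀ x₁ ∧ R.re ∈ Icc x₀ x₁ ∧ A.re ∈ Icc x₀ x₁ ∧
      Ioo x₀ x₁ ×ℂ Ioo y₀ y₁ ⊆ D' := by
    intro y₀ y₁ hy₀ hy₁ hy
    obtain ⟨w₁, hw₁, hw₁y⟩ := exists_mem_openSegment_im (P := P) (R := R) (y := (y₀ + y₁) / 2)
      (by linarith) (by linarith)
    have hm : w₁ ∈ planeTriangle P R A \ {P, R, A} := by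
      refine ⟨segment_subset_planeTriangle _ _ _ (openSegment_subset_segment ℝ _ _ hw₁), ?_⟩
      have hD := W.openSegment_subset hw₁
      rintro (h | h | h)
      · exact s.starView.notMem W.left (h ▸ hD)
      · exact s.starView.notMem W.right (h ▸ hD)
      · exact s.starView.notMem W.apex (h ▸ hD)
    obtain ⟨f', D', V', s', W', heq, -⟩ := W.rebase s hm
    have hE' : f' '' segment ℝ P R ∈ q.delaunayEdges := by
      rwa [(heq.mono (segment_subset_planeTriangle _ _ _)).image_eq]
    exact ⟨w₁, f', D', V', s', W', heq, W'.exists_window hq hτ s' hw₁ h1 h2 hE' hy₀ hy₁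
      (by constructor <;> linarith)⟩
  constructor
  · obtain ⟨w₁, f', D', V', s', W', heq, x₀, x₁, hx, hPx, hRx, hAx, hD⟩ :=
      key P.im A.im le_rfl h2.le h1
    have W₃ := W'.rotate.rotate
    have hw := width_le_one hq hτ hb W₃.ne (W₃.isFlatMap s') W₃.side₁
    have := s'.mem_delaunayEdges W₃.left W₃.right ⟨x₀, x₁, hx, hAx, hPx, by
      rwa [abs_sub_comm, ← Complex.sub_re], W₃.re_ne.1, W₃.im_ne.1, by rwa [uIoo_of_gt h1]⟩
    rwa [(heq.mono ?_).image_eq] at this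
    exact (convex_planeTriangle P R A).segment_subset (vertices_subset _ _ _ (by simp))
      (vertices_subset _ _ _ (by simp))
  · obtain ⟨w₁, f', D', V', s', W', heq, x₀, x₁, hx, hPx, hRx, hAx, hD⟩ :=
      key A.im R.im h1.le le_rfl h2
    have W₂ := W'.rotate
    have hw := width_le_one hq hτ hb W₂.ne (W₂.isFlatMap s') W₂.side₁
    have := s'.mem_delaunayEdges W₂.left W₂.right ⟨x₀, x₁, hx, hRx, hAx, by
      rwa [abs_sub_comm, ← Complex.sub_re], W₂.re_ne.1, W₂.im_ne.1, by rwa [uIoo_of_gt h2]⟩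
    rwa [(heq.mono ?_).image_eq] at this
    exact (convex_planeTriangle P R A).segment_subset (vertices_subset _ _ _ (by simp))
      (vertices_subset _ _ _ (by simp))

/-- This is the step of the descending induction on height. If an adjacent third vertex is outside
the height range of the edge, that triangle has a taller side, and `sides_mem` passes its window
down. If both are inside, the edge is backward flippable. The rectangle between the two third
vertices is then wider than one by balance and empty by `eq_apex`. -/
theorem mem_delaunayEdges_of_taller [T2Space S] [CompactSpace S] (hq : q.IsKeane)
    (hτ : τ.IsVeering) (hb : τ.IsBalanced) (s : q.Sky w₀ f D V) (hP : P ∈ V) (hR : R ∈ V)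
    (h0 : w₀ ∈ openSegment ℝ P R) (he : f '' segment ℝ P R ∈ τ.edges) (him : P.im < R.im)
    (ht : ∀ X Y : ℂ, X ≠ Y → q.IsFlatMap (segment ℝ X Y) {X, Y} f → f '' segment ℝ X Y ∈ τ.edges →
      |R.im - P.im| < |Y.im - X.im| → f '' segment ℝ X Y ∈ q.delaunayEdges) :
    f '' segment ℝ P R ∈ q.delaunayEdges := by
  rw [abs_of_pos (sub_pos.2 him)] at ht
  have hout : ∀ {σ : ℝ} {A : ℂ}, τ.Wing f D V σ P R A → ¬ (P.im < A.im ∧ A.im < R.im) →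
      f '' segment ℝ P R ∈ q.delaunayEdges := by
    intro σ A W hA
    rcases lt_or_gt_of_ne W.im_ne.2.1 with h | h
    · have W' := W.rotate.rotate.swap
      have := ht P A W'.ne (W'.isFlatMap s) W'.side₁ (by
        rw [abs_of_pos (by linarith)]; linarith)
      rw [segment_symm]
      exact (W'.sides_mem hq hτ hb s him h this).1
    · have hAP : A.im < P.im := lt_of_le_of_ne (not_lt.1 fun h' => hA ⟨h', h⟩) W.im_ne.2.2
      have W' := W.rotate.swap
      have := ht A R W'.ne (W'.isFlatMap s) W'.side₁ (by
        rw [abs_of_pos (by linarith)]; linarith)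
      rw [segment_symm]
      exact (W'.sides_mem hq hτ hb s hAP him this).2
  obtain ⟨L, hLP, hLR, WA, WB⟩ := exists_quadLayout hq hτ s hP hR h0 he
  by_cases hA : P.im < L.A.im ∧ L.A.im < R.im
  swap
  · exact hout WA hA
  by_cases hB : P.im < L.B.im ∧ L.B.im < R.im
  swap
  · exact hout WB hB
  obtain ⟨a1, a2⟩ := WA.apex_lt hA.1 hA.2
  obtain ⟨b1, b2⟩ := WB.apex_lt hB.1 hB.2
  have hL : 1 < L.flippedWidth := hb.2 L (L.backwardFlippable_iff.2 (by
    rw [hLP, hLR]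
    simp only [Complex.sub_re, Complex.sub_im]
    exact ⟨mul_pos_of_neg_of_neg (by linarith) (by linarith),
      mul_neg_of_pos_of_neg (by linarith) (by linarith), mul_pos (by linarith) (by linarith),
      mul_neg_of_neg_of_pos (by linarith) (by linarith)⟩))
  rw [QuadLayout.flippedWidth, Complex.sub_re, abs_of_neg (by linarith)] at hL
  have hw := width_le_one hq hτ hb WA.ne (WA.isFlatMap s) he
  have hPx : P.re ∈ Icc L.A.re L.B.re := ⟨by linarith, by linarith⟩
  have hRx : R.re ∈ Icc L.A.re L.B.re := ⟨by linarith, by linarith⟩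
  refine s.mem_delaunayEdges hP hR ⟨L.A.re, L.B.re, by linarith, hPx, hRx, by
    rwa [abs_sub_comm, ← Complex.sub_re], WA.re_ne.1, WA.im_ne.1, ?_⟩
  rw [uIoo_of_lt him]
  refine s.starView.subset_of_disjoint ((convex_rect _ _ _ _).starConvex
    (openSegment_subset_rect hPx hRx WA.re_ne.1 him h0)) ?_
  rintro κ ⟨hκ, hκi⟩ hκV
  rcases lt_trichotomy (orient P R κ) 0 with h | h | h
  · refine hκ.2.ne ?_
    rw [WB.eq_apex hq hτ s h0 hB.1 hB.2 hκV (by linarith) hκi.1.le hκi.2.le (by linarith [hκ.2])]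
  · exact s.starView.notMem hκV (WA.openSegment_subset
      (mem_openSegment_of_orient_eq_zero h hκi.1 hκi.2))
  · refine hκ.1.ne ?_
    rw [WA.eq_apex hq hτ s h0 hA.1 hA.2 hκV (by linarith) hκi.1.le hκi.2.le (by linarith [hκ.1])]

/-- Among edges outside `delaunayEdges` take a tallest one. All taller edges are in the set, so
`mem_delaunayEdges_of_taller` gives a contradiction. -/
theorem edges_subset_delaunayEdges [T2Space S] [CompactSpace S] (hq : q.IsKeane)
    (hτ : τ.IsVeering) (hb : τ.IsBalanced) : τ.edges ⊆ q.delaunayEdges := by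
  by_contra hn
  obtain ⟨φ, -, hφ⟩ := τ.exists_holonomy
  obtain ⟨e₀, he₀, hmax⟩ := Set.exists_max_image (τ.edges \ q.delaunayEdges)
    (fun e => |(φ e).im|) (τ.finite_edges.subset sdiff_subset) (sdiff_nonempty.2 hn)
  obtain ⟨w₀, f, D, V, P, R, s, hP, hR, h0, hne, rfl⟩ := exists_sky_of_edge he₀.1
  have hf := s.flatMap_segment hP hR (s.starView.openSegment_subset hP hR h0)
  have him : P.im ≠ R.im := fun h =>
    ((hf.isSaddleConnection hne).re_ne_zero hq).2 (by rw [Complex.sub_im, h, sub_self])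
  have ht : ∀ X Y : ℂ, X ≠ Y → q.IsFlatMap (segment ℝ X Y) {X, Y} f →
      f '' segment ℝ X Y ∈ τ.edges → |R.im - P.im| < |Y.im - X.im| →
      f '' segment ℝ X Y ∈ q.delaunayEdges := by
    intro X Y hXY hfXY he hlt
    by_contra h
    have := hmax _ ⟨he, h⟩
    rw [← Complex.sub_im, ← Complex.sub_im, (hφ f X Y hXY hfXY he).2, (hφ f P R hne hf he₀.1).2] at hlt
    exact absurd this (not_le.2 hlt)
  rcases lt_or_gt_of_ne him with h | h
  · exact he₀.2 (mem_delaunayEdges_of_taller hq hτ hb s hP hR h0 he₀.1 h ht)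
  · have he := he₀
    rw [segment_symm] at he
    rw [openSegment_symm] at h0
    rw [abs_sub_comm] at ht
    exact he.2 (mem_delaunayEdges_of_taller hq hτ hb s hR hP h0 he.1 h ht)

theorem ext_of_edges_faces {τ₁ τ₂ : q.StraightTriangulation} (h₁ : τ₁.edges = τ₂.edges)
    (h₂ : τ₁.faces = τ₂.faces) : τ₁ = τ₂ := by
  cases τ₁; cases τ₂
  simp only at h₁ h₂
  subst h₁ h₂
  rfl

/-- Since the edges are Delaunay, so are the faces. The given triangulation covers the surface, and
Delaunay edges and faces that meet away from marked points are equal, so none can be missing. -/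
theorem eq_delaunay [T2Space S] [CompactSpace S] [ConnectedSpace S] (hq : q.IsKeane)
    (hτ : τ.IsVeering) (hb : τ.IsBalanced) : τ = delaunay hq := by
  have hE := edges_subset_delaunayEdges hq hτ hb
  have hF : ∀ F ∈ τ.faces, ∃ f P Q R, q.IsDelaunayTriangle f P Q R ∧
      F = f '' interior (planeTriangle P Q R) := by
    intro F hF
    obtain ⟨f, P, Q, R, hT, rfl, h1, h2, h3⟩ := τ.face_triangle F hF
    exact ⟨f, P, Q, R, ⟨hT.anticlockwise, hT.flatMap, hE h1, hE h2, hE h3⟩, rfl⟩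
  have hcover : ∀ p, (∃ e ∈ τ.edges, p ∈ e) ∨ ∃ F ∈ τ.faces, p ∈ F := fun p => by
    have : p ∈ ⋃₀ τ.edges ∪ ⋃₀ τ.faces := τ.cover ▸ mem_univ p
    exact this
  refine ext_of_edges_faces (hE.antisymm ?_) (Subset.antisymm hF ?_)
  · rintro e he
    obtain ⟨w₀, f, D, V, P, Q, s, hP, hQ, h0, -, rfl⟩ := id he
    have hp := mem_image_of_mem f (openSegment_subset_segment ℝ _ _ h0)
    rcases hcover (f w₀) with ⟨e', he', hpe'⟩ | ⟨F, hF', hpF⟩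
    · rwa [eq_of_mem_delaunayEdges hq he (hE he') hp hpe' (s.free.notMem s.base)]
    · obtain ⟨g, X, Y, Z, hT, rfl⟩ := hF F hF'
      obtain ⟨w, hw, hw'⟩ := hpF
      exact absurd (hw' ▸ hp) (hT.notMem_edge hq hw he)
  · rintro _ ⟨f, P, Q, R, hT, rfl⟩
    obtain ⟨w, hw⟩ := hT.anticlockwise.interior_nonempty
    rcases hcover (f w) with ⟨e', he', hpe'⟩ | ⟨F, hF', hpF⟩
    · exact absurd hpe' (hT.notMem_edge hq hw (hE he'))
    · obtain ⟨g, X, Y, Z, hT', rfl⟩ := hF F hF'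
      rwa [hT.image_eq hq hT' (mem_image_of_mem f hw) hpF]

end StraightTriangulation

end HalfTranslationStructure

theorem proposition2p14 {S : Type*} [TopologicalSpace S] [T2Space S] [CompactSpace S]
    [ConnectedSpace S] (q : HalfTranslationStructure S) (hq : q.IsKeane) :
    ∃! τ : q.StraightTriangulation, τ.IsVeering ∧ τ.IsBalanced :=
  ⟨HalfTranslationStructure.delaunay hq,
    ⟨HalfTranslationStructure.isVeering_delaunay hq, HalfTranslationStructure.isBalanced_delaunay hq⟩,
    fun _ h => HalfTranslationStructure.StraightTriangulation.eq_delaunay hq h.1 h.2⟩
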